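/- Let $\bar M$ be a compact smooth manifold with boundary of dimension $m\ge 1$, with interior $M$. A boundary defining function (bdf) is a smooth function $x\ge 0$ on $\bar M$ that vanishes exactly on $\partial M$ and has $dx\ne 0$ there. Let $g$ be a Poincaré–Einstein metric on $M$: a smooth Riemannian metric with $\mathrm{Ric}(g)=-(m-1)g$ such that, for some bdf $x$, $x^2g$ extends to a continuous (non-degenerate) Riemannian metric on $\bar M$. A bdf $x$ is special if $|dx|^2_{x^2g}=1$ near $\partial M$. Fix a special bdf $x$, let $\bar g$ be the continuous extension of $x^2g$, and let $\Phi:\partial M\times[0,\varepsilon)\to\bar M$ be the identification with a neighbourhood of $\partial M$ given by the flow of $\nabla_{\bar g}x$, so that $x\circ\Phi(y,t)=t$ and $\Phi^*\bar g=dt^2+G_t$; it is taken to be a diffeomorphism up to the boundary. Write $g^{(0)}=G_0$. A function on $\partial M\times(0,\varepsilon)$ is polyhomogeneous if it is smooth and has an expansion $\sum_{k\ge 0}\sum_{p\le p_k}a_{k,p}(y)\,t^k\log^p t$ as $t\to0$, with $a_{k,p}$ smooth on $\partial M$, that may be differentiated term by term; it is even mod $x^K$ if no log terms and no odd powers occur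 below $t^K$. As usual, $G_t$ is assumed polyhomogeneous and continuous up to $t=0$. Besides smooth bdfs, special bdfs $\hat x=xe^{\omega}$ are allowed for which $\omega$ is merely continuous on $\bar M$, smooth on $M$ and polyhomogeneous in the collar $\Phi$ (so a smooth special bdf is included). Let $\mu=f\,\mathrm{dvol}_g$, $f\in C^\infty(M)$, be a density which in the collar has the form $$\mu = F(x,y)\,\frac{\mathrm{dvol}_{g^{(0)}}\,dx}{x^m},$$ where $F$ is smooth for $0<x<\varepsilon$, polyhomogeneous, and even mod $x^{m+1}$. For a bdf $x'$ let $\zeta_{x'}(z)=\int_M (x')^z\mu$ for $\operatorname{Re} z\gg0$; after meromorphic continuation to a half plane containing $0$, let ${}^R\!\!\int_{x'}\mu$ be the constant term (finite part) of the Laurent expansion of $\zeta_{x'}$ at $z=0$, and let $\operatorname{Res}_{x'}\mu$ be its residue there. Then these continuations exist for $x$ and for all $x'$, $\hat x$ considered below, and: 1. If $m$ is even, then ${}^R\!\!\int_{\hat x}\mu={}^R\!\!\int_{x}\mu$ for every special bdf $\hat x=xe^\omega$. 2. If $m$ is odd, then for every special bdf $\hat x=xe^\omega$ $${}^R\!\!\int_{\hat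 x}\mu-{}^R\!\!\int_{x}\mu=\int_{\partial M}(\omega F)_{(m-1)}\,\mathrm{dvol}_{g^{(0)}},$$ where $(\omega F)_{(m-1)}$ is the coefficient of $x^{m-1}$ in the (polyhomogeneous) expansion of $\omega F$ in the collar. 3. For $m$ of either parity, $\operatorname{Res}_{x'}\mu=\operatorname{Res}_{x}\mu$ for every smooth bdf $x'$ (special or not), and also for every special bdf $x'=xe^\omega$ as above. -/

import Mathlib

open Set Filter Topology MeasureTheory Bundle
open scoped Manifold ContDiff Asymptotics

noncomputable section

namespace PE

/-- Euclidean space `ℝ^d`. -/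
abbrev Euc (d : ℕ) : Type := EuclideanSpace ℝ (Fin d)

/-- The `i`-th standard basis vector of `ℝ^d`. -/
def stdVec {d : ℕ} (i : Fin d) : Euc d := EuclideanSpace.single i 1

/-! ### Local coordinates: metric components and Ricci curvature -/

section Coordinates

variable {d : ℕ}

/-- The partial derivative `∂_i f`. -/
def pd (i : Fin d) (f : Euc d → ℝ) (u : Euc d) : ℝ := fderiv ℝ f u (stdVec i)

/-- Christoffel symbols
`Γ^k_{ij} = ½ h^{kl} (∂_i h_{jl} + ∂_j h_{il} - ∂_l h_{ij})` of a metric `h` on an open set of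
`ℝ^d`. -/
def christoffel (h : Euc d → Matrix (Fin d) (Fin d) ℝ) (k i j : Fin d) (u : Euc d) : ℝ :=
  (1 / 2 : ℝ) * ∑ l, (h u)⁻¹ k l *
    (pd i (fun v => h v j l) u + pd j (fun v => h v i l) u - pd l (fun v => h v i j) u)

/-- Ricci curvature
`R_{ij} = ∂_k Γ^k_{ij} - ∂_j Γ^k_{ik} + Γ^k_{kl} Γ^l_{ij} - Γ^k_{jl} Γ^l_{ik}`
(positive on round spheres). -/
def ricci (h : Euc d → Matrix (Fin d) (Fin d) ℝ) (i j : Fin d) (u : Euc d) : ℝ :=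
  (∑ k, pd k (christoffel h k i j) u) - (∑ k, pd j (christoffel h k i k) u)
    + (∑ k, ∑ l, christoffel h k k l u * christoffel h l i j u)
    - ∑ k, ∑ l, christoffel h k j l u * christoffel h l i k u

end Coordinates

section Manifolds

variable {d : ℕ} {H : Type*} [TopologicalSpace H] (I : ModelWithCorners ℝ (Euc d) H)
  {M : Type*} [TopologicalSpace M] [ChartedSpace H M]

/-- A field of bilinear forms on the tangent spaces of `M`. -/
abbrev BilinField (M : Type*) [TopologicalSpace M] [ChartedSpace H M] : Type _ :=
  ∀ p : M, TangentSpace I p →L[ℝ] TangentSpace I p →L[ℝ] ℝ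

variable {I}

/-- The components `g_{ij}(u) = g(∂_iψ, ∂_jψ)` with respect to a parametrization `ψ`. -/
def components (g : BilinField I M) (ψ : Euc d → M) (u : Euc d) : Matrix (Fin d) (Fin d) ℝ :=
  Matrix.of fun i j =>
    g (ψ u) (mfderiv 𝓘(ℝ, Euc d) I ψ u (stdVec i)) (mfderiv 𝓘(ℝ, Euc d) I ψ u (stdVec j))

variable (I) in
/-- `ψ` is a smooth parametrization of a piece of the interior of `M` by an open set `U ⊆ ℝ^d`,
`d = dim M`; that is, `ψ⁻¹` is a local coordinate system. -/
structure IsLocalParam (ψ : Euc d → M) (U : Set (Euc d)) : Prop where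
  isOpen : IsOpen U
  mapsTo : MapsTo ψ U (I.interior M)
  smooth : ContMDiffOn 𝓘(ℝ, Euc d) I ∞ ψ U
  injOn : InjOn ψ U
  immersion : ∀ u ∈ U, Function.Injective (mfderiv 𝓘(ℝ, Euc d) I ψ u)

/-- `g` is a smooth Riemannian metric on the interior of `M`
(its values at boundary points are irrelevant). -/
structure IsInteriorMetric [IsManifold I ∞ M] (g : BilinField I M) : Prop where
  symm : ∀ p ∈ I.interior M, ∀ v w, g p v w = g p w v
  pos : ∀ p ∈ I.interior M, ∀ v, v ≠ 0 → 0 < g p v v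
  smooth : ContMDiffOn I (I.prod 𝓘(ℝ, Euc d →L[ℝ] Euc d →L[ℝ] ℝ)) ∞
    (fun p => TotalSpace.mk' (Euc d →L[ℝ] Euc d →L[ℝ] ℝ)
      (E := fun p : M => TangentSpace I p →L[ℝ] TangentSpace I p →L[ℝ] ℝ) p (g p))
    (I.interior M)

/-- `Ric(g) = -(dim M - 1) g` on the interior of `M`, in every local coordinate system. -/
def IsEinstein (g : BilinField I M) : Prop :=
  ∀ (ψ : Euc d → M) (U : Set (Euc d)), IsLocalParam I ψ U → ∀ u ∈ U, ∀ i j : Fin d,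
    ricci (components g ψ) i j u = -((d : ℝ) - 1) * components g ψ u i j

/-! ### Riemannian volume measure -/

variable (H M) in
/-- A compact manifold is covered by finitely many chart domains. -/
theorem exists_finite_chart_cover [CompactSpace M] :
    ∃ (k : ℕ) (c : Fin k → M), ∀ p : M, ∃ i, p ∈ (chartAt H (c i)).source := by
  obtain ⟨t, ht⟩ := isCompact_univ.elim_finite_subcover (fun c : M => (chartAt H c).source)
    (fun c => (chartAt H c).open_source)
    (fun p _ => mem_iUnion.2 ⟨p, mem_chart_source H p⟩)
  refine ⟨t.card, fun i => (t.equivFin.symm i : M), fun p => ?_⟩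
  obtain ⟨c, hc, hp⟩ := mem_iUnion₂.1 (ht (mem_univ p))
  exact ⟨t.equivFin ⟨c, hc⟩, by simpa using hp⟩

/-- The measure `√(det g_{ij}) du` of the chart at `c`, transported to `M`. -/
def chartVolume [MeasurableSpace M] (g : BilinField I M) (c : M) : Measure M :=
  Measure.map (extChartAt I c).symm
    ((volume.restrict (extChartAt I c).target).withDensity fun u =>
      ENNReal.ofReal (Real.sqrt (components g (extChartAt I c).symm u).det))

/-- The Riemannian volume measure of a compact manifold: `M` is cut along a finite cover by chart
domains, and `√(det g_{ij}) du` is used on each piece. (The coordinate densities agree on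
overlaps, so the choice of the cover does not matter.) -/
def riemVolume [MeasurableSpace M] [CompactSpace M] (g : BilinField I M) : Measure M :=
  let c := (exists_finite_chart_cover H M).choose_spec.choose
  Measure.sum fun i => (chartVolume g (c i)).restrict
    ((chartAt H (c i)).source \ ⋃ j, ⋃ (_ : j < i), (chartAt H (c j)).source)

/-! ### Boundary defining functions, conformally compact and Poincaré–Einstein metrics -/

variable (I) in
/-- Boundary defining functions: smooth, nonnegative, vanishing exactly on the boundary, with
non-zero differential there. -/
structure IsBdf (x : M → ℝ) : Prop where
  smooth : ContMDiff I 𝓘(ℝ, ℝ) ∞ x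
  nonneg : ∀ p, 0 ≤ x p
  zero_iff : ∀ p, x p = 0 ↔ p ∈ I.boundary M
  nondeg : ∀ p ∈ I.boundary M, mfderiv I 𝓘(ℝ, ℝ) x p ≠ 0

/-- `gbar` is a continuous Riemannian metric on all of `M`, equal to `x² g` in the interior. -/
def IsConfExtension [IsManifold I ∞ M] (g : BilinField I M) (x : M → ℝ)
    (gbar : ContinuousRiemannianMetric (Euc d) (fun p : M => TangentSpace I p)) : Prop :=
  ∀ p ∈ I.interior M, ∀ v w, gbar.inner p v w = x p ^ 2 * g p v w

/-- Poincaré–Einstein metrics: Einstein metrics on the interior that are conformally compact. -/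
structure IsPoincareEinstein [IsManifold I ∞ M] (g : BilinField I M) : Prop where
  metric : IsInteriorMetric g
  einstein : IsEinstein g
  confCompact : ∃ (x : M → ℝ)
    (gbar : ContinuousRiemannianMetric (Euc d) (fun p : M => TangentSpace I p)),
    IsBdf I x ∧ IsConfExtension g x gbar

/-- `|dx|²_{x²g} = 1` near the boundary. At an interior point `p`, `v` is the gradient of `x` with
respect to `x² g`, and `dx(v) = |dx|²`. -/
def IsSpecial (g : BilinField I M) (x : M → ℝ) : Prop :=
  ∃ U : Set M, IsOpen U ∧ I.boundary M ⊆ U ∧ ∀ p ∈ U ∩ I.interior M,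
    ∃ v : TangentSpace I p, (∀ w, x p ^ 2 * g p v w = mfderiv I 𝓘(ℝ, ℝ) x p w) ∧
      mfderiv I 𝓘(ℝ, ℝ) x p v = (1 : ℝ)

/-! ### Riesz regularization -/

/-- The integrand `x^z f` of the zeta function of the density `f dvol`. -/
def zetaIntegrand (x f : M → ℝ) (z : ℂ) (p : M) : ℂ := (x p : ℂ) ^ z * (f p : ℂ)

variable (I) in
/-- `Z` is a meromorphic continuation, to a half plane containing `0`, of
`ζ_x(z) = ∫ x^z f dν` (integral over the interior, absolutely convergent for large `Re z`). -/
def IsZetaContinuation [MeasurableSpace M] (ν : Measure M) (x f : M → ℝ) (Z : ℂ → ℂ) : Prop :=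
  (∃ δ : ℝ, 0 < δ ∧ MeromorphicOn Z {z : ℂ | -δ < z.re}) ∧
  ∃ σ : ℝ, ∀ z : ℂ, σ < z.re →
    IntegrableOn (zetaIntegrand x f z) (I.interior M) ν ∧
    Z z = ∫ p in I.interior M, zetaIntegrand x f z p ∂ν

variable (I) in
/-- The zeta function of `f dν` with respect to `x` has a meromorphic continuation. -/
def HasZetaContinuation [MeasurableSpace M] (ν : Measure M) (x f : M → ℝ) : Prop :=
  ∃ Z, IsZetaContinuation I ν x f Z

open Classical in
variable (I) in
/-- The continued zeta function (essentially unique, by the identity theorem). -/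
def zetaCont [MeasurableSpace M] (ν : Measure M) (x f : M → ℝ) : ℂ → ℂ :=
  if h : HasZetaContinuation I ν x f then h.choose else 0

/-- The coefficient of `z^k` in the Laurent expansion of `Z` at `0`:
`(2πi)⁻¹ ∮_{|z| = r} z^{-k-1} Z(z) dz` for small `r`. -/
def laurentCoeff (Z : ℂ → ℂ) (k : ℤ) : ℂ :=
  limUnder (𝓝[>] (0 : ℝ)) fun r =>
    (2 * (Real.pi : ℂ) * Complex.I)⁻¹ * ∮ z in C(0, r), z ^ (-k - 1) * Z z

variable (I) in
/-- The Riesz-renormalized integral `FP_{z=0} ζ_x(z)` of `f dν`. -/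
def rieszIntegral [MeasurableSpace M] (ν : Measure M) (x f : M → ℝ) : ℂ :=
  laurentCoeff (zetaCont I ν x f) 0

variable (I) in
/-- The residue `Res_{z=0} ζ_x(z)` of `f dν`. -/
def rieszResidue [MeasurableSpace M] (ν : Measure M) (x f : M → ℝ) : ℂ :=
  laurentCoeff (zetaCont I ν x f) (-1)

end Manifolds

/-! ### Polyhomogeneous expansions on `N × (0, ε)` -/

/-- Near `(u₀, 0)`, `f` is smooth for `t > 0` and
`f(u,t) ~ ∑_{k ≥ 0} ∑_{p ≤ P k} a_{k,p}(u) t^k (log t)^p` with smooth `a_{k,p}`; the expansion may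
be differentiated term by term. -/
def HasPhgExpansionAt {d : ℕ} (f : Euc d × ℝ → ℝ) (a : ℕ → ℕ → Euc d → ℝ) (P : ℕ → ℕ)
    (u₀ : Euc d) : Prop :=
  (∃ U : Set (Euc d), IsOpen U ∧ u₀ ∈ U ∧ (∀ k p, ContDiffOn ℝ ∞ (a k p) U) ∧
    ∃ δ : ℝ, 0 < δ ∧ ContDiffOn ℝ ∞ f (U ×ˢ Ioo 0 δ)) ∧
  ∀ K r : ℕ,
    (fun q : Euc d × ℝ => iteratedFDeriv ℝ r
      (fun q : Euc d × ℝ => f q - ∑ k ∈ Finset.range (K + 1), ∑ p ∈ Finset.range (P k + 1),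
        a k p q.1 * q.2 ^ k * Real.log q.2 ^ p) q)
      =O[𝓝 u₀ ×ˢ 𝓝[>] (0 : ℝ)] fun q : Euc d × ℝ => q.2 ^ ((K : ℤ) - (r : ℤ))

section Collar

variable {n : ℕ} {N : Type*} [TopologicalSpace N] [ChartedSpace (Euc n) N]

/-- `f(y,t) ~ ∑_{k ≥ 0} ∑_p a_{k,p}(y) t^k (log t)^p` as `t → 0+`, where for each `k` only finitely
many `a_{k,p}` are non-zero: the previous notion in the charts of `N`. -/
def HasPhgExpansion (f : N × ℝ → ℝ) (a : ℕ → ℕ → N → ℝ) : Prop :=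
  ∃ P : ℕ → ℕ, (∀ k p y, P k < p → a k p y = 0) ∧
    ∀ y₀ : N, HasPhgExpansionAt
      (fun q => f ((extChartAt (𝓡 n) y₀).symm q.1, q.2))
      (fun k p u => a k p ((extChartAt (𝓡 n) y₀).symm u)) P (extChartAt (𝓡 n) y₀ y₀)

/-- The expansion has no log terms and no odd powers below `t^K`. -/
def IsEvenMod (a : ℕ → ℕ → N → ℝ) (K : ℕ) : Prop :=
  ∀ k < K, (∀ p, 1 ≤ p → ∀ y, a k p y = 0) ∧ (Odd k → ∀ y, a k 0 y = 0)

variable {M : Type*} [TopologicalSpace M] [ChartedSpace (EuclideanHalfSpace (n + 1)) M]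
  [IsManifold (𝓡∂ (n + 1)) ∞ M]

/-- Continuous Riemannian metrics on the manifold with boundary `M`. -/
abbrev ContMetric (n : ℕ) (M : Type*) [TopologicalSpace M]
    [ChartedSpace (EuclideanHalfSpace (n + 1)) M] [IsManifold (𝓡∂ (n + 1)) ∞ M] : Type _ :=
  ContinuousRiemannianMetric (Euc (n + 1)) (fun p : M => TangentSpace (𝓡∂ (n + 1)) p)

/-- The identification `Φ` of `N × [0, ε)` with a neighbourhood of the boundary of `M` that is
induced by `x` through the flow of the gradient `∇x` with respect to `gbar`: `Φ` is a
diffeomorphism onto an open neighbourhood of the boundary, it maps `N × {0}` onto the boundary,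
`x(Φ(y,t)) = t`, and `∂_t Φ = ∇x`. -/
structure IsGeodesicCollar (gbar : ContMetric n M) (x : M → ℝ) (ε : ℝ) (Φ : N × ℝ → M) :
    Prop where
  pos : 0 < ε
  smooth : ContMDiffOn ((𝓡 n).prod 𝓘(ℝ, ℝ)) (𝓡∂ (n + 1)) ∞ Φ (univ ×ˢ Ico 0 ε)
  isOpen_image : IsOpen (Φ '' (univ ×ˢ Ico 0 ε))
  image_zero : Φ '' (univ ×ˢ {0}) = (𝓡∂ (n + 1)).boundary M
  smooth_inverse : ∃ Ψ : M → N × ℝ,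
    ContMDiffOn (𝓡∂ (n + 1)) ((𝓡 n).prod 𝓘(ℝ, ℝ)) ∞ Ψ (Φ '' (univ ×ˢ Ico 0 ε)) ∧
    LeftInvOn Ψ Φ (univ ×ˢ Ico 0 ε)
  x_eq : ∀ y : N, ∀ t ∈ Ico (0 : ℝ) ε, x (Φ (y, t)) = t
  flow : ∀ y : N, ∀ t ∈ Ioo (0 : ℝ) ε, ∀ w : TangentSpace (𝓡∂ (n + 1)) (Φ (y, t)),
    gbar.inner (Φ (y, t))
      (mfderiv 𝓘(ℝ, ℝ) (𝓡∂ (n + 1)) (fun s : ℝ => Φ (y, s)) t (1 : ℝ)) w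
      = mfderiv (𝓡∂ (n + 1)) 𝓘(ℝ, ℝ) x (Φ (y, t)) w

/-- The metric `G_t` on `N`, the pull-back of `gbar` by `Φ(·, t)`. For `t = 0` this is the boundary
metric `g^{(0)}`. -/
def sliceMetric (gbar : ContMetric n M) (Φ : N × ℝ → M) (t : ℝ) : BilinField (𝓡 n) N := fun y =>
  let D : Euc n →L[ℝ] Euc (n + 1) := mfderiv (𝓡 n) (𝓡∂ (n + 1)) (fun y => Φ (y, t)) y
  let B : Euc (n + 1) →L[ℝ] Euc (n + 1) →L[ℝ] ℝ := gbar.inner (Φ (y, t))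
  B.bilinearComp D D

/-- `gbar = dt² + G_t` is polyhomogeneous and continuous up to `t = 0` in the collar: the components
of `G_t` in charts of `N` have polyhomogeneous expansions, without log terms at order `t^0`. -/
def IsPhgMetric (gbar : ContMetric n M) (Φ : N × ℝ → M) : Prop :=
  ∀ y₀ : N, ∀ i j : Fin n, ∃ (a : ℕ → ℕ → Euc n → ℝ) (P : ℕ → ℕ), P 0 = 0 ∧
    HasPhgExpansionAt
      (fun q => components (sliceMetric gbar Φ q.2) (extChartAt (𝓡 n) y₀).symm q.1 i j)
      a P (extChartAt (𝓡 n) y₀ y₀)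

/-- `x' = x e^φ` with `φ` continuous on `M`, smooth in the interior and polyhomogeneous in the
collar `Φ`. -/
structure IsPhgBdf (x : M → ℝ) (Φ : N × ℝ → M) (x' φ : M → ℝ) : Prop where
  eq : ∀ p, x' p = x p * Real.exp (φ p)
  cont : Continuous φ
  smooth : ContMDiffOn (𝓡∂ (n + 1)) 𝓘(ℝ, ℝ) ∞ φ ((𝓡∂ (n + 1)).interior M)
  phg : ∃ w : ℕ → ℕ → N → ℝ, HasPhgExpansion (n := n) (fun q => φ (Φ q)) w

/-- In the collar, the density `f dvol_g` equals `F(y,t) dvol_{g^{(0)}} dt / t^{n+1}`: the two have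
the same integral over compact subsets of `N × (0, ε)`. -/
def IsDensityForm [CompactSpace M] [MeasurableSpace M] [CompactSpace N] [MeasurableSpace N]
    (g : BilinField (𝓡∂ (n + 1)) M) (gbar : ContMetric n M) (ε : ℝ) (Φ : N × ℝ → M)
    (f : M → ℝ) (F : N × ℝ → ℝ) : Prop :=
  ∀ K : Set (N × ℝ), IsCompact K → K ⊆ univ ×ˢ Ioo 0 ε →
    ∫ p in Φ '' K, f p ∂(riemVolume g)
      = ∫ q in K, F q / q.2 ^ (n + 1) ∂((riemVolume (sliceMetric gbar Φ 0)).prod volume)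

end Collar

end PE

end

noncomputable section

namespace PE

variable {n : ℕ}

/-! Write m = n + 1. In the collar coordinates (u, t) the metric is t⁻²(dt² + G_t). The statement
combines the evenness of G_t, the evenness of ω, and a computation of the zeta function near z = 0.

Evenness of G_t. The tangential part of the Einstein equation, `IsCollarMetric.ricci_eq`, involves
only G, its inverse, tangential derivatives of both, and A = ½ t∂_t G with its Euler derivative.
Suppose that G has only even, log-free terms below order k. Then every contribution is even modulo
t^(k+1), except for the linear action on the block of order k. On a coefficient α of A this action
is (n − k)α + (tr α)G_0, together with a shift that lowers the power of log t. It is injective for 0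
< k < n (`indicial_injective`). An even function cannot match log terms or odd powers at order k
(`coeff_eq_zero_of_evenMod`), so the block of order k has none (`evenCoeff_metric_step`). The
induction stops at k = n, where the operator kills trace-free α.

Evenness of ω. If x and x e^φ are both special, then θ = t∂_t φ satisfies 2θ + θ² + t²|d_u φ|² = 0,
the norm being that of G_t (`IsGeodesicCollar.eikonal`). The same induction applies, with θ ↦ 2θ as
its linear part. The factor t² leaves room to spare, so evenness of G below order n yields evenness
of φ below order n + 1. Continuity of φ up to the boundary starts the induction, since it forbids
log terms at order 0.

Both inductions use one calculus. Errors are conormal: they have bounds O(t^ρ) that survive ∂_u and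
t∂_t (`Conormal`). A function is handled as h(u, t²) plus such an error (`EvenMod`), and this class
is stable under products, inverses and tangential derivatives.

Zeta function. In the collar the integrand for x' = t e^φ is t^(z−n−1) e^(zφ) F. Subtracting the
expansion of e^(zφ) F through t^n leaves a term holomorphic for Re z > −1/2, and the subtracted
powers integrate explicitly. Only the power t^n has a pole at 0. Its coefficient equals that of F at
z = 0, so the residue does not see φ. The derivative of that coefficient at z = 0 is the t^n
coefficient of φF, which is the only way φ enters the finite part (`collarZeta_simplePole`). For n
odd, evenness of φ and F makes this coefficient vanish; for n even it is the anomaly. The residue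
needs only a log-free expansion of φ through order n. A smooth bdf has one, because x'/t is smooth
and positive up to the boundary (`IsGeodesicCollar.exists_bdf_expansion`).

The density is given only through integrals over compact sets. Radon–Nikodym derivatives with
respect to a common dominating measure extend the identity to all the integrands needed
(`setIntegral_image_eq`). -/

/-- The approach to the boundary point `(u₀, 0)` from `t > 0`. -/
abbrev bdryFilter (u₀ : Euc n) : Filter (Euc n × ℝ) := 𝓝 u₀ ×ˢ 𝓝[>] (0 : ℝ)

/-- The tangential derivative `∂f/∂u_i`. -/
def tanD (i : Fin n) (f : Euc n × ℝ → ℝ) (q : Euc n × ℝ) : ℝ := fderiv ℝ f q (stdVec i, 0)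

/-- The normal derivative `∂f/∂t`. -/
def norD (f : Euc n × ℝ → ℝ) (q : Euc n × ℝ) : ℝ := fderiv ℝ f q (0, 1)

/-- The Euler derivative `t ∂f/∂t`. -/
def eulD (f : Euc n × ℝ → ℝ) (q : Euc n × ℝ) : ℝ := q.2 * norD f q

/-! ### Properties that hold near a boundary point for t > 0. -/

theorem eventually_bdryFilter_pos (u₀ : Euc n) : ∀ᶠ q in bdryFilter u₀, 0 < q.2 :=
  tendsto_snd.eventually self_mem_nhdsWithin

theorem eventually_bdryFilter_lt (u₀ : Euc n) {δ : ℝ} (hδ : 0 < δ) :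
    ∀ᶠ q in bdryFilter u₀, q.2 < δ :=
  tendsto_snd.eventually (mem_nhdsWithin_of_mem_nhds (Iio_mem_nhds hδ))

theorem tendsto_snd_bdryFilter (u₀ : Euc n) :
    Tendsto (fun q : Euc n × ℝ => q.2) (bdryFilter u₀) (𝓝 0) :=
  (tendsto_nhdsWithin_iff.1 (tendsto_snd (f := 𝓝 u₀) (g := 𝓝[>] (0 : ℝ)))).1

theorem bdryFilter_le_nhds (u₀ : Euc n) : bdryFilter u₀ ≤ 𝓝 (u₀, 0) := by
  rw [nhds_prod_eq]; exact Filter.prod_mono le_rfl nhdsWithin_le_nhds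

theorem bdryFilter_basis (u₀ : Euc n) {p : Euc n × ℝ → Prop} :
    (∀ᶠ q in bdryFilter u₀, p q) ↔
      ∃ U : Set (Euc n), IsOpen U ∧ u₀ ∈ U ∧ ∃ δ > 0, ∀ u ∈ U, ∀ t ∈ Ioo (0 : ℝ) δ, p (u, t) := by
  constructor
  · intro h
    obtain ⟨A, hA, B, hB, hAB⟩ := Filter.mem_prod_iff.1 h
    obtain ⟨U, hUA, hU, huU⟩ := mem_nhds_iff.1 hA
    obtain ⟨δ, hδ, hδB⟩ := mem_nhdsGT_iff_exists_Ioo_subset.1 hB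
    exact ⟨U, hU, huU, δ, hδ, fun u hu t ht => hAB ⟨hUA hu, hδB ht⟩⟩
  · rintro ⟨U, hU, hu, δ, hδ, h⟩
    filter_upwards [prod_mem_prod (hU.mem_nhds hu) (Ioo_mem_nhdsGT hδ)] with q hq
    exact h _ hq.1 _ hq.2

/-- The basic sets U × (0, δ) are open. This is what lets identities along `bdryFilter` be
differentiated. -/
theorem eventually_eventually_bdryFilter {u₀ : Euc n} {p : Euc n × ℝ → Prop}
    (h : ∀ᶠ q in bdryFilter u₀, p q) : ∀ᶠ q in bdryFilter u₀, ∀ᶠ q' in 𝓝 q, p q' := by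
  obtain ⟨U, hU, hu, δ, hδ, h⟩ := (bdryFilter_basis u₀).1 h
  refine (bdryFilter_basis u₀).2 ⟨U, hU, hu, δ, hδ, fun u hu t ht => ?_⟩
  filter_upwards [(hU.prod isOpen_Ioo).mem_nhds (show (u, t) ∈ U ×ˢ Ioo 0 δ from ⟨hu, ht⟩)] with q hq
  exact h _ hq.1 _ hq.2

/-- Moves the base point: coefficients must be shown to vanish on a neighbourhood of u₀, since later
steps of the induction differentiate them. -/
theorem eventually_eventually_nhds_bdryFilter {u₀ : Euc n} {p : Euc n × ℝ → Prop}
    (h : ∀ᶠ q in bdryFilter u₀, p q) : ∀ᶠ u in 𝓝 u₀, ∀ᶠ q in bdryFilter u, p q := by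
  obtain ⟨U, hU, hu, δ, hδ, h⟩ := (bdryFilter_basis u₀).1 h
  filter_upwards [hU.mem_nhds hu] with u hu
  exact (bdryFilter_basis u).2 ⟨U, hU, hu, δ, hδ, h⟩

theorem eventually_slice_bdryFilter {u : Euc n} {p : Euc n × ℝ → Prop}
    (h : ∀ᶠ q in bdryFilter u, p q) : ∀ᶠ t in 𝓝[>] (0 : ℝ), p (u, t) := by
  obtain ⟨U, hU, hu, δ, hδ, h⟩ := (bdryFilter_basis u).1 h
  filter_upwards [Ioo_mem_nhdsGT hδ] with t ht using h u hu t ht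

theorem eventually_fderiv_eq {u₀ : Euc n} {f g : Euc n × ℝ → ℝ} (h : f =ᶠ[bdryFilter u₀] g) :
    ∀ᶠ q in bdryFilter u₀, fderiv ℝ f q = fderiv ℝ g q := by
  filter_upwards [eventually_eventually_bdryFilter h] with q hq
  exact Filter.EventuallyEq.fderiv_eq hq

theorem tanD_congr {u₀ : Euc n} {f g : Euc n × ℝ → ℝ} (h : f =ᶠ[bdryFilter u₀] g) (i : Fin n) :
    tanD i f =ᶠ[bdryFilter u₀] tanD i g := by
  filter_upwards [eventually_fderiv_eq h] with q hq
  simp [tanD, hq]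

theorem eulD_congr {u₀ : Euc n} {f g : Euc n × ℝ → ℝ} (h : f =ᶠ[bdryFilter u₀] g) :
    eulD f =ᶠ[bdryFilter u₀] eulD g := by
  filter_upwards [eventually_fderiv_eq h] with q hq
  simp [eulD, norD, hq]

/-! ### Smoothness near a boundary point, for `t > 0` -/

/-- `f` is smooth near `(u₀, 0)` for `t > 0`. -/
def SmoothNear (u₀ : Euc n) (f : Euc n × ℝ → ℝ) : Prop :=
  ∀ᶠ q in bdryFilter u₀, ContDiffAt ℝ ∞ f q

namespace SmoothNear

variable {u₀ : Euc n} {f g : Euc n × ℝ → ℝ}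

theorem congr (hf : SmoothNear u₀ f) (h : f =ᶠ[bdryFilter u₀] g) : SmoothNear u₀ g := by
  filter_upwards [hf, eventually_eventually_bdryFilter h] with q hq hq'
  exact hq.congr_of_eventuallyEq (hq'.mono fun _ h => h.symm)

theorem differentiableAt (hf : SmoothNear u₀ f) :
    ∀ᶠ q in bdryFilter u₀, DifferentiableAt ℝ f q :=
  hf.mono fun _ h => h.differentiableAt (by simp)

theorem add (hf : SmoothNear u₀ f) (hg : SmoothNear u₀ g) :
    SmoothNear u₀ (fun q => f q + g q) := by
  filter_upwards [hf, hg] with q h1 h2 using h1.add h2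

theorem mul (hf : SmoothNear u₀ f) (hg : SmoothNear u₀ g) :
    SmoothNear u₀ (fun q => f q * g q) := by
  filter_upwards [hf, hg] with q h1 h2 using h1.mul h2

theorem neg (hf : SmoothNear u₀ f) : SmoothNear u₀ (fun q => -f q) := by
  filter_upwards [hf] with q h1 using h1.neg

theorem inv (hf : SmoothNear u₀ f) (h0 : ∀ᶠ q in bdryFilter u₀, f q ≠ 0) :
    SmoothNear u₀ (fun q => (f q)⁻¹) := by
  filter_upwards [hf, h0] with q h1 h2 using h1.inv h2

theorem fderiv_apply (hf : SmoothNear u₀ f) (v : Euc n × ℝ) :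
    SmoothNear u₀ (fun q => fderiv ℝ f q v) := by
  filter_upwards [hf] with q h1
  exact (h1.fderiv_right (m := ∞) (by simp)).clm_apply contDiffAt_const

theorem tanD (hf : SmoothNear u₀ f) (i : Fin n) : SmoothNear u₀ (tanD i f) :=
  hf.fderiv_apply _

theorem norD (hf : SmoothNear u₀ f) : SmoothNear u₀ (norD f) :=
  hf.fderiv_apply _

end SmoothNear

/-! ### Leibniz and quotient rules for the tangential and Euler derivatives. -/

section DerivRules

variable {u₀ : Euc n} {f g : Euc n × ℝ → ℝ}

theorem tanD_add (hf : SmoothNear u₀ f) (hg : SmoothNear u₀ g) (i : Fin n) :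
    tanD i (fun q => f q + g q) =ᶠ[bdryFilter u₀] fun q => tanD i f q + tanD i g q := by
  filter_upwards [hf.differentiableAt, hg.differentiableAt] with q h1 h2
  simp [tanD, fderiv_fun_add h1 h2]

theorem eulD_add (hf : SmoothNear u₀ f) (hg : SmoothNear u₀ g) :
    eulD (fun q => f q + g q) =ᶠ[bdryFilter u₀] fun q => eulD f q + eulD g q := by
  filter_upwards [hf.differentiableAt, hg.differentiableAt] with q h1 h2
  simp [eulD, norD, fderiv_fun_add h1 h2, mul_add]

theorem tanD_mul (hf : SmoothNear u₀ f) (hg : SmoothNear u₀ g) (i : Fin n) :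
    tanD i (fun q => f q * g q) =ᶠ[bdryFilter u₀] fun q => tanD i f q * g q + f q * tanD i g q := by
  filter_upwards [hf.differentiableAt, hg.differentiableAt] with q h1 h2
  simp [tanD, fderiv_fun_mul h1 h2]; ring

theorem eulD_mul (hf : SmoothNear u₀ f) (hg : SmoothNear u₀ g) :
    eulD (fun q => f q * g q) =ᶠ[bdryFilter u₀] fun q => eulD f q * g q + f q * eulD g q := by
  filter_upwards [hf.differentiableAt, hg.differentiableAt] with q h1 h2
  simp [eulD, norD, fderiv_fun_mul h1 h2]; ring

theorem tanD_neg (i : Fin n) (q : Euc n × ℝ) : tanD i (fun q => -f q) q = -tanD i f q := by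
  simp [tanD, fderiv_fun_neg]

theorem eulD_neg (q : Euc n × ℝ) : eulD (fun q => -f q) q = -eulD f q := by
  simp [eulD, norD, fderiv_fun_neg]

theorem tanD_inv (hf : SmoothNear u₀ f) (h0 : ∀ᶠ q in bdryFilter u₀, f q ≠ 0) (i : Fin n) :
    tanD i (fun q => (f q)⁻¹) =ᶠ[bdryFilter u₀]
      fun q => -(tanD i f q * ((f q)⁻¹ * (f q)⁻¹)) := by
  filter_upwards [hf.differentiableAt, h0] with q h1 h2
  have := ((hasDerivAt_inv h2).comp_hasFDerivAt q h1.hasFDerivAt).fderiv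
  change fderiv ℝ (fun q => (f q)⁻¹) q _ = _
  rw [show (fun q => (f q)⁻¹) = Inv.inv ∘ f from rfl, this]
  simp [tanD]; field_simp

theorem eulD_inv (hf : SmoothNear u₀ f) (h0 : ∀ᶠ q in bdryFilter u₀, f q ≠ 0) :
    eulD (fun q => (f q)⁻¹) =ᶠ[bdryFilter u₀]
      fun q => -(eulD f q * ((f q)⁻¹ * (f q)⁻¹)) := by
  filter_upwards [hf.differentiableAt, h0] with q h1 h2
  have := ((hasDerivAt_inv h2).comp_hasFDerivAt q h1.hasFDerivAt).fderiv
  change _ * fderiv ℝ (fun q => (f q)⁻¹) q _ = _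
  rw [show (fun q => (f q)⁻¹) = Inv.inv ∘ f from rfl, this]
  simp [eulD, norD]; field_simp

end DerivRules

/-! ### Conormal functions -/

/-- `f` is smooth for `t > 0` and `O(t^ρ)` for all `ρ < k` near `(u₀, 0)`, together with its first
`r` derivatives along `∂/∂u_i` and `t ∂/∂t`. -/
def Conormal (u₀ : Euc n) (r : ℕ) (k : ℝ) : (Euc n × ℝ → ℝ) → Prop :=
  Nat.rec (fun f => SmoothNear u₀ f ∧ ∀ ρ < k, f =O[bdryFilter u₀] fun q => q.2 ^ ρ)
    (fun _ P f => (SmoothNear u₀ f ∧ ∀ ρ < k, f =O[bdryFilter u₀] fun q => q.2 ^ ρ) ∧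
      (∀ i, P (tanD i f)) ∧ P (eulD f)) r

namespace Conormal

variable {u₀ : Euc n} {f g : Euc n × ℝ → ℝ} {r : ℕ} {j k : ℝ}

theorem zero (hf : Conormal u₀ r k f) : Conormal u₀ 0 k f := by
  cases r with
  | zero => exact hf
  | succ r => exact hf.1

theorem smooth (hf : Conormal u₀ r k f) : SmoothNear u₀ f := hf.zero.1

theorem isBigO (hf : Conormal u₀ r k f) {ρ : ℝ} (h : ρ < k) :
    f =O[bdryFilter u₀] fun q => q.2 ^ ρ := hf.zero.2 ρ h

theorem tanD (hf : Conormal u₀ (r + 1) k f) (i : Fin n) : Conormal u₀ r k (tanD i f) := hf.2.1 i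

theorem eulD (hf : Conormal u₀ (r + 1) k f) : Conormal u₀ r k (eulD f) := hf.2.2

theorem congr (hf : Conormal u₀ r k f) (h : f =ᶠ[bdryFilter u₀] g) : Conormal u₀ r k g := by
  induction r generalizing f g with
  | zero => exact ⟨hf.1.congr h, fun ρ hρ => (hf.2 ρ hρ).congr' h .rfl⟩
  | succ r ih =>
    exact ⟨⟨hf.1.1.congr h, fun ρ hρ => (hf.1.2 ρ hρ).congr' h .rfl⟩,
      fun i => ih (hf.2.1 i) (tanD_congr h i), ih hf.2.2 (eulD_congr h)⟩

theorem of_succ (hf : Conormal u₀ (r + 1) k f) : Conormal u₀ r k f := by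
  induction r generalizing f with
  | zero => exact hf.1
  | succ r ih => exact ⟨hf.1, fun i => ih (hf.2.1 i), ih hf.2.2⟩

theorem of_le {s : ℕ} (hf : Conormal u₀ s k f) (h : r ≤ s) : Conormal u₀ r k f := by
  induction s, h using Nat.le_induction with
  | base => exact hf
  | succ s _ ih => exact ih hf.of_succ

theorem mono (hf : Conormal u₀ r k f) (h : j ≤ k) : Conormal u₀ r j f := by
  induction r generalizing f with
  | zero => exact ⟨hf.1, fun ρ hρ => hf.2 ρ (hρ.trans_le h)⟩
  | succ r ih =>
    exact ⟨⟨hf.1.1, fun ρ hρ => hf.1.2 ρ (hρ.trans_le h)⟩, fun i => ih (hf.2.1 i), ih hf.2.2⟩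

theorem add (hf : Conormal u₀ r k f) (hg : Conormal u₀ r k g) :
    Conormal u₀ r k (fun q => f q + g q) := by
  induction r generalizing f g with
  | zero => exact ⟨hf.1.add hg.1, fun ρ hρ => (hf.2 ρ hρ).add (hg.2 ρ hρ)⟩
  | succ r ih =>
    refine ⟨⟨hf.1.1.add hg.1.1, fun ρ hρ => (hf.1.2 ρ hρ).add (hg.1.2 ρ hρ)⟩, fun i => ?_, ?_⟩
    · exact (ih (hf.2.1 i) (hg.2.1 i)).congr (tanD_add hf.1.1 hg.1.1 i).symm
    · exact (ih hf.2.2 hg.2.2).congr (eulD_add hf.1.1 hg.1.1).symm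

theorem neg (hf : Conormal u₀ r k f) : Conormal u₀ r k (fun q => -f q) := by
  induction r generalizing f with
  | zero => exact ⟨hf.1.neg, fun ρ hρ => (hf.2 ρ hρ).neg_left⟩
  | succ r ih =>
    refine ⟨⟨hf.1.1.neg, fun ρ hρ => (hf.1.2 ρ hρ).neg_left⟩, fun i => ?_, ?_⟩
    · exact (ih (hf.2.1 i)).congr (.of_forall fun q => (tanD_neg i q).symm)
    · exact (ih hf.2.2).congr (.of_forall fun q => (eulD_neg q).symm)

theorem sub (hf : Conormal u₀ r k f) (hg : Conormal u₀ r k g) :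
    Conormal u₀ r k (fun q => f q - g q) := by
  simpa only [sub_eq_add_neg] using hf.add hg.neg

theorem mul_zero_order (hf : Conormal u₀ 0 j f) (hg : Conormal u₀ 0 k g) :
    Conormal u₀ 0 (j + k) (fun q => f q * g q) := by
  refine ⟨hf.1.mul hg.1, fun ρ hρ => ?_⟩
  -- The slack below j + k is shared equally, so that each factor is used at an exponent strictly
  -- below its own order.
  set η := (j + k - ρ) / 2 with hη
  have h1 := hf.2 (j - η) (by linarith)
  have h2 := hg.2 (k - η) (by linarith)
  refine (h1.mul h2).congr' .rfl ?_
  filter_upwards [eventually_bdryFilter_pos u₀] with q hq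
  rw [← Real.rpow_add hq]; congr 1; rw [hη]; ring

theorem mul (hf : Conormal u₀ r j f) (hg : Conormal u₀ r k g) :
    Conormal u₀ r (j + k) (fun q => f q * g q) := by
  induction r generalizing f g with
  | zero => exact hf.mul_zero_order hg
  | succ r ih =>
    refine ⟨hf.zero.mul_zero_order hg.zero, fun i => ?_, ?_⟩
    · exact ((ih (hf.2.1 i) hg.of_succ).add (ih hf.of_succ (hg.2.1 i))).congr
        (tanD_mul hf.1.1 hg.1.1 i).symm
    · exact ((ih hf.2.2 hg.of_succ).add (ih hf.of_succ hg.2.2)).congr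
        (eulD_mul hf.1.1 hg.1.1).symm

/-- A function smooth up to the boundary is bounded, hence O(t^ρ) for ρ < 0; ∂_u and t∂_t preserve
smoothness up to the boundary, so the bound iterates. -/
theorem of_smooth {h : Euc n × ℝ → ℝ} (hh : ∀ᶠ q in 𝓝 (u₀, (0 : ℝ)), ContDiffAt ℝ ∞ h q) :
    Conormal u₀ r 0 h := by
  have key : ∀ {h : Euc n × ℝ → ℝ}, (∀ᶠ q in 𝓝 (u₀, (0 : ℝ)), ContDiffAt ℝ ∞ h q) →
      Conormal u₀ 0 0 h := fun {h} hh => by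
    refine ⟨bdryFilter_le_nhds u₀ hh, fun ρ hρ => ?_⟩
    have h1 : h =O[bdryFilter u₀] fun _ => (1 : ℝ) :=
      (hh.self_of_nhds.continuousAt.isBigO_one ℝ).mono (bdryFilter_le_nhds u₀)
    refine h1.trans (Asymptotics.IsBigO.of_bound 1 ?_)
    filter_upwards [eventually_bdryFilter_pos u₀, eventually_bdryFilter_lt u₀ one_pos] with q h0 h1
    rw [Real.norm_of_nonneg (Real.rpow_nonneg h0.le _), norm_one, one_mul]
    exact Real.one_le_rpow_of_pos_of_le_one_of_nonpos h0 h1.le hρ.le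
  induction r generalizing h with
  | zero => exact key hh
  | succ r ih =>
    have hd : ∀ v, ∀ᶠ q in 𝓝 (u₀, (0 : ℝ)), ContDiffAt ℝ ∞ (fun q => fderiv ℝ h q v) q := by
      intro v
      filter_upwards [hh] with q h1
      exact (h1.fderiv_right (m := ∞) (by simp)).clm_apply contDiffAt_const
    refine ⟨key hh, fun i => ih (hd _), ih ?_⟩
    filter_upwards [hd (0, 1)] with q h1
    exact contDiffAt_snd.mul h1

theorem const (c : ℝ) : Conormal u₀ r 0 (fun _ => c) :=
  of_smooth (.of_forall fun _ => contDiffAt_const)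

theorem const_mul (hf : Conormal u₀ r k f) (c : ℝ) : Conormal u₀ r k (fun q => c * f q) := by
  simpa using (const (r := r) (u₀ := u₀) c).mul hf

theorem fun_zero : Conormal u₀ r k (fun _ => 0) := by
  have h0 : Conormal u₀ 0 k (fun _ => 0) :=
    ⟨.of_forall fun _ => contDiffAt_const, fun ρ hρ => Asymptotics.isBigO_zero _ _⟩
  induction r with
  | zero => exact h0
  | succ r ih =>
    exact ⟨h0, fun i => ih.congr (.of_forall fun q => by simp [PE.tanD]),
      ih.congr (.of_forall fun q => by simp [PE.eulD, PE.norD])⟩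

theorem sum {ι : Type*} (s : Finset ι) {F : ι → Euc n × ℝ → ℝ}
    (h : ∀ i ∈ s, Conormal u₀ r k (F i)) : Conormal u₀ r k (fun q => ∑ i ∈ s, F i q) := by
  classical
  induction s using Finset.induction_on with
  | empty => simpa using fun_zero
  | insert a s ha ih =>
    simp only [Finset.sum_insert ha]
    exact (h a (by simp)).add (ih fun i hi => h i (by simp [hi]))

/-- A derivative of 1/f is −f′·(1/f)², which is conormal by induction on the number of derivatives.
The lower bound on |f| supplies the case without derivatives. -/
theorem inv (hf : Conormal u₀ r 0 f) {c : ℝ} (hc : 0 < c)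
    (h0 : ∀ᶠ q in bdryFilter u₀, c ≤ |f q|) : Conormal u₀ r 0 (fun q => (f q)⁻¹) := by
  have hne : ∀ᶠ q in bdryFilter u₀, f q ≠ 0 := h0.mono fun q hq => abs_pos.1 (hc.trans_le hq)
  have key : Conormal u₀ 0 0 (fun q => (f q)⁻¹) := by
    refine ⟨hf.smooth.inv hne, fun ρ hρ => Asymptotics.IsBigO.of_bound c⁻¹ ?_⟩
    filter_upwards [eventually_bdryFilter_pos u₀, eventually_bdryFilter_lt u₀ one_pos, h0]
      with q h0 h1 h2
    rw [Real.norm_of_nonneg (Real.rpow_nonneg h0.le _), norm_inv, Real.norm_eq_abs]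
    have := Real.one_le_rpow_of_pos_of_le_one_of_nonpos h0 h1.le hρ.le
    have h3 := inv_anti₀ hc h2
    nlinarith [inv_pos.2 hc]
  induction r generalizing f with
  | zero => exact key
  | succ r ih =>
    have h1 := ih hf.of_succ h0 hne key
    refine ⟨key, fun i => ?_, ?_⟩
    · exact ((by simpa using (hf.tanD i).mul (h1.mul h1)) : Conormal u₀ r 0 _).neg.congr
        (tanD_inv hf.smooth hne i).symm
    · exact ((by simpa using hf.eulD.mul (h1.mul h1)) : Conormal u₀ r 0 _).neg.congr
        (eulD_inv hf.smooth hne).symm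

theorem tendsto_zero (hf : Conormal u₀ r k f) (hk : 0 < k) : Tendsto f (bdryFilter u₀) (𝓝 0) := by
  refine (hf.isBigO (half_lt_self hk)).trans_tendsto ?_
  have := (Real.continuousAt_rpow_const 0 (k / 2) (Or.inr (half_pos hk).le)).tendsto
  rw [Real.zero_rpow (half_pos hk).ne'] at this
  exact this.comp (tendsto_snd_bdryFilter u₀)

end Conormal


/-! ### Functions that are even in `t`, up to conormal errors -/

/-- Near `(u₀, 0)`, `f(u,t) = h(u, t²)` with `h` smooth. -/
def IsEvenNear (u₀ : Euc n) (f : Euc n × ℝ → ℝ) : Prop :=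
  ∃ h : Euc n × ℝ → ℝ, (∀ᶠ q in 𝓝 (u₀, (0 : ℝ)), ContDiffAt ℝ ∞ h q) ∧
    f =ᶠ[bdryFilter u₀] fun q => h (q.1, q.2 ^ 2)

theorem tendsto_sq_snd (u₀ : Euc n) :
    Tendsto (fun q : Euc n × ℝ => (q.1, q.2 ^ 2)) (𝓝 (u₀, 0)) (𝓝 (u₀, 0)) := by
  have : Continuous fun q : Euc n × ℝ => (q.1, q.2 ^ 2) := by fun_prop
  simpa using this.tendsto (u₀, 0)

theorem eventually_sq_snd {u₀ : Euc n} {p : Euc n × ℝ → Prop} (h : ∀ᶠ q in 𝓝 (u₀, (0 : ℝ)), p q) :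
    ∀ᶠ q in bdryFilter u₀, p (q.1, q.2 ^ 2) :=
  bdryFilter_le_nhds u₀ ((tendsto_sq_snd u₀).eventually h)

namespace IsEvenNear

variable {u₀ : Euc n} {f g : Euc n × ℝ → ℝ}

theorem add (hf : IsEvenNear u₀ f) (hg : IsEvenNear u₀ g) :
    IsEvenNear u₀ (fun q => f q + g q) := by
  obtain ⟨a, ha, haf⟩ := hf
  obtain ⟨b, hb, hbg⟩ := hg
  refine ⟨fun q => a q + b q, ?_, haf.add hbg⟩
  filter_upwards [ha, hb] with q h1 h2 using h1.add h2

theorem mul (hf : IsEvenNear u₀ f) (hg : IsEvenNear u₀ g) :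
    IsEvenNear u₀ (fun q => f q * g q) := by
  obtain ⟨a, ha, haf⟩ := hf
  obtain ⟨b, hb, hbg⟩ := hg
  refine ⟨fun q => a q * b q, ?_, haf.mul hbg⟩
  filter_upwards [ha, hb] with q h1 h2 using h1.mul h2

theorem const (c : ℝ) : IsEvenNear u₀ (fun _ => c) :=
  ⟨fun _ => c, .of_forall fun _ => contDiffAt_const, .rfl⟩

theorem sq : IsEvenNear u₀ (fun q => q.2 ^ 2) :=
  ⟨fun q => q.2, .of_forall fun _ => contDiffAt_snd, .rfl⟩

theorem of_fst {a : Euc n → ℝ} (ha : ∀ᶠ u in 𝓝 u₀, ContDiffAt ℝ ∞ a u) :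
    IsEvenNear u₀ (fun q => a q.1) := by
  refine ⟨fun q => a q.1, ?_, .rfl⟩
  filter_upwards [continuousAt_fst.eventually ha] with q h1
  exact h1.comp q contDiffAt_fst

/-- The limit determines the value of h at (u₀, 0), so h itself is invertible on a full
neighbourhood, including t ≤ 0. -/
theorem inv (hf : IsEvenNear u₀ f) {c : ℝ} (hc : c ≠ 0)
    (hlim : Tendsto f (bdryFilter u₀) (𝓝 c)) : IsEvenNear u₀ (fun q => (f q)⁻¹) := by
  obtain ⟨a, ha, haf⟩ := hf
  have hcont : ContinuousAt a (u₀, 0) := ha.self_of_nhds.continuousAt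
  have h1 : Tendsto f (bdryFilter u₀) (𝓝 (a (u₀, 0))) :=
    (((hcont.tendsto.comp (tendsto_sq_snd u₀)).mono_left (bdryFilter_le_nhds u₀))).congr' haf.symm
  have hac : a (u₀, 0) ≠ 0 := by
    rwa [tendsto_nhds_unique h1 hlim]
  refine ⟨fun q => (a q)⁻¹, ?_, haf.inv⟩
  filter_upwards [ha, hcont.eventually_ne hac] with q h1 h2 using h1.inv h2

theorem hasFDerivAt_comp_sq {h : Euc n × ℝ → ℝ} {q : Euc n × ℝ}
    (hh : DifferentiableAt ℝ h (q.1, q.2 ^ 2)) (v : Euc n × ℝ) :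
    fderiv ℝ (fun q : Euc n × ℝ => h (q.1, q.2 ^ 2)) q v
      = fderiv ℝ h (q.1, q.2 ^ 2) (v.1, 2 * q.2 * v.2) := by
  have h2 : HasFDerivAt (fun q : Euc n × ℝ => (q.1, q.2 ^ 2))
      ((ContinuousLinearMap.fst ℝ _ _).prod ((2 * q.2) • ContinuousLinearMap.snd ℝ _ _)) q := by
    refine hasFDerivAt_fst.prodMk ?_
    have := (hasDerivAt_pow 2 q.2).comp_hasFDerivAt q
      (hasFDerivAt_snd (𝕜 := ℝ) (E := Euc n) (F := ℝ) (p := q))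
    simpa using! this
  have := (HasFDerivAt.comp q (g := h) (f := fun q : Euc n × ℝ => (q.1, q.2 ^ 2))
    hh.hasFDerivAt h2).fderiv
  change fderiv ℝ (h ∘ fun q : Euc n × ℝ => (q.1, q.2 ^ 2)) q v = _
  rw [this]; simp

theorem smooth (hf : IsEvenNear u₀ f) : SmoothNear u₀ f := by
  obtain ⟨a, ha, haf⟩ := hf
  refine SmoothNear.congr ?_ haf.symm
  filter_upwards [eventually_sq_snd ha] with q hq
  exact hq.comp q (contDiffAt_fst.prodMk (contDiffAt_snd.pow 2))

theorem conormal (hf : IsEvenNear u₀ f) (r : ℕ) : Conormal u₀ r 0 f := by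
  obtain ⟨a, ha, haf⟩ := hf
  refine Conormal.congr (Conormal.of_smooth ?_) haf.symm
  filter_upwards [(tendsto_sq_snd u₀).eventually ha] with q hq
  exact hq.comp q (contDiffAt_fst.prodMk (contDiffAt_snd.pow 2))

theorem tanD (hf : IsEvenNear u₀ f) (i : Fin n) : IsEvenNear u₀ (tanD i f) := by
  obtain ⟨a, ha, haf⟩ := hf
  refine ⟨fun q => fderiv ℝ a q (stdVec i, 0), ?_, (tanD_congr haf i).trans ?_⟩
  · filter_upwards [ha] with q h1
    exact (h1.fderiv_right (m := ∞) (by simp)).clm_apply contDiffAt_const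
  · filter_upwards [eventually_sq_snd ha] with q hq
    simp [PE.tanD, hasFDerivAt_comp_sq (hq.differentiableAt (by simp))]

/-- The Euler derivative of an even function is `t²` times an even function. -/
theorem eulD (hf : IsEvenNear u₀ f) :
    ∃ e, IsEvenNear u₀ e ∧ eulD f =ᶠ[bdryFilter u₀] fun q => q.2 ^ 2 * e q := by
  obtain ⟨a, ha, haf⟩ := hf
  refine ⟨fun q => fderiv ℝ a (q.1, q.2 ^ 2) (0, 2), ⟨fun q => fderiv ℝ a q (0, 2), ?_, .rfl⟩,
    (eulD_congr haf).trans ?_⟩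
  · filter_upwards [ha] with q h1
    exact (h1.fderiv_right (m := ∞) (by simp)).clm_apply contDiffAt_const
  · filter_upwards [eventually_sq_snd ha] with q hq
    have h1 : ((0 : Euc n), 2 * q.2 * 1) = q.2 • ((0 : Euc n), (2 : ℝ)) := by
      ext <;> simp [mul_comm]
    simp only [PE.eulD, norD, hasFDerivAt_comp_sq (hq.differentiableAt (by simp)), h1, map_smul,
      smul_eq_mul]
    ring

end IsEvenNear

/-- `f` is the sum of an even function and a conormal function of order `k`. -/
def EvenMod (u₀ : Euc n) (r : ℕ) (k : ℝ) (f : Euc n × ℝ → ℝ) : Prop :=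
  ∃ e, IsEvenNear u₀ e ∧ Conormal u₀ r k (fun q => f q - e q)

theorem conormal_sq (u₀ : Euc n) (r : ℕ) : Conormal u₀ r 2 (fun q => q.2 ^ 2) := by
  have h0 : Conormal u₀ 0 2 (fun q => q.2 ^ 2) := by
    refine ⟨.of_forall fun _ => contDiffAt_snd.pow 2, fun ρ hρ => Asymptotics.IsBigO.of_bound 1 ?_⟩
    filter_upwards [eventually_bdryFilter_pos u₀, eventually_bdryFilter_lt u₀ one_pos] with q h0 h1
    rw [Real.norm_of_nonneg (by positivity), Real.norm_of_nonneg (Real.rpow_nonneg h0.le _),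
      one_mul, ← Real.rpow_natCast]
    exact Real.rpow_le_rpow_of_exponent_ge h0 h1.le (by exact_mod_cast hρ.le)
  induction r with
  | zero => exact h0
  | succ r ih =>
    have hd : ∀ (q v : Euc n × ℝ), fderiv ℝ (fun q : Euc n × ℝ => q.2 ^ 2) q v = 2 * q.2 * v.2 := by
      intro q v
      have := (hasDerivAt_pow 2 q.2).comp_hasFDerivAt q
        (hasFDerivAt_snd (𝕜 := ℝ) (E := Euc n) (F := ℝ) (p := q))
      have := this.fderiv
      change fderiv ℝ ((fun x : ℝ => x ^ 2) ∘ Prod.snd) q v = _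
      rw [this]; simp
    refine ⟨h0, fun i => Conormal.fun_zero.congr (.of_forall fun q => ?_),
      (ih.const_mul 2).congr (.of_forall fun q => ?_)⟩
    · simp [tanD, hd]
    · simp only [eulD, norD, hd]; ring

namespace EvenMod

variable {u₀ : Euc n} {f g : Euc n × ℝ → ℝ} {r : ℕ} {j k : ℝ}

theorem of_even (hf : IsEvenNear u₀ f) : EvenMod u₀ r k f :=
  ⟨f, hf, by simpa using Conormal.fun_zero⟩

theorem of_conormal (hf : Conormal u₀ r k f) : EvenMod u₀ r k f :=
  ⟨fun _ => 0, .const 0, by simpa using hf⟩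

theorem const (c : ℝ) : EvenMod u₀ r k (fun _ => c) := of_even (.const c)

theorem congr (hf : EvenMod u₀ r k f) (h : f =ᶠ[bdryFilter u₀] g) : EvenMod u₀ r k g := by
  obtain ⟨e, he, hr⟩ := hf
  exact ⟨e, he, hr.congr (h.sub .rfl)⟩

theorem mono (hf : EvenMod u₀ r k f) (h : j ≤ k) : EvenMod u₀ r j f := by
  obtain ⟨e, he, hr⟩ := hf
  exact ⟨e, he, hr.mono h⟩

theorem of_le {s : ℕ} (hf : EvenMod u₀ s k f) (h : r ≤ s) : EvenMod u₀ r k f := by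
  obtain ⟨e, he, hr⟩ := hf
  exact ⟨e, he, hr.of_le h⟩

theorem conormal (hf : EvenMod u₀ r k f) (hk : 0 ≤ k) : Conormal u₀ r 0 f := by
  obtain ⟨e, he, hr⟩ := hf
  exact ((hr.mono hk).add (he.conormal r)).congr (.of_forall fun q => by simp)

theorem add (hf : EvenMod u₀ r k f) (hg : EvenMod u₀ r k g) :
    EvenMod u₀ r k (fun q => f q + g q) := by
  obtain ⟨e, he, hr⟩ := hf
  obtain ⟨e', he', hr'⟩ := hg
  exact ⟨_, he.add he', (hr.add hr').congr (.of_forall fun q => by ring)⟩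

/-- fg − ee′ = f(g − e′) + (f − e)e′, where f and e′ have order 0. -/
theorem mul (hk : 0 ≤ k) (hf : EvenMod u₀ r k f) (hg : EvenMod u₀ r k g) :
    EvenMod u₀ r k (fun q => f q * g q) := by
  have hf0 := hf.conormal hk
  obtain ⟨e, he, hr⟩ := hf
  obtain ⟨e', he', hr'⟩ := hg
  have h1 : Conormal u₀ r k (fun q => f q * (g q - e' q)) := by simpa using hf0.mul hr'
  have h2 : Conormal u₀ r k (fun q => (f q - e q) * e' q) := by simpa using hr.mul (he'.conormal r)
  exact ⟨_, he.mul he', (h1.add h2).congr (.of_forall fun q => by ring)⟩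

theorem const_mul (hk : 0 ≤ k) (hf : EvenMod u₀ r k f) (c : ℝ) :
    EvenMod u₀ r k (fun q => c * f q) := (const c).mul hk hf

theorem neg (hf : EvenMod u₀ r k f) : EvenMod u₀ r k (fun q => -f q) := by
  obtain ⟨e, he, hr⟩ := hf
  exact ⟨fun q => -1 * e q, (IsEvenNear.const _).mul he, hr.neg.congr (.of_forall fun q => by ring)⟩

theorem sub (hf : EvenMod u₀ r k f) (hg : EvenMod u₀ r k g) :
    EvenMod u₀ r k (fun q => f q - g q) := by
  simpa only [sub_eq_add_neg] using hf.add hg.neg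

theorem sum {ι : Type*} (s : Finset ι) {F : ι → Euc n × ℝ → ℝ}
    (h : ∀ i ∈ s, EvenMod u₀ r k (F i)) : EvenMod u₀ r k (fun q => ∑ i ∈ s, F i q) := by
  classical
  induction s using Finset.induction_on with
  | empty => simpa using const 0
  | insert a s ha ih =>
    simp only [Finset.sum_insert ha]
    exact (h a (by simp)).add (ih fun i hi => h i (by simp [hi]))

theorem prod (hk : 0 ≤ k) {ι : Type*} (s : Finset ι) {F : ι → Euc n × ℝ → ℝ}
    (h : ∀ i ∈ s, EvenMod u₀ r k (F i)) : EvenMod u₀ r k (fun q => ∏ i ∈ s, F i q) := by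
  classical
  induction s using Finset.induction_on with
  | empty => simpa using const 1
  | insert a s ha ih =>
    simp only [Finset.prod_insert ha]
    exact (h a (by simp)).mul hk (ih fun i hi => h i (by simp [hi]))

/-- The gain of two orders here is what makes the curvature of the slices and the tangential
gradient harmless in the inductions. -/
theorem sq_mul (hf : EvenMod u₀ r k f) : EvenMod u₀ r (k + 2) (fun q => q.2 ^ 2 * f q) := by
  obtain ⟨e, he, hr⟩ := hf
  refine ⟨_, IsEvenNear.sq.mul he, ?_⟩
  rw [add_comm k 2]
  exact ((conormal_sq u₀ r).mul hr).congr (.of_forall fun q => by ring)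

theorem tanD (hf : EvenMod u₀ (r + 1) k f) (i : Fin n) : EvenMod u₀ r k (tanD i f) := by
  obtain ⟨e, he, hr⟩ := hf
  refine ⟨_, he.tanD i, (hr.tanD i).congr ?_⟩
  have h1 : SmoothNear u₀ f :=
    (hr.smooth.add he.smooth).congr (.of_forall fun q => by simp)
  filter_upwards [h1.differentiableAt, he.smooth.differentiableAt] with q h1 h2
  simp [PE.tanD, fderiv_fun_sub h1 h2]

/-- 1/f − 1/e = −(f − e)/(fe). Positivity of k makes the error tend to 0, so e has the same nonzero
limit as f. -/
theorem inv (hk : 0 < k) (hf : EvenMod u₀ r k f) {c : ℝ} (hc : c ≠ 0)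
    (hlim : Tendsto f (bdryFilter u₀) (𝓝 c)) : EvenMod u₀ r k (fun q => (f q)⁻¹) := by
  have hf0 := hf.conormal hk.le
  obtain ⟨e, he, hr⟩ := hf
  have hlime : Tendsto e (bdryFilter u₀) (𝓝 c) := by
    have := hlim.sub (hr.tendsto_zero hk)
    simpa using this
  have hb : ∀ {φ : Euc n × ℝ → ℝ}, Tendsto φ (bdryFilter u₀) (𝓝 c) →
      ∀ᶠ q in bdryFilter u₀, |c| / 2 ≤ |φ q| := fun h =>
    (h.abs.eventually (lt_mem_nhds (half_lt_self (abs_pos.2 hc)))).mono fun _ h => h.le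
  have hc2 : 0 < |c| / 2 := half_pos (abs_pos.2 hc)
  have h1 := hf0.inv hc2 (hb hlim)
  have h2 := (he.conormal r).inv hc2 (hb hlime)
  refine ⟨_, he.inv hc hlime, ?_⟩
  have h3 : Conormal u₀ r k (fun q => (f q - e q) * ((f q)⁻¹ * (e q)⁻¹)) := by
    simpa using hr.mul (h1.mul h2)
  refine h3.neg.congr ?_
  filter_upwards [hb hlim, hb hlime] with q h1 h2
  have h1 : f q ≠ 0 := abs_pos.1 (hc2.trans_le h1)
  have h2 : e q ≠ 0 := abs_pos.1 (hc2.trans_le h2)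
  field_simp; ring

end EvenMod


/-! ### Log-power terms and uniqueness of expansions -/

/-- The terms `∑_{p ≤ P} a_p(u) t^k (log t)^p` of order `k` of an expansion. -/
def logPoly (k P : ℕ) (a : ℕ → Euc n → ℝ) (q : Euc n × ℝ) : ℝ :=
  ∑ p ∈ Finset.range (P + 1), a p q.1 * q.2 ^ k * Real.log q.2 ^ p

theorem fderiv_pow_mul_log (k p : ℕ) {q : Euc n × ℝ} (hq : 0 < q.2) (v : Euc n × ℝ) :
    fderiv ℝ (fun q : Euc n × ℝ => q.2 ^ k * Real.log q.2 ^ p) q v =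
      (k * q.2 ^ (k - 1) * Real.log q.2 ^ p
        + q.2 ^ k * (p * Real.log q.2 ^ (p - 1) * q.2⁻¹)) * v.2 := by
  have h1 := (hasDerivAt_pow k q.2).mul ((Real.hasDerivAt_log hq.ne').pow p)
  have h2 := (h1.comp_hasFDerivAt q
    (hasFDerivAt_snd (𝕜 := ℝ) (E := Euc n) (F := ℝ) (p := q))).fderiv
  change fderiv ℝ (((fun t : ℝ => t ^ k) * Real.log ^ p) ∘ Prod.snd) q v = _
  rw [h2]
  simp

theorem eulD_pow_mul_log (k p : ℕ) {q : Euc n × ℝ} (hq : 0 < q.2) :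
    eulD (fun q : Euc n × ℝ => q.2 ^ k * Real.log q.2 ^ p) q =
      k * (q.2 ^ k * Real.log q.2 ^ p) + p * (q.2 ^ k * Real.log q.2 ^ (p - 1)) := by
  simp only [eulD, norD, fderiv_pow_mul_log k p hq]
  rcases k with _ | k
  · simp; field_simp
  · simp only [Nat.add_sub_cancel]; push_cast; field_simp; ring

theorem smoothNear_pow_mul_log (u₀ : Euc n) (k p : ℕ) :
    SmoothNear u₀ (fun q : Euc n × ℝ => q.2 ^ k * Real.log q.2 ^ p) := by
  filter_upwards [eventually_bdryFilter_pos u₀] with q hq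
  exact (contDiffAt_snd.pow k).mul ((contDiffAt_snd.log hq.ne').pow p)

/-- A power of log t costs an arbitrarily small power of t; this is why conormal orders are tested
only by exponents strictly below the order. -/
theorem isBigO_pow_mul_log {k p : ℕ} {ρ : ℝ} (hρ : ρ < k) :
    (fun t : ℝ => t ^ k * Real.log t ^ p) =O[𝓝[>] 0] fun t => t ^ ρ := by
  have h1 := (isLittleO_abs_log_rpow_rpow_nhdsGT_zero p (sub_neg.2 hρ)).isBigO
  have h2 := (Asymptotics.isBigO_refl (fun t : ℝ => t ^ k) (𝓝[>] 0)).mul h1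
  refine (Asymptotics.isBigO_norm_left.1 ((h2.norm_left).congr' ?_ ?_))
  · filter_upwards [self_mem_nhdsWithin] with t ht
    simp
  · filter_upwards [self_mem_nhdsWithin] with t (ht : 0 < t)
    rw [← Real.rpow_natCast, ← Real.rpow_add ht]; congr 1; ring

theorem conormal_pow_mul_log (u₀ : Euc n) (r k p : ℕ) :
    Conormal u₀ r k (fun q => q.2 ^ k * Real.log q.2 ^ p) := by
  have h0 : ∀ p, Conormal u₀ 0 k (fun q => q.2 ^ k * Real.log q.2 ^ p) := fun p =>
    ⟨smoothNear_pow_mul_log u₀ k p, fun ρ hρ => (isBigO_pow_mul_log hρ).comp_tendsto tendsto_snd⟩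
  induction r generalizing p with
  | zero => exact h0 p
  | succ r ih =>
    refine ⟨h0 p, fun i => Conormal.fun_zero.congr ?_,
      (((ih p).const_mul k).add ((ih (p - 1)).const_mul p)).congr ?_⟩
    · filter_upwards [eventually_bdryFilter_pos u₀] with q hq
      simp [tanD, fderiv_pow_mul_log k p hq]
    · filter_upwards [eventually_bdryFilter_pos u₀] with q hq
      rw [eulD_pow_mul_log k p hq]

theorem conormal_logPoly {u₀ : Euc n} (r k P : ℕ) {a : ℕ → Euc n → ℝ}
    (ha : ∀ p ≤ P, ∀ᶠ u in 𝓝 u₀, ContDiffAt ℝ ∞ (a p) u) : Conormal u₀ r k (logPoly k P a) := by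
  refine Conormal.sum _ fun p hp => ?_
  have h1 := ((IsEvenNear.of_fst (ha p (by simp at hp; omega))).conormal r).mul
    (conormal_pow_mul_log u₀ r k p)
  rw [zero_add] at h1
  exact h1.congr (.of_forall fun q => by ring)

/-- On a block of order k the Euler operator is k plus a nilpotent shift in the power of log t.
Vanishing of the coefficient P + 1 closes the shift on the given range. -/
theorem eulD_logPoly {u₀ : Euc n} (k P : ℕ) {a : ℕ → Euc n → ℝ}
    (ha : ∀ p ≤ P, ∀ᶠ u in 𝓝 u₀, ContDiffAt ℝ ∞ (a p) u) (hP : ∀ u, a (P + 1) u = 0) :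
    eulD (logPoly k P a) =ᶠ[bdryFilter u₀]
      logPoly k P (fun p u => k * a p u + (p + 1) * a (p + 1) u) := by
  have hev : ∀ p ∈ Finset.range (P + 1), ∀ᶠ q in bdryFilter u₀,
      DifferentiableAt ℝ (fun q : Euc n × ℝ => a p q.1) q := fun p hp =>
    (IsEvenNear.of_fst (ha p (by simp at hp; omega))).smooth.differentiableAt
  filter_upwards [eventually_bdryFilter_pos u₀, (Filter.eventually_all_finset _).2 hev] with q hq hd
  have hterm : ∀ p ∈ Finset.range (P + 1),
      HasFDerivAt (fun q : Euc n × ℝ => a p q.1 * q.2 ^ k * Real.log q.2 ^ p)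
        (a p q.1 • fderiv ℝ (fun q : Euc n × ℝ => q.2 ^ k * Real.log q.2 ^ p) q +
          (q.2 ^ k * Real.log q.2 ^ p) • fderiv ℝ (fun q : Euc n × ℝ => a p q.1) q) q := by
    intro p hp
    have h2 : DifferentiableAt ℝ (fun q : Euc n × ℝ => q.2 ^ k * Real.log q.2 ^ p) q :=
      ((contDiffAt_snd.pow k).mul ((contDiffAt_snd.log hq.ne').pow p) :
        ContDiffAt ℝ 1 _ q).differentiableAt (by simp)
    have := (hd p hp).hasFDerivAt.mul h2.hasFDerivAt
    simpa only [mul_assoc] using! this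
  have hz : ∀ p ∈ Finset.range (P + 1), fderiv ℝ (fun q : Euc n × ℝ => a p q.1) q (0, 1) = 0 := by
    intro p hp
    have h3 : HasFDerivAt (fun s : ℝ => ((q.1, s) : Euc n × ℝ))
      (ContinuousLinearMap.inr ℝ (Euc n) ℝ) q.2 := hasFDerivAt_prodMk_right q.1 q.2
    have h4 := HasFDerivAt.comp q.2 (g := fun q : Euc n × ℝ => a p q.1) (f := fun s : ℝ => (q.1, s))
      (hd p hp).hasFDerivAt h3
    have h5 := h4.unique (hasFDerivAt_const (a p q.1) q.2)
    have := congrArg (fun L => L 1) h5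
    simpa using this
  have hsum := (HasFDerivAt.fun_sum hterm).fderiv
  change q.2 * fderiv ℝ (fun q => ∑ p ∈ Finset.range (P + 1), a p q.1 * q.2 ^ k * Real.log q.2 ^ p)
    q (0, 1) = _
  rw [hsum, _root_.sum_apply, Finset.mul_sum]
  have e1 : ∀ p ∈ Finset.range (P + 1), q.2 * ((a p q.1 • fderiv ℝ
      (fun q : Euc n × ℝ => q.2 ^ k * Real.log q.2 ^ p) q +
      (q.2 ^ k * Real.log q.2 ^ p) • fderiv ℝ (fun q : Euc n × ℝ => a p q.1) q) (0, 1)) =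
      k * a p q.1 * q.2 ^ k * Real.log q.2 ^ p
        + p * a p q.1 * q.2 ^ k * Real.log q.2 ^ (p - 1) := by
    intro p hp
    have := eulD_pow_mul_log k p hq
    simp only [eulD, norD] at this
    simp only [_root_.add_apply, _root_.smul_apply, smul_eq_mul, hz p hp]
    linear_combination a p q.1 * this
  rw [Finset.sum_congr rfl e1, Finset.sum_add_distrib, logPoly]
  have e2 : ∀ p : ℕ, (k * a p q.1 + (p + 1) * a (p + 1) q.1) * q.2 ^ k * Real.log q.2 ^ p =
      k * a p q.1 * q.2 ^ k * Real.log q.2 ^ p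
        + (p + 1) * a (p + 1) q.1 * q.2 ^ k * Real.log q.2 ^ p := fun p => by ring
  simp only [e2, Finset.sum_add_distrib]
  congr 1
  rw [Finset.sum_range_succ', Finset.sum_range_succ _ P]
  simp [hP]

theorem tendsto_rpow_nhdsGT_zero {ρ : ℝ} (hρ : 0 < ρ) :
    Tendsto (fun t : ℝ => t ^ ρ) (𝓝[>] 0) (𝓝 0) := by
  have := (Real.continuousAt_rpow_const 0 ρ (Or.inr hρ.le)).tendsto
  rw [Real.zero_rpow hρ.ne'] at this
  exact this.mono_left nhdsWithin_le_nhds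

/-- A sum `∑_{k ≤ K} t^k Q_k(log t)` with polynomials `Q_k` that is `O(t^{K + 1/2})` vanishes. -/
theorem eq_zero_of_isBigO_pow_mul_log (K : ℕ) (Q : ℕ → Polynomial ℝ)
    (h : (fun t : ℝ => ∑ k ∈ Finset.range (K + 1), t ^ k * (Q k).eval (Real.log t))
      =O[𝓝[>] 0] fun t => t ^ (K + 1 / 2 : ℝ)) : ∀ k ≤ K, Q k = 0 := by
  have heval : ∀ (R : Polynomial ℝ) (k : ℕ), 0 < k →
      Tendsto (fun t : ℝ => t ^ k * R.eval (Real.log t)) (𝓝[>] 0) (𝓝 0) := by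
    intro R k hk
    have h1 : Tendsto (fun t : ℝ => ∑ p ∈ Finset.range (R.natDegree + 1),
        R.coeff p * (t ^ k * Real.log t ^ p)) (𝓝[>] 0)
          (𝓝 (∑ p ∈ Finset.range (R.natDegree + 1), R.coeff p * 0)) := by
      refine tendsto_finsetSum _ fun p _ => Tendsto.const_mul _ ?_
      refine (isBigO_pow_mul_log (ρ := 1 / 2) ?_).trans_tendsto ?_
      · have : (1 : ℝ) ≤ k := by exact_mod_cast hk
        linarith
      · exact tendsto_rpow_nhdsGT_zero (by norm_num)
    simp only [mul_zero, Finset.sum_const_zero] at h1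
    refine h1.congr fun t => ?_
    rw [Polynomial.eval_eq_sum_range, Finset.mul_sum]
    exact Finset.sum_congr rfl fun p _ => by ring
  -- Put t = e^(−s): a polynomial in s with limit 0 at infinity is zero.
  have hzero : ∀ R : Polynomial ℝ,
      Tendsto (fun t : ℝ => R.eval (Real.log t)) (𝓝[>] 0) (𝓝 0) → R = 0 := by
    intro R hR
    have h1 : Tendsto (fun s : ℝ => R.eval (-s)) atTop (𝓝 0) := by
      have h2 : Tendsto (fun s : ℝ => Real.exp (-s)) atTop (𝓝[>] 0) :=
        tendsto_nhdsWithin_iff.2 ⟨Real.tendsto_exp_neg_atTop_nhds_zero,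
          .of_forall fun s => Real.exp_pos _⟩
      simpa [Function.comp_def] using hR.comp h2
    have h3 : Tendsto (fun s : ℝ => (R.comp (-Polynomial.X)).eval s) atTop (𝓝 0) := by
      simpa using h1
    have h4 := ((R.comp (-Polynomial.X)).tendsto_nhds_iff.1 h3).1
    rw [Polynomial.leadingCoeff_eq_zero] at h4
    have h5 := congrArg (fun S : Polynomial ℝ => S.comp (-Polynomial.X)) h4
    simpa [Polynomial.comp_assoc] using h5
  induction K generalizing Q with
  | zero =>
    intro k hk
    obtain rfl : k = 0 := by omega
    refine hzero _ ?_
    have h1 := h.trans_tendsto (tendsto_rpow_nhdsGT_zero (by norm_num))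
    simpa using h1
  | succ K ih =>
    -- The terms with k ≥ 1 tend to 0, so the limit t → 0 isolates the polynomial at order 0.
    have hQ0 : Q 0 = 0 := by
      refine hzero _ ?_
      have h1 := h.trans_tendsto (tendsto_rpow_nhdsGT_zero (by positivity))
      have h2 : Tendsto (fun t : ℝ => ∑ k ∈ Finset.range (K + 1),
          t ^ (k + 1) * (Q (k + 1)).eval (Real.log t)) (𝓝[>] 0)
            (𝓝 (∑ k ∈ Finset.range (K + 1), 0)) :=
        tendsto_finsetSum _ fun k _ => heval _ _ (by omega)
      have h3 := h1.sub h2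
      simp only [Finset.sum_const_zero, sub_zero] at h3
      refine h3.congr fun t => ?_
      rw [Finset.sum_range_succ']; simp
    have h1 := ih (fun k => Q (k + 1)) ?_
    · intro k hk
      rcases k with _ | k
      · exact hQ0
      · exact h1 k (by omega)
    -- Once the order-0 term is gone, division by t lowers all orders by one and the induction
    -- hypothesis applies.
    · have h2 := (Asymptotics.isBigO_refl (fun t : ℝ => t⁻¹) (𝓝[>] 0)).mul h
      refine h2.congr' ?_ ?_
      · filter_upwards [self_mem_nhdsWithin] with t (ht : 0 < t)
        rw [Finset.sum_range_succ' _ (K + 1), hQ0]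
        simp only [Polynomial.eval_zero, mul_zero, add_zero, Finset.mul_sum]
        refine Finset.sum_congr rfl fun k _ => ?_
        rw [pow_succ]; field_simp
      · filter_upwards [self_mem_nhdsWithin] with t (ht : 0 < t)
        rw [← Real.rpow_neg_one, ← Real.rpow_add ht]; congr 1; push_cast; ring

/-- The polynomial in `log t` with coefficients `a 0, …, a P`. -/
def logPolyPoly (P : ℕ) (a : ℕ → ℝ) : Polynomial ℝ :=
  ∑ p ∈ Finset.range (P + 1), Polynomial.C (a p) * Polynomial.X ^ p

theorem coeff_logPolyPoly {P : ℕ} (a : ℕ → ℝ) {p : ℕ} (hp : p ≤ P) :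
    (logPolyPoly P a).coeff p = a p := by
  simp only [logPolyPoly, Polynomial.finsetSum_coeff, Polynomial.coeff_C_mul_X_pow]
  rw [Finset.sum_ite_eq]; simp; omega

theorem eval_logPolyPoly (P : ℕ) (a : ℕ → ℝ) (s : ℝ) :
    (logPolyPoly P a).eval s = ∑ p ∈ Finset.range (P + 1), a p * s ^ p := by
  simp [logPolyPoly, Polynomial.eval_finsetSum]

/-- One-variable form: log terms and odd powers are not even modulo higher order. -/
theorem coeff_eq_zero_of_even {k P : ℕ} {c : ℕ → ℝ} {ψ : ℝ → ℝ} (hψ : ContDiffAt ℝ ∞ ψ 0)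
    (h : (fun t : ℝ => (∑ p ∈ Finset.range (P + 1), c p * t ^ k * Real.log t ^ p) - ψ (t ^ 2))
      =O[𝓝[>] 0] fun t => t ^ (k + 1 / 2 : ℝ)) :
    (∀ p, 1 ≤ p → p ≤ P → c p = 0) ∧ (Odd k → c 0 = 0) := by
  obtain ⟨W, hW, h0W, hψW⟩ :=
    (hψ.of_le (show ((k + 1 : ℕ) : ℕ∞ω) ≤ ∞ by exact_mod_cast le_top)).contDiffOn'
      (m := (k + 1 : ℕ)) le_rfl (by simp)
  obtain ⟨η, hη, hηW⟩ := Metric.isOpen_iff.1 hW 0 h0W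
  have hT := taylor_isLittleO (n := k + 1) (convex_ball (0 : ℝ) η) (Metric.mem_ball_self hη)
    (hψW.mono (by simpa using hηW))
  rw [Metric.isOpen_ball.nhdsWithin_eq (Metric.mem_ball_self hη)] at hT
  set d : ℕ → ℝ := fun i => (i.factorial : ℝ)⁻¹ * iteratedDerivWithin i ψ (Metric.ball 0 η) 0 with hd
  have hsq : Tendsto (fun t : ℝ => t ^ 2) (𝓝[>] 0) (𝓝 0) := by
    have : Continuous fun t : ℝ => t ^ 2 := by fun_prop
    simpa using (this.tendsto 0).mono_left nhdsWithin_le_nhds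
  have h1 : (fun t : ℝ => ψ (t ^ 2) - ∑ i ∈ Finset.range (k + 2), d i * t ^ (2 * i))
      =O[𝓝[>] 0] fun t => t ^ (k + 1 / 2 : ℝ) := by
    refine ((hT.isBigO.comp_tendsto hsq).congr_left fun t => ?_).trans ?_
    · simp only [Function.comp, taylor_within_apply, sub_zero, smul_eq_mul, hd]
      congr 1
      exact Finset.sum_congr rfl fun i _ => by rw [← pow_mul]; ring
    · refine Asymptotics.IsBigO.of_bound 1 ?_
      filter_upwards [Ioo_mem_nhdsGT (zero_lt_one' ℝ)] with t ht
      simp only [Function.comp, sub_zero, one_mul]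
      rw [Real.norm_of_nonneg (by positivity), Real.norm_of_nonneg (Real.rpow_nonneg ht.1.le _),
        ← pow_mul, ← Real.rpow_natCast]
      refine Real.rpow_le_rpow_of_exponent_ge ht.1 ht.2.le ?_
      push_cast; linarith
  -- Taylor terms t^(2i) with 2i > k are already of the size of the error; only those with 2i ≤ k
  -- are kept for comparison.
  have h2 : (fun t : ℝ => ∑ i ∈ Finset.range (k + 2) with k < 2 * i, d i * t ^ (2 * i))
      =O[𝓝[>] 0] fun t => t ^ (k + 1 / 2 : ℝ) := by
    refine Asymptotics.IsBigO.fun_sum fun i hi => ?_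
    refine Asymptotics.IsBigO.const_mul_left (f := fun t : ℝ => t ^ (2 * i)) ?_ _
    have hi : k + 1 ≤ 2 * i := by simp at hi; omega
    refine Asymptotics.IsBigO.of_bound 1 ?_
    filter_upwards [Ioo_mem_nhdsGT (zero_lt_one' ℝ)] with t ht
    rw [one_mul, Real.norm_of_nonneg (by have := ht.1; positivity),
      Real.norm_of_nonneg (Real.rpow_nonneg ht.1.le _), ← Real.rpow_natCast]
    refine Real.rpow_le_rpow_of_exponent_ge ht.1 ht.2.le ?_
    have : ((k + 1 : ℕ) : ℝ) ≤ (2 * i : ℕ) := by exact_mod_cast hi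
    push_cast at this ⊢; linarith
  -- Order by order, the block at k minus the Taylor coefficients at even j. At j = k its vanishing
  -- says that the block is constant in log t, and zero when k is odd.
  set Q : ℕ → Polynomial ℝ := fun j => (if j = k then logPolyPoly P c else 0)
    - Polynomial.C (if Even j then d (j / 2) else 0) with hQ
  have h3 := eq_zero_of_isBigO_pow_mul_log k Q ?_ k le_rfl
  · have h4 : ∀ p, (logPolyPoly P c).coeff p =
        (Polynomial.C (if Even k then d (k / 2) else 0)).coeff p := by
      intro p
      simp only [hQ, if_true, sub_eq_zero] at h3
      rw [h3]
    refine ⟨fun p hp hpP => ?_, fun hk => ?_⟩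
    · have := h4 p
      rwa [coeff_logPolyPoly c hpP, Polynomial.coeff_C_of_ne_zero (by omega)] at this
    · have := h4 0
      rwa [coeff_logPolyPoly c (Nat.zero_le _), if_neg (Nat.not_even_iff_odd.2 hk), map_zero,
        Polynomial.coeff_zero] at this
  · refine ((h.add h1).add h2).congr_left fun t => ?_
    have e1 : ∑ j ∈ Finset.range (k + 1), t ^ j * (Q j).eval (Real.log t)
        = (∑ p ∈ Finset.range (P + 1), c p * t ^ k * Real.log t ^ p)
          - ∑ j ∈ Finset.range (k + 1), t ^ j * (if Even j then d (j / 2) else 0) := by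
      simp only [hQ, Polynomial.eval_sub, Polynomial.eval_C, mul_sub, Finset.sum_sub_distrib]
      congr 1
      rw [Finset.sum_eq_single k (fun j _ hj => by simp [hj]) (by simp)]
      simp only [if_true, eval_logPolyPoly, Finset.mul_sum]
      exact Finset.sum_congr rfl fun p _ => by ring
    have e2 : ∑ j ∈ Finset.range (k + 1), t ^ j * (if Even j then d (j / 2) else 0)
        = ∑ i ∈ Finset.range (k + 2) with ¬ k < 2 * i, d i * t ^ (2 * i) := by
      have : ∀ j, t ^ j * (if Even j then d (j / 2) else 0) =
          if Even j then d (j / 2) * t ^ j else 0 := fun j => by split_ifs <;> ring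
      simp only [this]
      rw [← Finset.sum_filter]
      refine Finset.sum_bij' (fun j _ => j / 2) (fun i _ => 2 * i) ?_ ?_ ?_ ?_ ?_
      · intro j hj; simp at hj ⊢; omega
      · intro i hi; simp at hi ⊢; omega
      · intro j hj; simp at hj; obtain ⟨s, rfl⟩ := hj.2; omega
      · intro i hi; simp
      · intro j hj; simp at hj; obtain ⟨s, rfl⟩ := hj.2
        rw [show (s + s) / 2 = s by omega, two_mul]
    rw [e1, e2, ← Finset.sum_filter_add_sum_filter_not (Finset.range (k + 2)) (fun i => k < 2 * i)]
    ring

/-- Coefficients at order `k` of a function that is even modulo order `k + 1`. -/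
theorem coeff_eq_zero_of_evenMod {u₀ : Euc n} {k P : ℕ} {a : ℕ → Euc n → ℝ}
    (h : EvenMod u₀ 0 (k + 1) (logPoly k P a)) :
    ∀ᶠ u in 𝓝 u₀, (∀ p, 1 ≤ p → p ≤ P → a p u = 0) ∧ (Odd k → a 0 u = 0) := by
  obtain ⟨e, ⟨ψ, hψ, he⟩, hr⟩ := h
  -- Any exponent strictly between k, the order of the block, and k + 1, the order of the error,
  -- would do.
  have h1 := (hr.isBigO (ρ := k + 1 / 2) (by linarith)).congr'
    ((EventuallyEq.rfl (f := logPoly k P a)).sub he) .rfl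
  obtain ⟨C, hC⟩ := h1.bound
  have hψ' : ∀ᶠ u in 𝓝 u₀, ContDiffAt ℝ ∞ ψ (u, 0) := by
    have : Tendsto (fun u : Euc n => (u, (0 : ℝ))) (𝓝 u₀) (𝓝 (u₀, 0)) :=
      (Continuous.prodMk_left (0 : ℝ)).tendsto u₀
    exact this.eventually hψ
  filter_upwards [eventually_eventually_nhds_bdryFilter hC, hψ'] with u hu hψu
  refine coeff_eq_zero_of_even (ψ := fun s => ψ (u, s)) (c := fun p => a p u) ?_
    (Asymptotics.IsBigO.of_bound C ?_)
  · exact ContDiffAt.comp (0 : ℝ) (g := ψ) hψu (contDiffAt_const.prodMk contDiffAt_id)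
  · exact eventually_slice_bdryFilter hu


/-! ### Polyhomogeneous expansions and conormal functions -/

theorem isBigO_rpow_of_le (u₀ : Euc n) {ρ σ : ℝ} (h : ρ ≤ σ) :
    (fun q : Euc n × ℝ => q.2 ^ σ) =O[bdryFilter u₀] fun q => q.2 ^ ρ := by
  refine Asymptotics.IsBigO.of_bound 1 ?_
  filter_upwards [eventually_bdryFilter_pos u₀, eventually_bdryFilter_lt u₀ one_pos] with q h0 h1
  rw [Real.norm_of_nonneg (Real.rpow_nonneg h0.le _),
    Real.norm_of_nonneg (Real.rpow_nonneg h0.le _), one_mul]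
  exact Real.rpow_le_rpow_of_exponent_ge h0 h1.le h

/-- Full derivative bounds `D^s h = O(t^{m-s})` give conormal bounds. -/
theorem conormal_of_iteratedFDeriv {u₀ : Euc n} (r : ℕ) {h : Euc n × ℝ → ℝ} {m : ℝ}
    (hs : SmoothNear u₀ h)
    (hb : ∀ s ≤ r, iteratedFDeriv ℝ s h =O[bdryFilter u₀] fun q => q.2 ^ (m - s)) :
    Conormal u₀ r (m - r) h := by
  have h0 : Conormal u₀ 0 m h := by
    refine ⟨hs, fun ρ hρ => ?_⟩
    have h1 := (hb 0 (Nat.zero_le _)).trans (isBigO_rpow_of_le u₀ (σ := m - (0 : ℕ)) (ρ := ρ)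
      (by simpa using hρ.le))
    refine (Asymptotics.isBigO_norm_left.1 (h1.norm_left.congr_left fun q => ?_))
    simp
  induction r generalizing h m with
  | zero => simpa using h0
  | succ r ih =>
    have hd : ∀ v, Conormal u₀ r (m - 1 - r) (fun q => fderiv ℝ h q v) := by
      intro v
      have hb' : ∀ s ≤ r, iteratedFDeriv ℝ s (fun q => fderiv ℝ h q v)
          =O[bdryFilter u₀] fun q => q.2 ^ (m - 1 - s) := by
        intro s hsr
        have h1 := hb (s + 1) (by omega)
        have e : m - ((s + 1 : ℕ) : ℝ) = m - 1 - s := by push_cast; ring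
        rw [e] at h1
        refine Asymptotics.IsBigO.trans (Asymptotics.IsBigO.of_bound ‖v‖ ?_) h1
        filter_upwards [hs] with q hq
        rw [← norm_iteratedFDeriv_fderiv]
        exact norm_iteratedFDeriv_clm_apply_const (N := ∞)
          (hq.fderiv_right (m := ∞) (by simp)) (by exact_mod_cast le_top)
      have h00 : Conormal u₀ 0 (m - 1) (fun q => fderiv ℝ h q v) := by
        refine ⟨hs.fderiv_apply v, fun ρ hρ => ?_⟩
        have h1 := (hb' 0 (Nat.zero_le _)).trans (isBigO_rpow_of_le u₀ (σ := m - 1 - (0 : ℕ))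
          (ρ := ρ) (by simpa using hρ.le))
        refine (Asymptotics.isBigO_norm_left.1 (h1.norm_left.congr_left fun q => ?_))
        simp
      exact ih (hs.fderiv_apply v) hb' h00
    have e : m - ((r + 1 : ℕ) : ℝ) = m - 1 - r := by push_cast; ring
    rw [e]
    refine ⟨h0.mono (by have : (0 : ℝ) ≤ r := r.cast_nonneg
                        linarith), fun i => hd _, ?_⟩
    have h2 : Conormal u₀ r 0 (fun q : Euc n × ℝ => q.2) :=
      Conormal.of_smooth (.of_forall fun _ => contDiffAt_snd)
    simpa using! h2.mul (hd (0, 1))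

theorem conormal_inv_snd (u₀ : Euc n) (r : ℕ) : Conormal u₀ r (-1) (fun q => q.2⁻¹) := by
  have h0 : Conormal u₀ 0 (-1) (fun q => q.2⁻¹) := by
    refine ⟨?_, fun ρ hρ => (isBigO_rpow_of_le u₀ hρ.le).congr_left fun q => ?_⟩
    · filter_upwards [eventually_bdryFilter_pos u₀] with q hq using contDiffAt_snd.inv hq.ne'
    · exact Real.rpow_neg_one _
  induction r with
  | zero => exact h0
  | succ r ih =>
    have hd : ∀ (q v : Euc n × ℝ), 0 < q.2 →
        fderiv ℝ (fun q : Euc n × ℝ => q.2⁻¹) q v = -(q.2 ^ 2)⁻¹ * v.2 := by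
      intro q v hq
      have := ((hasDerivAt_inv hq.ne').comp_hasFDerivAt q
        (hasFDerivAt_snd (𝕜 := ℝ) (E := Euc n) (F := ℝ) (p := q))).fderiv
      change fderiv ℝ (Inv.inv ∘ Prod.snd) q v = _
      rw [this]; simp
    refine ⟨h0, fun i => Conormal.fun_zero.congr ?_, ih.neg.congr ?_⟩
    · filter_upwards [eventually_bdryFilter_pos u₀] with q hq
      simp [tanD, hd q _ hq]
    · filter_upwards [eventually_bdryFilter_pos u₀] with q hq
      simp only [eulD, norD, hd q _ hq]; field_simp

theorem fderiv_eq_sum_components (h : Euc n × ℝ → ℝ) (q : Euc n × ℝ) :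
    fderiv ℝ h q = (∑ i : Fin n, tanD i h q • ((EuclideanSpace.proj i : Euc n →L[ℝ] ℝ).comp
      (ContinuousLinearMap.fst ℝ (Euc n) ℝ))) + norD h q • ContinuousLinearMap.snd ℝ (Euc n) ℝ := by
  ext v
  · have hv : ((v, 0) : Euc n × ℝ) = ∑ i : Fin n, v i • ((stdVec i : Euc n), (0 : ℝ)) := by
      ext j
      · simp [stdVec, Prod.fst_sum, Pi.single_apply]
      · simp [Prod.snd_sum]
    simp only [ContinuousLinearMap.comp_apply, ContinuousLinearMap.inl_apply]
    conv_lhs => rw [hv]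
    rw [map_sum]
    simp only [map_smul]
    simp [tanD, mul_comm]
  · simp [tanD, norD]

/-- Conormal bounds give full derivative bounds. -/
theorem Conormal.iteratedFDeriv_isBigO {u₀ : Euc n} (s : ℕ) {h : Euc n × ℝ → ℝ} {k ρ : ℝ}
    (hc : Conormal u₀ s k h) (hρ : ρ < k) :
    iteratedFDeriv ℝ s h =O[bdryFilter u₀] fun q => q.2 ^ (ρ - s) := by
  induction s generalizing h k ρ with
  | zero =>
    refine Asymptotics.isBigO_norm_left.1 ((hc.isBigO hρ).norm_left.congr (fun q => ?_) fun q => ?_)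
    · simp
    · simp
  | succ s ih =>
    -- ∂_t = t⁻¹ · t∂_t, so a normal derivative costs one order while tangential ones cost none.
    have hn : Conormal u₀ s (k - 1) (norD h) := by
      have := (conormal_inv_snd u₀ s).mul hc.eulD
      rw [show -1 + k = k - 1 by ring] at this
      refine this.congr ?_
      filter_upwards [eventually_bdryFilter_pos u₀] with q hq
      simp only [PE.eulD]; field_simp
    have h1 : ∀ i, iteratedFDeriv ℝ s (PE.tanD i h) =O[bdryFilter u₀] fun q => q.2 ^ (ρ - 1 - s) :=
      fun i => ih (hc.tanD i) (by linarith)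
    have h2 : iteratedFDeriv ℝ s (norD h) =O[bdryFilter u₀] fun q => q.2 ^ (ρ - 1 - s) :=
      ih hn (by linarith)
    have e : ρ - ((s + 1 : ℕ) : ℝ) = ρ - 1 - s := by push_cast; ring
    rw [e]
    set ℓ : Fin n → (Euc n × ℝ →L[ℝ] ℝ) := fun i =>
      (EuclideanSpace.proj i : Euc n →L[ℝ] ℝ).comp (ContinuousLinearMap.fst ℝ (Euc n) ℝ) with hℓ
    have h3 : (fun q => (∑ i, ‖ℓ i‖ * ‖iteratedFDeriv ℝ s (PE.tanD i h) q‖)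
        + ‖ContinuousLinearMap.snd ℝ (Euc n) ℝ‖ * ‖iteratedFDeriv ℝ s (norD h) q‖)
          =O[bdryFilter u₀] fun q => q.2 ^ (ρ - 1 - s) :=
      (Asymptotics.IsBigO.fun_sum fun i _ => (h1 i).norm_left.const_mul_left _).add
        (h2.norm_left.const_mul_left _)
    refine Asymptotics.IsBigO.trans (Asymptotics.IsBigO.of_bound 1 ?_) h3
    have hsm := hc.smooth
    filter_upwards [(Filter.eventually_all (ι := Fin n)).2 fun i => hsm.tanD i, hsm.norD]
      with q ht hq
    have hsN : ((s : ℕ) : ℕ∞ω) ≤ ∞ := by exact_mod_cast le_top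
    rw [one_mul, ← norm_iteratedFDeriv_fderiv]
    have hfun : fderiv ℝ h = fun q => (∑ i, ((1 : ℝ →L[ℝ] ℝ).smulRight (ℓ i) ∘ PE.tanD i h) q)
        + ((1 : ℝ →L[ℝ] ℝ).smulRight (ContinuousLinearMap.snd ℝ (Euc n) ℝ) ∘ norD h) q := by
      funext q
      rw [fderiv_eq_sum_components h q]
      simp [hℓ]
    have hA : ∀ i, ContDiffAt ℝ s ((1 : ℝ →L[ℝ] ℝ).smulRight (ℓ i) ∘ PE.tanD i h) q := fun i =>
      ((ContinuousLinearMap.contDiff _).contDiffAt).comp q ((ht i).of_le hsN)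
    have hB : ContDiffAt ℝ s
        ((1 : ℝ →L[ℝ] ℝ).smulRight (ContinuousLinearMap.snd ℝ (Euc n) ℝ) ∘ norD h) q :=
      ((ContinuousLinearMap.contDiff _).contDiffAt).comp q (hq.of_le hsN)
    rw [hfun, fun_iteratedFDeriv_add_apply (ContDiffAt.sum fun i _ => hA i) hB,
      iteratedFDeriv_fun_sum_apply (fun i _ => hA i)]
    refine (norm_add_le _ _).trans (le_trans ?_ (Real.le_norm_self _))
    refine add_le_add ((norm_sum_le _ _).trans (Finset.sum_le_sum fun i _ => ?_)) ?_
    · refine (ContinuousLinearMap.norm_iteratedFDeriv_comp_left _ (ht i) hsN).trans ?_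
      gcongr
      simp [ContinuousLinearMap.norm_smulRight_apply]
    · refine (ContinuousLinearMap.norm_iteratedFDeriv_comp_left _ hq hsN).trans ?_
      gcongr
      simp [ContinuousLinearMap.norm_smulRight_apply]

theorem eventually_contDiffAt_of_contDiffOn {U : Set (Euc n)} {u₀ : Euc n} {a : Euc n → ℝ}
    (hU : IsOpen U) (hu : u₀ ∈ U) (ha : ContDiffOn ℝ ∞ a U) :
    ∀ᶠ u in 𝓝 u₀, ContDiffAt ℝ ∞ a u := by
  filter_upwards [hU.mem_nhds hu] with u hu using ha.contDiffAt (hU.mem_nhds hu)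

section Expansion

variable {u₀ : Euc n} {f g : Euc n × ℝ → ℝ} {a b : ℕ → ℕ → Euc n → ℝ} {P Q : ℕ → ℕ}

theorem HasPhgExpansionAt.smooth (h : HasPhgExpansionAt f a P u₀) : SmoothNear u₀ f := by
  obtain ⟨⟨U, hU, hu, -, δ, hδ, hf⟩, -⟩ := h
  refine (bdryFilter_basis u₀).2 ⟨U, hU, hu, δ, hδ, fun u hu t ht => ?_⟩
  exact hf.contDiffAt ((hU.prod isOpen_Ioo).mem_nhds ⟨hu, ht⟩)

theorem HasPhgExpansionAt.smooth_coeff (h : HasPhgExpansionAt f a P u₀) (k p : ℕ) :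
    ∀ᶠ u in 𝓝 u₀, ContDiffAt ℝ ∞ (a k p) u := by
  obtain ⟨⟨U, hU, hu, ha, -⟩, -⟩ := h
  exact eventually_contDiffAt_of_contDiffOn hU hu (ha k p)

/-- Turning full derivative bounds into conormal ones loses r orders, because ∂_u is charged like
∂_t. The loss is absorbed by expanding to order K + 1 + r and then returning the extra blocks, each
conormal of order at least K + 1. -/
theorem HasPhgExpansionAt.conormal (h : HasPhgExpansionAt f a P u₀) (K r : ℕ) :
    Conormal u₀ r (K + 1)
      (fun q => f q - ∑ k ∈ Finset.range (K + 1), logPoly k (P k) (a k) q) := by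
  have hlp : ∀ k : ℕ, Conormal u₀ r k (logPoly k (P k) (a k)) := fun k =>
    conormal_logPoly r k (P k) fun p _ => h.smooth_coeff k p
  have hsm : SmoothNear u₀ (fun q => f q - ∑ k ∈ Finset.range (K + 1 + r + 1),
      logPoly k (P k) (a k) q) := by
    have : SmoothNear u₀ (fun q => ∑ k ∈ Finset.range (K + 1 + r + 1), logPoly k (P k) (a k) q) :=
      (Conormal.sum (r := r) (k := 0) _ fun k _ => (hlp k).mono k.cast_nonneg).smooth
    simpa only [sub_eq_add_neg] using h.smooth.add this.neg
  have h1 := conormal_of_iteratedFDeriv (m := ((K + 1 + r : ℕ) : ℝ)) r hsm fun s _ => by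
    refine (h.2 (K + 1 + r) s).congr' .rfl ?_
    filter_upwards [eventually_bdryFilter_pos u₀] with q hq
    rw [← Real.rpow_intCast]; push_cast; rfl
  have h2 : Conormal u₀ r (K + 1) (fun q => ∑ k ∈ Finset.range (r + 1),
      logPoly (K + 1 + k) (P (K + 1 + k)) (a (K + 1 + k)) q) :=
    Conormal.sum _ fun k _ => (hlp (K + 1 + k)).mono (by push_cast; linarith [k.cast_nonneg (α := ℝ)])
  have e : ((K + 1 + r : ℕ) : ℝ) - r = K + 1 := by push_cast; ring
  rw [e] at h1
  refine (h1.add h2).congr (.of_forall fun q => ?_)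
  simp only [show K + 1 + r + 1 = K + 1 + (r + 1) by ring,
    Finset.sum_range_add (fun k => logPoly k (P k) (a k) q) (K + 1)]
  ring

/-- The conormal form of a polyhomogeneous expansion. -/
theorem hasPhgExpansionAt_of_conormal
    (hsm : ∃ U : Set (Euc n), IsOpen U ∧ u₀ ∈ U ∧ (∀ k p, ContDiffOn ℝ ∞ (a k p) U) ∧
      ∃ δ : ℝ, 0 < δ ∧ ContDiffOn ℝ ∞ f (U ×ˢ Ioo 0 δ))
    (h : ∀ K r : ℕ, Conormal u₀ r (K + 1)
      (fun q => f q - ∑ k ∈ Finset.range (K + 1), logPoly k (P k) (a k) q)) :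
    HasPhgExpansionAt f a P u₀ := by
  refine ⟨hsm, fun K r => ?_⟩
  refine ((h K r).iteratedFDeriv_isBigO r (ρ := K) (by linarith)).congr' .rfl ?_
  filter_upwards with q
  rw [← Real.rpow_intCast]; push_cast; rfl

/-! ### Products of polyhomogeneous expansions. -/

/-- The polynomial in `log t` at order `k` of a product of two expansions. -/
def prodPoly (a b : ℕ → ℕ → ℝ) (P Q : ℕ → ℕ) (k : ℕ) : Polynomial ℝ :=
  ∑ ij ∈ Finset.HasAntidiagonal.antidiagonal k, logPolyPoly (P ij.1) (a ij.1) * logPolyPoly (Q ij.2) (b ij.2)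

/-- The largest power of `log t` at order `k` of a product. -/
def prodDeg (P Q : ℕ → ℕ) (k : ℕ) : ℕ :=
  ∑ ij ∈ Finset.HasAntidiagonal.antidiagonal k, (P ij.1 + Q ij.2)

theorem natDegree_logPolyPoly_le (P : ℕ) (a : ℕ → ℝ) : (logPolyPoly P a).natDegree ≤ P :=
  Polynomial.natDegree_sum_le_of_forall_le _ _ fun p hp =>
    (Polynomial.natDegree_C_mul_X_pow_le _ _).trans (by simp at hp; omega)

theorem coeff_logPolyPoly_eq_ite (P : ℕ) (a : ℕ → ℝ) (p : ℕ) :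
    (logPolyPoly P a).coeff p = if p ≤ P then a p else 0 := by
  split_ifs with h
  · exact coeff_logPolyPoly a h
  · exact Polynomial.coeff_eq_zero_of_natDegree_lt
      ((natDegree_logPolyPoly_le P a).trans_lt (not_le.1 h))

theorem natDegree_prodPoly_le (a b : ℕ → ℕ → ℝ) (P Q : ℕ → ℕ) (k : ℕ) :
    (prodPoly a b P Q k).natDegree ≤ prodDeg P Q k := by
  refine Polynomial.natDegree_sum_le_of_forall_le _ _ fun ij hij => ?_
  refine Polynomial.natDegree_mul_le.trans ((add_le_add (natDegree_logPolyPoly_le _ _)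
    (natDegree_logPolyPoly_le _ _)).trans ?_)
  exact Finset.single_le_sum (f := fun ij : ℕ × ℕ => P ij.1 + Q ij.2) (fun _ _ => Nat.zero_le _) hij

theorem logPoly_eq_eval (k P : ℕ) (a : ℕ → Euc n → ℝ) (q : Euc n × ℝ) :
    logPoly k P a q = q.2 ^ k * (logPolyPoly P (fun p => a p q.1)).eval (Real.log q.2) := by
  rw [eval_logPolyPoly, logPoly, Finset.mul_sum]
  exact Finset.sum_congr rfl fun p _ => by ring

theorem logPoly_prod (a b : ℕ → ℕ → Euc n → ℝ) (P Q : ℕ → ℕ) (k : ℕ) (q : Euc n × ℝ) :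
    logPoly k (prodDeg P Q k)
      (fun p u => (prodPoly (fun i s => a i s u) (fun i s => b i s u) P Q k).coeff p) q =
      ∑ ij ∈ Finset.HasAntidiagonal.antidiagonal k,
        logPoly ij.1 (P ij.1) (a ij.1) q * logPoly ij.2 (Q ij.2) (b ij.2) q := by
  have h1 := Polynomial.eval_eq_sum_range' (Nat.lt_succ_of_le (natDegree_prodPoly_le
    (fun i s => a i s q.1) (fun i s => b i s q.1) P Q k)) (Real.log q.2)
  have h2 : logPoly k (prodDeg P Q k) (fun p u =>
      (prodPoly (fun i s => a i s u) (fun i s => b i s u) P Q k).coeff p) q =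
      q.2 ^ k * (prodPoly (fun i s => a i s q.1) (fun i s => b i s q.1) P Q k).eval
        (Real.log q.2) := by
    rw [h1, logPoly, Finset.mul_sum]
    exact Finset.sum_congr rfl fun p _ => by ring
  rw [h2, prodPoly, Polynomial.eval_finsetSum, Finset.mul_sum]
  refine Finset.sum_congr rfl fun ij hij => ?_
  rw [logPoly_eq_eval, logPoly_eq_eval, Polynomial.eval_mul, ← Finset.HasAntidiagonal.mem_antidiagonal.1 hij,
    pow_add]
  ring

theorem sum_mul_sum_range (K : ℕ) (x y : ℕ → ℝ) :
    (∑ i ∈ Finset.range (K + 1), x i) * ∑ j ∈ Finset.range (K + 1), y j =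
      (∑ k ∈ Finset.range (K + 1), ∑ ij ∈ Finset.HasAntidiagonal.antidiagonal k, x ij.1 * y ij.2) +
        ∑ ij ∈ (Finset.range (K + 1) ×ˢ Finset.range (K + 1)).filter (fun ij => K < ij.1 + ij.2),
          x ij.1 * y ij.2 := by
  rw [Finset.sum_mul_sum, ← Finset.sum_product',
    ← Finset.sum_filter_add_sum_filter_not _ (fun ij : ℕ × ℕ => K < ij.1 + ij.2), add_comm]
  congr 1
  rw [← Finset.sum_fiberwise_of_maps_to (g := fun ij : ℕ × ℕ => ij.1 + ij.2)
    (t := Finset.range (K + 1))]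
  · refine Finset.sum_congr rfl fun k hk => Finset.sum_congr ?_ fun _ _ => rfl
    ext ij
    simp at hk ⊢; omega
  · intro ij; simp

/-- With partial sums S and remainders R, fg = R_f g + S_f R_g + S_f S_g. The blocks of S_f S_g with
i + j ≤ K are the product expansion and the others have order at least K + 1. The argument runs in
the conormal class, which is closed under products. -/
theorem HasPhgExpansionAt.mul (hf : HasPhgExpansionAt f a P u₀) (hg : HasPhgExpansionAt g b Q u₀) :
    HasPhgExpansionAt (fun q => f q * g q)
      (fun k p u => (prodPoly (fun i s => a i s u) (fun i s => b i s u) P Q k).coeff p)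
      (prodDeg P Q) u₀ := by
  refine hasPhgExpansionAt_of_conormal ?_ fun K r => ?_
  · obtain ⟨⟨U, hU, hu, ha, δ, hδ, hf⟩, -⟩ := hf
    obtain ⟨⟨U', hU', hu', hb, δ', hδ', hg⟩, -⟩ := hg
    refine ⟨U ∩ U', hU.inter hU', ⟨hu, hu'⟩, fun k p => ?_, min δ δ', lt_min hδ hδ', ?_⟩
    · simp only [prodPoly, Polynomial.finsetSum_coeff, Polynomial.coeff_mul,
        coeff_logPolyPoly_eq_ite]
      refine ContDiffOn.sum fun ij _ => ContDiffOn.sum fun st _ => ContDiffOn.mul ?_ ?_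
      · split_ifs
        · exact (ha _ _).mono inter_subset_left
        · exact contDiffOn_const
      · split_ifs
        · exact (hb _ _).mono inter_subset_right
        · exact contDiffOn_const
    · exact (hf.mono (prod_mono inter_subset_left (Ioo_subset_Ioo_right (min_le_left _ _)))).mul
        (hg.mono (prod_mono inter_subset_right (Ioo_subset_Ioo_right (min_le_right _ _))))
  · have hlf : ∀ k : ℕ, Conormal u₀ r k (logPoly k (P k) (a k)) := fun k =>
      conormal_logPoly r k (P k) fun p _ => hf.smooth_coeff k p
    have hlg : ∀ k : ℕ, Conormal u₀ r k (logPoly k (Q k) (b k)) := fun k =>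
      conormal_logPoly r k (Q k) fun p _ => hg.smooth_coeff k p
    have hSf : Conormal u₀ r 0 (fun q => ∑ k ∈ Finset.range (K + 1), logPoly k (P k) (a k) q) :=
      Conormal.sum _ fun k _ => (hlf k).mono k.cast_nonneg
    have hSg : Conormal u₀ r 0 (fun q => ∑ k ∈ Finset.range (K + 1), logPoly k (Q k) (b k) q) :=
      Conormal.sum _ fun k _ => (hlg k).mono k.cast_nonneg
    have hK : (0 : ℝ) ≤ (K : ℝ) + 1 := by positivity
    have hRf := hf.conormal K r
    have hRg := hg.conormal K r
    have hg0 : Conormal u₀ r 0 g := ((hRg.mono hK).add hSg).congr (.of_forall fun q => by simp)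
    have h1 := hRf.mul hg0
    have h2 := hSf.mul hRg
    rw [add_zero] at h1
    rw [zero_add] at h2
    have h3 : Conormal u₀ r (K + 1) (fun q => ∑ ij ∈ (Finset.range (K + 1) ×ˢ
        Finset.range (K + 1)).filter (fun ij => K < ij.1 + ij.2),
          logPoly ij.1 (P ij.1) (a ij.1) q * logPoly ij.2 (Q ij.2) (b ij.2) q) := by
      refine Conormal.sum _ fun ij hij => ((hlf ij.1).mul (hlg ij.2)).mono ?_
      have : K + 1 ≤ ij.1 + ij.2 := (Finset.mem_filter.1 hij).2
      exact_mod_cast this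
    refine ((h1.add h2).add h3).congr (.of_forall fun q => ?_)
    simp only [logPoly_prod]
    have := sum_mul_sum_range K (fun k => logPoly k (P k) (a k) q)
      (fun k => logPoly k (Q k) (b k) q)
    linear_combination -this

end Expansion


/-! ### The Ricci tensor of `t⁻² (dt² + G_t)` -/

/-- The coordinates `(t, u)` on the collar. -/
def collarCoord (n : ℕ) : (Euc n × ℝ) ≃L[ℝ] Euc (n + 1) :=
  LinearEquiv.toContinuousLinearEquiv
    { toFun := fun q => WithLp.toLp 2 (Fin.cons q.2 fun i => q.1 i)
      invFun := fun v => (WithLp.toLp 2 fun i => v i.succ, v 0)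
      map_add' := fun q q' => by ext i; refine Fin.cases ?_ (fun i => ?_) i <;> simp
      map_smul' := fun c q => by ext i; refine Fin.cases ?_ (fun i => ?_) i <;> simp
      left_inv := fun q => by ext <;> simp
      right_inv := fun v => by ext i; refine Fin.cases ?_ (fun i => ?_) i <;> simp }

@[simp] theorem collarCoord_zero (q : Euc n × ℝ) : collarCoord n q 0 = q.2 := rfl

@[simp] theorem collarCoord_succ (q : Euc n × ℝ) (i : Fin n) :
    collarCoord n q i.succ = q.1 i := rfl

theorem collarCoord_normal : collarCoord n (0, 1) = stdVec 0 := by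
  ext i; refine Fin.cases ?_ (fun i => ?_) i <;> simp [stdVec]

theorem collarCoord_tangential (i : Fin n) : collarCoord n (stdVec i, 0) = stdVec i.succ := by
  ext j; refine Fin.cases ?_ (fun j => ?_) j <;> simp [stdVec]

theorem pd_zero_collarCoord (f : Euc (n + 1) → ℝ) (q : Euc n × ℝ) :
    pd 0 f (collarCoord n q) = norD (fun q => f (collarCoord n q)) q := by
  have := (collarCoord n).comp_right_fderiv (f := f) (x := q)
  change _ = fderiv ℝ (f ∘ collarCoord n) q (0, 1)
  rw [this]
  simp [pd, collarCoord_normal]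

theorem pd_succ_collarCoord (f : Euc (n + 1) → ℝ) (i : Fin n) (q : Euc n × ℝ) :
    pd i.succ f (collarCoord n q) = tanD i (fun q => f (collarCoord n q)) q := by
  have := (collarCoord n).comp_right_fderiv (f := f) (x := q)
  change _ = fderiv ℝ (f ∘ collarCoord n) q (stdVec i, 0)
  rw [this]
  simp [pd, collarCoord_tangential]

/-- Christoffel symbols of the family `G_t`. -/
def christoffelSlice (G : Euc n × ℝ → Matrix (Fin n) (Fin n) ℝ) (k i j : Fin n)
    (q : Euc n × ℝ) : ℝ :=
  (1 / 2 : ℝ) * ∑ l, (G q)⁻¹ k l *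
    (tanD i (fun q => G q j l) q + tanD j (fun q => G q i l) q - tanD l (fun q => G q i j) q)

/-- Ricci curvature of the family `G_t`. -/
def ricciSlice (G : Euc n × ℝ → Matrix (Fin n) (Fin n) ℝ) (i j : Fin n) (q : Euc n × ℝ) : ℝ :=
  (∑ k, tanD k (christoffelSlice G k i j) q) - (∑ k, tanD j (christoffelSlice G k i k) q)
    + (∑ k, ∑ l, christoffelSlice G k k l q * christoffelSlice G l i j q)
    - ∑ k, ∑ l, christoffelSlice G k j l q * christoffelSlice G l i k q

/-- `½ t ∂_t G_{ij}`. -/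
def halfEul (G : Euc n × ℝ → Matrix (Fin n) (Fin n) ℝ) (i j : Fin n) (q : Euc n × ℝ) : ℝ :=
  (1 / 2 : ℝ) * eulD (fun q => G q i j) q

/-- On the open set `W ⊆ {t > 0}`, `h = t⁻² (dt² + G_t)` with `G` a smooth family of metrics. -/
structure IsCollarMetric (W : Set (Euc n × ℝ)) (G : Euc n × ℝ → Matrix (Fin n) (Fin n) ℝ)
    (h : Euc (n + 1) → Matrix (Fin (n + 1)) (Fin (n + 1)) ℝ) : Prop where
  isOpen : IsOpen W
  pos : ∀ q ∈ W, 0 < q.2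
  zero_zero : ∀ q ∈ W, h (collarCoord n q) 0 0 = (q.2 ^ 2)⁻¹
  zero_succ : ∀ q ∈ W, ∀ i : Fin n, h (collarCoord n q) 0 i.succ = 0
  succ_zero : ∀ q ∈ W, ∀ i : Fin n, h (collarCoord n q) i.succ 0 = 0
  succ_succ : ∀ q ∈ W, ∀ i j : Fin n, h (collarCoord n q) i.succ j.succ = (q.2 ^ 2)⁻¹ * G q i j
  symm : ∀ q ∈ W, ∀ i j, G q i j = G q j i
  det : ∀ q ∈ W, (G q).det ≠ 0
  smooth : ∀ q ∈ W, ∀ i j, ContDiffAt ℝ ∞ (fun q => G q i j) q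

theorem hasFDerivAt_inv_sq {q : Euc n × ℝ} (hq : 0 < q.2) :
    HasFDerivAt (fun q : Euc n × ℝ => (q.2 ^ 2)⁻¹)
      ((-2 * (q.2 ^ 3)⁻¹) • ContinuousLinearMap.snd ℝ (Euc n) ℝ) q := by
  have h1 : HasDerivAt (fun t : ℝ => (t ^ 2)⁻¹) (-2 * (q.2 ^ 3)⁻¹) q.2 := by
    have := ((hasDerivAt_pow 2 q.2).inv (pow_ne_zero 2 hq.ne'))
    refine this.congr_deriv ?_
    field_simp; norm_num; ring
  exact h1.comp_hasFDerivAt q (hasFDerivAt_snd (𝕜 := ℝ) (E := Euc n) (F := ℝ) (p := q))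

theorem tanD_of_eqOn {W : Set (Euc n × ℝ)} (hW : IsOpen W) {f g : Euc n × ℝ → ℝ}
    (h : EqOn f g W) {q : Euc n × ℝ} (hq : q ∈ W) (i : Fin n) : tanD i f q = tanD i g q := by
  have : f =ᶠ[𝓝 q] g := by filter_upwards [hW.mem_nhds hq] with x hx using h hx
  simp [tanD, this.fderiv_eq]

theorem norD_of_eqOn {W : Set (Euc n × ℝ)} (hW : IsOpen W) {f g : Euc n × ℝ → ℝ}
    (h : EqOn f g W) {q : Euc n × ℝ} (hq : q ∈ W) : norD f q = norD g q := by
  have : f =ᶠ[𝓝 q] g := by filter_upwards [hW.mem_nhds hq] with x hx using h hx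
  simp [norD, this.fderiv_eq]

namespace IsCollarMetric

variable {W : Set (Euc n × ℝ)} {G : Euc n × ℝ → Matrix (Fin n) (Fin n) ℝ}
    {h : Euc (n + 1) → Matrix (Fin (n + 1)) (Fin (n + 1)) ℝ} {q : Euc n × ℝ}

theorem inv_eq (H : IsCollarMetric W G h) (hq : q ∈ W) :
    (h (collarCoord n q))⁻¹ = Matrix.of (Fin.cons (Fin.cons (q.2 ^ 2) fun _ => 0)
      fun i => Fin.cons 0 fun j => q.2 ^ 2 * (G q)⁻¹ i j) := by
  have hp := (H.pos q hq).ne'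
  refine Matrix.inv_eq_right_inv ?_
  have hG : G q * (G q)⁻¹ = 1 := Matrix.mul_nonsing_inv _ (isUnit_iff_ne_zero.2 (H.det q hq))
  ext i j
  rw [Matrix.mul_apply, Fin.sum_univ_succ]
  refine Fin.cases ?_ (fun i => ?_) i <;> refine Fin.cases ?_ (fun j => ?_) j
  · simp [H.zero_zero q hq, H.zero_succ q hq, hp]
  · simp [H.zero_zero q hq, H.zero_succ q hq, (Fin.succ_ne_zero j).symm]
  · simp [H.succ_zero q hq]
  · have h1 := congrFun (congrFun hG i) j
    rw [Matrix.mul_apply] at h1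
    have h2 : ∀ k, (q.2 ^ 2)⁻¹ * G q i k * (q.2 ^ 2 * (G q)⁻¹ k j) = G q i k * (G q)⁻¹ k j := by
      intro k; field_simp
    simp [H.succ_zero q hq, H.succ_succ q hq, h2, h1, Matrix.one_apply]

theorem differentiableAt (H : IsCollarMetric W G h) (hq : q ∈ W) (i j : Fin n) :
    DifferentiableAt ℝ (fun q => G q i j) q := (H.smooth q hq i j).differentiableAt (by simp)

theorem norD_zero_zero (H : IsCollarMetric W G h) (hq : q ∈ W) :
    norD (fun q => h (collarCoord n q) 0 0) q = -2 * (q.2 ^ 3)⁻¹ := by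
  rw [norD_of_eqOn H.isOpen (g := fun q => (q.2 ^ 2)⁻¹) (fun q hq => H.zero_zero q hq) hq, norD,
    (hasFDerivAt_inv_sq (H.pos q hq)).fderiv]
  simp

theorem tanD_zero_zero (H : IsCollarMetric W G h) (hq : q ∈ W) (i : Fin n) :
    tanD i (fun q => h (collarCoord n q) 0 0) q = 0 := by
  rw [tanD_of_eqOn H.isOpen (g := fun q => (q.2 ^ 2)⁻¹) (fun q hq => H.zero_zero q hq) hq, tanD,
    (hasFDerivAt_inv_sq (H.pos q hq)).fderiv]
  simp

theorem norD_zero_succ (H : IsCollarMetric W G h) (hq : q ∈ W) (i : Fin n) :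
    norD (fun q => h (collarCoord n q) 0 i.succ) q = 0 := by
  rw [norD_of_eqOn H.isOpen (g := fun _ => 0) (fun q hq => H.zero_succ q hq i) hq]; simp [norD]

theorem norD_succ_zero (H : IsCollarMetric W G h) (hq : q ∈ W) (i : Fin n) :
    norD (fun q => h (collarCoord n q) i.succ 0) q = 0 := by
  rw [norD_of_eqOn H.isOpen (g := fun _ => 0) (fun q hq => H.succ_zero q hq i) hq]; simp [norD]

theorem tanD_zero_succ (H : IsCollarMetric W G h) (hq : q ∈ W) (i j : Fin n) :
    tanD j (fun q => h (collarCoord n q) 0 i.succ) q = 0 := by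
  rw [tanD_of_eqOn H.isOpen (g := fun _ => 0) (fun q hq => H.zero_succ q hq i) hq]; simp [tanD]

theorem tanD_succ_zero (H : IsCollarMetric W G h) (hq : q ∈ W) (i j : Fin n) :
    tanD j (fun q => h (collarCoord n q) i.succ 0) q = 0 := by
  rw [tanD_of_eqOn H.isOpen (g := fun _ => 0) (fun q hq => H.succ_zero q hq i) hq]; simp [tanD]

theorem tanD_succ_succ (H : IsCollarMetric W G h) (hq : q ∈ W) (i j k : Fin n) :
    tanD k (fun q => h (collarCoord n q) i.succ j.succ) q
      = (q.2 ^ 2)⁻¹ * tanD k (fun q => G q i j) q := by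
  rw [tanD_of_eqOn H.isOpen (g := fun q => (q.2 ^ 2)⁻¹ * G q i j)
    (fun q hq => H.succ_succ q hq i j) hq, tanD,
    ((hasFDerivAt_inv_sq (H.pos q hq)).fun_mul (H.differentiableAt hq i j).hasFDerivAt).fderiv]
  simp [tanD]

/-- Normal derivatives enter only through ½ t∂_t G, the variable in which the Einstein equation has
regular singular form. -/
theorem norD_succ_succ (H : IsCollarMetric W G h) (hq : q ∈ W) (i j : Fin n) :
    norD (fun q => h (collarCoord n q) i.succ j.succ) q
      = 2 * (q.2 ^ 3)⁻¹ * (halfEul G i j q - G q i j) := by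
  have hp := (H.pos q hq).ne'
  rw [norD_of_eqOn H.isOpen (g := fun q => (q.2 ^ 2)⁻¹ * G q i j)
    (fun q hq => H.succ_succ q hq i j) hq, norD,
    ((hasFDerivAt_inv_sq (H.pos q hq)).fun_mul (H.differentiableAt hq i j).hasFDerivAt).fderiv]
  simp [norD, halfEul, eulD]
  field_simp; ring

/-- In these names `z` is the normal index, `s` a tangential one, and the upper index comes first.
-/
theorem christoffel_zzz (H : IsCollarMetric W G h) (hq : q ∈ W) :
    christoffel h 0 0 0 (collarCoord n q) = -q.2⁻¹ := by
  have hp := (H.pos q hq).ne'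
  simp only [christoffel, Fin.sum_univ_succ, H.inv_eq hq, pd_zero_collarCoord,
    H.norD_zero_zero hq]
  simp
  field_simp

theorem christoffel_zzs (H : IsCollarMetric W G h) (hq : q ∈ W) (j : Fin n) : christoffel h 0 0 j.succ (collarCoord n q) = 0 := by
  simp only [christoffel, Fin.sum_univ_succ, H.inv_eq hq, pd_zero_collarCoord,
    pd_succ_collarCoord, H.tanD_zero_zero hq, H.norD_succ_zero hq, H.norD_zero_succ hq]
  simp

theorem christoffel_zsz (H : IsCollarMetric W G h) (hq : q ∈ W) (j : Fin n) : christoffel h 0 j.succ 0 (collarCoord n q) = 0 := by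
  simp only [christoffel, Fin.sum_univ_succ, H.inv_eq hq, pd_zero_collarCoord,
    pd_succ_collarCoord, H.tanD_zero_zero hq, H.norD_succ_zero hq]
  simp

theorem christoffel_zss (H : IsCollarMetric W G h) (hq : q ∈ W) (i j : Fin n) : christoffel h 0 i.succ j.succ (collarCoord n q)
    = q.2⁻¹ * (G q i j - halfEul G i j q) := by
  have hp := (H.pos q hq).ne'
  simp only [christoffel, Fin.sum_univ_succ, H.inv_eq hq, pd_zero_collarCoord,
    pd_succ_collarCoord, H.tanD_succ_zero hq, H.norD_succ_succ hq]
  simp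
  field_simp; ring

theorem sum_inv_mul (H : IsCollarMetric W G h) (hq : q ∈ W) (k j : Fin n) : ∑ l, (G q)⁻¹ k l * G q l j = if k = j then 1 else 0 := by
  have hG : (G q)⁻¹ * G q = 1 := Matrix.nonsing_inv_mul _ (isUnit_iff_ne_zero.2 (H.det q hq))
  have h1 := congrFun (congrFun hG k) j
  rwa [Matrix.mul_apply, Matrix.one_apply] at h1

theorem sum_mul_inv (H : IsCollarMetric W G h) (hq : q ∈ W) (k j : Fin n) : ∑ l, G q k l * (G q)⁻¹ l j = if k = j then 1 else 0 := by
  have hG : G q * (G q)⁻¹ = 1 := Matrix.mul_nonsing_inv _ (isUnit_iff_ne_zero.2 (H.det q hq))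
  have h1 := congrFun (congrFun hG k) j
  rwa [Matrix.mul_apply, Matrix.one_apply] at h1

theorem halfEul_symm (H : IsCollarMetric W G h) (hq : q ∈ W) (i j : Fin n) : halfEul G i j q = halfEul G j i q := by
  simp only [halfEul, eulD]
  rw [norD_of_eqOn H.isOpen (fun q hq => H.symm q hq i j) hq]

theorem christoffel_ssz (H : IsCollarMetric W G h) (hq : q ∈ W) (k j : Fin n) : christoffel h k.succ j.succ 0 (collarCoord n q)
    = q.2⁻¹ * ((∑ l, (G q)⁻¹ k l * halfEul G l j q) - if k = j then 1 else 0) := by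
  have hp := (H.pos q hq).ne'
  simp only [christoffel, Fin.sum_univ_succ, H.inv_eq hq, pd_zero_collarCoord,
    pd_succ_collarCoord, H.tanD_zero_succ hq, H.tanD_succ_zero hq, H.norD_succ_succ hq]
  simp only [Matrix.of_apply, Fin.cons_succ, Fin.cons_zero, zero_mul, zero_add, sub_zero]
  rw [← H.sum_inv_mul hq k j, ← Finset.sum_sub_distrib, Finset.mul_sum, Finset.mul_sum]
  refine Finset.sum_congr rfl fun l _ => ?_
  rw [H.symm q hq j l, H.halfEul_symm hq j l]
  field_simp

theorem christoffel_sss (H : IsCollarMetric W G h) (hq : q ∈ W) (k i j : Fin n) : christoffel h k.succ i.succ j.succ (collarCoord n q)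
    = christoffelSlice G k i j q := by
  have hp := (H.pos q hq).ne'
  simp only [christoffel, christoffelSlice, Fin.sum_univ_succ, H.inv_eq hq, pd_zero_collarCoord,
    pd_succ_collarCoord, H.tanD_succ_succ hq]
  simp only [Matrix.of_apply, Fin.cons_succ, Fin.cons_zero, zero_mul, zero_add]
  congr 1
  refine Finset.sum_congr rfl fun l _ => ?_
  field_simp

theorem differentiableAt_eulD (H : IsCollarMetric W G h) (hq : q ∈ W) (i j : Fin n) :
    DifferentiableAt ℝ (halfEul G i j) q := by
  have h1 : ContDiffAt ℝ ∞ (fun q => fderiv ℝ (fun q => G q i j) q (0, 1)) q :=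
    ((H.smooth q hq i j).fderiv_right (m := ∞) (by simp)).clm_apply contDiffAt_const
  exact (((contDiffAt_snd.mul h1).differentiableAt (by simp)).const_mul _)

theorem norD_christoffel_zss (H : IsCollarMetric W G h) (hq : q ∈ W) (i j : Fin n) :
    norD (fun q => christoffel h 0 i.succ j.succ (collarCoord n q)) q
      = (q.2 ^ 2)⁻¹ * (3 * halfEul G i j q - eulD (halfEul G i j) q - G q i j) := by
  have hp := (H.pos q hq).ne'
  have h1 : HasFDerivAt (fun q : Euc n × ℝ => q.2⁻¹)
      ((-(q.2 ^ 2)⁻¹) • ContinuousLinearMap.snd ℝ (Euc n) ℝ) q :=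
    (hasDerivAt_inv hp).comp_hasFDerivAt q
      (hasFDerivAt_snd (𝕜 := ℝ) (E := Euc n) (F := ℝ) (p := q))
  rw [norD_of_eqOn H.isOpen (fun q hq => H.christoffel_zss hq i j) hq, norD,
    (h1.fun_mul ((H.differentiableAt hq i j).hasFDerivAt.fun_sub
      (H.differentiableAt_eulD hq i j).hasFDerivAt)).fderiv]
  simp only [_root_.add_apply, _root_.smul_apply, _root_.sub_apply,
    ContinuousLinearMap.coe_snd', smul_eq_mul, mul_one, eulD, norD, halfEul]
  field_simp; ring

/-- The tangential components of the Ricci tensor of `t⁻² (dt² + G_t)`. -/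
theorem ricci_eq (H : IsCollarMetric W G h) (hq : q ∈ W) (i j : Fin n) :
    q.2 ^ 2 * ricci h i.succ j.succ (collarCoord n q) =
      q.2 ^ 2 * ricciSlice G i j q - eulD (halfEul G i j) q + n * halfEul G i j q - n * G q i j
        + (∑ k, ∑ l, (G q)⁻¹ k l * halfEul G l k q) * (G q i j - halfEul G i j q)
        + 2 * ∑ k, ∑ l, halfEul G i k q * (G q)⁻¹ k l * halfEul G l j q := by
  have hp := (H.pos q hq).ne'
  have hd0 : ∀ k, tanD j (fun q => christoffel h k i.succ k (collarCoord n q)) q =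
      Fin.cases 0 (fun k => tanD j (christoffelSlice G k i k) q) k := by
    intro k
    refine Fin.cases ?_ (fun k => ?_) k
    · rw [tanD_of_eqOn H.isOpen (g := fun _ => 0) (fun q hq => H.christoffel_zsz hq i) hq]
      simp [tanD]
    · rw [tanD_of_eqOn H.isOpen (fun q hq => H.christoffel_sss hq k i k) hq]; rfl
  have hd1 : ∀ k : Fin n, tanD k (fun q => christoffel h k.succ i.succ j.succ (collarCoord n q)) q =
      tanD k (christoffelSlice G k i j) q := fun k => by
    rw [tanD_of_eqOn H.isOpen (fun q hq => H.christoffel_sss hq k i j) hq]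
  -- The contraction of Γ⁰_{ik} with Γ^k_{j0}, stripped of powers of t; products of G with its
  -- inverse collapse.
  have key : ∀ i j : Fin n, ∑ k, (G q i k - halfEul G i k q) *
      ((∑ l, (G q)⁻¹ k l * halfEul G l j q) - if k = j then 1 else 0) =
      2 * halfEul G i j q - G q i j
        - ∑ k, ∑ l, halfEul G i k q * (G q)⁻¹ k l * halfEul G l j q := by
    intro i j
    have e1 : ∑ k, G q i k * (∑ l, (G q)⁻¹ k l * halfEul G l j q) = halfEul G i j q := by
      simp only [Finset.mul_sum]
      rw [Finset.sum_comm]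
      have : ∀ l, ∑ k, G q i k * ((G q)⁻¹ k l * halfEul G l j q) =
          (if i = l then 1 else 0) * halfEul G l j q := fun l => by
        rw [← H.sum_mul_inv hq i l, Finset.sum_mul]
        exact Finset.sum_congr rfl fun k _ => by ring
      simp [this]
    have e2 : ∑ k, halfEul G i k q * (∑ l, (G q)⁻¹ k l * halfEul G l j q) =
        ∑ k, ∑ l, halfEul G i k q * (G q)⁻¹ k l * halfEul G l j q := by
      simp only [Finset.mul_sum, mul_assoc]
    have e3 : ∑ k, (G q i k - halfEul G i k q) * (if k = j then (1 : ℝ) else 0) =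
        G q i j - halfEul G i j q := by simp
    have : ∀ k, (G q i k - halfEul G i k q) *
        ((∑ l, (G q)⁻¹ k l * halfEul G l j q) - if k = j then 1 else 0) =
        G q i k * (∑ l, (G q)⁻¹ k l * halfEul G l j q)
          - halfEul G i k q * (∑ l, (G q)⁻¹ k l * halfEul G l j q)
          - (G q i k - halfEul G i k q) * (if k = j then (1 : ℝ) else 0) := fun k => by ring
    simp only [this, Finset.sum_sub_distrib, e1, e2, e3]
    ring
  have key2 : ∑ k, ((∑ l, (G q)⁻¹ k l * halfEul G l k q) - 1) =
      (∑ k, ∑ l, (G q)⁻¹ k l * halfEul G l k q) - n := by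
    simp [Finset.sum_sub_distrib]
  -- The two mixed contractions in the Ricci tensor differ by exchanging i and j; symmetry of A G⁻¹
  -- A merges them into the coefficient 2.
  have hsymm : ∀ i j : Fin n, ∑ k, ∑ l, halfEul G i k q * (G q)⁻¹ k l * halfEul G l j q =
      ∑ k, ∑ l, halfEul G j k q * (G q)⁻¹ k l * halfEul G l i q := by
    intro i j
    have hGs : ∀ k l, (G q)⁻¹ k l = (G q)⁻¹ l k := by
      have : (G q).IsSymm := Matrix.IsSymm.ext fun i j => H.symm q hq j i
      intro k l
      exact congrFun (congrFun this.inv k) l |>.symm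
    rw [Finset.sum_comm]
    refine Finset.sum_congr rfl fun k _ => Finset.sum_congr rfl fun l _ => ?_
    rw [hGs l k, H.halfEul_symm hq i l, H.halfEul_symm hq k j]
    ring
  have k1 := key j i
  have k2 := key i j
  rw [hsymm j i, H.halfEul_symm hq j i, H.symm q hq j i] at k1
  simp only [ricci, Fin.sum_univ_succ, pd_zero_collarCoord, pd_succ_collarCoord,
    H.norD_christoffel_zss hq, hd0, hd1, H.christoffel_zzz hq, H.christoffel_zzs hq,
    H.christoffel_zsz hq, H.christoffel_zss hq,
    H.christoffel_ssz hq, H.christoffel_sss hq]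
  simp only [Fin.cases_zero, Fin.cases_succ, mul_zero, zero_mul, zero_add, add_zero,
    Finset.sum_const_zero, Finset.sum_add_distrib, if_true]
  have s1 : ∑ k, q.2⁻¹ * (G q j k - halfEul G j k q) *
      (q.2⁻¹ * ((∑ l, (G q)⁻¹ k l * halfEul G l i q) - if k = i then 1 else 0)) =
      (q.2 ^ 2)⁻¹ * ∑ k, (G q j k - halfEul G j k q) *
        ((∑ l, (G q)⁻¹ k l * halfEul G l i q) - if k = i then 1 else 0) := by
    rw [Finset.mul_sum]
    refine Finset.sum_congr rfl fun k _ => ?_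
    field_simp
  have s2 : ∑ k, q.2⁻¹ * ((∑ l, (G q)⁻¹ k l * halfEul G l j q) - if k = j then 1 else 0) *
      (q.2⁻¹ * (G q i k - halfEul G i k q)) =
      (q.2 ^ 2)⁻¹ * ∑ k, (G q i k - halfEul G i k q) *
        ((∑ l, (G q)⁻¹ k l * halfEul G l j q) - if k = j then 1 else 0) := by
    rw [Finset.mul_sum]
    refine Finset.sum_congr rfl fun k _ => ?_
    field_simp
  have s3 : ∑ k, q.2⁻¹ * ((∑ l, (G q)⁻¹ k l * halfEul G l k q) - 1) *
      (q.2⁻¹ * (G q i j - halfEul G i j q)) =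
      (q.2 ^ 2)⁻¹ * ((∑ k, ∑ l, (G q)⁻¹ k l * halfEul G l k q) - n)
        * (G q i j - halfEul G i j q) := by
    rw [← key2, Finset.mul_sum, Finset.sum_mul]
    refine Finset.sum_congr rfl fun k _ => ?_
    field_simp
  rw [s1, s2, s3, k1, k2, ricciSlice]
  field_simp
  ring

end IsCollarMetric


/-! ### Evenness of expansions -/

/-- The coefficients below order `k` have no log terms and vanish at odd orders, near `u₀`. -/
def EvenCoeff (u₀ : Euc n) (a : ℕ → ℕ → Euc n → ℝ) (P : ℕ → ℕ) (k : ℕ) : Prop :=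
  ∀ j < k, ∀ᶠ u in 𝓝 u₀, (∀ p, 1 ≤ p → p ≤ P j → a j p u = 0) ∧ (Odd j → a j 0 u = 0)

theorem EvenCoeff.succ {u₀ : Euc n} {a : ℕ → ℕ → Euc n → ℝ} {P : ℕ → ℕ} {k : ℕ}
    (h : EvenCoeff u₀ a P k)
    (hk : ∀ᶠ u in 𝓝 u₀, (∀ p, 1 ≤ p → p ≤ P k → a k p u = 0) ∧ (Odd k → a k 0 u = 0)) :
    EvenCoeff u₀ a P (k + 1) := by
  intro j hj
  rcases Nat.lt_succ_iff_lt_or_eq.1 hj with h1 | rfl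
  · exact h j h1
  · exact hk

theorem isEvenNear_pow {u₀ : Euc n} {j : ℕ} (hj : Even j) :
    IsEvenNear u₀ (fun q => q.2 ^ j) := by
  obtain ⟨i, rfl⟩ := hj
  refine ⟨fun q => q.2 ^ i, .of_forall fun _ => contDiffAt_snd.pow i, .of_forall fun q => ?_⟩
  simp only
  rw [← pow_mul]; congr 1; ring

/-- The blocks below order k are even near u₀ and merge into e. The block of order k stays separate,
being the unknown of the inductive step; one e serves all numbers r of derivatives. -/
theorem HasPhgExpansionAt.exists_even {u₀ : Euc n} {f : Euc n × ℝ → ℝ} {a : ℕ → ℕ → Euc n → ℝ}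
    {P : ℕ → ℕ} (h : HasPhgExpansionAt f a P u₀) {k : ℕ} (hk : EvenCoeff u₀ a P k) :
    ∃ e, IsEvenNear u₀ e ∧ ∀ r, Conormal u₀ r (k + 1)
      (fun q => f q - (e q + logPoly k (P k) (a k) q)) := by
  have h1 : ∀ j < k, ∃ e, IsEvenNear u₀ e ∧ logPoly j (P j) (a j) =ᶠ[bdryFilter u₀] e := by
    intro j hj
    have h2 := (tendsto_fst (f := 𝓝 u₀) (g := 𝓝[>] (0 : ℝ))).eventually (hk j hj)
    have h0 : logPoly j (P j) (a j) =ᶠ[bdryFilter u₀] fun q => a j 0 q.1 * q.2 ^ j := by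
      filter_upwards [h2] with q hq
      rw [logPoly, Finset.sum_range_succ', Finset.sum_eq_zero]
      · simp
      · intro p hp
        rw [hq.1 (p + 1) (by omega) (by simp at hp; omega)]; simp
    rcases Nat.even_or_odd j with he | ho
    · exact ⟨_, (IsEvenNear.of_fst (h.smooth_coeff j 0)).mul (isEvenNear_pow he), h0⟩
    · refine ⟨fun _ => 0, .const 0, h0.trans ?_⟩
      filter_upwards [h2] with q hq
      rw [hq.2 ho, zero_mul]
  choose! e he hej using h1
  have hsum : ∀ K ≤ k, IsEvenNear u₀ (fun q => ∑ j ∈ Finset.range K, e j q) := by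
    intro K hK
    induction K with
    | zero => simpa using IsEvenNear.const 0
    | succ K ih =>
      simp only [Finset.sum_range_succ]
      exact (ih (by omega)).add (he K (by omega))
  refine ⟨_, hsum k le_rfl, fun r => (h.conormal k r).congr ?_⟩
  filter_upwards [(Filter.eventually_all_finset (Finset.range k)).2
    fun j hj => hej j (Finset.mem_range.1 hj)] with q hq
  rw [Finset.sum_range_succ, Finset.sum_congr rfl hq]

theorem HasPhgExpansionAt.conormal_logPoly {u₀ : Euc n} {f : Euc n × ℝ → ℝ}
    {a : ℕ → ℕ → Euc n → ℝ} {P : ℕ → ℕ} (h : HasPhgExpansionAt f a P u₀) (k r : ℕ) :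
    Conormal u₀ r k (logPoly k (P k) (a k)) :=
  PE.conormal_logPoly r k (P k) fun p _ => h.smooth_coeff k p

theorem HasPhgExpansionAt.evenMod {u₀ : Euc n} {f : Euc n × ℝ → ℝ} {a : ℕ → ℕ → Euc n → ℝ}
    {P : ℕ → ℕ} (h : HasPhgExpansionAt f a P u₀) {k : ℕ} (hk : EvenCoeff u₀ a P k) (r : ℕ) :
    EvenMod u₀ r k f := by
  obtain ⟨e, he, hr⟩ := h.exists_even hk
  refine ⟨e, he, (((hr r).mono (by linarith)).add (h.conormal_logPoly k r)).congr
    (.of_forall fun q => by ring)⟩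

/-- Continuity up to `t = 0` excludes log terms at order `t⁰`. -/
theorem HasPhgExpansionAt.evenCoeff_one {u₀ : Euc n} {f : Euc n × ℝ → ℝ} {a : ℕ → ℕ → Euc n → ℝ}
    {P : ℕ → ℕ} (h : HasPhgExpansionAt f a P u₀)
    (hlim : ∀ᶠ u in 𝓝 u₀, ∃ c, Tendsto (fun t => f (u, t)) (𝓝[>] 0) (𝓝 c)) :
    EvenCoeff u₀ a P 1 := by
  intro j hj
  obtain rfl : j = 0 := by omega
  have h1 := ((h.conormal 0 0).isBigO (ρ := 1 / 2) (by norm_num))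
  obtain ⟨C, hC⟩ := h1.bound
  filter_upwards [hlim, eventually_eventually_nhds_bdryFilter hC] with u ⟨c, hc⟩ hu
  refine ⟨fun p hp hpP => ?_, fun h => by simp at h⟩
  have h2 : Tendsto (fun t => f (u, t) - logPoly 0 (P 0) (a 0) (u, t)) (𝓝[>] 0) (𝓝 0) := by
    refine Asymptotics.IsBigO.trans_tendsto (Asymptotics.IsBigO.of_bound C ?_)
      (tendsto_rpow_nhdsGT_zero (show (0 : ℝ) < 1 / 2 by norm_num))
    simpa using eventually_slice_bdryFilter hu
  -- The order-0 block at u is a polynomial in log t converging to c as log t → −∞, so it is the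
  -- constant c.
  have h3 : Tendsto (fun t => (logPolyPoly (P 0) (fun p => a 0 p u)
      - Polynomial.C c).eval (Real.log t)) (𝓝[>] 0) (𝓝 0) := by
    have := (hc.sub h2).sub_const c
    simp only [sub_zero, sub_self] at this
    refine this.congr fun t => ?_
    rw [logPoly_eq_eval]; simp
  have h4 : Tendsto (fun s : ℝ => ((logPolyPoly (P 0) (fun p => a 0 p u)
      - Polynomial.C c).comp (-Polynomial.X)).eval s) atTop (𝓝 0) := by
    have h2 : Tendsto (fun s : ℝ => Real.exp (-s)) atTop (𝓝[>] 0) :=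
      tendsto_nhdsWithin_iff.2 ⟨Real.tendsto_exp_neg_atTop_nhds_zero,
        .of_forall fun s => Real.exp_pos _⟩
    simpa [Function.comp_def] using h3.comp h2
  have h5 := (Polynomial.tendsto_nhds_iff _).1 h4 |>.1
  rw [Polynomial.leadingCoeff_eq_zero] at h5
  have h6 := congrArg (fun S : Polynomial ℝ => S.comp (-Polynomial.X)) h5
  simp only [Polynomial.comp_assoc, Polynomial.neg_comp, Polynomial.X_comp, neg_neg,
    Polynomial.comp_X, Polynomial.zero_comp] at h6
  have h7 := congrArg (fun S : Polynomial ℝ => S.coeff p) h6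
  simpa [coeff_logPolyPoly _ hpP, Polynomial.coeff_C_of_ne_zero (show p ≠ 0 by omega)] using h7

/-! ### Determinants and inverses of matrices of functions -/

theorem evenMod_det {u₀ : Euc n} {r m : ℕ} {k : ℝ} (hk : 0 ≤ k)
    {A : Euc n × ℝ → Matrix (Fin m) (Fin m) ℝ} (hA : ∀ i j, EvenMod u₀ r k (fun q => A q i j)) :
    EvenMod u₀ r k (fun q => (A q).det) := by
  simp only [Matrix.det_apply']
  exact EvenMod.sum _ fun σ _ => EvenMod.const_mul hk
    (EvenMod.prod hk _ fun i _ => hA _ _) _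

/-- Cramer's rule: adjugate entries are determinants of matrices whose entries are constants or
entries of A, and the determinant has a nonzero limit. -/
theorem evenMod_inv {u₀ : Euc n} {r m : ℕ} {k : ℝ} (hk : 0 < k)
    {A : Euc n × ℝ → Matrix (Fin m) (Fin m) ℝ} {A₀ : Matrix (Fin m) (Fin m) ℝ}
    (hA : ∀ i j, EvenMod u₀ r k (fun q => A q i j))
    (hlim : ∀ i j, Tendsto (fun q => A q i j) (bdryFilter u₀) (𝓝 (A₀ i j)))
    (hdet : A₀.det ≠ 0) (i j : Fin m) : EvenMod u₀ r k (fun q => (A q)⁻¹ i j) := by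
  have hdlim : Tendsto (fun q => (A q).det) (bdryFilter u₀) (𝓝 A₀.det) := by
    simp only [Matrix.det_apply']
    exact tendsto_finsetSum _ fun σ _ => (tendsto_finsetProd _ fun i _ => hlim _ _).const_mul _
  have h1 := (evenMod_det hk.le hA).inv hk hdet hdlim
  have h2 : EvenMod u₀ r k (fun q => (A q).adjugate i j) := by
    simp only [Matrix.adjugate_apply]
    refine evenMod_det hk.le fun i' j' => ?_
    by_cases h : i' = j
    · subst h; simpa using EvenMod.const _
    · simpa [Matrix.updateRow_ne h] using hA i' j'
  refine (h1.mul hk.le h2).congr (.of_forall fun q => ?_)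
  simp [Matrix.inv_def]

theorem eventually_det_ne_zero {u₀ : Euc n} {m : ℕ}
    {A : Euc n × ℝ → Matrix (Fin m) (Fin m) ℝ} {A₀ : Matrix (Fin m) (Fin m) ℝ}
    (hlim : ∀ i j, Tendsto (fun q => A q i j) (bdryFilter u₀) (𝓝 (A₀ i j)))
    (hdet : A₀.det ≠ 0) : ∀ᶠ q in bdryFilter u₀, (A q).det ≠ 0 := by
  have hdlim : Tendsto (fun q => (A q).det) (bdryFilter u₀) (𝓝 A₀.det) := by
    simp only [Matrix.det_apply']
    exact tendsto_finsetSum _ fun σ _ => (tendsto_finsetProd _ fun i _ => hlim _ _).const_mul _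
  exact hdlim.eventually_ne hdet

/-! ### The metric -/

/-- Inverts an operator of the form "injective plus shift" by working down from the highest power of
log t. The threshold p₀ permits p = 0 to be left out. -/
theorem eq_zero_of_descending {x : ℕ → ℝ} {N p₀ : ℕ} (hN : ∀ p, N < p → x p = 0)
    (hs : ∀ p, p₀ ≤ p → x (p + 1) = 0 → x p = 0) {p : ℕ} (hp : p₀ ≤ p) : x p = 0 := by
  by_cases h : N < p
  · exact hN p h
  · obtain ⟨d, hd⟩ := Nat.exists_eq_add_of_le (not_lt.1 h)
    induction d generalizing p with
    | zero => exact hs p hp (hN _ (by omega))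
    | succ d ih =>
      refine hs p hp ?_
      by_cases h' : N < p + 1
      · exact hN _ h'
      · exact ih (by omega) h' (by omega)

/-- Padding with zeros gives all components of the metric the same number of log powers, so that
traces can be taken coefficientwise. -/
theorem logPoly_eq_of_le {k P N : ℕ} (h : P ≤ N) (a : ℕ → Euc n → ℝ) (q : Euc n × ℝ) :
    logPoly k P a q = logPoly k N (fun p u => if p ≤ P then a p u else 0) q := by
  rw [logPoly, logPoly, ← Finset.sum_subset (Finset.range_mono (Nat.succ_le_succ h))]
  · refine Finset.sum_congr rfl fun p hp => ?_
    rw [if_pos (by simp at hp; omega)]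
  · intro p _ hp
    rw [if_neg (by simp at hp; omega)]; ring

theorem logPoly_add (k N : ℕ) (a b : ℕ → Euc n → ℝ) (q : Euc n × ℝ) :
    logPoly k N (fun p u => a p u + b p u) q = logPoly k N a q + logPoly k N b q := by
  simp only [logPoly, add_mul, Finset.sum_add_distrib]

theorem logPoly_mul (k N : ℕ) (c : Euc n → ℝ) (a : ℕ → Euc n → ℝ) (q : Euc n × ℝ) :
    logPoly k N (fun p u => c u * a p u) q = c q.1 * logPoly k N a q := by
  simp only [logPoly, Finset.mul_sum, mul_assoc]

theorem logPoly_sum {ι : Type*} (s : Finset ι) (k N : ℕ) (a : ι → ℕ → Euc n → ℝ) (q : Euc n × ℝ) :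
    logPoly k N (fun p u => ∑ i ∈ s, a i p u) q = ∑ i ∈ s, logPoly k N (a i) q := by
  simp only [logPoly, Finset.sum_mul]
  exact Finset.sum_comm

section Metric

variable {u₀ : Euc n} {G : Euc n × ℝ → Matrix (Fin n) (Fin n) ℝ}

/-- The curvature of the slices involves only tangential derivatives, at most two of them, and these
preserve both evenness and the order of the error. -/
theorem evenMod_ricciSlice {k : ℝ} (hk : 0 ≤ k)
    (hG : ∀ i j, EvenMod u₀ 2 k (fun q => G q i j))
    (hGi : ∀ i j, EvenMod u₀ 2 k (fun q => (G q)⁻¹ i j)) (i j : Fin n) :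
    EvenMod u₀ 0 k (ricciSlice G i j) := by
  have hΓ : ∀ k' i j, EvenMod u₀ 1 k (christoffelSlice G k' i j) := fun k' i j =>
    EvenMod.const_mul hk (EvenMod.sum _ fun l _ => ((hGi k' l).of_le (by omega)).mul hk
      ((((hG j l).tanD i).add ((hG i l).tanD j)).sub ((hG i j).tanD l))) _
  have hΓ0 : ∀ k' i j, EvenMod u₀ 0 k (christoffelSlice G k' i j) := fun k' i j =>
    (hΓ k' i j).of_le (by omega)
  exact (((EvenMod.sum _ fun k' _ => (hΓ k' i j).tanD k').sub
    (EvenMod.sum _ fun k' _ => (hΓ k' i k').tanD j)).add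
      (EvenMod.sum _ fun k' _ => EvenMod.sum _ fun l _ => (hΓ0 k' k' l).mul hk (hΓ0 l i j))).sub
      (EvenMod.sum _ fun k' _ => EvenMod.sum _ fun l _ => (hΓ0 k' j l).mul hk (hΓ0 l i k'))

variable {a : Fin n → Fin n → ℕ → ℕ → Euc n → ℝ} {P : Fin n → Fin n → ℕ → ℕ}

/-- The boundary metric. -/
def leadingMetric (a : Fin n → Fin n → ℕ → ℕ → Euc n → ℝ) (u : Euc n) : Matrix (Fin n) (Fin n) ℝ :=
  Matrix.of fun i j => a i j 0 0 u

theorem conormal_sub_leading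
    (hG : ∀ i j, HasPhgExpansionAt (fun q => G q i j) (a i j) (P i j) u₀)
    (hP : ∀ i j, P i j 0 = 0) (r : ℕ) (i j : Fin n) :
    Conormal u₀ r 1 (fun q => G q i j - leadingMetric a q.1 i j) := by
  have := (hG i j).conormal 0 r
  norm_num at this
  refine this.congr (.of_forall fun q => ?_)
  simp [logPoly, hP, leadingMetric]

theorem tendsto_leading
    (hG : ∀ i j, HasPhgExpansionAt (fun q => G q i j) (a i j) (P i j) u₀)
    (hP : ∀ i j, P i j 0 = 0) (i j : Fin n) :
    Tendsto (fun q => G q i j) (bdryFilter u₀) (𝓝 (leadingMetric a u₀ i j)) := by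
  have h1 := (conormal_sub_leading hG hP 0 i j).tendsto_zero one_pos
  have h2 : Tendsto (fun q : Euc n × ℝ => leadingMetric a q.1 i j) (bdryFilter u₀)
      (𝓝 (leadingMetric a u₀ i j)) :=
    (((hG i j).smooth_coeff 0 0).self_of_nhds.continuousAt.tendsto).comp tendsto_fst
  simpa using h1.add h2

theorem evenCoeff_one_metric (hP : ∀ i j, P i j 0 = 0) (i j : Fin n) :
    EvenCoeff u₀ (a i j) (P i j) 1 := by
  intro l hl
  obtain rfl : l = 0 := by omega
  refine .of_forall fun u => ⟨fun p hp hpP => ?_, fun h => by simp at h⟩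
  rw [hP] at hpP; omega

theorem eventually_leading_det
    (hG : ∀ i j, HasPhgExpansionAt (fun q => G q i j) (a i j) (P i j) u₀)
    (hdet : (leadingMetric a u₀).det ≠ 0) : ∀ᶠ u in 𝓝 u₀, (leadingMetric a u).det ≠ 0 := by
  have : Tendsto (fun u => (leadingMetric a u).det) (𝓝 u₀) (𝓝 (leadingMetric a u₀).det) := by
    simp only [Matrix.det_apply']
    refine tendsto_finsetSum _ fun σ _ => (tendsto_finsetProd _ fun i _ => ?_).const_mul _
    exact ((hG _ _).smooth_coeff 0 0).self_of_nhds.continuousAt.tendsto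
  exact this.eventually_ne hdet

end Metric


/-! ### Evenness of Poincaré–Einstein metrics -/

section Metric

variable {u₀ : Euc n} {G : Euc n × ℝ → Matrix (Fin n) (Fin n) ℝ}
  {a : Fin n → Fin n → ℕ → ℕ → Euc n → ℝ} {P : Fin n → Fin n → ℕ → ℕ}

/-- The tangential Einstein equation for `t⁻² (dt² + G_t)`. -/
def TangentialEinstein (u₀ : Euc n) (G : Euc n × ℝ → Matrix (Fin n) (Fin n) ℝ) : Prop :=
  ∀ᶠ q in bdryFilter u₀, ∀ i j : Fin n,
    q.2 ^ 2 * ricciSlice G i j q - eulD (halfEul G i j) q + n * halfEul G i j q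
      + (∑ k, ∑ l, (G q)⁻¹ k l * halfEul G l k q) * (G q i j - halfEul G i j q)
      + 2 * ∑ k, ∑ l, halfEul G i k q * (G q)⁻¹ k l * halfEul G l j q = 0

/-- The indicial operator of the Einstein equation is injective at orders `0 < k < n`. -/
theorem indicial_injective {k : ℕ} (hk : k < n) {g : Matrix (Fin n) (Fin n) ℝ}
    (hg : g.det ≠ 0) {α : Fin n → Fin n → ℝ}
    (h : ∀ i j, ((n : ℝ) - k) * α i j + (∑ s, ∑ l, g⁻¹ s l * α l s) * g i j = 0) :
    ∀ i j, α i j = 0 := by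
  have hnk : (0 : ℝ) < n - k := by
    have : (k : ℝ) < n := by exact_mod_cast hk
    linarith
  set τ := ∑ s, ∑ l, g⁻¹ s l * α l s with hτ
  have h1 : ∑ s, ∑ l, g⁻¹ s l * (((n : ℝ) - k) * α l s + τ * g l s) = 0 :=
    Finset.sum_eq_zero fun s _ => Finset.sum_eq_zero fun l _ => by rw [h]; ring
  have h2 : ∑ s, ∑ l, g⁻¹ s l * g l s = n := by
    have hG : g⁻¹ * g = 1 := Matrix.nonsing_inv_mul _ (isUnit_iff_ne_zero.2 hg)
    have : ∀ s, ∑ l, g⁻¹ s l * g l s = 1 := fun s => by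
      have := congrFun (congrFun hG s) s
      rwa [Matrix.mul_apply, Matrix.one_apply_eq] at this
    simp [this]
  have h3 : ∑ s, ∑ l, g⁻¹ s l * (((n : ℝ) - k) * α l s + τ * g l s) =
      ((n : ℝ) - k) * τ + τ * n := by
    rw [hτ, ← h2]
    simp only [Finset.mul_sum, ← Finset.sum_add_distrib, mul_add]
    refine Finset.sum_congr rfl fun s _ => Finset.sum_congr rfl fun l _ => by ring
  have h4 : τ = 0 := by
    -- The trace of the equation. Since 2n − k > 0 the trace of α vanishes, and the equation reduces
    -- to (n − k)α = 0.
    have h5 : τ * (((n : ℝ) - k) + n) = 0 := by linear_combination h1 - h3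
    rcases mul_eq_zero.1 h5 with h | h
    · exact h
    · have : (0 : ℝ) ≤ n := n.cast_nonneg
      linarith
  intro i j
  have := h i j
  rw [h4, zero_mul, add_zero] at this
  exact (mul_eq_zero.1 this).resolve_left hnk.ne'

theorem eulD_sub_add {f e T : Euc n × ℝ → ℝ} {q : Euc n × ℝ} (d1 : DifferentiableAt ℝ f q)
    (d2 : DifferentiableAt ℝ e q) (d3 : DifferentiableAt ℝ T q) :
    eulD (fun q => f q - (e q + T q)) q = eulD f q - (eulD e q + eulD T q) := by
  simp only [eulD, norD]
  rw [fderiv_fun_sub d1 (d2.fun_add d3), fderiv_fun_add d2 d3]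
  simp only [_root_.sub_apply, _root_.add_apply]; ring

/-- Insert G = even + block of order k + O(t^(k+1)) into the Einstein equation. Modulo even
functions and order k + 1 only the linear action on the block survives, so its image has no log
terms and, for k odd, no constant one. The indicial operator is injective because k < n, and the
same follows for the block. -/
theorem evenCoeff_metric_step {k : ℕ} (hk1 : 1 ≤ k) (hkn : k < n)
    (hG : ∀ i j, HasPhgExpansionAt (fun q => G q i j) (a i j) (P i j) u₀)
    (hP : ∀ i j, P i j 0 = 0) (hdet : (leadingMetric a u₀).det ≠ 0)
    (hE : TangentialEinstein u₀ G) (hev : ∀ i j, EvenCoeff u₀ (a i j) (P i j) k) :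
    ∀ i j, EvenCoeff u₀ (a i j) (P i j) (k + 1) := by
  classical
  have hk0 : (0 : ℝ) < k := by exact_mod_cast hk1
  have hk1' : (1 : ℝ) ≤ k := by exact_mod_cast hk1
  set N := ∑ i, ∑ j, P i j k with hN
  have hPN : ∀ i j, P i j k ≤ N := fun i j =>
    (Finset.single_le_sum (f := fun j => P i j k) (fun _ _ => Nat.zero_le _)
      (Finset.mem_univ j)).trans (Finset.single_le_sum (f := fun i => ∑ j, P i j k)
        (fun _ _ => Nat.zero_le _) (Finset.mem_univ i))
  set b : Fin n → Fin n → ℕ → Euc n → ℝ := fun i j p u => if p ≤ P i j k then a i j k p u else 0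
    with hb
  have hbsm : ∀ i j p, ∀ᶠ u in 𝓝 u₀, ContDiffAt ℝ ∞ (b i j p) u := by
    intro i j p
    by_cases h : p ≤ P i j k
    · simpa [hb, h] using (hG i j).smooth_coeff k p
    · simp [hb, h, contDiffAt_const]
  have hbN : ∀ i j p u, N < p → b i j p u = 0 := fun i j p u hp => by
    simp only [hb]; rw [if_neg (by have := hPN i j; omega)]
  -- Coefficients of the order-k block of A = ½ t∂_t G; the second term is the shift produced by
  -- differentiating log t.
  set α : Fin n → Fin n → ℕ → Euc n → ℝ := fun i j p u =>
    (1 / 2 : ℝ) * (k * b i j p u + (p + 1) * b i j (p + 1) u) with hα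
  have hαsm : ∀ i j p, ∀ᶠ u in 𝓝 u₀, ContDiffAt ℝ ∞ (α i j p) u := by
    intro i j p
    filter_upwards [hbsm i j p, hbsm i j (p + 1)] with u h1 h2
    exact contDiffAt_const.mul ((contDiffAt_const.mul h1).add (contDiffAt_const.mul h2))
  have hαN : ∀ i j p u, N < p → α i j p u = 0 := fun i j p u hp => by
    simp only [hα]; rw [hbN i j p u hp, hbN i j (p + 1) u (by omega)]; ring
  have hαc : ∀ i j r, Conormal u₀ r k (logPoly k N (α i j)) := fun i j r =>
    conormal_logPoly r k N fun p _ => hαsm i j p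
  -- splitting of `½ t ∂_t G`
  have hA : ∀ i j, ∃ e, IsEvenNear u₀ e ∧ ∀ r, Conormal u₀ r (k + 1)
      (fun q => halfEul G i j q - (q.2 ^ 2 * e q + logPoly k N (α i j) q)) := by
    intro i j
    obtain ⟨e, he, hr⟩ := (hG i j).exists_even (hev i j)
    obtain ⟨e', he', h'⟩ := he.eulD
    refine ⟨fun q => (1 / 2 : ℝ) * e' q, (IsEvenNear.const _).mul he', fun r => ?_⟩
    have hT : eulD (logPoly k (P i j k) (a i j k)) =ᶠ[bdryFilter u₀]
        fun q => 2 * logPoly k N (α i j) q := by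
      have h1 : logPoly k (P i j k) (a i j k) = logPoly k N (b i j) :=
        funext fun q => logPoly_eq_of_le (hPN i j) _ q
      rw [h1]
      refine (eulD_logPoly k N (fun p _ => hbsm i j p) fun u => hbN i j _ u (by omega)).trans ?_
      refine .of_forall fun q => ?_
      simp only [hα]
      rw [logPoly_mul k N (fun _ => (1 / 2 : ℝ)) (fun p u => k * b i j p u
        + (p + 1) * b i j (p + 1) u)]
      ring
    refine ((hr (r + 1)).eulD.const_mul (1 / 2)).congr ?_
    have s1 := (hG i j).smooth
    have s2 := he.smooth
    have s3 := ((hG i j).conormal_logPoly k 0).smooth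
    filter_upwards [s1.differentiableAt, s2.differentiableAt, s3.differentiableAt, h', hT]
      with q d1 d2 d3 h4 h5
    have : eulD (fun q => G q i j - (e q + logPoly k (P i j k) (a i j k) q)) q =
        eulD (fun q => G q i j) q - (eulD e q + eulD (logPoly k (P i j k) (a i j k)) q) := by
      exact eulD_sub_add d1 d2 d3
    rw [this, h4, h5, halfEul]; ring
  choose e he hAr using hA
  have hlim := tendsto_leading hG hP
  have hGev : ∀ r i j, EvenMod u₀ r k (fun q => G q i j) := fun r i j => (hG i j).evenMod (hev i j) r
  have hGi : ∀ r i j, EvenMod u₀ r k (fun q => (G q)⁻¹ i j) := fun r =>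
    evenMod_inv hk0 (hGev r) hlim hdet
  have hAev : ∀ i j, EvenMod u₀ 0 k (halfEul G i j) := by
    intro i j
    refine ⟨_, IsEvenNear.sq.mul (he i j), (((hAr i j 0).mono (by linarith)).add
      (hαc i j 0)).congr (.of_forall fun q => by ring)⟩
  -- `B = A - t² e`
  have hB : ∀ i j, Conormal u₀ 0 k (fun q => halfEul G i j q - q.2 ^ 2 * e i j q) := fun i j =>
    (((hAr i j 0).mono (by linarith)).add (hαc i j 0)).congr (.of_forall fun q => by ring)
  -- A vanishes at the boundary, as t²e has order 2 and the rest order k ≥ 1. This extra order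
  -- pushes products of A with the block up to order k + 1.
  have hA1 : ∀ i j, Conormal u₀ 0 1 (halfEul G i j) := by
    intro i j
    have h2 : Conormal u₀ 0 1 (fun q => q.2 ^ 2 * e i j q) := by
      have := (conormal_sq u₀ 0).mul ((he i j).conormal 0)
      exact this.mono (by norm_num)
    exact (((hB i j).mono hk1').add h2).congr (.of_forall fun q => by ring)
  set g : Euc n → Matrix (Fin n) (Fin n) ℝ := leadingMetric a with hg
  have hgd := eventually_leading_det hG hdet
  have hGg : ∀ i j, Conormal u₀ 0 1 (fun q => G q i j - g q.1 i j) := fun i j =>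
    conormal_sub_leading hG hP 0 i j
  have hgsm : ∀ i j, ∀ᶠ u in 𝓝 u₀, ContDiffAt ℝ ∞ (fun u => g u i j) u := fun i j =>
    (hG i j).smooth_coeff 0 0
  have hgiE : ∀ i j, EvenMod u₀ 0 1 (fun q => (g q.1)⁻¹ i j) := by
    refine evenMod_inv one_pos (fun i j => EvenMod.of_even (.of_fst (hgsm i j)))
      (A₀ := g u₀) (fun i j => ?_) hdet
    exact (hgsm i j).self_of_nhds.continuousAt.tendsto.comp tendsto_fst
  have hgic : ∀ i j, Conormal u₀ 0 0 (fun q => (g q.1)⁻¹ i j) := fun i j =>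
    (hgiE i j).conormal zero_le_one
  -- G⁻¹ − g⁻¹ = −G⁻¹(G − g)g⁻¹, so the coefficients of the linearization may be frozen at the
  -- boundary metric.
  have hGig : ∀ i j, Conormal u₀ 0 1 (fun q => (G q)⁻¹ i j - (g q.1)⁻¹ i j) := by
    intro i j
    have h1 : Conormal u₀ 0 1 (fun q => ∑ s, ∑ l,
        (G q)⁻¹ i s * (G q s l - g q.1 s l) * (g q.1)⁻¹ l j) := by
      refine Conormal.sum _ fun s _ => Conormal.sum _ fun l _ => ?_
      simpa using (((hGi 0 i s).conormal hk0.le).mul (hGg s l)).mul (hgic l j)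
    refine h1.neg.congr ?_
    filter_upwards [eventually_det_ne_zero hlim hdet,
      (tendsto_fst (f := 𝓝 u₀) (g := 𝓝[>] (0 : ℝ))).eventually hgd] with q d1 d2
    have e1 : (G q)⁻¹ * (G q - g q.1) * (g q.1)⁻¹ = (g q.1)⁻¹ - (G q)⁻¹ := by
      rw [Matrix.mul_sub, Matrix.sub_mul, Matrix.nonsing_inv_mul _ (isUnit_iff_ne_zero.2 d1),
        Matrix.mul_assoc, Matrix.mul_nonsing_inv _ (isUnit_iff_ne_zero.2 d2)]
      simp
    have e2 := congrFun (congrFun e1 i) j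
    rw [Matrix.mul_apply] at e2
    simp only [Matrix.mul_apply, Finset.sum_mul, Matrix.sub_apply] at e2
    rw [Finset.sum_comm, e2]; ring
  -- the trace terms
  set τT : Euc n × ℝ → ℝ := fun q => ∑ s, ∑ l, (g q.1)⁻¹ s l * logPoly k N (α l s) q with hτT
  have hτTc : Conormal u₀ 0 k τT := Conormal.sum _ fun s _ => Conormal.sum _ fun l _ => by
    simpa using (hgic s l).mul (hαc l s 0)
  have hτ : Conormal u₀ 0 (k + 1) (fun q => (∑ s, ∑ l, (G q)⁻¹ s l * halfEul G l s q)
      - (q.2 ^ 2 * (∑ s, ∑ l, (G q)⁻¹ s l * e l s q) + τT q)) := by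
    have h1 : Conormal u₀ 0 (k + 1) (fun q => ∑ s, ∑ l, ((G q)⁻¹ s l *
        (halfEul G l s q - (q.2 ^ 2 * e l s q + logPoly k N (α l s) q))
        + ((G q)⁻¹ s l - (g q.1)⁻¹ s l) * logPoly k N (α l s) q)) := by
      refine Conormal.sum _ fun s _ => Conormal.sum _ fun l _ => Conormal.add ?_ ?_
      · simpa using ((hGi 0 s l).conormal hk0.le).mul (hAr l s 0)
      · have := (hGig s l).mul (hαc l s 0)
        rwa [add_comm (1 : ℝ)] at this
    refine h1.congr (.of_forall fun q => ?_)
    simp only [hτT, Finset.mul_sum, ← Finset.sum_add_distrib, ← Finset.sum_sub_distrib]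
    exact Finset.sum_congr rfl fun s _ => Finset.sum_congr rfl fun l _ => by ring
  have hk2 : (k : ℝ) + 1 ≤ k + 2 := by linarith
  -- The trace is t² times something even modulo t^k, plus `τT`, plus an error of order k + 1. In
  -- `τT`·(G − A), replacing G − A by the boundary metric costs order 1.
  have hτprod : ∀ i j, EvenMod u₀ 0 (k + 1) (fun q => (∑ s, ∑ l, (G q)⁻¹ s l * halfEul G l s q)
      * (G q i j - halfEul G i j q) - τT q * g q.1 i j) := by
    intro i j
    have h1 : EvenMod u₀ 0 (k + 1) (fun q => q.2 ^ 2 * ((∑ s, ∑ l, (G q)⁻¹ s l * e l s q)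
        * (G q i j - halfEul G i j q))) := by
      refine EvenMod.mono (EvenMod.sq_mul (k := k) ?_) hk2
      refine EvenMod.mul hk0.le (EvenMod.sum _ fun s _ => EvenMod.sum _ fun l _ =>
        (hGi 0 s l).mul hk0.le (.of_even (he l s))) ((hGev 0 i j).sub (hAev i j))
    have h2 : Conormal u₀ 0 (k + 1) (fun q => ((∑ s, ∑ l, (G q)⁻¹ s l * halfEul G l s q)
        - (q.2 ^ 2 * (∑ s, ∑ l, (G q)⁻¹ s l * e l s q) + τT q))
          * (G q i j - halfEul G i j q)) := by
      simpa using hτ.mul (((hGev 0 i j).sub (hAev i j)).conormal hk0.le)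
    have h3 : Conormal u₀ 0 (k + 1) (fun q => τT q *
        ((G q i j - g q.1 i j) - halfEul G i j q)) := hτTc.mul ((hGg i j).sub (hA1 i j))
    exact ((h1.add (.of_conormal h2)).add (.of_conormal h3)).congr (.of_forall fun q => by ring)
  -- Split the first factor A as t²e + B: the t²e part gains two orders, and B has order k while the
  -- other A has order 1.
  have hquad : ∀ i j, EvenMod u₀ 0 (k + 1) (fun q =>
      ∑ s, ∑ l, halfEul G i s q * (G q)⁻¹ s l * halfEul G l j q) := by
    intro i j
    refine EvenMod.sum _ fun s _ => EvenMod.sum _ fun l _ => ?_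
    have h1 : EvenMod u₀ 0 (k + 1) (fun q => q.2 ^ 2 *
        (e i s q * ((G q)⁻¹ s l * halfEul G l j q))) := by
      refine EvenMod.mono (EvenMod.sq_mul (k := k) ?_) hk2
      exact EvenMod.mul hk0.le (.of_even (he i s)) ((hGi 0 s l).mul hk0.le (hAev l j))
    have h2 : Conormal u₀ 0 (k + 1) (fun q => (halfEul G i s q - q.2 ^ 2 * e i s q) *
        ((G q)⁻¹ s l * halfEul G l j q)) := by
      have := (hB i s).mul (((hGi 0 s l).conormal hk0.le).mul (hA1 l j))
      simpa using this
    exact (h1.add (.of_conormal h2)).congr (.of_forall fun q => by ring)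
  have hric : ∀ i j, EvenMod u₀ 0 (k + 1) (fun q => q.2 ^ 2 * ricciSlice G i j q) := fun i j =>
    ((evenMod_ricciSlice hk0.le (hGev 2) (hGi 2) i j).sq_mul).mono hk2
  have hlin : ∀ i j, EvenMod u₀ 0 (k + 1) (fun q => n * halfEul G i j q - n * logPoly k N (α i j) q) := by
    intro i j
    have h1 : EvenMod u₀ 0 (k + 1) (fun q => n * (q.2 ^ 2 * e i j q)) :=
      .of_even ((IsEvenNear.const _).mul (IsEvenNear.sq.mul (he i j)))
    exact (h1.add (.of_conormal ((hAr i j 0).const_mul n))).congr (.of_forall fun q => by ring)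
  -- A second Euler derivative acts on the block by the same k-plus-shift rule; the splitting of A
  -- is used here with one derivative in reserve.
  have heul : ∀ i j, EvenMod u₀ 0 (k + 1) (fun q => eulD (halfEul G i j) q
      - logPoly k N (fun p u => k * α i j p u + (p + 1) * α i j (p + 1) u) q) := by
    intro i j
    have hse : IsEvenNear u₀ (fun q => q.2 ^ 2 * e i j q) := IsEvenNear.sq.mul (he i j)
    obtain ⟨e₂, he₂, h₂⟩ := hse.eulD
    have hT := eulD_logPoly (u₀ := u₀) k N (fun p _ => hαsm i j p)
      fun u => hαN i j (N + 1) u (by omega)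
    refine ((EvenMod.of_even (IsEvenNear.sq.mul he₂)).add
      (.of_conormal (hAr i j 1).eulD)).congr ?_
    have s1 : SmoothNear u₀ (halfEul G i j) := (hAev i j).conormal hk0.le |>.smooth
    filter_upwards [s1.differentiableAt, hse.smooth.differentiableAt,
      (hαc i j 0).smooth.differentiableAt, h₂, hT] with q d1 d2 d3 h4 h5
    have : eulD (fun q => halfEul G i j q - (q.2 ^ 2 * e i j q + logPoly k N (α i j) q)) q =
        eulD (halfEul G i j) q - (eulD (fun q => q.2 ^ 2 * e i j q) q
          + eulD (logPoly k N (α i j)) q) := by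
      exact eulD_sub_add d1 d2 d3
    rw [this, h4, h5]; ring
  -- the terms of order `k` of the Einstein equation
  set β : Fin n → Fin n → ℕ → Euc n → ℝ := fun i j p u =>
    (-1) * (k * α i j p u + (p + 1) * α i j (p + 1) u) + n * α i j p u
      + g u i j * (∑ s, ∑ l, (g u)⁻¹ s l * α l s p u) with hβ
  have hβev : ∀ i j, EvenMod u₀ 0 (k + 1) (logPoly k N (β i j)) := by
    intro i j
    have hk10 : (0 : ℝ) ≤ k + 1 := by linarith
    refine ((((heul i j).sub (hric i j)).sub (hlin i j)).sub (hτprod i j) |>.sub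
      ((hquad i j).const_mul hk10 2)).congr ?_
    filter_upwards [hE] with q hq
    have h1 : logPoly k N (β i j) q =
        (-1) * logPoly k N (fun p u => k * α i j p u + (p + 1) * α i j (p + 1) u) q
        + n * logPoly k N (α i j) q + g q.1 i j * τT q := by
      rw [hβ]
      simp only []
      rw [logPoly_add k N (fun p u => (-1) * (k * α i j p u + (p + 1) * α i j (p + 1) u)
          + n * α i j p u) (fun p u => g u i j * (∑ s, ∑ l, (g u)⁻¹ s l * α l s p u)),
        logPoly_add k N (fun p u => (-1) * (k * α i j p u + (p + 1) * α i j (p + 1) u))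
          (fun p u => n * α i j p u),
        logPoly_mul k N (fun _ => (-1 : ℝ)) (fun p u => k * α i j p u + (p + 1) * α i j (p + 1) u),
        logPoly_mul k N (fun _ => (n : ℝ)) (α i j),
        logPoly_mul k N (fun u => g u i j) (fun p u => ∑ s, ∑ l, (g u)⁻¹ s l * α l s p u),
        logPoly_sum _ k N (fun s p u => ∑ l, (g u)⁻¹ s l * α l s p u)]
      congr 2
      refine Finset.sum_congr rfl fun s _ => ?_
      rw [logPoly_sum _ k N (fun l p u => (g u)⁻¹ s l * α l s p u)]
      exact Finset.sum_congr rfl fun l _ => logPoly_mul k N (fun u => (g u)⁻¹ s l) (α l s) q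
    rw [h1]
    linear_combination (-1 : ℝ) * hq i j
  have hβ0 : ∀ᶠ u in 𝓝 u₀, ∀ i j, (∀ p, 1 ≤ p → p ≤ N → β i j p u = 0) ∧
      (Odd k → β i j 0 u = 0) :=
    Filter.eventually_all.2 fun i => Filter.eventually_all.2 fun j =>
      coeff_eq_zero_of_evenMod (hβev i j)
  -- Take p₀ = 1 for the log terms, and p₀ = 0 when k is odd, to kill the plain power as well.
  have hbz : ∀ᶠ u in 𝓝 u₀, ∀ p₀ : ℕ, (1 ≤ p₀ ∨ Odd k) → ∀ p, p₀ ≤ p → ∀ i j, b i j p u = 0 := by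
    filter_upwards [hβ0, hgd] with u hu hd p₀ hp₀
    have hβz : ∀ i j p, p₀ ≤ p → β i j p u = 0 := by
      intro i j p hp
      by_cases hpN : N < p
      · simp only [hβ, hαN _ _ p u hpN, hαN _ _ (p + 1) u (by omega)]
        simp
      · rcases Nat.eq_zero_or_pos p with rfl | h
        · exact (hu i j).2 (hp₀.resolve_left (by omega))
        · exact (hu i j).1 p h (by omega)
    -- Descending in p removes the shift from β, leaving the indicial equation for α at level p.
    -- Summed absolute values treat all components at once.
    have hαz : ∀ p, p₀ ≤ p → (fun i j => α i j p u) = 0 := by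
      refine fun p hp => funext fun i => funext fun j => ?_
      have key : ∀ p, p₀ ≤ p → (∑ i, ∑ j, |α i j p u|) = 0 := by
        refine fun p hp => eq_zero_of_descending (x := fun p => ∑ i, ∑ j, |α i j p u|)
          (N := N) (p₀ := p₀) (fun p hp => ?_) (fun p hp h1 => ?_) hp
        · exact Finset.sum_eq_zero fun i _ => Finset.sum_eq_zero fun j _ => by
            rw [hαN i j p u hp, abs_zero]
        · have h2 : ∀ i j, α i j (p + 1) u = 0 := fun i j => by
            have h3 := (Finset.sum_eq_zero_iff_of_nonneg fun i _ =>
              Finset.sum_nonneg fun j _ => abs_nonneg (α i j (p + 1) u)).1 h1 i (Finset.mem_univ i)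
            exact abs_eq_zero.1 ((Finset.sum_eq_zero_iff_of_nonneg fun j _ =>
              abs_nonneg (α i j (p + 1) u)).1 h3 j (Finset.mem_univ j))
          have h4 := indicial_injective hkn hd (α := fun i j => α i j p u) fun i j => by
            have := hβz i j p hp
            simp only [hβ, h2 i j] at this
            linear_combination this
          exact Finset.sum_eq_zero fun i _ => Finset.sum_eq_zero fun j _ => by
            rw [h4 i j, abs_zero]
      have h3 := (Finset.sum_eq_zero_iff_of_nonneg fun i _ =>
        Finset.sum_nonneg fun j _ => abs_nonneg (α i j p u)).1 (key p hp) i (Finset.mem_univ i)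
      exact abs_eq_zero.1 ((Finset.sum_eq_zero_iff_of_nonneg fun j _ =>
        abs_nonneg (α i j p u)).1 h3 j (Finset.mem_univ j))
    intro p hp i j
    -- A second descent recovers the block of G from that of A, by inverting k plus the shift with k
    -- ≠ 0.
    refine eq_zero_of_descending (x := fun p => b i j p u) (N := N) (p₀ := p₀)
      (fun p hp => hbN i j p u hp) (fun p hp h1 => ?_) hp
    have h2 : α i j p u = 0 := congrFun (congrFun (hαz p hp) i) j
    simp only [hα] at h2
    rw [h1] at h2
    have : (k : ℝ) * b i j p u = 0 := by linarith
    exact (mul_eq_zero.1 this).resolve_left hk0.ne'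
  refine fun i j => (hev i j).succ ?_
  filter_upwards [hbz] with u hu
  refine ⟨fun p hp hpP => ?_, fun hodd => ?_⟩
  · have := hu 1 (.inl le_rfl) p hp i j
    simpa only [hb, if_pos hpP] using this
  · have := hu 0 (.inr hodd) 0 le_rfl i j
    simpa only [hb, if_pos (Nat.zero_le _)] using this

/-- The expansion of a Poincaré–Einstein metric in a geodesic collar is even below order `n`. -/
theorem evenCoeff_metric (hn : 1 ≤ n)
    (hG : ∀ i j, HasPhgExpansionAt (fun q => G q i j) (a i j) (P i j) u₀)
    (hP : ∀ i j, P i j 0 = 0) (hdet : (leadingMetric a u₀).det ≠ 0)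
    (hE : TangentialEinstein u₀ G) (i j : Fin n) : EvenCoeff u₀ (a i j) (P i j) n := by
  have : ∀ k, 1 ≤ k → k ≤ n → ∀ i j, EvenCoeff u₀ (a i j) (P i j) k := by
    intro k hk
    induction k, hk using Nat.le_induction with
    | base => exact fun _ i j => evenCoeff_one_metric hP i j
    | succ k hk ih => exact fun h => evenCoeff_metric_step hk (by omega) hG hP hdet hE (ih (by omega))
  exact this n hn le_rfl i j

/-! ### The eikonal equation -/

/-- The eikonal equation for the factor `e^φ` between two special boundary defining functions. -/
def Eikonal (u₀ : Euc n) (G : Euc n × ℝ → Matrix (Fin n) (Fin n) ℝ) (φ : Euc n × ℝ → ℝ) : Prop :=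
  ∀ᶠ q in bdryFilter u₀, 2 * eulD φ q + eulD φ q ^ 2
    + q.2 ^ 2 * ∑ i, ∑ j, (G q)⁻¹ i j * tanD i φ q * tanD j φ q = 0

/-- Solve the eikonal equation for θ = t∂_t φ. Since θ has order 1 and is even up to its block of
order k, θ² is even modulo t^(k+1). The gradient term carries t², so evenness of G⁻¹ modulo t^(k−1)
is enough. Hence the block of θ, and by descent that of φ, is even. -/
theorem evenCoeff_eikonal_step {φ : Euc n × ℝ → ℝ} {w : ℕ → ℕ → Euc n → ℝ} {Q : ℕ → ℕ} {k : ℕ}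
    (hk1 : 1 ≤ k) (hφ : HasPhgExpansionAt φ w Q u₀)
    (hGi : ∀ i j, EvenMod u₀ 0 ((k : ℝ) - 1) (fun q => (G q)⁻¹ i j))
    (hE : Eikonal u₀ G φ) (hev : EvenCoeff u₀ w Q k) : EvenCoeff u₀ w Q (k + 1) := by
  have hk1' : (1 : ℝ) ≤ k := by exact_mod_cast hk1
  have hk0 : (0 : ℝ) < k := by linarith
  have hkm : (0 : ℝ) ≤ k - 1 := by linarith
  obtain ⟨e, he, hr⟩ := hφ.exists_even hev
  obtain ⟨e', he', h'⟩ := he.eulD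
  set b : ℕ → Euc n → ℝ := fun p u => if p ≤ Q k then w k p u else 0 with hb
  have hbsm : ∀ p, ∀ᶠ u in 𝓝 u₀, ContDiffAt ℝ ∞ (b p) u := by
    intro p
    by_cases h : p ≤ Q k
    · simpa [hb, h] using hφ.smooth_coeff k p
    · simp [hb, h, contDiffAt_const]
  set c : ℕ → Euc n → ℝ := fun p u => k * b p u + (p + 1) * b (p + 1) u with hc
  have hT : eulD (logPoly k (Q k) (w k)) =ᶠ[bdryFilter u₀] logPoly k (Q k) c := by
    have h1 : logPoly k (Q k) (w k) = logPoly k (Q k) b :=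
      funext fun q => logPoly_eq_of_le le_rfl _ q
    rw [h1]
    exact eulD_logPoly k (Q k) (fun p _ => hbsm p) fun u => by simp [hb]
  have hcsm : ∀ p, ∀ᶠ u in 𝓝 u₀, ContDiffAt ℝ ∞ (c p) u := by
    intro p
    filter_upwards [hbsm p, hbsm (p + 1)] with u h1 h2
    exact (contDiffAt_const.mul h1).add (contDiffAt_const.mul h2)
  have hcc : Conormal u₀ 0 k (logPoly k (Q k) c) := PE.conormal_logPoly 0 k _ fun p _ => hcsm p
  have hθ : Conormal u₀ 0 (k + 1) (fun q => eulD φ q - (q.2 ^ 2 * e' q + logPoly k (Q k) c q)) := by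
    refine (hr 1).eulD.congr ?_
    filter_upwards [hφ.smooth.differentiableAt, he.smooth.differentiableAt,
      (hφ.conormal_logPoly k 0).smooth.differentiableAt, h', hT] with q d1 d2 d3 h4 h5
    rw [eulD_sub_add d1 d2 d3, h4, h5]
  have hθ' : Conormal u₀ 0 k (fun q => eulD φ q - q.2 ^ 2 * e' q) :=
    ((hθ.mono (by linarith)).add hcc).congr (.of_forall fun q => by ring)
  have hsqc : Conormal u₀ 0 1 (fun q => q.2 ^ 2 * e' q) :=
    ((conormal_sq u₀ 0).mul (he'.conormal 0)).mono (by norm_num)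
  have hθ1 : Conormal u₀ 0 1 (eulD φ) :=
    ((hθ'.mono hk1').add hsqc).congr (.of_forall fun q => by ring)
  have hsq : EvenMod u₀ 0 (k + 1) (fun q => eulD φ q ^ 2) := by
    have h1 : EvenMod u₀ 0 (k + 1) (fun q => (q.2 ^ 2 * e' q) * (q.2 ^ 2 * e' q)) :=
      .of_even ((IsEvenNear.sq.mul he').mul (IsEvenNear.sq.mul he'))
    have h2 := (hθ'.mul (hθ1.add hsqc))
    exact (h1.add (.of_conormal h2)).congr (.of_forall fun q => by ring)
  have hφev : EvenMod u₀ 1 ((k : ℝ) - 1) φ := (hφ.evenMod hev 1).mono (by linarith)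
  have htan : EvenMod u₀ 0 (k + 1) (fun q =>
      q.2 ^ 2 * ∑ i, ∑ j, (G q)⁻¹ i j * tanD i φ q * tanD j φ q) := by
    refine EvenMod.mono (EvenMod.sq_mul (k := (k : ℝ) - 1) ?_) (by linarith)
    exact EvenMod.sum _ fun i _ => EvenMod.sum _ fun j _ =>
      ((hGi i j).mul hkm (hφev.tanD i)).mul hkm (hφev.tanD j)
  have hcev : EvenMod u₀ 0 (k + 1) (logPoly k (Q k) c) := by
    have h1 : EvenMod u₀ 0 (k + 1) (fun q => q.2 ^ 2 * e' q) := .of_even (IsEvenNear.sq.mul he')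
    refine ((((hsq.add htan).const_mul (by linarith) (-(1 / 2))).sub (.of_conormal hθ)).sub
      h1).congr ?_
    filter_upwards [hE] with q hq
    linear_combination (-1 / 2 : ℝ) * hq
  refine hev.succ ?_
  filter_upwards [coeff_eq_zero_of_evenMod hcev] with u hu
  have hbz : ∀ p₀ : ℕ, (1 ≤ p₀ ∨ Odd k) → ∀ p, p₀ ≤ p → b p u = 0 := by
    intro p₀ hp₀ p hp
    refine eq_zero_of_descending (x := fun p => b p u) (N := Q k) (p₀ := p₀)
      (fun p hp => by simp only [hb]; rw [if_neg (by omega)]) (fun p hp h1 => ?_) hp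
    by_cases hpN : Q k < p
    · simp only [hb]; rw [if_neg (by omega)]
    have h2 : c p u = 0 := by
      rcases Nat.eq_zero_or_pos p with rfl | h
      · exact hu.2 (hp₀.resolve_left (by omega))
      · exact hu.1 p h (by omega)
    simp only [hc] at h2
    rw [h1] at h2
    have : (k : ℝ) * b p u = 0 := by linarith
    exact (mul_eq_zero.1 this).resolve_left hk0.ne'
  refine ⟨fun p hp hpP => ?_, fun hodd => ?_⟩
  · simpa only [hb, if_pos hpP] using hbz 1 (.inl le_rfl) p hp
  · simpa only [hb, if_pos (Nat.zero_le _)] using hbz 0 (.inr hodd) 0 le_rfl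

/-- The logarithm of the quotient of two special boundary defining functions of a
Poincaré–Einstein metric is even below order `n + 1`. -/
theorem evenCoeff_eikonal
    (hG : ∀ i j, HasPhgExpansionAt (fun q => G q i j) (a i j) (P i j) u₀)
    (hP : ∀ i j, P i j 0 = 0) (hdet : (leadingMetric a u₀).det ≠ 0)
    (hE : TangentialEinstein u₀ G) {φ : Euc n × ℝ → ℝ} {w : ℕ → ℕ → Euc n → ℝ} {Q : ℕ → ℕ}
    (hφ : HasPhgExpansionAt φ w Q u₀) (hev : EvenCoeff u₀ w Q 1) (hφE : Eikonal u₀ G φ) :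
    EvenCoeff u₀ w Q (n + 1) := by
  have : ∀ k, 1 ≤ k → k ≤ n + 1 → EvenCoeff u₀ w Q k := by
    intro k hk
    induction k, hk using Nat.le_induction with
    | base => exact fun _ => hev
    | succ k hk ih =>
      intro h
      have hn : 1 ≤ n := by omega
      have hn0 : (0 : ℝ) < n := by exact_mod_cast hn
      refine evenCoeff_eikonal_step hk hφ (fun i j => ?_) hφE (ih (by omega))
      -- G⁻¹ is even modulo t^n, which covers the required order k − 1 for every k ≤ n.
      have h1 := evenMod_inv hn0 (fun i j => (hG i j).evenMod (evenCoeff_metric hn hG hP hdet hE i j) 0)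
        (tendsto_leading hG hP) hdet i j
      refine h1.mono ?_
      have : (k : ℝ) ≤ n := by exact_mod_cast (by omega : k ≤ n)
      linarith
  exact this (n + 1) (by omega) le_rfl

end Metric


/-! ### Components of metrics under parametrizations -/

section Pullback

variable {d : ℕ} {H : Type*} [TopologicalSpace H] {I : ModelWithCorners ℝ (Euc d) H}
  {M : Type*} [TopologicalSpace M] [ChartedSpace H M] [IsManifold I ∞ M]
  {E₀ : Type*} [NormedAddCommGroup E₀] [NormedSpace ℝ E₀]

/-- The bundle form of continuity of a metric, turned into continuity of its components. Derivatives
within S are used so that S may contain boundary points of the collar; T separates metrics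
continuous on all of M from those defined on the interior. -/
theorem continuousOn_pullback {g : BilinField I M} {T : Set M}
    (hg : ContinuousOn (fun p => TotalSpace.mk' (Euc d →L[ℝ] Euc d →L[ℝ] ℝ)
      (E := fun p : M => TangentSpace I p →L[ℝ] TangentSpace I p →L[ℝ] ℝ) p (g p)) T)
    {f : E₀ → M} {S : Set E₀} (hf : ContMDiffOn 𝓘(ℝ, E₀) I ∞ f S) (hS : UniqueDiffOn ℝ S)
    (hT : MapsTo f S T) (v w : E₀) :
    ContinuousOn (fun q => g (f q) (mfderivWithin 𝓘(ℝ, E₀) I f S q v)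
      (mfderivWithin 𝓘(ℝ, E₀) I f S q w)) S := by
  have : IsManifold I 1 M := IsManifold.of_le (n := ∞) (by norm_num)
  have hsec : ∀ v : E₀, ContinuousOn (fun q => (⟨f q, mfderivWithin 𝓘(ℝ, E₀) I f S q v⟩ :
      TangentBundle I M)) S := by
    intro v
    have h1 := hf.continuousOn_tangentMapWithin (by norm_num) hS.uniqueMDiffOn
    have h2 : Continuous (fun q : E₀ => (⟨q, v⟩ : TangentBundle 𝓘(ℝ, E₀) E₀)) :=
      (tangentBundleModelSpaceHomeomorph 𝓘(ℝ, E₀)).symm.continuous.comp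
        (f := fun q : E₀ => ((q, v) : ModelProd E₀ E₀)) (by fun_prop)
    exact h1.comp h2.continuousOn fun q hq => hq
  intro q hq
  have : ContinuousWithinAt
      (fun q => TotalSpace.mk' ℝ (E := Bundle.Trivial M ℝ) (f q)
        (g (f q) (mfderivWithin 𝓘(ℝ, E₀) I f S q v) (mfderivWithin 𝓘(ℝ, E₀) I f S q w))) S q :=
    ((hg.comp hf.continuousOn hT) q hq).clm_bundle_apply₂ (F₁ := Euc d) (F₂ := Euc d)
      (hsec v q hq) (hsec w q hq)
  simp only [FiberBundle.continuousWithinAt_totalSpace] at this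
  exact this.2

theorem eq_sum_stdVec (v : Euc d) : v = ∑ i, v i • stdVec i := by
  have := (EuclideanSpace.basisFun (Fin d) ℝ).sum_repr v
  simpa [stdVec] using this.symm

theorem posDef_gram {E₁ : Type*} [AddCommGroup E₁] [Module ℝ E₁] [TopologicalSpace E₁]
    (B : E₁ →L[ℝ] E₁ →L[ℝ] ℝ) (hsymm : ∀ v w, B v w = B w v)
    (hpos : ∀ v, v ≠ 0 → 0 < B v v) (A : Euc d →L[ℝ] E₁) (hA : Function.Injective A) :
    (Matrix.of fun i j => B (A (stdVec i)) (A (stdVec j))).PosDef := by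
  refine Matrix.PosDef.of_dotProduct_mulVec_pos (Matrix.IsHermitian.ext fun i j => ?_)
    fun x hx => ?_
  · simp [hsymm]
  · have h1 : A (WithLp.toLp 2 x) = ∑ i, x i • A (stdVec i) := by
      conv_lhs => rw [eq_sum_stdVec (WithLp.toLp 2 x)]
      simp
    have h2 : A (WithLp.toLp 2 x) ≠ 0 := fun h => hx (by
      have := hA (h.trans (map_zero A).symm)
      simpa using this)
    have h3 := hpos _ h2
    rw [h1] at h3
    simp only [map_sum, map_smul, _root_.sum_apply, _root_.smul_apply, smul_eq_mul] at h3
    simp only [star_trivial, dotProduct, Matrix.mulVec, Matrix.of_apply, Finset.mul_sum]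
    rw [Finset.sum_comm]
    refine h3.trans_eq ?_
    refine Finset.sum_congr rfl fun i _ => ?_
    rw [Finset.mul_sum]
    exact Finset.sum_congr rfl fun j _ => by ring

end Pullback

/-! ### The collar map in charts of the boundary. -/

section CollarMap

variable {N : Type*} [TopologicalSpace N] [ChartedSpace (Euc n) N] [IsManifold (𝓡 n) ∞ N]
  {M : Type*} [TopologicalSpace M] [ChartedSpace (EuclideanHalfSpace (n + 1)) M]
  [IsManifold (𝓡∂ (n + 1)) ∞ M]
  {gbar : ContMetric n M} {x : M → ℝ} {ε : ℝ} {Φ : N × ℝ → M}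

/-- The collar in the chart of `N` at `y₀`. -/
def collarMap (Φ : N × ℝ → M) (y₀ : N) (q : Euc n × ℝ) : M :=
  Φ ((extChartAt (𝓡 n) y₀).symm q.1, q.2)

/-- The domain of `collarMap`. -/
def collarDom (n : ℕ) {N : Type*} [TopologicalSpace N] [ChartedSpace (Euc n) N] (y₀ : N) (ε : ℝ) :
    Set (Euc n × ℝ) :=
  (extChartAt (𝓡 n) y₀).target ×ˢ Ico 0 ε

theorem uniqueDiffOn_collarDom (y₀ : N) (ε : ℝ) : UniqueDiffOn ℝ (collarDom n y₀ ε) :=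
  (isOpen_extChartAt_target y₀).uniqueDiffOn.prod (uniqueDiffOn_Ico 0 ε)

theorem contMDiffOn_chartProd (y₀ : N) :
    ContMDiffOn 𝓘(ℝ, Euc n × ℝ) ((𝓡 n).prod 𝓘(ℝ, ℝ)) ∞
      (fun q : Euc n × ℝ => ((extChartAt (𝓡 n) y₀).symm q.1, q.2))
      ((extChartAt (𝓡 n) y₀).target ×ˢ univ) := by
  refine ContMDiffOn.prodMk ?_ contDiff_snd.contMDiff.contMDiffOn
  exact (contMDiffOn_extChartAt_symm y₀).comp
    (contDiff_fst.contMDiff (f := fun q : Euc n × ℝ => q.1)).contMDiffOn fun q hq => hq.1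

namespace IsGeodesicCollar

theorem contMDiffOn_collarMap (hΦ : IsGeodesicCollar gbar x ε Φ) (y₀ : N) :
    ContMDiffOn 𝓘(ℝ, Euc n × ℝ) (𝓡∂ (n + 1)) ∞ (collarMap Φ y₀) (collarDom n y₀ ε) :=
  hΦ.smooth.comp ((contMDiffOn_chartProd y₀).mono (Set.prod_mono le_rfl (subset_univ _)))
    fun q hq => ⟨mem_univ _, hq.2⟩

/-- A left inverse of `collarMap`, differentiable along its image. -/
theorem exists_leftInverse (hΦ : IsGeodesicCollar gbar x ε Φ) (y₀ : N) :
    ∃ χ : M → Euc n × ℝ, (∀ q ∈ collarDom n y₀ ε, χ (collarMap Φ y₀ q) = q) ∧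
      ∀ q ∈ collarDom n y₀ ε,
        ContMDiffAt (𝓡∂ (n + 1)) 𝓘(ℝ, Euc n × ℝ) ∞ χ (collarMap Φ y₀ q) := by
  obtain ⟨Ψ, hΨ, hL⟩ := hΦ.smooth_inverse
  have hinv : ∀ q ∈ collarDom n y₀ ε,
      Ψ (collarMap Φ y₀ q) = ((extChartAt (𝓡 n) y₀).symm q.1, q.2) := fun q hq =>
    hL ⟨mem_univ _, hq.2⟩
  refine ⟨fun p => (extChartAt (𝓡 n) y₀ (Ψ p).1, (Ψ p).2), fun q hq => ?_, fun q hq => ?_⟩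
  · simp only [hinv q hq]
    rw [(extChartAt (𝓡 n) y₀).right_inv hq.1]
  · have h1 : ContMDiffAt (𝓡∂ (n + 1)) ((𝓡 n).prod 𝓘(ℝ, ℝ)) ∞ Ψ (collarMap Φ y₀ q) :=
      hΨ.contMDiffAt (hΦ.isOpen_image.mem_nhds ⟨_, ⟨mem_univ _, hq.2⟩, rfl⟩)
    refine ContMDiffAt.prodMk_space ?_ ?_
    · have h2 : ContMDiffAt (𝓡 n) 𝓘(ℝ, Euc n) ∞ (extChartAt (𝓡 n) y₀)
          (Ψ (collarMap Φ y₀ q)).1 := by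
        rw [hinv q hq]
        refine contMDiffAt_extChartAt' ?_
        simpa using (extChartAt (𝓡 n) y₀).map_target hq.1
      exact h2.comp (collarMap Φ y₀ q) h1.fst
    · exact h1.snd

/-- The chain rule for a smooth left inverse. Unique differentiability of the half-open product
makes it valid at t = 0 too. -/
theorem injective_mfderivWithin_collarMap (hΦ : IsGeodesicCollar gbar x ε Φ) (y₀ : N)
    {q : Euc n × ℝ} (hq : q ∈ collarDom n y₀ ε) :
    Function.Injective
      (mfderivWithin 𝓘(ℝ, Euc n × ℝ) (𝓡∂ (n + 1)) (collarMap Φ y₀) (collarDom n y₀ ε) q) := by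
  obtain ⟨χ, h1, h2⟩ := hΦ.exists_leftInverse y₀
  have hu : UniqueMDiffWithinAt 𝓘(ℝ, Euc n × ℝ) (collarDom n y₀ ε) q :=
    (uniqueDiffOn_collarDom y₀ ε).uniqueMDiffOn q hq
  have h3 := ((h2 q hq).mdifferentiableAt (by simp)).hasMFDerivAt.comp_hasMFDerivWithinAt q
    ((hΦ.contMDiffOn_collarMap y₀ q hq).mdifferentiableWithinAt (by simp)).hasMFDerivWithinAt
  have h4 : HasMFDerivWithinAt 𝓘(ℝ, Euc n × ℝ) 𝓘(ℝ, Euc n × ℝ) (χ ∘ collarMap Φ y₀)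
      (collarDom n y₀ ε) q (ContinuousLinearMap.id ℝ (Euc n × ℝ)) :=
    (hasMFDerivWithinAt_id _ q).congr_of_eventuallyEq
      (eventually_nhdsWithin_of_forall fun q hq => h1 q hq) (h1 q hq)
  have h5 := hu.eq h3 h4
  intro v w hvw
  exact (DFunLike.congr_fun h5 v).symm.trans
    ((congrArg (mfderiv (𝓡∂ (n + 1)) 𝓘(ℝ, Euc n × ℝ) χ (collarMap Φ y₀ q)) hvw).trans
      (DFunLike.congr_fun h5 w))

/-- Slice metrics are defined by derivatives along slices; expressing these through the full collar
map lets joint continuity in (u, t) be inherited from the metric on M. -/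
theorem slice_mfderiv (hΦ : IsGeodesicCollar gbar x ε Φ) (y₀ : N)
    {q : Euc n × ℝ} (hq : q ∈ collarDom n y₀ ε) (v : Euc n) :
    mfderiv (𝓡 n) (𝓡∂ (n + 1)) (fun y => Φ (y, q.2)) ((extChartAt (𝓡 n) y₀).symm q.1)
      (mfderiv 𝓘(ℝ, Euc n) (𝓡 n) (extChartAt (𝓡 n) y₀).symm q.1 v) =
    mfderivWithin 𝓘(ℝ, Euc n × ℝ) (𝓡∂ (n + 1)) (collarMap Φ y₀) (collarDom n y₀ ε) q (v, 0) := by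
  have hs : ContMDiff (𝓡 n) (𝓡∂ (n + 1)) ∞ (fun y => Φ (y, q.2)) := by
    rw [← contMDiffOn_univ]
    exact hΦ.smooth.comp (contMDiff_id.prodMk contMDiff_const).contMDiffOn
      fun y _ => ⟨mem_univ _, hq.2⟩
  have hc : ContMDiffAt 𝓘(ℝ, Euc n) (𝓡 n) ∞ (extChartAt (𝓡 n) y₀).symm q.1 :=
    (contMDiffOn_extChartAt_symm y₀).contMDiffAt ((isOpen_extChartAt_target y₀).mem_nhds hq.1)
  have h0 := mfderiv_comp_apply q.1 (g := fun y => Φ (y, q.2))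
    (hs.mdifferentiableAt (by simp)) (hc.mdifferentiableAt (by simp)) v
  refine h0.symm.trans ?_
  have hι : HasMFDerivAt 𝓘(ℝ, Euc n) 𝓘(ℝ, Euc n × ℝ) (fun u : Euc n => (u, q.2)) q.1
      (ContinuousLinearMap.inl ℝ (Euc n) ℝ) :=
    ((hasFDerivAt_id q.1).prodMk (hasFDerivAt_const q.2 q.1)).hasMFDerivAt
  have h1 : HasMFDerivWithinAt 𝓘(ℝ, Euc n × ℝ) (𝓡∂ (n + 1)) (collarMap Φ y₀) (collarDom n y₀ ε) q
      (mfderivWithin 𝓘(ℝ, Euc n × ℝ) (𝓡∂ (n + 1)) (collarMap Φ y₀) (collarDom n y₀ ε) q) :=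
    ((hΦ.contMDiffOn_collarMap y₀ q hq).mdifferentiableWithinAt (by simp)).hasMFDerivWithinAt
  have h2 : HasMFDerivAt 𝓘(ℝ, Euc n) (𝓡∂ (n + 1)) (collarMap Φ y₀ ∘ fun u : Euc n => (u, q.2)) q.1
      ((mfderivWithin 𝓘(ℝ, Euc n × ℝ) (𝓡∂ (n + 1)) (collarMap Φ y₀) (collarDom n y₀ ε) q).comp
        (ContinuousLinearMap.inl ℝ (Euc n) ℝ)) := by
    have h3 := HasMFDerivWithinAt.comp (s := (extChartAt (𝓡 n) y₀).target) q.1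
      (f := fun u : Euc n => (u, q.2)) h1 hι.hasMFDerivWithinAt fun u hu => ⟨hu, hq.2⟩
    exact h3.hasMFDerivAt ((isOpen_extChartAt_target y₀).mem_nhds hq.1)
  exact DFunLike.congr_fun h2.mfderiv v

theorem components_slice (hΦ : IsGeodesicCollar gbar x ε Φ) (y₀ : N)
    {q : Euc n × ℝ} (hq : q ∈ collarDom n y₀ ε) (i j : Fin n) :
    components (sliceMetric gbar Φ q.2) (extChartAt (𝓡 n) y₀).symm q.1 i j =
      gbar.inner (collarMap Φ y₀ q)
        (mfderivWithin 𝓘(ℝ, Euc n × ℝ) (𝓡∂ (n + 1)) (collarMap Φ y₀) (collarDom n y₀ ε) q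
          (stdVec i, 0))
        (mfderivWithin 𝓘(ℝ, Euc n × ℝ) (𝓡∂ (n + 1)) (collarMap Φ y₀) (collarDom n y₀ ε) q
          (stdVec j, 0)) := by
  rw [← hΦ.slice_mfderiv y₀ hq, ← hΦ.slice_mfderiv y₀ hq]
  rfl

theorem continuousOn_components_slice (hΦ : IsGeodesicCollar gbar x ε Φ) (y₀ : N) (i j : Fin n) :
    ContinuousOn (fun q : Euc n × ℝ =>
      components (sliceMetric gbar Φ q.2) (extChartAt (𝓡 n) y₀).symm q.1 i j)
      (collarDom n y₀ ε) :=
  (continuousOn_pullback (g := fun p => gbar.inner p) gbar.continuous.continuousOn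
    (hΦ.contMDiffOn_collarMap y₀) (uniqueDiffOn_collarDom y₀ ε) (mapsTo_univ _ _) _ _).congr
    fun _ hq => hΦ.components_slice y₀ hq i j

theorem components_slice_posDef (hΦ : IsGeodesicCollar gbar x ε Φ) (y₀ : N)
    {q : Euc n × ℝ} (hq : q ∈ collarDom n y₀ ε) :
    (components (sliceMetric gbar Φ q.2) (extChartAt (𝓡 n) y₀).symm q.1).PosDef := by
  have h1 : components (sliceMetric gbar Φ q.2) (extChartAt (𝓡 n) y₀).symm q.1 = _ :=
    Matrix.ext fun i j => hΦ.components_slice y₀ hq i j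
  rw [h1]
  let D : (Euc n × ℝ) →L[ℝ] TangentSpace (𝓡∂ (n + 1)) (collarMap Φ y₀ q) :=
    mfderivWithin 𝓘(ℝ, Euc n × ℝ) (𝓡∂ (n + 1)) (collarMap Φ y₀) (collarDom n y₀ ε) q
  refine posDef_gram (E₁ := TangentSpace (𝓡∂ (n + 1)) (collarMap Φ y₀ q))
    (gbar.inner (collarMap Φ y₀ q)) (gbar.symm _) (gbar.pos _)
    (D.comp (ContinuousLinearMap.inl ℝ (Euc n) ℝ)) ?_
  exact (hΦ.injective_mfderivWithin_collarMap y₀ hq).comp (LinearMap.inl_injective)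

/-! ### The metric in the collar -/

theorem collarMap_interior (hΦ : IsGeodesicCollar gbar x ε Φ)
    (hx : IsBdf (𝓡∂ (n + 1)) x) (y : N) {t : ℝ} (ht : t ∈ Ioo 0 ε) :
    Φ (y, t) ∈ (𝓡∂ (n + 1)).interior M := by
  rw [← ModelWithCorners.compl_boundary]
  intro h
  have := (hx.zero_iff _).2 h
  rw [hΦ.x_eq y t ⟨ht.1.le, ht.2⟩] at this
  exact ht.1.ne' this

theorem collarDom_mem_nhds (y₀ : N) {q : Euc n × ℝ}
    (hq : q ∈ (extChartAt (𝓡 n) y₀).target ×ˢ Ioo 0 ε) : collarDom n y₀ ε ∈ 𝓝 q :=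
  mem_of_superset (((isOpen_extChartAt_target y₀).prod isOpen_Ioo).mem_nhds hq)
    (Set.prod_mono le_rfl Ioo_subset_Ico_self)

theorem hasMFDerivAt_collarMap (hΦ : IsGeodesicCollar gbar x ε Φ) (y₀ : N) {q : Euc n × ℝ}
    (hq : q ∈ (extChartAt (𝓡 n) y₀).target ×ˢ Ioo 0 ε) :
    HasMFDerivAt 𝓘(ℝ, Euc n × ℝ) (𝓡∂ (n + 1)) (collarMap Φ y₀) q
      (mfderivWithin 𝓘(ℝ, Euc n × ℝ) (𝓡∂ (n + 1)) (collarMap Φ y₀) (collarDom n y₀ ε) q) :=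
  ((hΦ.contMDiffOn_collarMap y₀ q (mem_of_mem_nhds (collarDom_mem_nhds y₀ hq))
    ).mdifferentiableWithinAt (by simp)).hasMFDerivWithinAt.hasMFDerivAt (collarDom_mem_nhds y₀ hq)

/-- The derivative of a function on `M` in the collar. -/
theorem mfderiv_collar_apply (hΦ : IsGeodesicCollar gbar x ε Φ) (y₀ : N) {q : Euc n × ℝ}
    (hq : q ∈ (extChartAt (𝓡 n) y₀).target ×ˢ Ioo 0 ε) {f : M → ℝ}
    (hf : MDifferentiableAt (𝓡∂ (n + 1)) 𝓘(ℝ, ℝ) f (collarMap Φ y₀ q)) (v : Euc n × ℝ) :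
    mfderiv (𝓡∂ (n + 1)) 𝓘(ℝ, ℝ) f (collarMap Φ y₀ q)
      (mfderivWithin 𝓘(ℝ, Euc n × ℝ) (𝓡∂ (n + 1)) (collarMap Φ y₀) (collarDom n y₀ ε) q v)
      = fderiv ℝ (fun q => f (collarMap Φ y₀ q)) q v := by
  have h1 := hf.hasMFDerivAt.comp q (hΦ.hasMFDerivAt_collarMap y₀ hq)
  have h2 : mfderiv 𝓘(ℝ, Euc n × ℝ) 𝓘(ℝ, ℝ) (fun q => f (collarMap Φ y₀ q)) q =
    fderiv ℝ (fun q => f (collarMap Φ y₀ q)) q := mfderiv_eq_fderiv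
  exact (DFunLike.congr_fun h1.mfderiv v).symm.trans (DFunLike.congr_fun h2 v)

theorem mdifferentiableAt_bdf (hx : IsBdf (𝓡∂ (n + 1)) x) (p : M) :
    MDifferentiableAt (𝓡∂ (n + 1)) 𝓘(ℝ, ℝ) x p := (hx.smooth p).mdifferentiableAt (by simp)

theorem collar_dx (hΦ : IsGeodesicCollar gbar x ε Φ) (hx : IsBdf (𝓡∂ (n + 1)) x) (y₀ : N)
    {q : Euc n × ℝ} (hq : q ∈ (extChartAt (𝓡 n) y₀).target ×ˢ Ioo 0 ε) (v : Euc n × ℝ) :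
    mfderiv (𝓡∂ (n + 1)) 𝓘(ℝ, ℝ) x (collarMap Φ y₀ q)
      (mfderivWithin 𝓘(ℝ, Euc n × ℝ) (𝓡∂ (n + 1)) (collarMap Φ y₀) (collarDom n y₀ ε) q v)
      = v.2 := by
  rw [hΦ.mfderiv_collar_apply y₀ hq (mdifferentiableAt_bdf hx _)]
  have h1 : (fun q => x (collarMap Φ y₀ q)) =ᶠ[𝓝 q] Prod.snd := by
    filter_upwards [collarDom_mem_nhds y₀ hq] with q' hq'
    exact hΦ.x_eq _ _ hq'.2
  rw [h1.fderiv_eq, fderiv_snd]; rfl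

theorem collar_normal (hΦ : IsGeodesicCollar gbar x ε Φ) (y₀ : N)
    {q : Euc n × ℝ} (hq : q ∈ (extChartAt (𝓡 n) y₀).target ×ˢ Ioo 0 ε) :
    mfderiv 𝓘(ℝ, ℝ) (𝓡∂ (n + 1)) (fun s : ℝ => Φ ((extChartAt (𝓡 n) y₀).symm q.1, s)) q.2 (1 : ℝ)
      = mfderivWithin 𝓘(ℝ, Euc n × ℝ) (𝓡∂ (n + 1)) (collarMap Φ y₀) (collarDom n y₀ ε) q
        (0, 1) := by
  have hι : HasMFDerivAt 𝓘(ℝ, ℝ) 𝓘(ℝ, Euc n × ℝ) (fun s : ℝ => (q.1, s)) q.2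
      (ContinuousLinearMap.inr ℝ (Euc n) ℝ) :=
    ((hasFDerivAt_const q.1 q.2).prodMk (hasFDerivAt_id q.2)).hasMFDerivAt
  have h1 := HasMFDerivAt.comp q.2 (f := fun s : ℝ => (q.1, s))
    (hΦ.hasMFDerivAt_collarMap y₀ hq) hι
  exact DFunLike.congr_fun h1.mfderiv (1 : ℝ)

/-- The flow equation makes ∂_t dual to dx, and dx = dt in the collar. This is the splitting dt² +
G_t without mixed terms. -/
theorem gbar_normal (hΦ : IsGeodesicCollar gbar x ε Φ) (hx : IsBdf (𝓡∂ (n + 1)) x) (y₀ : N)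
    {q : Euc n × ℝ} (hq : q ∈ (extChartAt (𝓡 n) y₀).target ×ˢ Ioo 0 ε) (v : Euc n × ℝ) :
    gbar.inner (collarMap Φ y₀ q)
      (mfderivWithin 𝓘(ℝ, Euc n × ℝ) (𝓡∂ (n + 1)) (collarMap Φ y₀) (collarDom n y₀ ε) q (0, 1))
      (mfderivWithin 𝓘(ℝ, Euc n × ℝ) (𝓡∂ (n + 1)) (collarMap Φ y₀) (collarDom n y₀ ε) q v)
      = v.2 := by
  rw [← hΦ.collar_dx hx y₀ hq v, ← hΦ.collar_normal y₀ hq]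
  exact hΦ.flow _ q.2 hq.2 _

end IsGeodesicCollar

end CollarMap


/-! ### The Einstein and eikonal equations in the collar. -/

section CollarMetric

variable {N : Type*} [TopologicalSpace N] [ChartedSpace (Euc n) N] [IsManifold (𝓡 n) ∞ N]
  {M : Type*} [TopologicalSpace M] [ChartedSpace (EuclideanHalfSpace (n + 1)) M]
  [IsManifold (𝓡∂ (n + 1)) ∞ M]
  {gbar : ContMetric n M} {x : M → ℝ} {ε : ℝ} {Φ : N × ℝ → M} {g : BilinField (𝓡∂ (n + 1)) M}

/-- The components of `G_t` in the chart of `N` at `y₀`. -/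
def sliceComp (gbar : ContMetric n M) (Φ : N × ℝ → M) (y₀ : N) (q : Euc n × ℝ) :
    Matrix (Fin n) (Fin n) ℝ :=
  components (sliceMetric gbar Φ q.2) (extChartAt (𝓡 n) y₀).symm q.1

/-- The parametrization of `M` by `collarMap`, as a function on `ℝ^{n+1}`. -/
def collarParam (Φ : N × ℝ → M) (y₀ : N) (v : Euc (n + 1)) : M :=
  collarMap Φ y₀ ((collarCoord n).symm v)

namespace IsGeodesicCollar

theorem hasMFDerivAt_collarParam (hΦ : IsGeodesicCollar gbar x ε Φ) (y₀ : N) {v : Euc (n + 1)}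
    (hv : (collarCoord n).symm v ∈ (extChartAt (𝓡 n) y₀).target ×ˢ Ioo 0 ε) :
    HasMFDerivAt 𝓘(ℝ, Euc (n + 1)) (𝓡∂ (n + 1)) (collarParam Φ y₀) v
      ((mfderivWithin 𝓘(ℝ, Euc n × ℝ) (𝓡∂ (n + 1)) (collarMap Φ y₀) (collarDom n y₀ ε)
        ((collarCoord n).symm v)).comp
        ((collarCoord n).symm : Euc (n + 1) →L[ℝ] Euc n × ℝ)) := by
  have h1 : HasMFDerivAt 𝓘(ℝ, Euc (n + 1)) 𝓘(ℝ, Euc n × ℝ) (collarCoord n).symm v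
      ((collarCoord n).symm : Euc (n + 1) →L[ℝ] Euc n × ℝ) :=
    (collarCoord n).symm.hasFDerivAt.hasMFDerivAt
  exact HasMFDerivAt.comp v (hΦ.hasMFDerivAt_collarMap y₀ hv) h1

/-- The Einstein condition is imposed in every interior parametrization, so it can be read directly
in the coordinates (t, u), without a transformation law for Ricci curvature. -/
theorem isLocalParam (hΦ : IsGeodesicCollar gbar x ε Φ) (hx : IsBdf (𝓡∂ (n + 1)) x) (y₀ : N) :
    IsLocalParam (𝓡∂ (n + 1)) (collarParam Φ y₀)
      ((collarCoord n).symm ⁻¹' ((extChartAt (𝓡 n) y₀).target ×ˢ Ioo 0 ε)) where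
  isOpen := ((isOpen_extChartAt_target y₀).prod isOpen_Ioo).preimage
    (collarCoord n).symm.continuous
  mapsTo v hv := hΦ.collarMap_interior hx _ hv.2
  smooth := (hΦ.contMDiffOn_collarMap y₀).comp
    ((collarCoord n).symm.contDiff.contMDiff).contMDiffOn
    fun v hv => ⟨hv.1, Ioo_subset_Ico_self hv.2⟩
  injOn := by
    obtain ⟨χ, hχ, -⟩ := hΦ.exists_leftInverse y₀
    intro v hv w hw h
    have h1 := congrArg χ h
    simp only [collarParam] at h1
    rw [hχ _ ⟨hv.1, Ioo_subset_Ico_self hv.2⟩, hχ _ ⟨hw.1, Ioo_subset_Ico_self hw.2⟩] at h1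
    exact (collarCoord n).symm.injective h1
  immersion v hv := by
    rw [(hΦ.hasMFDerivAt_collarParam y₀ hv).mfderiv]
    exact (hΦ.injective_mfderivWithin_collarMap y₀
      (mem_of_mem_nhds (collarDom_mem_nhds y₀ hv))).comp (collarCoord n).symm.injective

theorem components_collarParam (hΦ : IsGeodesicCollar gbar x ε Φ) (hx : IsBdf (𝓡∂ (n + 1)) x)
    (hgbar : IsConfExtension g x gbar) (y₀ : N) {q : Euc n × ℝ}
    (hq : q ∈ (extChartAt (𝓡 n) y₀).target ×ˢ Ioo 0 ε) (i j : Fin (n + 1)) :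
    components g (collarParam Φ y₀) (collarCoord n q) i j = (q.2 ^ 2)⁻¹ *
      gbar.inner (collarMap Φ y₀ q)
      (mfderivWithin 𝓘(ℝ, Euc n × ℝ) (𝓡∂ (n + 1)) (collarMap Φ y₀) (collarDom n y₀ ε) q
        ((collarCoord n).symm (stdVec i)))
      (mfderivWithin 𝓘(ℝ, Euc n × ℝ) (𝓡∂ (n + 1)) (collarMap Φ y₀) (collarDom n y₀ ε) q
        ((collarCoord n).symm (stdVec j))) := by
  have h1 : collarMap Φ y₀ q ∈ (𝓡∂ (n + 1)).interior M := hΦ.collarMap_interior hx _ hq.2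
  have h2 : x (collarMap Φ y₀ q) = q.2 := hΦ.x_eq _ _ (Ioo_subset_Ico_self hq.2)
  have h3 : (collarCoord n).symm (collarCoord n q) = q := by simp
  have h4 := (hΦ.hasMFDerivAt_collarParam y₀ (v := collarCoord n q) (by rwa [h3])).mfderiv
  rw [components, Matrix.of_apply, h4, hgbar _ h1, h2]
  have h5 : q.2 ^ 2 ≠ 0 := pow_ne_zero 2 hq.2.1.ne'
  -- The base point occurs in the types of the tangent vectors, so the two expressions for it are
  -- identified by substituting a generalized point.
  have key : ∀ q' : Euc n × ℝ, q' = q → ∀ p : M, p = collarMap Φ y₀ q' → ∀ v w : Euc n × ℝ,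
      g p (mfderivWithin 𝓘(ℝ, Euc n × ℝ) (𝓡∂ (n + 1)) (collarMap Φ y₀) (collarDom n y₀ ε) q' v)
        (mfderivWithin 𝓘(ℝ, Euc n × ℝ) (𝓡∂ (n + 1)) (collarMap Φ y₀) (collarDom n y₀ ε) q' w)
      = (q.2 ^ 2)⁻¹ * (q.2 ^ 2 * g (collarMap Φ y₀ q)
        (mfderivWithin 𝓘(ℝ, Euc n × ℝ) (𝓡∂ (n + 1)) (collarMap Φ y₀) (collarDom n y₀ ε) q v)
        (mfderivWithin 𝓘(ℝ, Euc n × ℝ) (𝓡∂ (n + 1)) (collarMap Φ y₀) (collarDom n y₀ ε) q w)) := by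
    rintro q' rfl p rfl v w
    rw [inv_mul_cancel_left₀ h5]
  exact key _ h3 _ rfl _ _

theorem symm_stdVec_zero : (collarCoord n).symm (stdVec 0) = (0, 1) := by
  rw [← collarCoord_normal, ContinuousLinearEquiv.symm_apply_apply]

theorem symm_stdVec_succ (i : Fin n) : (collarCoord n).symm (stdVec i.succ) = (stdVec i, 0) := by
  rw [← collarCoord_tangential, ContinuousLinearEquiv.symm_apply_apply]

theorem mem_collarDom {y₀ : N} {q : Euc n × ℝ}
    (hq : q ∈ (extChartAt (𝓡 n) y₀).target ×ˢ Ioo 0 ε) : q ∈ collarDom n y₀ ε :=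
  ⟨hq.1, Ioo_subset_Ico_self hq.2⟩

theorem isCollarMetric (hΦ : IsGeodesicCollar gbar x ε Φ) (hx : IsBdf (𝓡∂ (n + 1)) x)
    (hgbar : IsConfExtension g x gbar) (y₀ : N) {W : Set (Euc n × ℝ)} (hW : IsOpen W)
    (hWU : W ⊆ (extChartAt (𝓡 n) y₀).target ×ˢ Ioo 0 ε)
    (hsm : ∀ q ∈ W, ∀ i j, ContDiffAt ℝ ∞ (fun q => sliceComp gbar Φ y₀ q i j) q) :
    IsCollarMetric W (sliceComp gbar Φ y₀) (components g (collarParam Φ y₀)) where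
  isOpen := hW
  pos q hq := (hWU hq).2.1
  zero_zero q hq := by
    rw [hΦ.components_collarParam hx hgbar y₀ (hWU hq), symm_stdVec_zero,
      hΦ.gbar_normal hx y₀ (hWU hq)]
    simp
  zero_succ q hq i := by
    rw [hΦ.components_collarParam hx hgbar y₀ (hWU hq), symm_stdVec_zero, symm_stdVec_succ,
      hΦ.gbar_normal hx y₀ (hWU hq)]
    simp
  succ_zero q hq i := by
    rw [hΦ.components_collarParam hx hgbar y₀ (hWU hq), symm_stdVec_zero, symm_stdVec_succ,
      gbar.symm, hΦ.gbar_normal hx y₀ (hWU hq)]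
    simp
  succ_succ q hq i j := by
    rw [hΦ.components_collarParam hx hgbar y₀ (hWU hq), symm_stdVec_succ, symm_stdVec_succ,
      sliceComp, hΦ.components_slice y₀ (mem_collarDom (hWU hq))]
  symm q hq i j := by
    rw [sliceComp, hΦ.components_slice y₀ (mem_collarDom (hWU hq)),
      hΦ.components_slice y₀ (mem_collarDom (hWU hq)), gbar.symm]
  det q hq := (hΦ.components_slice_posDef y₀ (mem_collarDom (hWU hq))).det_pos.ne'
  smooth := hsm

theorem eventually_mem_collar (hΦ : IsGeodesicCollar gbar x ε Φ) (y₀ : N) :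
    ∀ᶠ q in bdryFilter (extChartAt (𝓡 n) y₀ y₀),
      q ∈ (extChartAt (𝓡 n) y₀).target ×ˢ Ioo 0 ε :=
  prod_mem_prod ((isOpen_extChartAt_target y₀).mem_nhds (mem_extChartAt_target y₀))
    (Ioo_mem_nhdsGT hΦ.pos)

/-- The dimension is n + 1, so the equation reads Ric = −n g. Multiplied by t², its right side is
−nG, which cancels the same term in `IsCollarMetric.ricci_eq`. -/
theorem tangentialEinstein (hΦ : IsGeodesicCollar gbar x ε Φ) (hx : IsBdf (𝓡∂ (n + 1)) x)
    (hgbar : IsConfExtension g x gbar) (hE : IsEinstein g) (y₀ : N)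
    (hsm : ∀ i j, SmoothNear (extChartAt (𝓡 n) y₀ y₀) (fun q => sliceComp gbar Φ y₀ q i j)) :
    TangentialEinstein (extChartAt (𝓡 n) y₀ y₀) (sliceComp gbar Φ y₀) := by
  have h1 : ∀ᶠ q in bdryFilter (extChartAt (𝓡 n) y₀ y₀),
      q ∈ (extChartAt (𝓡 n) y₀).target ×ˢ Ioo 0 ε ∧
      ∀ i j, ContDiffAt ℝ ∞ (fun q => sliceComp gbar Φ y₀ q i j) q :=
    (hΦ.eventually_mem_collar y₀).and
      (Filter.eventually_all.2 fun i => Filter.eventually_all.2 fun j => hsm i j)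
  obtain ⟨U, hU, hu, δ, hδ, h⟩ := (bdryFilter_basis _).1 h1
  have H := hΦ.isCollarMetric hx hgbar y₀ (W := U ×ˢ Ioo 0 δ) (hU.prod isOpen_Ioo)
    (fun q hq => (h q.1 hq.1 q.2 hq.2).1) (fun q hq => (h q.1 hq.1 q.2 hq.2).2)
  refine (bdryFilter_basis _).2 ⟨U, hU, hu, δ, hδ, fun u hu t ht i j => ?_⟩
  have hq : (u, t) ∈ U ×ˢ Ioo 0 δ := ⟨hu, ht⟩
  have h2 := H.ricci_eq hq i j
  have h3 := hE _ _ (hΦ.isLocalParam hx y₀) (collarCoord n (u, t))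
    (by simpa using (h u hu t ht).1) i.succ j.succ
  rw [h3, H.succ_succ _ hq] at h2
  have h5 : t ^ 2 ≠ 0 := pow_ne_zero 2 ht.1.ne'
  have h6 : t ^ 2 * (-(((n + 1 : ℕ) : ℝ) - 1) * ((t ^ 2)⁻¹ * sliceComp gbar Φ y₀ (u, t) i j)) =
      -(n * sliceComp gbar Φ y₀ (u, t) i j) := by
    push_cast
    rw [show ∀ c G : ℝ, t ^ 2 * (c * ((t ^ 2)⁻¹ * G)) = c * G from fun c G => by
      rw [mul_left_comm, mul_inv_cancel_left₀ h5]]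
    ring
  simp only at h2 ⊢
  rw [h6] at h2
  linear_combination -h2

/-- The leading coefficients are the limits of the components as t → 0. Since gbar is continuous up
to the boundary, they are the components of G_0, a positive definite matrix. -/
theorem det_leadingMetric (hΦ : IsGeodesicCollar gbar x ε Φ) (y₀ : N)
    {a : Fin n → Fin n → ℕ → ℕ → Euc n → ℝ} {P : Fin n → Fin n → ℕ → ℕ}
    (hG : ∀ i j, HasPhgExpansionAt (fun q => sliceComp gbar Φ y₀ q i j) (a i j) (P i j)
      (extChartAt (𝓡 n) y₀ y₀)) (hP : ∀ i j, P i j 0 = 0) :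
    (leadingMetric a (extChartAt (𝓡 n) y₀ y₀)).det ≠ 0 := by
  set u₀ := extChartAt (𝓡 n) y₀ y₀
  have hmem : (u₀, (0 : ℝ)) ∈ collarDom n y₀ ε := ⟨mem_extChartAt_target y₀, le_rfl, hΦ.pos⟩
  have h1 : leadingMetric a u₀ = sliceComp gbar Φ y₀ (u₀, 0) := by
    ext i j
    have h2 : Tendsto (fun t : ℝ => (u₀, t)) (𝓝[>] 0) (bdryFilter u₀) :=
      tendsto_const_nhds.prodMk tendsto_id
    have h3 := (tendsto_leading hG hP i j).comp h2
    have h4 : Tendsto (fun t : ℝ => (u₀, t)) (𝓝[>] 0) (𝓝[collarDom n y₀ ε] (u₀, 0)) := by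
      refine tendsto_nhdsWithin_iff.2 ⟨?_, ?_⟩
      · exact (tendsto_const_nhds.prodMk_nhds tendsto_id).mono_left nhdsWithin_le_nhds
      · filter_upwards [Ioo_mem_nhdsGT hΦ.pos] with t ht
        exact ⟨hmem.1, ht.1.le, ht.2⟩
    exact tendsto_nhds_unique h3 ((hΦ.continuousOn_components_slice y₀ i j _ hmem).tendsto.comp h4)
  rw [h1]
  exact (hΦ.components_slice_posDef y₀ hmem).det_pos.ne'

/-- Along the collar, `φ ∘ Φ` satisfies the eikonal equation. -/
theorem eikonal (hΦ : IsGeodesicCollar gbar x ε Φ) (hx : IsBdf (𝓡∂ (n + 1)) x)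
    (hgbar : IsConfExtension g x gbar) {x' φ : M → ℝ} (hφ : IsPhgBdf (n := n) x Φ x' φ)
    (hs : IsSpecial g x') (y₀ : N) :
    Eikonal (extChartAt (𝓡 n) y₀ y₀) (sliceComp gbar Φ y₀)
      (fun q => φ (collarMap Φ y₀ q)) := by
  classical
  obtain ⟨U, hU, hbU, hsp⟩ := hs
  set u₀ := extChartAt (𝓡 n) y₀ y₀
  have hmem : (u₀, (0 : ℝ)) ∈ collarDom n y₀ ε := ⟨mem_extChartAt_target y₀, le_rfl, hΦ.pos⟩
  have hcont : ContinuousWithinAt (collarMap Φ y₀) (collarDom n y₀ ε) (u₀, 0) :=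
    (hΦ.contMDiffOn_collarMap y₀).continuousOn _ hmem
  have hb0 : collarMap Φ y₀ (u₀, 0) ∈ U := hbU (by
    rw [← hΦ.image_zero]; exact ⟨(_, 0), ⟨mem_univ _, mem_singleton _⟩, rfl⟩)
  have hle : bdryFilter u₀ ≤ 𝓝[collarDom n y₀ ε] (u₀, 0) := by
    refine le_inf (bdryFilter_le_nhds u₀) (le_principal_iff.2 ?_)
    filter_upwards [hΦ.eventually_mem_collar y₀] with q hq using mem_collarDom hq
  have hUev : ∀ᶠ q in bdryFilter u₀, collarMap Φ y₀ q ∈ U :=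
    hle (hcont.preimage_mem_nhdsWithin (hU.mem_nhds hb0))
  filter_upwards [hUev, hΦ.eventually_mem_collar y₀] with q hqU hq
  have hint : collarMap Φ y₀ q ∈ (𝓡∂ (n + 1)).interior M := hΦ.collarMap_interior hx _ hq.2
  set p := collarMap Φ y₀ q with hp
  obtain ⟨v, hv1, hv2⟩ := hsp p ⟨hqU, hint⟩
  have ht : q.2 ≠ 0 := hq.2.1.ne'
  have hxp : x p = q.2 := hΦ.x_eq _ _ (Ioo_subset_Ico_self hq.2)
  let D : (Euc n × ℝ) →L[ℝ] TangentSpace (𝓡∂ (n + 1)) p :=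
    mfderivWithin 𝓘(ℝ, Euc n × ℝ) (𝓡∂ (n + 1)) (collarMap Φ y₀) (collarDom n y₀ ε) q
  have hDinj : Function.Injective D := hΦ.injective_mfderivWithin_collarMap y₀ (mem_collarDom hq)
  -- Equal dimensions: the gradient v of x′ can be written as the image of a vector ξ in collar
  -- coordinates.
  have hDsurj : Function.Surjective D := by
    have h1 : Module.finrank ℝ (Euc n × ℝ) = Module.finrank ℝ (Euc (n + 1)) := by simp
    exact (LinearMap.injective_iff_surjective_of_finrank_eq_finrank
      (f := (show (Euc n × ℝ) →L[ℝ] Euc (n + 1) from D).toLinearMap) h1).1 hDinj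
  obtain ⟨ξ, hξ⟩ := hDsurj v
  -- differentiability
  have hintn : (𝓡∂ (n + 1)).interior M ∈ 𝓝 p :=
    ((𝓡∂ (n + 1)).isOpen_interior (n := ∞) (by simp)).mem_nhds hint
  have hφd : MDifferentiableAt (𝓡∂ (n + 1)) 𝓘(ℝ, ℝ) φ p :=
    (hφ.smooth.contMDiffAt hintn).mdifferentiableAt (by simp)
  have hx' : x' = fun p => x p * Real.exp (φ p) := funext hφ.eq
  have hx'd : MDifferentiableAt (𝓡∂ (n + 1)) 𝓘(ℝ, ℝ) x' p := by
    rw [hx']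
    refine MDifferentiableAt.mul (mdifferentiableAt_bdf hx p) ?_
    exact (Real.differentiable_exp.differentiableAt.mdifferentiableAt).comp p hφd
  set φc : Euc n × ℝ → ℝ := fun q => φ (collarMap Φ y₀ q) with hφc
  have hφcd : DifferentiableAt ℝ φc q := by
    have := hφd.comp q (hΦ.hasMFDerivAt_collarMap y₀ hq).mdifferentiableAt
    exact mdifferentiableAt_iff_differentiableAt.1 this
  set E := Real.exp (φc q) with hEdef
  have hE0 : E ≠ 0 := (Real.exp_pos _).ne'
  have hdx' : ∀ η : Euc n × ℝ, mfderiv (𝓡∂ (n + 1)) 𝓘(ℝ, ℝ) x' p (D η) =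
      E * (η.2 + q.2 * fderiv ℝ φc q η) := by
    intro η
    refine (hΦ.mfderiv_collar_apply y₀ hq hx'd η).trans ?_
    have h1 : (fun q => x' (collarMap Φ y₀ q)) =ᶠ[𝓝 q] fun q => q.2 * Real.exp (φc q) := by
      filter_upwards [collarDom_mem_nhds y₀ hq] with q' hq'
      rw [hφ.eq]
      congr 1
      exact hΦ.x_eq _ _ hq'.2
    have h2 : HasFDerivAt (fun q : Euc n × ℝ => q.2 * Real.exp (φc q)) _ q :=
      (hasFDerivAt_snd (𝕜 := ℝ) (E := Euc n) (F := ℝ) (p := q)).mul hφcd.hasFDerivAt.exp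
    rw [h1.fderiv_eq, h2.fderiv]
    change q.2 * (E * fderiv ℝ φc q η) + E * η.2 = E * (η.2 + q.2 * fderiv ℝ φc q η)
    ring
  have hgD : ∀ η : Euc n × ℝ, x' p ^ 2 * g p v (D η) = E ^ 2 * gbar.inner p (D ξ) (D η) := by
    intro η
    rw [hgbar p hint, hφ.eq, hxp, ← hξ]
    change (q.2 * E) ^ 2 * _ = _
    ring
  have hgb : ∀ η : Euc n × ℝ, gbar.inner p (D (0, 1)) (D η) = η.2 := hΦ.gbar_normal hx y₀ hq
  set G := sliceComp gbar Φ y₀ q with hG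
  have hGc : ∀ i j, gbar.inner p (D (stdVec i, 0)) (D (stdVec j, 0)) = G i j := fun i j =>
    (hΦ.components_slice y₀ (mem_collarDom hq) i j).symm
  have hξs : ξ = (∑ i, ξ.1 i • ((stdVec i, 0) : Euc n × ℝ)) + ξ.2 • ((0, 1) : Euc n × ℝ) := by
    ext i
    · conv_lhs => rw [eq_sum_stdVec ξ.1]
      simp [Prod.fst_sum]
    · simp [Prod.snd_sum]
  have hlin : ∀ L : (Euc n × ℝ) →L[ℝ] ℝ, L ξ = (∑ i, ξ.1 i * L (stdVec i, 0)) + ξ.2 * L (0, 1) := by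
    intro L
    conv_lhs => rw [hξs]
    simp only [map_add, map_sum, map_smul, smul_eq_mul]
  have hDξ : D ξ = (∑ i, ξ.1 i • D (stdVec i, 0)) + ξ.2 • D (0, 1) := by
    conv_lhs => rw [hξs]
    simp only [map_add, map_sum, map_smul]
  -- In the collar x′²g = E²·gbar with E = e^φ and dx′ = E(dt + t dφ). Pairing the gradient equation
  -- with ∂_t gives the normal component of ξ; `ha` does the same tangentially.
  have hb : E * ξ.2 = 1 + eulD φc q := by
    have h1 := (hgD (0, 1)).symm.trans ((hv1 (D (0, 1))).trans (hdx' (0, 1)))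
    rw [gbar.symm, hgb] at h1
    have h2 : E * (E * ξ.2) = E * (1 + eulD φc q) := by
      simp only [eulD, norD]; linear_combination h1
    exact mul_left_cancel₀ hE0 h2
  have hzero : ∀ j, gbar.inner p (D (0, 1)) (D (stdVec j, 0)) = 0 := fun j => hgb _
  have ha : ∀ j, E * ∑ i, ξ.1 i * G i j = q.2 * tanD j φc q := by
    intro j
    have h1 := (hgD (stdVec j, 0)).symm.trans ((hv1 (D (stdVec j, 0))).trans (hdx' (stdVec j, 0)))
    have h3 : gbar.inner p (D ξ) (D (stdVec j, 0)) = ∑ i, ξ.1 i * G i j := by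
      rw [hDξ]
      simp only [map_add, map_sum, map_smul, _root_.add_apply, _root_.sum_apply,
        _root_.smul_apply, smul_eq_mul, hzero, hGc, mul_zero, add_zero]
    rw [h3] at h1
    have h2 : E * (E * ∑ i, ξ.1 i * G i j) = E * (q.2 * tanD j φc q) := by
      simp only [tanD]; linear_combination h1
    exact mul_left_cancel₀ hE0 h2
  -- The condition dx′(v) = 1. Substituting the components of ξ turns it into the eikonal equation.
  have h1 : (1 : ℝ) = E * (ξ.2 + q.2 * fderiv ℝ φc q ξ) := by
    rw [← hdx', hξ]; exact hv2.symm
  rw [hlin (fderiv ℝ φc q)] at h1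
  have hGdet : G.det ≠ 0 := (hΦ.components_slice_posDef y₀ (mem_collarDom hq)).det_pos.ne'
  have ha' : ∀ i, E * ξ.1 i = q.2 * ∑ j, G⁻¹ i j * tanD j φc q := by
    intro i
    have hGs : ∀ i j, G i j = G j i := fun i j => by rw [← hGc, ← hGc, gbar.symm]
    have e1 : ∑ j, G⁻¹ i j * (E * ∑ k, ξ.1 k * G k j) = E * ξ.1 i := by
      have e2 : G⁻¹ * G = 1 := Matrix.nonsing_inv_mul _ (isUnit_iff_ne_zero.2 hGdet)
      have e3 : ∀ k, ∑ j, G⁻¹ i j * G j k = if i = k then 1 else 0 := fun k => by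
        have := congrFun (congrFun e2 i) k
        rwa [Matrix.mul_apply, Matrix.one_apply] at this
      calc ∑ j, G⁻¹ i j * (E * ∑ k, ξ.1 k * G k j)
          = ∑ k, E * ξ.1 k * ∑ j, G⁻¹ i j * G j k := by
            simp only [Finset.mul_sum]
            rw [Finset.sum_comm]
            refine Finset.sum_congr rfl fun k _ => Finset.sum_congr rfl fun j _ => ?_
            rw [hGs k j]; ring
        _ = _ := by simp [e3]
    rw [← e1, Finset.mul_sum]
    exact Finset.sum_congr rfl fun j _ => by rw [ha]; ring
  have h2 : (1 : ℝ) = (1 + eulD φc q) + eulD φc q * (1 + eulD φc q)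
      + q.2 * ∑ i, (E * ξ.1 i) * tanD i φc q := by
    have h4 : ∑ i, (E * ξ.1 i) * tanD i φc q = E * ∑ i, ξ.1 i * fderiv ℝ φc q (stdVec i, 0) := by
      rw [Finset.mul_sum]
      exact Finset.sum_congr rfl fun i _ => by simp only [tanD]; ring
    rw [← hb, h4]
    simp only [eulD, norD]
    linear_combination h1
  have h3 : q.2 * ∑ i, (E * ξ.1 i) * tanD i φc q =
      q.2 ^ 2 * ∑ i, ∑ j, G⁻¹ i j * tanD i φc q * tanD j φc q := by
    simp only [ha', Finset.mul_sum, Finset.sum_mul]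
    exact Finset.sum_congr rfl fun i _ => Finset.sum_congr rfl fun j _ => by ring
  rw [h3] at h2
  linear_combination -h2

end IsGeodesicCollar

end CollarMetric


/-! ### Holomorphic parameter integrals and Laurent coefficients -/

section ComplexAnalysis

/-- Only the integrand needs a dominating function: Cauchy's estimate bounds its z-derivative on a
smaller disc. -/
theorem hasDerivAt_integral_of_holomorphic {α : Type*} [MeasurableSpace α] {μ : Measure α}
    {g : ℂ → α → ℂ} {z₀ : ℂ} {r : ℝ} (hr : 0 < r) {bound : α → ℝ}
    (hmeas : ∀ z ∈ Metric.ball z₀ r, AEStronglyMeasurable (g z) μ)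
    (hd : ∀ᵐ a ∂μ, DifferentiableOn ℂ (fun z => g z a) (Metric.ball z₀ r))
    (hb : ∀ᵐ a ∂μ, ∀ z ∈ Metric.ball z₀ r, ‖g z a‖ ≤ bound a) (hbi : Integrable bound μ) :
    HasDerivAt (fun z => ∫ a, g z a ∂μ) (∫ a, deriv (fun z => g z a) z₀ ∂μ) z₀ := by
  have hz₀ : z₀ ∈ Metric.ball z₀ r := Metric.mem_ball_self hr
  refine (hasDerivAt_integral_of_dominated_loc_of_deriv_le (F := g)
    (F' := fun z a => deriv (fun z => g z a) z) (s := Metric.ball z₀ (r / 2))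
    (bound := fun a => bound a / (r / 3)) (Metric.ball_mem_nhds _ (by linarith)) ?_ ?_ ?_ ?_ ?_
    ?_).2
  · filter_upwards [Metric.ball_mem_nhds z₀ hr] with z hz using hmeas z hz
  · exact hbi.mono' (hmeas z₀ hz₀) (hb.mono fun a ha => ha z₀ hz₀)
  -- The z-derivative at z₀ is measurable as a limit of difference quotients, with steps below r so
  -- that z₀ + u k stays in the ball.
  · set u : ℕ → ℂ := fun k => (((r / 2) * ((1 : ℝ) / (k + 1)) : ℝ) : ℂ) with hu
    have hu0 : Tendsto u atTop (𝓝[≠] 0) := by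
      refine tendsto_nhdsWithin_iff.2 ⟨?_, .of_forall fun k => ?_⟩
      · have h1 : Tendsto (fun k : ℕ => (r / 2) * ((1 : ℝ) / (k + 1))) atTop (𝓝 0) := by
          simpa using (tendsto_one_div_add_atTop_nhds_zero_nat (𝕜 := ℝ)).const_mul (r / 2)
        have h2 := (Complex.continuous_ofReal.tendsto 0).comp h1
        rwa [Complex.ofReal_zero] at h2
      · have : (0 : ℝ) < (r / 2) * ((1 : ℝ) / (k + 1)) := by positivity
        simp only [hu, mem_compl_iff, mem_singleton_iff, Complex.ofReal_eq_zero]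
        exact this.ne'
    have hub : ∀ k, z₀ + u k ∈ Metric.ball z₀ r := fun k => by
      have h0 : (0 : ℝ) < (r / 2) * ((1 : ℝ) / (k + 1)) := by positivity
      have h1 : (1 : ℝ) / (k + 1) ≤ 1 := by
        rw [div_le_one (by positivity)]
        have : (0 : ℝ) ≤ k := k.cast_nonneg
        linarith
      rw [Metric.mem_ball, dist_self_add_left, hu, Complex.norm_real, Real.norm_of_nonneg h0.le]
      nlinarith
    refine aestronglyMeasurable_of_tendsto_ae atTop
      (f := fun k a => (u k)⁻¹ • (g (z₀ + u k) a - g z₀ a)) (fun k => ?_) ?_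
    · exact ((hmeas _ (hub k)).sub (hmeas _ hz₀)).const_smul ((u k)⁻¹)
    · filter_upwards [hd] with a ha
      have h1 := (ha.differentiableAt (Metric.ball_mem_nhds z₀ hr)).hasDerivAt
      exact (hasDerivAt_iff_tendsto_slope_zero.1 h1).comp hu0
  · filter_upwards [hd, hb] with a hda hba z hz
    -- As 1/2 + 1/3 < 1, circles of radius r/3 about points of the half-size ball remain in the
    -- domain.
    have hsub : Metric.closedBall z (r / 3) ⊆ Metric.ball z₀ r := by
      refine Metric.closedBall_subset_ball' ?_
      rw [Metric.mem_ball] at hz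
      linarith
    refine Complex.norm_deriv_le_of_forall_mem_sphere_norm_le (by linarith)
      ((hda.mono hsub).diffContOnCl_ball le_rfl) fun w hw => ?_
    exact hba w (hsub (Metric.sphere_subset_closedBall hw))
  · exact hbi.div_const _
  · filter_upwards [hd] with a ha z hz
    exact (ha.differentiableAt (Metric.isOpen_ball.mem_nhds
      (Metric.ball_subset_ball (by linarith) hz))).hasDerivAt

theorem laurentCoeff_congr {Z Z' : ℂ → ℂ} (h : Z =ᶠ[𝓝[≠] 0] Z') (k : ℤ) :
    laurentCoeff Z k = laurentCoeff Z' k := by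
  obtain ⟨r₀, hr₀, hsub⟩ := Metric.mem_nhdsWithin_iff.1 h
  unfold laurentCoeff limUnder
  congr 1
  refine Filter.map_congr ?_
  filter_upwards [Ioo_mem_nhdsGT hr₀] with r hr
  congr 1
  refine circleIntegral.integral_congr hr.1.le fun z hz => ?_
  have hzn : ‖z‖ = r := by simpa using hz
  have : Z z = Z' z := hsub ⟨by simpa [hzn] using hr.2, by
    rintro rfl; simp at hzn; exact hr.1.ne hzn⟩
  simp only [this]

theorem laurentCoeff_eq_of_forall {Z : ℂ → ℂ} {k : ℤ} {c : ℂ} {r₀ : ℝ} (hr₀ : 0 < r₀)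
    (h : ∀ r ∈ Ioo 0 r₀, (∮ z in C(0, r), z ^ (-k - 1) * Z z) = 2 * Real.pi * Complex.I * c) :
    laurentCoeff Z k = c := by
  refine Tendsto.limUnder_eq ?_
  refine tendsto_const_nhds.congr' ?_
  filter_upwards [Ioo_mem_nhdsGT hr₀] with r hr
  rw [h r hr, inv_mul_cancel_left₀ Complex.two_pi_I_ne_zero]

theorem circleIntegral_zpow_neg_two {r : ℝ} : (∮ z in C(0, r), (z : ℂ) ^ (-2 : ℤ)) = 0 := by
  have := circleIntegral.integral_sub_zpow_of_ne (n := -2) (by norm_num) 0 0 r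
  simpa using this

/-- The Laurent coefficients of a function with a simple pole. -/
theorem laurentCoeff_of_simplePole {Z B : ℂ → ℂ} {a : ℂ} {r₀ : ℝ} (hr₀ : 0 < r₀)
    (hB : DifferentiableOn ℂ B (Metric.ball 0 r₀)) (hZ : Z =ᶠ[𝓝[≠] 0] fun z => a / z + B z) :
    laurentCoeff Z (-1) = a ∧ laurentCoeff Z 0 = B 0 := by
  rw [laurentCoeff_congr hZ, laurentCoeff_congr hZ]
  have hcl : ∀ r ∈ Ioo 0 r₀, Metric.closedBall (0 : ℂ) r ⊆ Metric.ball 0 r₀ := fun r hr =>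
    Metric.closedBall_subset_ball hr.2
  have hsph : ∀ r ∈ Ioo (0 : ℝ) r₀, ∀ z ∈ Metric.sphere (0 : ℂ) r, z ≠ 0 := by
    intro r hr z hz h
    rw [h] at hz
    simp at hz
    exact hr.1.ne hz
  have hBc : ∀ r ∈ Ioo 0 r₀, ContinuousOn B (Metric.sphere 0 r) := fun r hr =>
    hB.continuousOn.mono (Metric.sphere_subset_closedBall.trans (hcl r hr))
  have hBd : ∀ r ∈ Ioo 0 r₀, DiffContOnCl ℂ B (Metric.ball 0 r) := fun r hr =>
    (hB.mono (hcl r hr)).diffContOnCl_ball le_rfl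
  have hpow : ∀ r ∈ Ioo (0 : ℝ) r₀, ∀ k : ℤ, ContinuousOn (fun z : ℂ => z ^ k)
      (Metric.sphere 0 r) := fun r hr k =>
    continuousOn_id.zpow₀ k fun z hz => .inl (hsph r hr z hz)
  have hinv : ∀ r ∈ Ioo (0 : ℝ) r₀, (∮ z in C(0, r), (z : ℂ)⁻¹) = 2 * Real.pi * Complex.I := by
    intro r hr
    have := circleIntegral.integral_sub_center_inv 0 hr.1.ne'
    simpa using this
  constructor
  · refine laurentCoeff_eq_of_forall hr₀ fun r hr => ?_
    have h1 : (∮ z in C(0, r), z ^ (-(-1 : ℤ) - 1) * (a / z + B z)) =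
        ∮ z in C(0, r), a * z ^ (-1 : ℤ) + B z := by
      refine circleIntegral.integral_congr hr.1.le fun z hz => ?_
      simp only [neg_neg, sub_self, zpow_zero, one_mul, zpow_neg_one, div_eq_mul_inv]
    rw [h1, circleIntegral.integral_add
      ((continuousOn_const.fun_mul (hpow r hr _)).circleIntegrable hr.1.le)
      ((hBc r hr).circleIntegrable hr.1.le), (hBd r hr).circleIntegral_eq_zero hr.1.le, add_zero]
    have h2 := circleIntegral.integral_const_mul a (fun z : ℂ => z ^ (-1 : ℤ)) 0 r
    rw [h2]
    simp only [zpow_neg_one]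
    rw [hinv r hr]; ring
  · refine laurentCoeff_eq_of_forall hr₀ fun r hr => ?_
    -- The pole contributes a z⁻², whose circle integral is zero; Cauchy's formula evaluates the
    -- rest to B(0).
    have h1 : (∮ z in C(0, r), z ^ (-(0 : ℤ) - 1) * (a / z + B z)) =
        ∮ z in C(0, r), a * z ^ (-2 : ℤ) + (z - 0)⁻¹ • B z := by
      refine circleIntegral.integral_congr hr.1.le fun z hz => ?_
      have := hsph r hr z hz
      simp only [neg_zero, zero_sub, zpow_neg_one, sub_zero, smul_eq_mul, div_eq_mul_inv]
      rw [show (-2 : ℤ) = -1 + -1 by norm_num, zpow_add₀ this, zpow_neg_one]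
      ring
    rw [h1, circleIntegral.integral_add
      ((continuousOn_const.fun_mul (hpow r hr _)).circleIntegrable hr.1.le) ?_,
      (hBd r hr).circleIntegral_sub_inv_smul (Metric.mem_ball_self hr.1)]
    · have h2 := circleIntegral.integral_const_mul a (fun z : ℂ => z ^ (-2 : ℤ)) 0 r
      rw [h2, circleIntegral_zpow_neg_two]; simp
    · refine ContinuousOn.circleIntegrable hr.1.le ?_
      refine ContinuousOn.fun_smul ?_ (hBc r hr)
      simpa using hpow r hr (-1)

end ComplexAnalysis

/-! ### Uniqueness of the meromorphic continuation. -/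

section ZetaUniqueness

variable {d : ℕ} {H : Type*} [TopologicalSpace H] {I : ModelWithCorners ℝ (Euc d) H}
  {M : Type*} [TopologicalSpace M] [ChartedSpace H M] [MeasurableSpace M] {ν : Measure M}
  {x f : M → ℝ} {Z Z' : ℂ → ℂ}

/-- Identity theorem: the difference is meromorphic on a convex half plane and vanishes far to the
right, so it has infinite order at 0 as well. Thus the choice made in `zetaCont` does not affect
Laurent coefficients. -/
theorem IsZetaContinuation.eventuallyEq (h : IsZetaContinuation I ν x f Z)
    (h' : IsZetaContinuation I ν x f Z') : Z =ᶠ[𝓝[≠] 0] Z' := by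
  obtain ⟨⟨δ, hδ, hm⟩, σ, hσ⟩ := h
  obtain ⟨⟨δ', hδ', hm'⟩, σ', hσ'⟩ := h'
  set U : Set ℂ := {z | -(min δ δ') < z.re} with hU
  have hmU : MeromorphicOn (Z - Z') U := by
    refine MeromorphicOn.sub (hm.mono_set fun z hz => ?_) (hm'.mono_set fun z hz => ?_)
    · have := min_le_left δ δ'
      simp only [hU, mem_ofPred_eq] at hz ⊢; linarith
    · have := min_le_right δ δ'
      simp only [hU, mem_ofPred_eq] at hz ⊢; linarith
  have h0 : (0 : ℂ) ∈ U := by simp [hU, hδ, hδ']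
  have hconv : Convex ℝ U := convex_halfSpace_re_gt _
  have hconn : IsConnected U := ⟨⟨0, h0⟩, hconv.isPreconnected⟩
  set s : ℝ := max (max σ σ') 0 with hs
  have h1 : ((s + 1 : ℝ) : ℂ) ∈ U := by
    have := le_max_right (max σ σ') 0
    have := lt_min hδ hδ'
    simp only [hU, mem_ofPred_eq, Complex.ofReal_re]
    linarith
  have hev : ∀ᶠ z in 𝓝 ((s + 1 : ℝ) : ℂ), (Z - Z') z = 0 := by
    have : {z : ℂ | s < z.re} ∈ 𝓝 ((s + 1 : ℝ) : ℂ) :=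
      (isOpen_lt continuous_const Complex.continuous_re).mem_nhds (by
        simp only [mem_ofPred_eq, Complex.ofReal_re]; linarith)
    filter_upwards [this] with z hz
    have hz1 : σ < z.re := ((le_max_left σ σ').trans (le_max_left _ _)).trans_lt hz
    have hz2 : σ' < z.re := ((le_max_right σ σ').trans (le_max_left _ _)).trans_lt hz
    rw [Pi.sub_apply, (hσ z hz1).2, (hσ' z hz2).2, sub_self]
  have htop : meromorphicOrderAt (Z - Z') ((s + 1 : ℝ) : ℂ) = ⊤ :=
    meromorphicOrderAt_eq_top_iff.2 (hev.filter_mono nhdsWithin_le_nhds)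
  have hz0 : meromorphicOrderAt (Z - Z') 0 = ⊤ := by
    by_contra hne
    exact (hmU.exists_meromorphicOrderAt_ne_top_iff_forall_mem hconn).1 ⟨0, h0, hne⟩ _ h1 htop
  filter_upwards [meromorphicOrderAt_eq_top_iff.1 hz0] with z hz
  exact sub_eq_zero.1 hz

theorem zetaCont_eventuallyEq (h : IsZetaContinuation I ν x f Z) :
    zetaCont I ν x f =ᶠ[𝓝[≠] 0] Z := by
  have h1 : HasZetaContinuation I ν x f := ⟨Z, h⟩
  rw [zetaCont, dif_pos h1]
  exact h1.choose_spec.eventuallyEq h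

/-- Residue and finite part from a continuation with a simple pole at `0`. -/
theorem riesz_of_simplePole (h : IsZetaContinuation I ν x f Z) {B : ℂ → ℂ} {a : ℂ} {r₀ : ℝ}
    (hr₀ : 0 < r₀) (hB : DifferentiableOn ℂ B (Metric.ball 0 r₀))
    (hZ : Z =ᶠ[𝓝[≠] 0] fun z => a / z + B z) :
    rieszResidue I ν x f = a ∧ rieszIntegral I ν x f = B 0 :=
  laurentCoeff_of_simplePole hr₀ hB ((zetaCont_eventuallyEq h).trans hZ)

end ZetaUniqueness


/-! ### Uniform finite expansions in powers of `t` -/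

/-- `f(x,t) = ∑_{k ≤ n} c_k(x) t^k + O(t^{n + 1/2})` with bounded `c_k`, uniformly in `x`. -/
structure UnifExp (n : ℕ) (δ : ℝ) {X : Type*} (f : X → ℝ → ℂ) (c : X → PowerSeries ℂ) : Prop where
  coeff_bound : ∀ k ≤ n, ∃ B, ∀ x, ‖(c x).coeff k‖ ≤ B
  remainder : ∃ C, ∀ x, ∀ t ∈ Ioo 0 δ,
    ‖f x t - ∑ k ∈ Finset.range (n + 1), (c x).coeff k * (t : ℂ) ^ k‖ ≤ C * t ^ (n + 1 / 2 : ℝ)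

namespace UnifExp

variable {δ : ℝ} {X : Type*} {f g : X → ℝ → ℂ} {c d : X → PowerSeries ℂ}

theorem exists_coeff_bound (hf : UnifExp n δ f c) :
    ∃ B, 0 ≤ B ∧ ∀ k ≤ n, ∀ x, ‖(c x).coeff k‖ ≤ B := by
  choose! B hB using hf.coeff_bound
  refine ⟨∑ k ∈ Finset.range (n + 1), |B k|, Finset.sum_nonneg fun _ _ => abs_nonneg _,
    fun k hk x => (hB k hk x).trans ((le_abs_self _).trans ?_)⟩
  exact Finset.single_le_sum (f := fun k => |B k|) (fun _ _ => abs_nonneg _)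
    (Finset.mem_range.2 (by omega))

theorem exists_remainder_bound (hf : UnifExp n δ f c) :
    ∃ C, 0 ≤ C ∧ ∀ x, ∀ t ∈ Ioo 0 δ,
      ‖f x t - ∑ k ∈ Finset.range (n + 1), (c x).coeff k * (t : ℂ) ^ k‖ ≤
        C * t ^ (n + 1 / 2 : ℝ) := by
  obtain ⟨C, hC⟩ := hf.remainder
  refine ⟨|C|, abs_nonneg _, fun x t ht => (hC x t ht).trans ?_⟩
  exact mul_le_mul_of_nonneg_right (le_abs_self _) (Real.rpow_nonneg ht.1.le _)

theorem norm_pow_le_one (hδ : δ ≤ 1) {t : ℝ} (ht : t ∈ Ioo 0 δ) (k : ℕ) : ‖(t : ℂ) ^ k‖ ≤ 1 := by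
  rw [norm_pow, Complex.norm_real, Real.norm_of_nonneg ht.1.le]
  exact pow_le_one₀ ht.1.le (ht.2.le.trans hδ)

theorem rpow_le_one_of_mem (hδ : δ ≤ 1) {t : ℝ} (ht : t ∈ Ioo 0 δ) {s : ℝ} (hs : 0 ≤ s) :
    t ^ s ≤ 1 := Real.rpow_le_one ht.1.le (ht.2.le.trans hδ) hs

theorem exists_poly_bound (hδ : δ ≤ 1) (hf : UnifExp n δ f c) : ∃ B, 0 ≤ B ∧ ∀ x, ∀ t ∈ Ioo 0 δ,
    ‖∑ k ∈ Finset.range (n + 1), (c x).coeff k * (t : ℂ) ^ k‖ ≤ B := by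
  obtain ⟨B, hB0, hB⟩ := hf.exists_coeff_bound
  refine ⟨∑ k ∈ Finset.range (n + 1), B, Finset.sum_nonneg fun _ _ => hB0, fun x t ht =>
    (norm_sum_le _ _).trans (Finset.sum_le_sum fun k hk => ?_)⟩
  rw [norm_mul]
  have := hB k (by simp at hk; omega) x
  nlinarith [norm_pow_le_one hδ ht k, norm_nonneg ((t : ℂ) ^ k), norm_nonneg ((c x).coeff k)]

theorem exists_bound (hδ : δ ≤ 1) (hf : UnifExp n δ f c) :
    ∃ B, 0 ≤ B ∧ ∀ x, ∀ t ∈ Ioo 0 δ, ‖f x t‖ ≤ B := by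
  obtain ⟨B, hB0, hB⟩ := hf.exists_poly_bound hδ
  obtain ⟨C, hC0, hC⟩ := hf.exists_remainder_bound
  refine ⟨C + B, by positivity, fun x t ht => ?_⟩
  have h1 := norm_add_le (f x t - ∑ k ∈ Finset.range (n + 1), (c x).coeff k * (t : ℂ) ^ k)
    (∑ k ∈ Finset.range (n + 1), (c x).coeff k * (t : ℂ) ^ k)
  rw [sub_add_cancel] at h1
  have h2 := rpow_le_one_of_mem hδ ht (s := (n + 1 / 2 : ℝ)) (by positivity)
  nlinarith [hB x t ht, hC x t ht, mul_le_mul_of_nonneg_left h2 hC0]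

theorem of_const {a : X → ℂ} {B : ℝ} (ha : ∀ x, ‖a x‖ ≤ B) :
    UnifExp n δ (fun x _ => a x) (fun x => PowerSeries.C (a x)) where
  coeff_bound k hk := ⟨max B 0, fun x => by
    rw [PowerSeries.coeff_C]
    split_ifs
    · exact (ha x).trans (le_max_left _ _)
    · simp⟩
  remainder := ⟨0, fun x t ht => by
    rw [Finset.sum_eq_single 0]
    · simp
    · intro k _ hk
      rw [PowerSeries.coeff_C, if_neg hk, zero_mul]
    · simp⟩

theorem add (hf : UnifExp n δ f c) (hg : UnifExp n δ g d) :
    UnifExp n δ (fun x t => f x t + g x t) (fun x => c x + d x) where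
  coeff_bound k hk := by
    obtain ⟨B, hB⟩ := hf.coeff_bound k hk
    obtain ⟨B', hB'⟩ := hg.coeff_bound k hk
    exact ⟨B + B', fun x => by
      rw [map_add]; exact (norm_add_le _ _).trans (add_le_add (hB x) (hB' x))⟩
  remainder := by
    obtain ⟨C, hC⟩ := hf.remainder
    obtain ⟨C', hC'⟩ := hg.remainder
    refine ⟨C + C', fun x t ht => ?_⟩
    have h1 := (norm_add_le _ _).trans (add_le_add (hC x t ht) (hC' x t ht))
    rw [← add_mul] at h1
    refine le_trans (le_of_eq ?_) h1
    congr 1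
    simp only [map_add, add_mul, Finset.sum_add_distrib]; ring

theorem comp {Y : Type*} (hf : UnifExp n δ f c) (h : Y → X) :
    UnifExp n δ (fun y => f (h y)) (fun y => c (h y)) where
  coeff_bound k hk := (hf.coeff_bound k hk).imp fun _ hB y => hB (h y)
  remainder := hf.remainder.imp fun _ hC y => hC (h y)

theorem congr_of_norm_le (hf : UnifExp n δ f c) {C : ℝ}
    (h : ∀ x, ∀ t ∈ Ioo 0 δ, ‖g x t - f x t‖ ≤ C * t ^ (n + 1 / 2 : ℝ)) : UnifExp n δ g c where
  coeff_bound := hf.coeff_bound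
  remainder := by
    obtain ⟨C', hC'⟩ := hf.remainder
    refine ⟨C + C', fun x t ht => ?_⟩
    have h1 := (norm_add_le _ _).trans (add_le_add (h x t ht) (hC' x t ht))
    rw [← add_mul] at h1
    refine le_trans (le_of_eq ?_) h1
    congr 1; ring

theorem mono {δ' : ℝ} (hf : UnifExp n δ f c) (h : δ' ≤ δ) : UnifExp n δ' f c where
  coeff_bound := hf.coeff_bound
  remainder := hf.remainder.imp fun _ hC x t ht => hC x t ⟨ht.1, ht.2.trans_le h⟩

/-- Truncation of the product of two polynomials of degree `n`. -/
theorem prod_sub_trunc (p q : PowerSeries ℂ) (t : ℂ) :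
    (∑ k ∈ Finset.range (n + 1), p.coeff k * t ^ k) * (∑ k ∈ Finset.range (n + 1), q.coeff k * t ^ k)
      - ∑ k ∈ Finset.range (n + 1), (p * q).coeff k * t ^ k =
    ∑ i ∈ Finset.range (n + 1), ∑ j ∈ Finset.range (n + 1),
      if n < i + j then p.coeff i * q.coeff j * t ^ (i + j) else 0 := by
  have h1 : ∑ k ∈ Finset.range (n + 1), (p * q).coeff k * t ^ k =
      ∑ i ∈ Finset.range (n + 1), ∑ j ∈ Finset.range (n + 1),
        if i + j ≤ n then p.coeff i * q.coeff j * t ^ (i + j) else 0 := by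
    have h2 : ∀ k ∈ Finset.range (n + 1), (p * q).coeff k * t ^ k =
        ∑ ij ∈ Finset.range (n + 1) ×ˢ Finset.range (n + 1),
          if ij.1 + ij.2 = k then p.coeff ij.1 * q.coeff ij.2 * t ^ k else 0 := by
      intro k hk
      rw [PowerSeries.coeff_mul, Finset.sum_mul, ← Finset.sum_filter]
      refine Finset.sum_congr ?_ fun _ _ => rfl
      ext ⟨i, j⟩
      simp only [Finset.HasAntidiagonal.mem_antidiagonal, Finset.mem_filter, Finset.mem_product,
        Finset.mem_range] at hk ⊢
      omega
    rw [Finset.sum_congr rfl h2, Finset.sum_comm, Finset.sum_product]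
    refine Finset.sum_congr rfl fun i _ => Finset.sum_congr rfl fun j _ => ?_
    rw [Finset.sum_ite_eq]
    simp only [Finset.mem_range, Nat.lt_succ_iff]
  rw [h1, Finset.sum_mul_sum, ← Finset.sum_sub_distrib]
  refine Finset.sum_congr rfl fun i _ => ?_
  rw [← Finset.sum_sub_distrib]
  refine Finset.sum_congr rfl fun j _ => ?_
  by_cases h : i + j ≤ n
  · rw [if_pos h, if_neg (by omega), pow_add]; ring
  · rw [if_neg h, if_pos (by omega), pow_add]; ring

theorem pow_le_rpow_half (hδ : δ ≤ 1) {t : ℝ} (ht : t ∈ Ioo 0 δ) {k : ℕ} (hk : n < k) :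
    t ^ k ≤ t ^ (n + 1 / 2 : ℝ) := by
  rw [← Real.rpow_natCast]
  refine Real.rpow_le_rpow_of_exponent_ge ht.1 (ht.2.le.trans hδ) ?_
  have : (n : ℝ) + 1 ≤ k := by exact_mod_cast hk
  linarith

/-- The exponent is 1/2 and not 1 because for n = 0 the remainder itself is only O(t^(1/2)). -/
theorem exists_half_bound (hδ : δ ≤ 1) (hf : UnifExp n δ f c) : ∃ A, 0 ≤ A ∧ ∀ x, ∀ t ∈ Ioo 0 δ,
    ‖f x t - (c x).coeff 0‖ ≤ A * t ^ (1 / 2 : ℝ) := by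
  obtain ⟨B, hB0, hB⟩ := hf.exists_coeff_bound
  obtain ⟨C, hC0, hC⟩ := hf.exists_remainder_bound
  refine ⟨C + ∑ k ∈ Finset.range n, B, by positivity, fun x t ht => ?_⟩
  have e1 : f x t - (c x).coeff 0 =
      (f x t - ∑ k ∈ Finset.range (n + 1), (c x).coeff k * (t : ℂ) ^ k) +
      ∑ k ∈ Finset.range n, (c x).coeff (k + 1) * (t : ℂ) ^ (k + 1) := by
    rw [Finset.sum_range_succ', pow_zero, mul_one]; ring
  have ht1 : t ≤ 1 := ht.2.le.trans hδ
  rw [e1, add_mul, Finset.sum_mul]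
  refine (norm_add_le _ _).trans (add_le_add ((hC x t ht).trans ?_)
    ((norm_sum_le _ _).trans (Finset.sum_le_sum fun k hk => ?_)))
  · refine mul_le_mul_of_nonneg_left ?_ hC0
    exact Real.rpow_le_rpow_of_exponent_ge ht.1 ht1 (by simp)
  · rw [norm_mul, norm_pow, Complex.norm_real, Real.norm_of_nonneg ht.1.le]
    simp only [Finset.mem_range] at hk
    refine mul_le_mul (hB _ (by omega) x) ?_ (by have := ht.1; positivity) hB0
    rw [← Real.rpow_natCast]
    refine Real.rpow_le_rpow_of_exponent_ge ht.1 ht1 ?_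
    push_cast
    have : (0 : ℝ) ≤ k := k.cast_nonneg
    linarith

/-- The power series merely carry the coefficients through order n; truncating their product
discards terms t^(i+j) with i + j > n, which are smaller than the remainder. -/
theorem mul (hδ : δ ≤ 1) (hf : UnifExp n δ f c) (hg : UnifExp n δ g d) :
    UnifExp n δ (fun x t => f x t * g x t) (fun x => c x * d x) := by
  obtain ⟨B₁, hB₁0, hB₁⟩ := hf.exists_coeff_bound
  obtain ⟨B₂, hB₂0, hB₂⟩ := hg.exists_coeff_bound
  obtain ⟨A, hA0, hA⟩ := hf.exists_bound hδ
  obtain ⟨Q, hQ0, hQ⟩ := hg.exists_poly_bound hδ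
  obtain ⟨C₁, hC₁0, hC₁⟩ := hf.exists_remainder_bound
  obtain ⟨C₂, hC₂0, hC₂⟩ := hg.exists_remainder_bound
  refine ⟨fun k hk => ⟨∑ ij ∈ Finset.HasAntidiagonal.antidiagonal k, B₁ * B₂, fun x => ?_⟩, ?_⟩
  · rw [PowerSeries.coeff_mul]
    refine (norm_sum_le _ _).trans (Finset.sum_le_sum fun ij hij => ?_)
    have := Finset.HasAntidiagonal.mem_antidiagonal.1 hij
    rw [norm_mul]
    exact mul_le_mul (hB₁ _ (by omega) x) (hB₂ _ (by omega) x) (norm_nonneg _) hB₁0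
  · refine ⟨A * C₂ + C₁ * Q + ∑ i ∈ Finset.range (n + 1), ∑ j ∈ Finset.range (n + 1), B₁ * B₂,
      fun x t ht => ?_⟩
    have hT := Real.rpow_nonneg ht.1.le (n + 1 / 2 : ℝ)
    set T := t ^ (n + 1 / 2 : ℝ) with hTdef
    have h3 : ‖∑ i ∈ Finset.range (n + 1), ∑ j ∈ Finset.range (n + 1),
        if n < i + j then (c x).coeff i * (d x).coeff j * (t : ℂ) ^ (i + j) else 0‖ ≤
        (∑ i ∈ Finset.range (n + 1), ∑ j ∈ Finset.range (n + 1), B₁ * B₂) * T := by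
      simp only [Finset.sum_mul]
      refine (norm_sum_le _ _).trans (Finset.sum_le_sum fun i hi => (norm_sum_le _ _).trans
        (Finset.sum_le_sum fun j hj => ?_))
      split_ifs with h
      · have h4 : ‖(t : ℂ) ^ (i + j)‖ ≤ T := by
          rw [norm_pow, Complex.norm_real, Real.norm_of_nonneg ht.1.le]
          exact pow_le_rpow_half hδ ht h
        rw [norm_mul, norm_mul]
        simp only [Finset.mem_range] at hi hj
        exact mul_le_mul (mul_le_mul (hB₁ i (by omega) x) (hB₂ j (by omega) x) (norm_nonneg _) hB₁0)
          h4 (norm_nonneg _) (by positivity)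
      · rw [norm_zero]; positivity
    rw [← prod_sub_trunc] at h3
    have h1 : ‖f x t * (g x t - ∑ k ∈ Finset.range (n + 1), (d x).coeff k * (t : ℂ) ^ k)‖ ≤
        A * (C₂ * T) := by
      rw [norm_mul]; exact mul_le_mul (hA x t ht) (hC₂ x t ht) (norm_nonneg _) hA0
    have h2 : ‖(f x t - ∑ k ∈ Finset.range (n + 1), (c x).coeff k * (t : ℂ) ^ k) *
        ∑ k ∈ Finset.range (n + 1), (d x).coeff k * (t : ℂ) ^ k‖ ≤ (C₁ * T) * Q := by
      rw [norm_mul]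
      exact mul_le_mul (hC₁ x t ht) (hQ x t ht) (norm_nonneg _) (by positivity)
    refine le_trans (le_of_eq ?_) ((norm_add₃_le).trans ((add_le_add (add_le_add h1 h2) h3).trans
      (le_of_eq ?_)))
    · congr 1; ring
    · ring

theorem pow (hδ : δ ≤ 1) (hf : UnifExp n δ f c) (j : ℕ) :
    UnifExp n δ (fun x t => f x t ^ j) (fun x => c x ^ j) := by
  induction j with
  | zero => simpa using of_const (n := n) (δ := δ) (a := fun _ : X => (1 : ℂ)) (B := 1) (by simp)
  | succ j ih => simpa only [pow_succ] using ih.mul hδ hf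

theorem sum {ι : Type*} (s : Finset ι) {f : ι → X → ℝ → ℂ} {c : ι → X → PowerSeries ℂ}
    (h : ∀ i ∈ s, UnifExp n δ (f i) (c i)) :
    UnifExp n δ (fun x t => ∑ i ∈ s, f i x t) (fun x => ∑ i ∈ s, c i x) := by
  classical
  induction s using Finset.induction_on with
  | empty => simpa using of_const (n := n) (δ := δ) (a := fun _ : X => (0 : ℂ)) (B := 0) (by simp)
  | insert i s hi ih =>
    simp only [Finset.sum_insert hi]
    exact (h i (Finset.mem_insert_self _ _)).add
      (ih fun j hj => h j (Finset.mem_insert_of_mem hj))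

end UnifExp

/-- The expansion of `e^{s f}` for `f ~ w`. -/
def expSeries (n : ℕ) (s : ℂ) (w : PowerSeries ℂ) : PowerSeries ℂ :=
  PowerSeries.C (Complex.exp (s * w.coeff 0)) *
    ∑ j ∈ Finset.range (2 * n + 2), PowerSeries.C (s ^ j / j.factorial) *
      (w - PowerSeries.C (w.coeff 0)) ^ j

/-- The exponent s may vary with x, so a bounded set of s can be built into the index space and the
bounds are then uniform in s. -/
theorem UnifExp.exp {δ : ℝ} {X : Type*} {f : X → ℝ → ℂ} {c : X → PowerSeries ℂ} (hδ : δ ≤ 1)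
    (hf : UnifExp n δ f c) {s : X → ℂ} {R : ℝ} (hs : ∀ x, ‖s x‖ ≤ R) :
    UnifExp n δ (fun x t => Complex.exp (s x * f x t)) (fun x => expSeries n (s x) (c x)) := by
  by_cases hX : Nonempty X
  swap
  · rw [not_nonempty_iff] at hX
    exact ⟨fun k _ => ⟨0, fun x => isEmptyElim x⟩, ⟨0, fun x => isEmptyElim x⟩⟩
  have hR : 0 ≤ R := (norm_nonneg _).trans (hs hX.some)
  obtain ⟨B, hB0, hB⟩ := hf.exists_coeff_bound
  have h0 : ∀ x, ‖-(c x).coeff 0‖ ≤ B := fun x => by rw [norm_neg]; exact hB 0 (by omega) x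
  have hft : UnifExp n δ (fun x t => f x t - (c x).coeff 0)
      (fun x => c x - PowerSeries.C ((c x).coeff 0)) := by
    simpa only [sub_eq_add_neg, map_neg] using hf.add (of_const h0)
  obtain ⟨A, hA0, hA⟩ := hf.exists_half_bound hδ
  have hexp0 : ∀ x, ‖Complex.exp (s x * (c x).coeff 0)‖ ≤ Real.exp (R * B) := fun x => by
    refine (Complex.norm_exp_le_exp_norm _).trans (Real.exp_le_exp.2 ?_)
    rw [norm_mul]
    exact mul_le_mul (hs x) (hB 0 (by omega) x) (norm_nonneg _) hR
  have hmain : UnifExp n δ (fun x t => Complex.exp (s x * (c x).coeff 0) *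
      ∑ j ∈ Finset.range (2 * n + 2), s x ^ j / j.factorial * (f x t - (c x).coeff 0) ^ j)
      (fun x => expSeries n (s x) (c x)) := by
    refine (of_const hexp0).mul hδ (sum _ fun j _ => ?_)
    refine (of_const (B := R ^ j) fun x => ?_).mul hδ (hft.pow hδ j)
    rw [norm_div, norm_pow]
    refine (div_le_self (by positivity) ?_).trans (pow_le_pow_left₀ (norm_nonneg _) (hs x) _)
    rw [Complex.norm_natCast]
    exact_mod_cast j.factorial_pos
  refine hmain.congr_of_norm_le
    (C := Real.exp (R * B) * ((R * A) ^ (2 * n + 2) * Real.exp (R * A))) fun x t ht => ?_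
  have ht1 : t ≤ 1 := ht.2.le.trans hδ
  set F := f x t - (c x).coeff 0 with hF
  have e1 : Complex.exp (s x * f x t) = Complex.exp (s x * (c x).coeff 0) * Complex.exp (s x * F) := by
    rw [← Complex.exp_add]; congr 1; rw [hF]; ring
  have e2 : ∑ j ∈ Finset.range (2 * n + 2), s x ^ j / j.factorial * F ^ j =
      ∑ j ∈ Finset.range (2 * n + 2), (s x * F) ^ j / j.factorial :=
    Finset.sum_congr rfl fun j _ => by rw [mul_pow]; ring
  rw [e1, e2, ← mul_sub, norm_mul, mul_assoc]
  refine mul_le_mul (hexp0 x) ?_ (norm_nonneg _) (Real.exp_pos _).le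
  refine (Complex.norm_exp_sub_sum_le_norm_mul_exp _ _).trans ?_
  have hhalf : t ^ (1 / 2 : ℝ) ≤ 1 := Real.rpow_le_one ht.1.le ht1 (by norm_num)
  have hsF : ‖s x * F‖ ≤ R * A * t ^ (1 / 2 : ℝ) := by
    rw [norm_mul, mul_assoc]
    exact mul_le_mul (hs x) (hA x t ht) (norm_nonneg _) hR
  -- Since f − c₀ is O(t^(1/2)), the exponential series cut after 2n + 2 terms leaves t^(n+1).
  have hpow : (t ^ (1 / 2 : ℝ)) ^ (2 * n + 2) ≤ t ^ (n + 1 / 2 : ℝ) := by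
    rw [← Real.rpow_natCast, ← Real.rpow_mul ht.1.le]
    refine Real.rpow_le_rpow_of_exponent_ge ht.1 ht1 ?_
    push_cast; linarith
  calc ‖s x * F‖ ^ (2 * n + 2) * Real.exp ‖s x * F‖
      ≤ (R * A * t ^ (1 / 2 : ℝ)) ^ (2 * n + 2) * Real.exp (R * A) := by
        refine mul_le_mul (pow_le_pow_left₀ (norm_nonneg _) hsF _) (Real.exp_le_exp.2 ?_)
          (Real.exp_pos _).le (by have := Real.rpow_nonneg ht.1.le (1 / 2 : ℝ); positivity)
        exact hsF.trans (mul_le_of_le_one_right (by positivity) hhalf)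
    _ ≤ _ := by
        rw [mul_pow]
        have : (0 : ℝ) ≤ (R * A) ^ (2 * n + 2) * Real.exp (R * A) := by positivity
        nlinarith [mul_le_mul_of_nonneg_left hpow this]

theorem expSeries_zero (w : PowerSeries ℂ) : expSeries n 0 w = 1 := by
  rw [expSeries, Finset.sum_eq_single 0]
  · simp
  · intro j _ hj
    simp [zero_pow hj]
  · simp

theorem coeff_expSeries_mul (s : ℂ) (w a : PowerSeries ℂ) (k : ℕ) :
    (expSeries n s w * a).coeff k = Complex.exp (s * w.coeff 0) *
      ∑ j ∈ Finset.range (2 * n + 2), s ^ j / j.factorial *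
        ((w - PowerSeries.C (w.coeff 0)) ^ j * a).coeff k := by
  rw [expSeries, mul_assoc, PowerSeries.coeff_C_mul, Finset.sum_mul, map_sum]
  congr 1
  exact Finset.sum_congr rfl fun j _ => by rw [mul_assoc, PowerSeries.coeff_C_mul]

theorem differentiable_coeff_expSeries_mul (w a : PowerSeries ℂ) (k : ℕ) :
    Differentiable ℂ (fun s => (expSeries n s w * a).coeff k) := by
  simp only [coeff_expSeries_mul]
  fun_prop

/-- The product rule gives w₀a_k from the prefactor and ((w − w₀)a)_k from the sum. At k = n this is
the source of the anomaly term. -/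
theorem deriv_coeff_expSeries_mul (w a : PowerSeries ℂ) (k : ℕ) :
    deriv (fun s => (expSeries n s w * a).coeff k) 0 = (w * a).coeff k := by
  simp only [coeff_expSeries_mul]
  set m : ℕ → ℂ := fun j => ((w - PowerSeries.C (w.coeff 0)) ^ j * a).coeff k with hm
  have h1 : HasDerivAt (fun s : ℂ => Complex.exp (s * w.coeff 0)) (w.coeff 0) 0 := by
    have := ((hasDerivAt_id (0 : ℂ)).mul_const (w.coeff 0)).cexp
    simpa using this
  have h2 : HasDerivAt (fun s : ℂ => ∑ j ∈ Finset.range (2 * n + 2), s ^ j / j.factorial * m j)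
      (m 1) 0 := by
    have h3 : ∀ j ∈ Finset.range (2 * n + 2), HasDerivAt
        (fun s : ℂ => s ^ j / j.factorial * m j) (if j = 1 then m 1 else 0) 0 := by
      intro j _
      refine ((hasDerivAt_pow j (0 : ℂ)).div_const _ |>.mul_const (m j)).congr_deriv ?_
      rcases j with _ | _ | j
      · simp
      · simp
      · simp
    refine (HasDerivAt.fun_sum h3).congr_deriv ?_
    rw [Finset.sum_ite_eq']
    simp
  refine (h1.fun_mul h2).deriv.trans ?_
  have h4 : ∑ j ∈ Finset.range (2 * n + 2), (0 : ℂ) ^ j / j.factorial * m j = m 0 := by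
    rw [Finset.sum_eq_single 0]
    · simp
    · intro j _ hj
      simp [zero_pow hj]
    · simp
  rw [h4]
  simp only [hm, zero_mul, Complex.exp_zero, pow_zero, one_mul, pow_one, sub_mul, map_sub,
    PowerSeries.coeff_C_mul]
  ring

/-- Power series with continuous coefficients. -/
def ContCoeff {X : Type*} [TopologicalSpace X] (c : X → PowerSeries ℂ) : Prop :=
  ∀ k, Continuous fun x => (c x).coeff k

namespace ContCoeff

variable {X : Type*} [TopologicalSpace X] {c d : X → PowerSeries ℂ}

theorem mul (hc : ContCoeff c) (hd : ContCoeff d) : ContCoeff fun x => c x * d x := by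
  intro k
  simp only [PowerSeries.coeff_mul]
  exact continuous_finsetSum _ fun ij _ => (hc ij.1).mul (hd ij.2)

theorem sub (hc : ContCoeff c) (hd : ContCoeff d) : ContCoeff fun x => c x - d x := by
  intro k
  simp only [map_sub]
  exact (hc k).sub (hd k)

theorem constantCoeff {a : X → ℂ} (ha : Continuous a) : ContCoeff fun x => PowerSeries.C (a x) := by
  intro k
  simp only [PowerSeries.coeff_C]
  split_ifs
  · exact ha
  · exact continuous_const

theorem pow (hc : ContCoeff c) (j : ℕ) : ContCoeff fun x => c x ^ j := by
  induction j with
  | zero => simpa using constantCoeff (X := X) (a := fun _ => 1) continuous_const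
  | succ j ih => simpa only [pow_succ] using ih.mul hc

theorem expSeries_mul (hc : ContCoeff c) (hd : ContCoeff d) (s : ℂ) :
    ContCoeff fun x => expSeries n s (c x) * d x := by
  intro k
  simp only [coeff_expSeries_mul]
  refine (Complex.continuous_exp.comp (continuous_const.mul (hc 0))).mul
    (continuous_finsetSum _ fun j _ => continuous_const.mul ?_)
  exact (((hc.sub (constantCoeff (hc 0))).pow j).mul hd) k

end ContCoeff


/-! ### The zeta function of the collar -/

section CollarZeta

variable {N : Type*} [TopologicalSpace N] [CompactSpace N] [MeasurableSpace N] [BorelSpace N]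

/-- The measure `dν dt` on `N × (0, δ)`. -/
def collarMeasure (ν : Measure N) (δ : ℝ) : Measure (N × ℝ) :=
  (ν.prod volume).restrict (univ ×ˢ Ioo 0 δ)

variable {ν : Measure N} [IsFiniteMeasure ν] {δ : ℝ} {φ F : N × ℝ → ℝ} {w a : N → PowerSeries ℂ}

theorem collarMeasure_eq (ν : Measure N) [IsFiniteMeasure ν] (δ : ℝ) :
    collarMeasure ν δ = ν.prod (volume.restrict (Ioo 0 δ)) := by
  rw [collarMeasure, ← Measure.prod_restrict, Measure.restrict_univ]

theorem ae_collarMeasure (ν : Measure N) (δ : ℝ) :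
    ∀ᵐ q ∂(collarMeasure ν δ), q.2 ∈ Ioo 0 δ := by
  filter_upwards [ae_restrict_mem (MeasurableSet.univ.prod measurableSet_Ioo)] with q hq
  exact hq.2

theorem integrableOn_rpow_Ioo (hδ : 0 < δ) {s : ℝ} (hs : -1 < s) :
    IntegrableOn (fun t : ℝ => t ^ s) (Ioo 0 δ) :=
  (intervalIntegrable_iff_integrableOn_Ioo_of_le hδ.le).1 (intervalIntegral.intervalIntegrable_rpow' hs)

theorem integrable_rpow_collar (hδ : 0 < δ) {s : ℝ} (hs : -1 < s) (C : ℝ) :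
    Integrable (fun q : N × ℝ => C * q.2 ^ s) (collarMeasure ν δ) := by
  rw [collarMeasure_eq]
  exact (integrable_const C).mul_prod (integrableOn_rpow_Ioo hδ hs)

theorem integrable_of_norm_le_rpow (hδ : 0 < δ) {s C : ℝ} (hs : -1 < s) {h : N × ℝ → ℂ}
    (hm : AEStronglyMeasurable h (collarMeasure ν δ))
    (hb : ∀ y, ∀ t ∈ Ioo 0 δ, ‖h (y, t)‖ ≤ C * t ^ s) : Integrable h (collarMeasure ν δ) := by
  refine (integrable_rpow_collar hδ hs C).mono' hm ?_
  filter_upwards [ae_collarMeasure ν δ] with q hq using hb q.1 q.2 hq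

theorem integral_cpow_Ioo (hδ : 0 < δ) {s : ℂ} (hs : 0 < s.re) :
    ∫ t in Ioo 0 δ, (t : ℂ) ^ (s - 1) = (δ : ℂ) ^ s / s := by
  have hs0 : s ≠ 0 := by rintro rfl; simp at hs
  rw [← integral_Ioc_eq_integral_Ioo, ← intervalIntegral.integral_of_le hδ.le,
    integral_cpow (.inl (by simp; exact hs)), sub_add_cancel, Complex.ofReal_zero,
    Complex.zero_cpow hs0, sub_zero]

theorem norm_cpow_of_pos {t : ℝ} (ht : 0 < t) (s : ℂ) : ‖(t : ℂ) ^ s‖ = t ^ s.re := by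
  rw [Complex.norm_cpow_eq_rpow_re_of_pos ht]

/-- The integrand `t^{z-n-1} e^{zφ} F`. -/
def collarIntegrand (n : ℕ) (φ F : N × ℝ → ℝ) (z : ℂ) (q : N × ℝ) : ℂ :=
  (q.2 : ℂ) ^ (z - n - 1) * (Complex.exp (z * φ q) * F q)

/-- The coefficient of `t^k` in `e^{zφ} F`, integrated over `N`. -/
def coeffIntegral (ν : Measure N) (n : ℕ) (w a : N → PowerSeries ℂ) (k : ℕ) (z : ℂ) : ℂ :=
  ∫ y, (expSeries n z (w y) * a y).coeff k ∂ν

/-- The integrand after subtraction of the expansion. -/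
def collarRemainder (n : ℕ) (φ F : N × ℝ → ℝ) (w a : N → PowerSeries ℂ) (z : ℂ) (q : N × ℝ) : ℂ :=
  (q.2 : ℂ) ^ (z - n - 1) * (Complex.exp (z * φ q) * F q -
    ∑ k ∈ Finset.range (n + 1), (expSeries n z (w q.1) * a q.1).coeff k * (q.2 : ℂ) ^ k)

/-- A closed disc of parameters z is adjoined to the index space; the resulting constants dominate
the parameter integrals. -/
theorem unifExp_exp_mul (hδ : δ ≤ 1) (hw : UnifExp n δ (fun y t => (φ (y, t) : ℂ)) w)
    (ha : UnifExp n δ (fun y t => (F (y, t) : ℂ)) a) (R : ℝ) :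
    UnifExp n δ (fun (p : Metric.closedBall (0 : ℂ) R × N) t =>
      Complex.exp (p.1 * φ (p.2, t)) * F (p.2, t))
      (fun p => expSeries n p.1 (w p.2) * a p.2) :=
  ((hw.comp Prod.snd).exp hδ (s := fun p : Metric.closedBall (0 : ℂ) R × N => (p.1 : ℂ)) (R := R)
    fun p => mem_closedBall_zero_iff.1 p.1.2).mul hδ (ha.comp Prod.snd)

theorem hasDerivAt_coeffIntegral (hδ : δ ≤ 1) (hw : UnifExp n δ (fun y t => (φ (y, t) : ℂ)) w)
    (ha : UnifExp n δ (fun y t => (F (y, t) : ℂ)) a) (hwc : ContCoeff w) (hac : ContCoeff a)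
    {k : ℕ} (hk : k ≤ n) (z : ℂ) :
    HasDerivAt (coeffIntegral ν n w a k)
      (∫ y, deriv (fun z => (expSeries n z (w y) * a y).coeff k) z ∂ν) z := by
  obtain ⟨B, hB⟩ := (unifExp_exp_mul hδ hw ha (‖z‖ + 1)).coeff_bound k hk
  refine hasDerivAt_integral_of_holomorphic one_pos (bound := fun _ => B) (fun s _ => ?_) ?_ ?_
    (integrable_const B)
  · exact (hwc.expSeries_mul hac s k).aestronglyMeasurable
  · exact .of_forall fun y => (differentiable_coeff_expSeries_mul _ _ _).differentiableOn
  · refine .of_forall fun y s hs => ?_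
    have hs' : s ∈ Metric.closedBall (0 : ℂ) (‖z‖ + 1) := by
      rw [Metric.mem_ball, dist_eq_norm] at hs
      rw [mem_closedBall_zero_iff]
      calc ‖s‖ = ‖z + (s - z)‖ := by congr 1; ring
        _ ≤ ‖z‖ + ‖s - z‖ := norm_add_le _ _
        _ ≤ _ := by linarith
    exact hB (⟨s, hs'⟩, y)

theorem aestronglyMeasurable_collar {h : N × ℝ → ℝ} (hh : ContinuousOn h (univ ×ˢ Ioo 0 δ)) :
    AEStronglyMeasurable (fun q => (h q : ℂ)) (collarMeasure ν δ) :=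
  ContinuousOn.aestronglyMeasurable (Complex.continuous_ofReal.comp_continuousOn hh)
    (MeasurableSet.univ.prod measurableSet_Ioo)

theorem aestronglyMeasurable_cpow (z : ℂ) :
    AEStronglyMeasurable (fun q : N × ℝ => (q.2 : ℂ) ^ z) (collarMeasure ν δ) := by
  have : Measurable (fun q : N × ℝ => (q.2 : ℂ) ^ z) :=
    (Complex.measurable_ofReal.comp measurable_snd).pow_const z
  exact this.aestronglyMeasurable

theorem aestronglyMeasurable_exp_mul (hφ : ContinuousOn φ (univ ×ˢ Ioo 0 δ))
    (hF : ContinuousOn F (univ ×ˢ Ioo 0 δ)) (z : ℂ) :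
    AEStronglyMeasurable (fun q => Complex.exp (z * φ q) * F q) (collarMeasure ν δ) :=
  (Complex.continuous_exp.comp_aestronglyMeasurable
    ((aestronglyMeasurable_collar hφ).const_mul z)).mul (aestronglyMeasurable_collar hF)

theorem aestronglyMeasurable_term (hwc : ContCoeff w) (hac : ContCoeff a) (z : ℂ) (k : ℕ) :
    AEStronglyMeasurable (fun q : N × ℝ => (expSeries n z (w q.1) * a q.1).coeff k * (q.2 : ℂ) ^ k)
      (collarMeasure ν δ) := by
  refine AEStronglyMeasurable.mul ?_ ?_
  · exact ((hwc.expSeries_mul hac z k).comp continuous_fst).aestronglyMeasurable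
  · exact ((Complex.continuous_ofReal.comp continuous_snd).pow k).aestronglyMeasurable

theorem aestronglyMeasurable_remainder (hφ : ContinuousOn φ (univ ×ˢ Ioo 0 δ))
    (hF : ContinuousOn F (univ ×ˢ Ioo 0 δ)) (hwc : ContCoeff w) (hac : ContCoeff a) (z : ℂ) :
    AEStronglyMeasurable (collarRemainder n φ F w a z) (collarMeasure ν δ) :=
  (aestronglyMeasurable_cpow _).mul ((aestronglyMeasurable_exp_mul hφ hF z).sub
    (Finset.aestronglyMeasurable_fun_sum _ fun k _ => aestronglyMeasurable_term hwc hac z k))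

/-- t^(Re z − n − 1) · t^(n + 1/2) = t^(Re z − 1/2), integrable at 0 exactly when Re z > −1/2. -/
theorem exists_remainder_bound (hδ : δ ≤ 1) (hw : UnifExp n δ (fun y t => (φ (y, t) : ℂ)) w)
    (ha : UnifExp n δ (fun y t => (F (y, t) : ℂ)) a) (R : ℝ) :
    ∃ C, 0 ≤ C ∧ ∀ z : ℂ, ‖z‖ ≤ R → ∀ y, ∀ t ∈ Ioo 0 δ,
      ‖collarRemainder n φ F w a z (y, t)‖ ≤ C * t ^ (z.re - 1 / 2) := by
  obtain ⟨C, hC0, hC⟩ := (unifExp_exp_mul hδ hw ha R).exists_remainder_bound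
  refine ⟨C, hC0, fun z hz y t ht => ?_⟩
  rw [collarRemainder, norm_mul, norm_cpow_of_pos ht.1]
  have h1 := hC (⟨z, by simpa using hz⟩, y) t ht
  have h2 : t ^ (z.re - 1 / 2) = t ^ (z - n - 1 : ℂ).re * t ^ (n + 1 / 2 : ℝ) := by
    rw [← Real.rpow_add ht.1]; congr 1; simp; ring
  rw [h2]
  have h3 := mul_le_mul_of_nonneg_left h1 (Real.rpow_nonneg ht.1.le (z - n - 1 : ℂ).re)
  refine h3.trans (le_of_eq (by ring))

theorem differentiable_remainder (φ F : N × ℝ → ℝ) (w a : N → PowerSeries ℂ) {q : N × ℝ}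
    (hq : 0 < q.2) : Differentiable ℂ (fun z => collarRemainder n φ F w a z q) := by
  have hq' : (q.2 : ℂ) ≠ 0 := by exact_mod_cast hq.ne'
  unfold collarRemainder
  refine Differentiable.mul (fun z => ?_) (Differentiable.sub (by fun_prop) ?_)
  · exact DifferentiableAt.const_cpow (by fun_prop) (.inl hq')
  · exact Differentiable.fun_sum fun k _ =>
      (differentiable_coeff_expSeries_mul _ _ k).mul_const _

theorem hasDerivAt_remainderIntegral (hδ0 : 0 < δ) (hδ : δ ≤ 1)
    (hφ : ContinuousOn φ (univ ×ˢ Ioo 0 δ)) (hF : ContinuousOn F (univ ×ˢ Ioo 0 δ))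
    (hw : UnifExp n δ (fun y t => (φ (y, t) : ℂ)) w)
    (ha : UnifExp n δ (fun y t => (F (y, t) : ℂ)) a) (hwc : ContCoeff w) (hac : ContCoeff a)
    {z : ℂ} (hz : -(1 / 2) < z.re) :
    DifferentiableAt ℂ (fun z => ∫ q, collarRemainder n φ F w a z q ∂(collarMeasure ν δ)) z := by
  -- Half the distance from z to the line Re = −1/2: on the ball of radius r the exponent stays at
  -- least r − 1 > −1.
  set r := (z.re + 1 / 2) / 2 with hr
  have hr0 : 0 < r := by rw [hr]; linarith
  obtain ⟨C, hC0, hC⟩ := exists_remainder_bound hδ hw ha (‖z‖ + r)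
  refine (hasDerivAt_integral_of_holomorphic hr0 (bound := fun q => C * q.2 ^ (r - 1))
    (fun s _ => aestronglyMeasurable_remainder hφ hF hwc hac s) ?_ ?_
    (integrable_rpow_collar hδ0 (by linarith) C)).differentiableAt
  · filter_upwards [ae_collarMeasure ν δ] with q hq
    exact (differentiable_remainder φ F w a hq.1).differentiableOn
  · filter_upwards [ae_collarMeasure ν δ] with q hq s hs
    rw [Metric.mem_ball, dist_eq_norm] at hs
    have h1 : ‖s‖ ≤ ‖z‖ + r := by
      calc ‖s‖ = ‖z + (s - z)‖ := by congr 1; ring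
        _ ≤ ‖z‖ + ‖s - z‖ := norm_add_le _ _
        _ ≤ _ := by linarith
    refine (hC s h1 q.1 q.2 hq).trans (mul_le_mul_of_nonneg_left ?_ hC0)
    refine Real.rpow_le_rpow_of_exponent_ge hq.1 (hq.2.le.trans hδ) ?_
    have h2 := (Complex.abs_re_le_norm (s - z)).trans hs.le
    rw [Complex.sub_re, abs_le] at h2
    linarith [h2.1]

theorem integrable_remainder (hδ0 : 0 < δ) (hδ : δ ≤ 1)
    (hφ : ContinuousOn φ (univ ×ˢ Ioo 0 δ)) (hF : ContinuousOn F (univ ×ˢ Ioo 0 δ))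
    (hw : UnifExp n δ (fun y t => (φ (y, t) : ℂ)) w)
    (ha : UnifExp n δ (fun y t => (F (y, t) : ℂ)) a) (hwc : ContCoeff w) (hac : ContCoeff a)
    {z : ℂ} (hz : -(1 / 2) < z.re) :
    Integrable (collarRemainder n φ F w a z) (collarMeasure ν δ) := by
  obtain ⟨C, hC0, hC⟩ := exists_remainder_bound hδ hw ha ‖z‖
  exact integrable_of_norm_le_rpow hδ0 (by linarith)
    (aestronglyMeasurable_remainder hφ hF hwc hac z) (hC z le_rfl)

/-- The continued zeta function of the collar. -/
def collarZeta (ν : Measure N) (n : ℕ) (δ : ℝ) (φ F : N × ℝ → ℝ) (w a : N → PowerSeries ℂ)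
    (z : ℂ) : ℂ :=
  (∑ k ∈ Finset.range (n + 1), coeffIntegral ν n w a k z * ((δ : ℂ) ^ (z - n + k) / (z - n + k)))
    + ∫ q, collarRemainder n φ F w a z q ∂(collarMeasure ν δ)

/-- For Re z > n every power t^(z−n+k−1) is integrable on (0, δ), so the subtracted terms factor by
Fubini and can be added back explicitly. -/
theorem collarIntegrand_integral (hδ0 : 0 < δ) (hδ : δ ≤ 1)
    (hφ : ContinuousOn φ (univ ×ˢ Ioo 0 δ)) (hF : ContinuousOn F (univ ×ˢ Ioo 0 δ))
    (hw : UnifExp n δ (fun y t => (φ (y, t) : ℂ)) w)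
    (ha : UnifExp n δ (fun y t => (F (y, t) : ℂ)) a) (hwc : ContCoeff w) (hac : ContCoeff a)
    {z : ℂ} (hz : n < z.re) :
    Integrable (collarIntegrand n φ F z) (collarMeasure ν δ) ∧
      ∫ q, collarIntegrand n φ F z q ∂(collarMeasure ν δ) = collarZeta ν n δ φ F w a z := by
  have hn0 : (0 : ℝ) ≤ n := n.cast_nonneg
  have hrem := integrable_remainder (ν := ν) (n := n) hδ0 hδ hφ hF hw ha hwc hac (z := z)
    (by linarith)
  have hre : ∀ k : ℕ, 0 < (z - n + k : ℂ).re := fun k => by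
    have : (0 : ℝ) ≤ k := k.cast_nonneg
    simp; linarith
  obtain ⟨B, hB0, hB⟩ := (unifExp_exp_mul hδ hw ha ‖z‖).exists_coeff_bound
  set T : ℕ → N × ℝ → ℂ := fun k q =>
    (expSeries n z (w q.1) * a q.1).coeff k * (q.2 : ℂ) ^ (z - n + k - 1) with hT
  have hcoef : ∀ k ≤ n, Integrable (fun y => (expSeries n z (w y) * a y).coeff k) ν := by
    intro k hk
    refine (integrable_const B).mono' (hwc.expSeries_mul hac z k).aestronglyMeasurable
      (.of_forall fun y => hB k hk (⟨z, by simp⟩, y))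
  have hcp : ∀ k : ℕ, IntegrableOn (fun t : ℝ => (t : ℂ) ^ (z - n + k - 1)) (Ioo 0 δ) := by
    intro k
    refine (intervalIntegrable_iff_integrableOn_Ioo_of_le hδ0.le).1
      (intervalIntegral.intervalIntegrable_cpow' ?_)
    have := hre k
    rw [Complex.sub_re, Complex.one_re]; linarith
  have hTi : ∀ k ≤ n, Integrable (T k) (collarMeasure ν δ) := by
    intro k hk
    rw [collarMeasure_eq]
    exact (hcoef k hk).mul_prod (hcp k)
  have hTI : ∀ k ≤ n, ∫ q, T k q ∂(collarMeasure ν δ) =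
      coeffIntegral ν n w a k z * ((δ : ℂ) ^ (z - n + k) / (z - n + k)) := by
    intro k hk
    rw [collarMeasure_eq, ← integral_cpow_Ioo hδ0 (hre k), coeffIntegral]
    exact integral_prod_mul (μ := ν) (ν := volume.restrict (Ioo 0 δ))
      (fun y => (expSeries n z (w y) * a y).coeff k) (fun t : ℝ => (t : ℂ) ^ (z - n + k - 1))
  have hdec : ∀ q : N × ℝ, 0 < q.2 → collarIntegrand n φ F z q =
      (∑ k ∈ Finset.range (n + 1), T k q) + collarRemainder n φ F w a z q := by
    intro q hq
    have hq' : (q.2 : ℂ) ≠ 0 := by exact_mod_cast hq.ne'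
    have h1 : ∑ k ∈ Finset.range (n + 1), T k q = (q.2 : ℂ) ^ (z - n - 1) *
        ∑ k ∈ Finset.range (n + 1), (expSeries n z (w q.1) * a q.1).coeff k * (q.2 : ℂ) ^ k := by
      rw [Finset.mul_sum]
      refine Finset.sum_congr rfl fun k _ => ?_
      simp only [hT]
      rw [show z - n + k - 1 = (z - n - 1) + (k : ℂ) by ring, Complex.cpow_add _ _ hq',
        Complex.cpow_natCast]
      ring
    rw [h1, collarIntegrand, collarRemainder]; ring
  have hsum : Integrable (fun q => ∑ k ∈ Finset.range (n + 1), T k q) (collarMeasure ν δ) :=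
    integrable_finsetSum _ fun k hk => hTi k (by simp at hk; omega)
  have hae : (fun q => (∑ k ∈ Finset.range (n + 1), T k q) + collarRemainder n φ F w a z q)
      =ᵐ[collarMeasure ν δ] collarIntegrand n φ F z := by
    filter_upwards [ae_collarMeasure ν δ] with q hq using (hdec q hq.1).symm
  refine ⟨(hsum.add hrem).congr hae, ?_⟩
  rw [← integral_congr_ae hae, integral_add hsum hrem,
    integral_finsetSum _ fun k hk => hTi k (by simp at hk; omega), collarZeta]
  congr 1
  exact Finset.sum_congr rfl fun k hk => hTI k (by simp at hk; omega)

theorem meromorphicOn_collarZeta (hδ0 : 0 < δ) (hδ : δ ≤ 1)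
    (hφ : ContinuousOn φ (univ ×ˢ Ioo 0 δ)) (hF : ContinuousOn F (univ ×ˢ Ioo 0 δ))
    (hw : UnifExp n δ (fun y t => (φ (y, t) : ℂ)) w)
    (ha : UnifExp n δ (fun y t => (F (y, t) : ℂ)) a) (hwc : ContCoeff w) (hac : ContCoeff a) :
    MeromorphicOn (collarZeta ν n δ φ F w a) {z | -(1 / 2) < z.re} := by
  have hδ' : (δ : ℂ) ≠ 0 := by exact_mod_cast hδ0.ne'
  intro z hz
  refine MeromorphicAt.fun_add (MeromorphicAt.fun_sum fun k hk => ?_) ?_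
  · have h1 : Differentiable ℂ (coeffIntegral ν n w a k) := fun s =>
      (hasDerivAt_coeffIntegral hδ hw ha hwc hac (by simp at hk; omega) s).differentiableAt
    have h2 : Differentiable ℂ (fun z : ℂ => (δ : ℂ) ^ (z - n + k)) := fun s =>
      DifferentiableAt.const_cpow (by fun_prop) (.inl hδ')
    have h3 : Differentiable ℂ (fun z : ℂ => z - n + k) := by fun_prop
    exact (h1.analyticAt z).meromorphicAt.mul
      ((h2.analyticAt z).meromorphicAt.div (h3.analyticAt z).meromorphicAt)
  · have hopen : IsOpen {z : ℂ | -(1 / 2) < z.re} := isOpen_lt continuous_const Complex.continuous_re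
    have h1 : DifferentiableOn ℂ
        (fun z => ∫ q, collarRemainder n φ F w a z q ∂(collarMeasure ν δ))
        {z : ℂ | -(1 / 2) < z.re} := fun s hs =>
      (hasDerivAt_remainderIntegral hδ0 hδ hφ hF hw ha hwc hac hs).differentiableWithinAt
    exact (h1.analyticAt (hopen.mem_nhds hz)).meromorphicAt

/-- The part of the finite part of `collarZeta` that does not depend on `φ`. -/
def collarFinitePart (ν : Measure N) (n : ℕ) (δ : ℝ) (F : N × ℝ → ℝ) (a : N → PowerSeries ℂ) : ℂ :=
  (∑ k ∈ Finset.range n, (∫ y, (a y).coeff k ∂ν) * ((δ : ℂ) ^ (0 - n + k : ℂ) / (0 - n + k)))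
    + Complex.log δ * (∫ y, (a y).coeff n ∂ν)
    + ∫ q, (q.2 : ℂ) ^ (0 - n - 1 : ℂ) *
        (F q - ∑ k ∈ Finset.range (n + 1), (a q.1).coeff k * (q.2 : ℂ) ^ k) ∂(collarMeasure ν δ)

/-- For k < n the denominators z − n + k have no zero in |z| < 1/2. The term k = n is A(z)/z, with
value A(0) giving the residue and `dslope` its holomorphic part, equal to A′(0) at 0. Everything
else at z = 0 is independent of φ because e^(zφ) = 1 there. -/
theorem collarZeta_simplePole (hδ0 : 0 < δ) (hδ : δ ≤ 1)
    (hφ : ContinuousOn φ (univ ×ˢ Ioo 0 δ)) (hF : ContinuousOn F (univ ×ˢ Ioo 0 δ))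
    (hw : UnifExp n δ (fun y t => (φ (y, t) : ℂ)) w)
    (ha : UnifExp n δ (fun y t => (F (y, t) : ℂ)) a) (hwc : ContCoeff w) (hac : ContCoeff a) :
    ∃ B : ℂ → ℂ, DifferentiableOn ℂ B (Metric.ball 0 (1 / 2)) ∧
      (∀ z, z ≠ 0 → collarZeta ν n δ φ F w a z = (∫ y, (a y).coeff n ∂ν) / z + B z) ∧
      B 0 = (∫ y, (w y * a y).coeff n ∂ν) + collarFinitePart ν n δ F a := by
  have hδ' : (δ : ℂ) ≠ 0 := by exact_mod_cast hδ0.ne'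
  set A : ℂ → ℂ := fun z => coeffIntegral ν n w a n z * (δ : ℂ) ^ z with hA
  have hC0 : ∀ k, coeffIntegral ν n w a k 0 = ∫ y, (a y).coeff k ∂ν := fun k => by
    simp only [coeffIntegral, expSeries_zero, one_mul]
  have hCd : ∀ k ≤ n, Differentiable ℂ (coeffIntegral ν n w a k) := fun k hk s =>
    (hasDerivAt_coeffIntegral hδ hw ha hwc hac hk s).differentiableAt
  have hAd : Differentiable ℂ A := (hCd n le_rfl).mul fun s =>
    DifferentiableAt.const_cpow (by fun_prop) (.inl hδ')
  have hA0 : A 0 = ∫ y, (a y).coeff n ∂ν := by simp [hA, hC0]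
  have hA' : deriv A 0 = (∫ y, (w y * a y).coeff n ∂ν) +
      Complex.log δ * (∫ y, (a y).coeff n ∂ν) := by
    have h1 := hasDerivAt_coeffIntegral (ν := ν) hδ hw ha hwc hac (le_refl n) 0
    have h2 : HasDerivAt (fun z : ℂ => (δ : ℂ) ^ z) (Complex.log δ) 0 := by
      have := (hasDerivAt_id (0 : ℂ)).const_cpow (c := (δ : ℂ)) (.inl hδ')
      simpa using this
    refine (h1.fun_mul h2).deriv.trans ?_
    simp only [deriv_coeff_expSeries_mul, Complex.cpow_zero, hC0]
    ring
  refine ⟨fun z => (∑ k ∈ Finset.range n,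
      coeffIntegral ν n w a k z * ((δ : ℂ) ^ (z - n + k) / (z - n + k))) + dslope A 0 z
      + ∫ q, collarRemainder n φ F w a z q ∂(collarMeasure ν δ), ?_, fun z hz => ?_, ?_⟩
  · intro z hz
    have hzr : |z.re| < 1 / 2 := (Complex.abs_re_le_norm z).trans_lt (by simpa using hz)
    have hzr' := abs_lt.1 hzr
    refine DifferentiableAt.differentiableWithinAt (DifferentiableAt.fun_add
      (DifferentiableAt.fun_add (DifferentiableAt.fun_sum fun k hk => ?_) ?_) ?_)
    · have hkn : (k : ℝ) + 1 ≤ n := by exact_mod_cast Finset.mem_range.1 hk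
      have hne : z - n + k ≠ 0 := fun h => by
        have := congrArg Complex.re h
        simp at this
        linarith
      refine ((hCd k (Finset.mem_range.1 hk).le) z).mul (DifferentiableAt.div ?_ (by fun_prop) hne)
      exact DifferentiableAt.const_cpow (by fun_prop) (.inl hδ')
    · exact ((Complex.differentiableOn_dslope (Filter.univ_mem (f := 𝓝 (0 : ℂ)))).2
        hAd.differentiableOn).differentiableAt Filter.univ_mem
    · exact hasDerivAt_remainderIntegral hδ0 hδ hφ hF hw ha hwc hac (by linarith [hzr'.1])
  · beta_reduce
    rw [collarZeta, Finset.sum_range_succ, dslope_of_ne _ hz, slope_def_field]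
    simp only [sub_zero, sub_add_cancel]
    rw [hA0, hA]
    field_simp
    ring
  · simp only [dslope_same, hA', hC0, collarFinitePart]
    simp only [collarRemainder, expSeries_zero, one_mul, zero_mul, Complex.exp_zero]
    ring

end CollarZeta


/-! ### Local finiteness of the Riemannian volume -/

section LocallyFinite

variable {d : ℕ} {H : Type*} [TopologicalSpace H] {I : ModelWithCorners ℝ (Euc d) H}
  {M : Type*} [TopologicalSpace M] [ChartedSpace H M] [IsManifold I ∞ M]

theorem extChartAt_target_mem_nhds_of_interior {c : M} {u : Euc d}
    (hu : u ∈ (extChartAt I c).target) (h : (extChartAt I c).symm u ∈ I.interior M) :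
    (extChartAt I c).target ∈ 𝓝 u := by
  have h1 := (I.isInteriorPoint_iff_of_mem_atlas (n := ∞) (by simp) (chart_mem_atlas H c)
    (x := (extChartAt I c).symm u) (by simpa using (extChartAt I c).map_target hu)).1 h
  have h2 : (extChartAt I c).target ∈ 𝓝 (extChartAt I c ((extChartAt I c).symm u)) :=
    mem_interior_iff_mem_nhds.1 h1
  rwa [(extChartAt I c).right_inv hu] at h2

theorem contMDiffAt_extChartAt_symm {c : M} {u : Euc d}
    (hu : u ∈ (extChartAt I c).target) (h : (extChartAt I c).symm u ∈ I.interior M) :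
    ContMDiffAt 𝓘(ℝ, Euc d) I ∞ (extChartAt I c).symm u :=
  (contMDiffOn_extChartAt_symm c).contMDiffAt (extChartAt_target_mem_nhds_of_interior hu h)

theorem gram_comp {E₁ : Type*} [AddCommGroup E₁] [Module ℝ E₁] [TopologicalSpace E₁]
    (B : E₁ →L[ℝ] E₁ →L[ℝ] ℝ) (D : Euc d →L[ℝ] E₁) {T : Euc d →L[ℝ] Euc d}
    {J : Matrix (Fin d) (Fin d) ℝ} (hT : ∀ j, T (stdVec j) = ∑ k, J k j • stdVec k)
    (i j : Fin d) : B (D (T (stdVec i))) (D (T (stdVec j))) =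
      (J.transpose * (Matrix.of fun i j => B (D (stdVec i)) (D (stdVec j))) * J) i j := by
  rw [hT, hT]
  simp only [map_sum, map_smul, _root_.sum_apply, _root_.smul_apply, smul_eq_mul,
    Matrix.mul_apply, Matrix.transpose_apply, Matrix.of_apply, Finset.sum_mul, Finset.mul_sum]
  exact Finset.sum_congr rfl fun k _ => Finset.sum_congr rfl fun l _ => by ring

/-- Transformation of the components of a metric under a change of parametrization. -/
theorem components_comp {g : BilinField I M} {ψ : Euc d → M} {τ : Euc d → Euc d} {u : Euc d}
    {χ : Euc d → M} (hχ : χ =ᶠ[𝓝 u] ψ ∘ τ) (hψ : MDifferentiableAt 𝓘(ℝ, Euc d) I ψ (τ u))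
    (hτ : DifferentiableAt ℝ τ u) :
    (components g χ u).det = (fderiv ℝ τ u).det ^ 2 * (components g ψ (τ u)).det := by
  classical
  set J : Matrix (Fin d) (Fin d) ℝ := Matrix.of fun i j => fderiv ℝ τ u (stdVec j) i with hJ
  have hdet : J.det = (fderiv ℝ τ u).det := by
    have h1 : J = LinearMap.toMatrix (EuclideanSpace.basisFun (Fin d) ℝ).toBasis
        (EuclideanSpace.basisFun (Fin d) ℝ).toBasis (fderiv ℝ τ u : Euc d →ₗ[ℝ] Euc d) := by
      ext i j
      simp [hJ, LinearMap.toMatrix_apply, stdVec]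
    rw [h1, LinearMap.det_toMatrix]
  have h2 : HasMFDerivAt 𝓘(ℝ, Euc d) I χ u
      ((mfderiv 𝓘(ℝ, Euc d) I ψ (τ u)).comp (fderiv ℝ τ u)) :=
    (HasMFDerivAt.comp u hψ.hasMFDerivAt hτ.hasFDerivAt.hasMFDerivAt).congr_of_eventuallyEq hχ
  have hp : χ u = ψ (τ u) := hχ.self_of_nhds
  have hτ' : ∀ j, fderiv ℝ τ u (stdVec j) = ∑ k, J k j • stdVec k := fun j =>
    eq_sum_stdVec (fderiv ℝ τ u (stdVec j))
  have key : ∀ p, p = ψ (τ u) → ∀ D : Euc d →L[ℝ] Euc d, D = (show Euc d →L[ℝ] Euc d from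
      mfderiv 𝓘(ℝ, Euc d) I ψ (τ u)).comp (fderiv ℝ τ u) → ∀ i j,
      (show Euc d →L[ℝ] Euc d →L[ℝ] ℝ from g p) (D (stdVec i)) (D (stdVec j)) =
      (J.transpose * components g ψ (τ u) * J) i j := by
    rintro p rfl D rfl i j
    exact gram_comp (E₁ := TangentSpace I (ψ (τ u))) (g (ψ (τ u)))
      (mfderiv 𝓘(ℝ, Euc d) I ψ (τ u)) hτ' i j
  have h3 : components g χ u = J.transpose * components g ψ (τ u) * J := by
    ext i j
    exact key _ hp _ h2.mfderiv i j
  rw [h3, Matrix.det_mul, Matrix.det_mul, Matrix.det_transpose, hdet]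
  ring

/-- The Riemannian volume is assembled from unspecified charts. Change of variables moves the
density of any chart into the fixed chart at p₀, where it is bounded, so one neighbourhood serves
all charts. -/
theorem exists_chartVolume_bound [MeasurableSpace M] [BorelSpace M] {g : BilinField I M} {p₀ : M}
    (hp₀ : p₀ ∈ I.interior M) {C : ℝ} (hC : ∀ᶠ u in 𝓝 (extChartAt I p₀ p₀),
      |(components g (extChartAt I p₀).symm u).det| ≤ C) :
    ∃ O : Set M, IsOpen O ∧ p₀ ∈ O ∧ ∀ c, chartVolume g c O < ⊤ := by
  set c₀ := extChartAt I p₀ with hc₀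
  set u₀ := c₀ p₀ with hu₀
  have htgt : c₀.target ∈ 𝓝 u₀ := by
    refine extChartAt_target_mem_nhds_of_interior (mem_extChartAt_target p₀) ?_
    rwa [extChartAt_to_inv]
  obtain ⟨r, hr, hball⟩ := Metric.mem_nhds_iff.1 (Filter.inter_mem htgt hC)
  set O : Set M := c₀.source ∩ c₀ ⁻¹' Metric.ball u₀ r with hO
  have hOo : IsOpen O :=
    (continuousOn_extChartAt p₀).isOpen_inter_preimage (isOpen_extChartAt_source p₀)
      Metric.isOpen_ball
  have hOint : ∀ p ∈ O, p ∈ I.interior M := by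
    intro p hp
    refine (I.isInteriorPoint_iff_of_mem_atlas (n := ∞) (by simp) (chart_mem_atlas H p₀)
      (x := p) (by rw [← extChartAt_source I p₀]; exact hp.1)).2 ?_
    exact mem_interior.2 ⟨Metric.ball u₀ r, fun u hu => (hball hu).1, Metric.isOpen_ball, hp.2⟩
  refine ⟨O, hOo, ⟨mem_extChartAt_source p₀, Metric.mem_ball_self hr⟩, fun c => ?_⟩
  set e := extChartAt I c with he
  unfold chartVolume
  -- A pushforward along a map that is not a.e. measurable is zero by convention, so that case is
  -- trivial.
  by_cases hm : AEMeasurable e.symm ((volume.restrict e.target).withDensity fun u =>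
      ENNReal.ofReal (Real.sqrt (components g e.symm u).det))
  swap
  · rw [Measure.map_of_not_aemeasurable hm]; simp
  rw [Measure.map_apply_of_aemeasurable hm hOo.measurableSet, withDensity_apply']
  set A : Set (Euc d) := e.symm ⁻¹' O ∩ e.target with hA
  have hAint : ∀ u ∈ A, e.symm u ∈ I.interior M := fun u hu => hOint _ hu.1
  have hAo : IsOpen A := by
    refine isOpen_iff_mem_nhds.2 fun u hu => ?_
    have h1 := extChartAt_target_mem_nhds_of_interior hu.2 (hAint u hu)
    refine Filter.inter_mem ?_ h1
    exact (contMDiffAt_extChartAt_symm hu.2 (hAint u hu)).continuousAt.preimage_mem_nhds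
      (hOo.mem_nhds hu.1)
  set τ : Euc d → Euc d := fun u => c₀ (e.symm u) with hτ
  have hτd : ∀ u ∈ A, DifferentiableAt ℝ τ u := by
    intro u hu
    have h1 : ContMDiffAt I 𝓘(ℝ, Euc d) ∞ c₀ (e.symm u) :=
      contMDiffAt_extChartAt' (by rw [← extChartAt_source I p₀]; exact hu.1.1)
    have h2 := h1.comp u (contMDiffAt_extChartAt_symm hu.2 (hAint u hu))
    exact h2.contDiffAt.differentiableAt (by simp)
  have hinj : InjOn τ A := by
    intro u hu v hv h
    exact e.symm.injOn (by simpa using hu.2) (by simpa using hv.2) (c₀.injOn hu.1.1 hv.1.1 h)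
  have hsub : τ '' A ⊆ Metric.ball u₀ r := by
    rintro _ ⟨u, hu, rfl⟩
    exact hu.1.2
  have hdet : ∀ u ∈ A, ENNReal.ofReal (Real.sqrt (components g e.symm u).det) =
      ENNReal.ofReal |(fderiv ℝ τ u).det| *
        ENNReal.ofReal (Real.sqrt (components g c₀.symm (τ u)).det) := by
    intro u hu
    have h1 : e.symm =ᶠ[𝓝 u] c₀.symm ∘ τ := by
      filter_upwards [hAo.mem_nhds hu] with v hv
      exact (c₀.left_inv hv.1.1).symm
    have h2 : τ u ∈ c₀.target := (hball (hsub ⟨u, hu, rfl⟩)).1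
    have h3 : c₀.symm (τ u) = e.symm u := c₀.left_inv hu.1.1
    rw [components_comp h1 ((contMDiffAt_extChartAt_symm h2
      (by rw [← hc₀, h3]; exact hAint u hu)).mdifferentiableAt (by simp)) (hτd u hu),
      Real.sqrt_mul (sq_nonneg _), Real.sqrt_sq_eq_abs, ENNReal.ofReal_mul (abs_nonneg _)]
  have hOm : MeasurableSet A := hAo.measurableSet
  have h1 : ∫⁻ u in e.symm ⁻¹' O, ENNReal.ofReal (Real.sqrt (components g e.symm u).det)
      ∂(volume.restrict e.target) =
      ∫⁻ u in A, ENNReal.ofReal (Real.sqrt (components g e.symm u).det) := by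
    have hT : MeasurableSet e.target := by
      rw [he, extChartAt_target]
      exact ((chartAt H c).open_target.preimage I.continuous_symm).measurableSet.inter
        I.isClosed_range.measurableSet
    rw [Measure.restrict_restrict' hT]
  rw [h1, setLIntegral_congr_fun hOm hdet,
    ← lintegral_image_eq_lintegral_abs_det_fderiv_mul volume hOm
      (fun u hu => (hτd u hu).hasFDerivAt.hasFDerivWithinAt) hinj
      (fun v => ENNReal.ofReal (Real.sqrt (components g c₀.symm v).det))]
  calc ∫⁻ v in τ '' A, ENNReal.ofReal (Real.sqrt (components g c₀.symm v).det)
      ≤ ∫⁻ v in Metric.ball u₀ r, ENNReal.ofReal (Real.sqrt (components g c₀.symm v).det) :=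
        lintegral_mono_set hsub
    _ ≤ ∫⁻ _ in Metric.ball u₀ r, ENNReal.ofReal (Real.sqrt C) :=
        setLIntegral_mono measurable_const fun v hv =>
          ENNReal.ofReal_le_ofReal (Real.sqrt_le_sqrt ((le_abs_self _).trans (hball hv).2))
    _ = ENNReal.ofReal (Real.sqrt C) * volume (Metric.ball u₀ r) := by simp
    _ < ⊤ := ENNReal.mul_lt_top ENNReal.ofReal_lt_top measure_ball_lt_top

theorem exists_riemVolume_lt_top [MeasurableSpace M] [BorelSpace M] [CompactSpace M]
    {g : BilinField I M} {p₀ : M}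
    (hp₀ : p₀ ∈ I.interior M) {C : ℝ} (hC : ∀ᶠ u in 𝓝 (extChartAt I p₀ p₀),
      |(components g (extChartAt I p₀).symm u).det| ≤ C) :
    ∃ O ∈ 𝓝 p₀, riemVolume g O < ⊤ := by
  obtain ⟨O, hO, hp, h⟩ := exists_chartVolume_bound hp₀ hC
  refine ⟨O, hO.mem_nhds hp, ?_⟩
  unfold riemVolume
  rw [Measure.sum_apply _ hO.measurableSet, tsum_fintype]
  exact ENNReal.sum_lt_top.2 fun i _ => (Measure.restrict_apply_le _ _).trans_lt (h _)

theorem riemVolume_lt_top_of_isCompact [MeasurableSpace M] [BorelSpace M] [CompactSpace M]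
    {g : BilinField I M} {K : Set M} (hK : IsCompact K) (hKi : K ⊆ I.interior M)
    (hC : ∀ p₀ ∈ K, ∃ C, ∀ᶠ u in 𝓝 (extChartAt I p₀ p₀),
      |(components g (extChartAt I p₀).symm u).det| ≤ C) : riemVolume g K < ⊤ := by
  refine hK.measure_lt_top_of_nhdsWithin fun p hp => ?_
  obtain ⟨C, hC⟩ := hC p hp
  obtain ⟨O, hO, h⟩ := exists_riemVolume_lt_top (hKi hp) hC
  exact ⟨O, mem_nhdsWithin_of_mem_nhds hO, h⟩

theorem exists_det_bound {g : BilinField I M} {ψ : Euc d → M} {u : Euc d}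
    (h : ∀ i j, ContinuousAt (fun u => components g ψ u i j) u) :
    ∃ C, ∀ᶠ v in 𝓝 u, |(components g ψ v).det| ≤ C := by
  have h1 : ContinuousAt (fun v => |(components g ψ v).det|) u := by
    refine ContinuousAt.abs ?_
    simp only [Matrix.det_apply']
    exact tendsto_finsetSum _ fun σ _ => (tendsto_finsetProd _ fun i _ => h _ _).const_mul _
  exact ⟨_, h1.eventually_le_const (lt_add_one _)⟩

/-- The Riemannian volume is finite on compact subsets of the interior. -/
theorem IsInteriorMetric.riemVolume_lt_top [MeasurableSpace M] [BorelSpace M] [CompactSpace M]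
    {g : BilinField I M} (hg : IsInteriorMetric g) {K : Set M} (hK : IsCompact K)
    (hKi : K ⊆ I.interior M) : riemVolume g K < ⊤ := by
  refine riemVolume_lt_top_of_isCompact hK hKi fun p hp => exists_det_bound fun i j => ?_
  set e := extChartAt I p with he
  set S : Set (Euc d) := e.target ∩ e.symm ⁻¹' (I.interior M) with hS
  have hmem : e p ∈ S := ⟨mem_extChartAt_target p, by
    rw [mem_preimage, he, extChartAt_to_inv]; exact hKi hp⟩
  have hSo : IsOpen S := by
    refine isOpen_iff_mem_nhds.2 fun u hu => ?_
    refine Filter.inter_mem (extChartAt_target_mem_nhds_of_interior hu.1 hu.2) ?_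
    exact (contMDiffAt_extChartAt_symm hu.1 hu.2).continuousAt.preimage_mem_nhds
      ((I.isOpen_interior (n := ∞) (by simp)).mem_nhds hu.2)
  have h1 := continuousOn_pullback (g := g) (T := I.interior M) hg.smooth.continuousOn
    (f := e.symm) (S := S) ((contMDiffOn_extChartAt_symm p).mono inter_subset_left)
    hSo.uniqueDiffOn (fun u hu => hu.2) (stdVec i) (stdVec j)
  refine (h1.continuousAt (hSo.mem_nhds hmem)).congr ?_
  filter_upwards [hSo.mem_nhds hmem] with u hu
  rw [components, Matrix.of_apply]
  have h2 : mfderivWithin 𝓘(ℝ, Euc d) I e.symm S u = mfderiv 𝓘(ℝ, Euc d) I e.symm u :=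
    mfderivWithin_of_isOpen hSo hu
  rw [h2]

end LocallyFinite


/-! ### Densities with the same integrals over compact sets -/

section Densities

variable {X : Type*} [TopologicalSpace X] [T2Space X] [SigmaCompactSpace X] [MeasurableSpace X]
  [BorelSpace X] {lam lam' : Measure X} {S : Set X} {s : ℕ → Set X} {f₁ f₂ : X → ℝ}

theorem sigmaFinite_of_iUnion (hs : ⋃ k, s k = S) (hS : lam Sᶜ = 0) (hfin : ∀ k, lam (s k) < ⊤) :
    SigmaFinite lam := by
  refine ⟨⟨⟨fun k => s k ∪ Sᶜ, fun _ => trivial, fun k => ?_, ?_⟩⟩⟩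
  · exact (measure_union_le _ _).trans_lt (by rw [hS, add_zero]; exact hfin k)
  · rw [← iUnion_union, hs, union_compl_self]

/-- Both measures have densities with respect to their sum. On each compact piece the two integrands
against that sum have equal integrals over all compact subsets, hence agree almost everywhere; the
complement of S is null for both. -/
theorem rnDeriv_mul_ae_eq [SigmaFinite lam] [SigmaFinite lam']
    (hs : ⋃ k, s k = S) (hsc : ∀ k, IsCompact (s k)) (hS : lam Sᶜ = 0) (hS' : lam' Sᶜ = 0)
    (h₁ : ∀ k, IntegrableOn f₁ (s k) lam) (h₂ : ∀ k, IntegrableOn f₂ (s k) lam')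
    (h : ∀ K, IsCompact K → K ⊆ S → ∫ q in K, f₁ q ∂lam = ∫ q in K, f₂ q ∂lam') :
    ∀ᵐ q ∂(lam + lam'), (lam.rnDeriv (lam + lam') q).toReal * f₁ q =
      (lam'.rnDeriv (lam + lam') q).toReal * f₂ q := by
  set μ := lam + lam' with hμ
  set ρ := lam.rnDeriv μ with hρ
  set ρ' := lam'.rnDeriv μ with hρ'
  have e : lam = μ.withDensity ρ :=
    (Measure.withDensity_rnDeriv_eq _ _ (Measure.AbsolutelyContinuous.rfl.add_right _)).symm
  have e' : lam' = μ.withDensity ρ' := by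
    refine (Measure.withDensity_rnDeriv_eq _ _ ?_).symm
    rw [hμ, add_comm]
    exact Measure.AbsolutelyContinuous.rfl.add_right _
  have hρm : Measurable ρ := Measure.measurable_rnDeriv _ _
  have hρm' : Measurable ρ' := Measure.measurable_rnDeriv _ _
  have hρl : ∀ᵐ q ∂μ, ρ q < ⊤ := Measure.rnDeriv_lt_top _ _
  have hρl' : ∀ᵐ q ∂μ, ρ' q < ⊤ := Measure.rnDeriv_lt_top _ _
  have key : ∀ k, ∀ᵐ q ∂(μ.restrict (s k)), (ρ q).toReal * f₁ q - (ρ' q).toReal * f₂ q = 0 := by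
    intro k
    have hm := (hsc k).measurableSet
    have i₁ : ∀ K, MeasurableSet K → IntegrableOn f₁ K lam →
        IntegrableOn (fun q => (ρ q).toReal * f₁ q) K μ ∧
        ∫ q in K, (ρ q).toReal * f₁ q ∂μ = ∫ q in K, f₁ q ∂lam := by
      intro K hK hi
      have e1 : lam.restrict K = (μ.restrict K).withDensity ρ := by
        conv_lhs => rw [e]
        exact restrict_withDensity hK ρ
      refine ⟨?_, ?_⟩
      · rw [IntegrableOn, e1] at hi
        exact (integrable_withDensity_iff_integrable_smul' hρm (ae_restrict_of_ae hρl)).1 hi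
      · rw [e1, integral_withDensity_eq_integral_toReal_smul hρm (ae_restrict_of_ae hρl)]
        rfl
    have i₂ : ∀ K, MeasurableSet K → IntegrableOn f₂ K lam' →
        IntegrableOn (fun q => (ρ' q).toReal * f₂ q) K μ ∧
        ∫ q in K, (ρ' q).toReal * f₂ q ∂μ = ∫ q in K, f₂ q ∂lam' := by
      intro K hK hi
      have e1 : lam'.restrict K = (μ.restrict K).withDensity ρ' := by
        conv_lhs => rw [e']
        exact restrict_withDensity hK ρ'
      refine ⟨?_, ?_⟩
      · rw [IntegrableOn, e1] at hi
        exact (integrable_withDensity_iff_integrable_smul' hρm' (ae_restrict_of_ae hρl')).1 hi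
      · rw [e1, integral_withDensity_eq_integral_toReal_smul hρm' (ae_restrict_of_ae hρl')]
        rfl
    refine ae_eq_zero_of_forall_setIntegral_isCompact_eq_zero
      ((i₁ _ hm (h₁ k)).1.sub (i₂ _ hm (h₂ k)).1) fun K hK => ?_
    have hKs : IsCompact (K ∩ s k) := hK.inter (hsc k)
    rw [Measure.restrict_restrict hK.measurableSet, integral_sub]
    · rw [(i₁ _ hKs.measurableSet ((h₁ k).mono_set inter_subset_right)).2,
        (i₂ _ hKs.measurableSet ((h₂ k).mono_set inter_subset_right)).2,
        h _ hKs (inter_subset_right.trans (hs ▸ subset_iUnion s k)), sub_self]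
    · exact (i₁ _ hKs.measurableSet ((h₁ k).mono_set inter_subset_right)).1
    · exact (i₂ _ hKs.measurableSet ((h₂ k).mono_set inter_subset_right)).1
  have h0 : ∀ᵐ q ∂μ, q ∈ S := by
    rw [ae_iff]
    change μ Sᶜ = 0
    rw [hμ, Measure.add_apply, hS, hS', add_zero]
  have h1 : ∀ᵐ q ∂(μ.restrict S), (ρ q).toReal * f₁ q - (ρ' q).toReal * f₂ q = 0 := by
    rw [← hs]
    exact (ae_restrict_iUnion_iff _ _).2 key
  have h2 : ∀ᵐ q ∂μ, q ∈ S → (ρ q).toReal * f₁ q - (ρ' q).toReal * f₂ q = 0 := by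
    refine (ae_restrict_iff' ?_).1 h1
    rw [← hs]
    exact MeasurableSet.iUnion fun k => (hsc k).measurableSet
  filter_upwards [h0, h2] with q hq hq2
  exact sub_eq_zero.1 (hq2 hq)

/-- Once the densities agree almost everywhere, multiplication by any G keeps them equal, so
integrability passes from one side to the other along with the value. -/
theorem integral_mul_eq_of_densities [SigmaFinite lam] [SigmaFinite lam']
    (h : ∀ᵐ q ∂(lam + lam'), (lam.rnDeriv (lam + lam') q).toReal * f₁ q =
      (lam'.rnDeriv (lam + lam') q).toReal * f₂ q) {G : X → ℂ}
    (hG : Integrable (fun q => G q * f₂ q) lam') :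
    Integrable (fun q => G q * f₁ q) lam ∧
      ∫ q, G q * f₁ q ∂lam = ∫ q, G q * f₂ q ∂lam' := by
  set μ := lam + lam' with hμ
  set ρ := lam.rnDeriv μ with hρ
  set ρ' := lam'.rnDeriv μ with hρ'
  have e : lam = μ.withDensity ρ :=
    (Measure.withDensity_rnDeriv_eq _ _ (Measure.AbsolutelyContinuous.rfl.add_right _)).symm
  have e' : lam' = μ.withDensity ρ' := by
    refine (Measure.withDensity_rnDeriv_eq _ _ ?_).symm
    rw [hμ, add_comm]
    exact Measure.AbsolutelyContinuous.rfl.add_right _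
  have hρm : Measurable ρ := Measure.measurable_rnDeriv _ _
  have hρm' : Measurable ρ' := Measure.measurable_rnDeriv _ _
  have hρl : ∀ᵐ q ∂μ, ρ q < ⊤ := Measure.rnDeriv_lt_top _ _
  have hρl' : ∀ᵐ q ∂μ, ρ' q < ⊤ := Measure.rnDeriv_lt_top _ _
  have h1 : (fun q => (ρ q).toReal • (G q * f₁ q)) =ᵐ[μ]
      fun q => (ρ' q).toReal • (G q * f₂ q) := by
    filter_upwards [h] with q hq
    have hq' : ((ρ q).toReal : ℂ) * f₁ q = (ρ' q).toReal * f₂ q := by exact_mod_cast hq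
    rw [Complex.real_smul, Complex.real_smul, mul_left_comm, hq', mul_left_comm]
  constructor
  · rw [e', integrable_withDensity_iff_integrable_smul' hρm' hρl'] at hG
    rw [e, integrable_withDensity_iff_integrable_smul' hρm hρl]
    exact hG.congr h1.symm
  · conv_lhs => rw [e]
    conv_rhs => rw [e']
    rw [integral_withDensity_eq_integral_toReal_smul hρm hρl,
      integral_withDensity_eq_integral_toReal_smul hρm' hρl']
    exact integral_congr_ae h1

end Densities


/-! ### Transport of densities through the collar. -/

section Transport

variable {X : Type*} [TopologicalSpace X] [T2Space X] [SigmaCompactSpace X] [MeasurableSpace X]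
  [BorelSpace X] {lam' : Measure X} {S : Set X} {s : ℕ → Set X}
  {M : Type*} [TopologicalSpace M] [T2Space M] [MeasurableSpace M] [BorelSpace M]
  {vol : Measure M} {Φ : X → M} {Ψ : M → X} {f : M → ℝ} {f' : X → ℝ}

/-- If the density `f dvol` corresponds to the density `f' dlam'` on compact sets, then it does so
for arbitrary integrands. -/
theorem setIntegral_image_eq (hΦ : ContinuousOn Φ S) (hΨ : ContinuousOn Ψ (Φ '' S))
    (hV : MeasurableSet (Φ '' S)) (hL : LeftInvOn Ψ Φ S) (hs : ⋃ k, s k = S)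
    (hsc : ∀ k, IsCompact (s k)) (hvol : ∀ k, vol (Φ '' s k) < ⊤) [IsFiniteMeasure lam']
    (hS' : lam' Sᶜ = 0) (hf : ContinuousOn f (Φ '' S)) (hf' : ContinuousOn f' S)
    (h : ∀ K, IsCompact K → K ⊆ S → ∫ p in Φ '' K, f p ∂vol = ∫ q in K, f' q ∂lam')
    {D : Set X} (hD : D ⊆ S) (hDm : MeasurableSet D) (hDm' : MeasurableSet (Φ '' D)) {g : M → ℂ}
    (hg : IntegrableOn (fun q => g (Φ q) * f' q) D lam') :
    IntegrableOn (fun p => g p * f p) (Φ '' D) vol ∧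
      ∫ p in Φ '' D, g p * f p ∂vol = ∫ q in D, g (Φ q) * f' q ∂lam' := by
  set V := Φ '' S with hVdef
  have hSm : MeasurableSet S := hs ▸ MeasurableSet.iUnion fun k => (hsc k).measurableSet
  have hsS : ∀ k, s k ⊆ S := fun k => hs ▸ subset_iUnion s k
  have hpre : ∀ K ⊆ S, Ψ ⁻¹' K ∩ V = Φ '' K := by
    intro K hK
    ext p
    constructor
    · rintro ⟨hp, q, hq, rfl⟩
      rw [mem_preimage, hL hq] at hp
      exact ⟨q, hp, rfl⟩
    · rintro ⟨q, hq, rfl⟩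
      exact ⟨by rw [mem_preimage, hL (hK hq)]; exact hq, q, hK hq, rfl⟩
  have hΨm : AEMeasurable Ψ (vol.restrict V) := hΨ.aemeasurable hV
  -- The volume pulled back to S through the inverse of Φ. It is only σ-finite, while the reference
  -- measure is finite.
  set lam := (vol.restrict V).map Ψ with hlam
  have hlam_apply : ∀ K ⊆ S, MeasurableSet K → lam K = vol (Φ '' K) := by
    intro K hK hKm
    rw [hlam, Measure.map_apply_of_aemeasurable hΨm hKm, Measure.restrict_apply' hV, hpre K hK]
  have hS : lam Sᶜ = 0 := by
    rw [hlam, Measure.map_apply_of_aemeasurable hΨm hSm.compl, Measure.restrict_apply' hV]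
    convert measure_empty (μ := vol)
    ext p
    simp only [mem_inter_iff, mem_preimage, mem_compl_iff, mem_empty_iff_false, iff_false, not_and]
    rintro hp ⟨q, hq, rfl⟩
    exact hp (by rwa [hL hq])
  have hlamS : lam.restrict S = lam := by
    refine Measure.restrict_eq_self_of_ae_mem ?_
    rw [ae_iff]
    exact hS
  have hfin : ∀ k, lam (s k) < ⊤ := fun k => by
    rw [hlam_apply _ (hsS k) (hsc k).measurableSet]; exact hvol k
  have : SigmaFinite lam := sigmaFinite_of_iUnion hs hS hfin
  have hfΦ : ContinuousOn (fun q => f (Φ q)) S := hf.comp hΦ (mapsTo_image _ _)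
  have hfm : AEStronglyMeasurable (fun q => f (Φ q)) lam := by
    rw [← hlamS]; exact hfΦ.aestronglyMeasurable hSm
  have hcomp : ∀ K, IsCompact K → K ⊆ S → ∫ q in K, f (Φ q) ∂lam = ∫ q in K, f' q ∂lam' := by
    intro K hK hKS
    rw [← h K hK hKS, hlam, setIntegral_map hK.measurableSet hfm hΨm,
      Measure.restrict_restrict' hV, hpre K hKS]
    refine setIntegral_congr_fun ?_ ?_
    · exact (hK.image_of_continuousOn (hΦ.mono hKS)).measurableSet
    · rintro _ ⟨q, hq, rfl⟩
      change f (Φ (Ψ (Φ q))) = _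
      rw [hL (hKS hq)]
  have hae := rnDeriv_mul_ae_eq (lam := lam) (lam' := lam') hs hsc hS hS'
    (fun k => (hfΦ.mono (hsS k)).integrableOn_of_subset_isCompact (hsc k)
      (hsc k).measurableSet subset_rfl (hfin k).ne)
    (fun k => (hf'.mono (hsS k)).integrableOn_of_subset_isCompact (hsc k)
      (hsc k).measurableSet subset_rfl (measure_ne_top _ _)) hcomp
  -- The integrand is cut off to D at this point because the comparison lemma works on the whole
  -- space.
  have hG : (fun q => D.indicator (fun q => g (Φ q)) q * (f' q : ℂ)) =
      D.indicator fun q => g (Φ q) * f' q := by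
    ext q; simp [indicator]
  obtain ⟨h1, h2⟩ := integral_mul_eq_of_densities hae
    (G := D.indicator fun q => g (Φ q)) (by rw [hG]; exact (integrable_indicator_iff hDm).2 hg)
  rw [hG, integral_indicator hDm] at h2
  have hE : (fun p => D.indicator (fun q => g (Φ q)) (Ψ p) * (f (Φ (Ψ p)) : ℂ))
      =ᵐ[vol.restrict V] (Φ '' D).indicator fun p => g p * f p := by
    filter_upwards [ae_restrict_mem hV] with p hp
    obtain ⟨q, hq, rfl⟩ := hp
    rw [hL hq]
    by_cases hqD : q ∈ D
    · rw [indicator_of_mem hqD, indicator_of_mem (mem_image_of_mem _ hqD)]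
    · rw [indicator_of_notMem hqD, indicator_of_notMem, zero_mul]
      rintro ⟨q', hq', he⟩
      exact hqD (hL.injOn (hD hq') hq he ▸ hq')
  have hDV : Φ '' D ∩ V = Φ '' D := inter_eq_left.2 (image_mono hD)
  constructor
  · have h3 := (h1.comp_aemeasurable hΨm).congr hE
    rw [integrable_indicator_iff hDm', IntegrableOn, Measure.restrict_restrict hDm', hDV] at h3
    exact h3
  · rw [← h2, hlam, integral_map hΨm h1.1, integral_congr_ae hE, integral_indicator hDm',
      Measure.restrict_restrict hDm', hDV]

end Transport

/-! ### The density in the collar -/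

section CollarDensity

variable {M : Type*} [TopologicalSpace M] [T2Space M] [CompactSpace M]
  [ChartedSpace (EuclideanHalfSpace (n + 1)) M] [IsManifold (𝓡∂ (n + 1)) ∞ M]
  [MeasurableSpace M] [BorelSpace M]
  {N : Type*} [TopologicalSpace N] [T2Space N] [CompactSpace N]
  [ChartedSpace (Euc n) N] [IsManifold (𝓡 n) ∞ N] [MeasurableSpace N] [BorelSpace N]
  {g : BilinField (𝓡∂ (n + 1)) M} {gbar : ContMetric n M} {x : M → ℝ} {ε : ℝ} {Φ : N × ℝ → M}

theorem IsGeodesicCollar.isFiniteMeasure (hΦ : IsGeodesicCollar gbar x ε Φ) :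
    IsFiniteMeasure (riemVolume (sliceMetric gbar Φ 0)) := by
  refine ⟨riemVolume_lt_top_of_isCompact isCompact_univ ?_ fun y₀ _ => ?_⟩
  · rw [ModelWithCorners.interior_eq_univ]
  · refine exists_det_bound fun i j => ?_
    have h1 : ContinuousOn (fun u : Euc n => ((u, 0) : Euc n × ℝ)) (extChartAt (𝓡 n) y₀).target := by
      fun_prop
    exact ((hΦ.continuousOn_components_slice y₀ i j).comp h1
      fun u hu => ⟨hu, le_rfl, hΦ.pos⟩).continuousAt
      ((isOpen_extChartAt_target y₀).mem_nhds (mem_extChartAt_target y₀))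

theorem IsGeodesicCollar.mem_image_iff (hΦ : IsGeodesicCollar gbar x ε Φ) {δ : ℝ} (hδ : δ ≤ ε)
    {T : Set ℝ} (hT : T ⊆ Ico 0 δ) {p : M} :
    p ∈ Φ '' (univ ×ˢ T) ↔ p ∈ Φ '' (univ ×ˢ Ico 0 ε) ∧ x p ∈ T := by
  have hT' : T ⊆ Ico 0 ε := hT.trans (Ico_subset_Ico_right hδ)
  constructor
  · rintro ⟨⟨y, t⟩, ⟨-, ht⟩, rfl⟩
    exact ⟨⟨(y, t), ⟨mem_univ _, hT' ht⟩, rfl⟩, by rw [hΦ.x_eq y t (hT' ht)]; exact ht⟩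
  · rintro ⟨⟨⟨y, t⟩, ⟨-, ht⟩, rfl⟩, h⟩
    rw [hΦ.x_eq y t ht] at h
    exact ⟨(y, t), ⟨mem_univ _, h⟩, rfl⟩

theorem IsGeodesicCollar.isOpen_image_Ioo (hΦ : IsGeodesicCollar gbar x ε Φ)
    (hx : IsBdf (𝓡∂ (n + 1)) x) {δ : ℝ} (hδ : δ ≤ ε) : IsOpen (Φ '' (univ ×ˢ Ioo 0 δ)) := by
  have : Φ '' (univ ×ˢ Ioo 0 δ) = Φ '' (univ ×ˢ Ico 0 ε) ∩ x ⁻¹' Ioo 0 δ := by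
    ext p; exact hΦ.mem_image_iff hδ Ioo_subset_Ico_self
  rw [this]
  exact hΦ.isOpen_image.inter (isOpen_Ioo.preimage hx.smooth.continuous)

theorem IsGeodesicCollar.isOpen_image_Ico (hΦ : IsGeodesicCollar gbar x ε Φ)
    (hx : IsBdf (𝓡∂ (n + 1)) x) {δ : ℝ} (hδ : δ ≤ ε) : IsOpen (Φ '' (univ ×ˢ Ico 0 δ)) := by
  have : Φ '' (univ ×ˢ Ico 0 δ) = Φ '' (univ ×ˢ Ico 0 ε) ∩ x ⁻¹' Iio δ := by
    ext p
    rw [hΦ.mem_image_iff hδ subset_rfl]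
    refine and_congr_right fun _ => ?_
    simp [hx.nonneg p]
  rw [this]
  exact hΦ.isOpen_image.inter (isOpen_Iio.preimage hx.smooth.continuous)

/-- Promotes the identity of integrals over compact sets to integrands singular at the boundary,
such as x^z f. The transport is done on the full collar (0, ε) and then restricted to (0, δ). -/
theorem IsDensityForm.setIntegral_collar {f : M → ℝ} {F : N × ℝ → ℝ}
    (hμ : IsDensityForm g gbar ε Φ f F) (hΦ : IsGeodesicCollar gbar x ε Φ)
    (hx : IsBdf (𝓡∂ (n + 1)) x) (hg : IsInteriorMetric g)
    (hf : ContinuousOn f ((𝓡∂ (n + 1)).interior M)) (hF : ContinuousOn F (univ ×ˢ Ioo 0 ε))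
    {δ : ℝ} (hδ : δ ≤ ε) {h : M → ℂ}
    (hh : Integrable (fun q => h (Φ q) * ((F q / q.2 ^ (n + 1) : ℝ) : ℂ))
      (collarMeasure (riemVolume (sliceMetric gbar Φ 0)) δ)) :
    IntegrableOn (fun p => h p * f p) (Φ '' (univ ×ˢ Ioo 0 δ)) (riemVolume g) ∧
      ∫ p in Φ '' (univ ×ˢ Ioo 0 δ), h p * f p ∂(riemVolume g) =
        ∫ q, h (Φ q) * ((F q / q.2 ^ (n + 1) : ℝ) : ℂ)
          ∂(collarMeasure (riemVolume (sliceMetric gbar Φ 0)) δ) := by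
  set ν := riemVolume (sliceMetric gbar Φ 0) with hν
  have : IsFiniteMeasure ν := hΦ.isFiniteMeasure
  have : SecondCountableTopology N := ChartedSpace.secondCountable_of_sigmaCompact (Euc n) N
  have hfin : IsFiniteMeasure (collarMeasure ν ε) := by rw [collarMeasure_eq]; infer_instance
  obtain ⟨Ψ, hΨ, hL⟩ := hΦ.smooth_inverse
  have hsub : (univ : Set N) ×ˢ Ioo 0 ε ⊆ univ ×ˢ Ico 0 ε := Set.prod_mono le_rfl Ioo_subset_Ico_self
  have hDS : (univ : Set N) ×ˢ Ioo 0 δ ⊆ univ ×ˢ Ioo 0 ε :=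
    Set.prod_mono le_rfl (Ioo_subset_Ioo_right hδ)
  have hint : Φ '' (univ ×ˢ Ioo 0 ε) ⊆ (𝓡∂ (n + 1)).interior M := by
    rintro _ ⟨⟨y, t⟩, ⟨-, ht⟩, rfl⟩
    exact hΦ.collarMap_interior hx y ht
  have hmS : MeasurableSet ((univ : Set N) ×ˢ Ioo 0 ε) := MeasurableSet.univ.prod measurableSet_Ioo
  have hmD : MeasurableSet ((univ : Set N) ×ˢ Ioo 0 δ) := MeasurableSet.univ.prod measurableSet_Ioo
  -- A compact exhaustion of N × (0, ε) that avoids both ends, where the volume of M may be infinite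
  -- or the collar map uncontrolled.
  set s : ℕ → Set (N × ℝ) := fun k =>
    univ ×ˢ Icc (ε / (k + 2)) (ε - ε / (k + 2)) with hsdef
  have hε := hΦ.pos
  have hsS : ∀ k, s k ⊆ univ ×ˢ Ioo 0 ε := fun k => by
    have : 0 < ε / (k + 2) := by positivity
    exact Set.prod_mono le_rfl fun t ht => ⟨this.trans_le ht.1, ht.2.trans_lt (by linarith)⟩
  have hs : ⋃ k, s k = univ ×ˢ Ioo 0 ε := by
    refine subset_antisymm (iUnion_subset hsS) fun q hq => ?_
    have ht := hq.2
    have hm : 0 < min q.2 (ε - q.2) := lt_min ht.1 (by linarith [ht.2])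
    obtain ⟨k, hk⟩ := exists_nat_gt (ε / min q.2 (ε - q.2))
    have h1 : ε / (k + 2) ≤ min q.2 (ε - q.2) := by
      rw [div_lt_iff₀ hm] at hk
      rw [div_le_iff₀ (by positivity)]
      nlinarith
    exact mem_iUnion.2 ⟨k, mem_univ _, h1.trans (min_le_left _ _),
      by linarith [min_le_right q.2 (ε - q.2)]⟩
  have hsc : ∀ k, IsCompact (s k) := fun k => isCompact_univ.prod isCompact_Icc
  have hrestr : ∀ K : Set (N × ℝ), K ⊆ univ ×ˢ Ioo 0 ε →
      (collarMeasure ν ε).restrict K = (ν.prod volume).restrict K := fun K hK => by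
    rw [collarMeasure, Measure.restrict_restrict' hmS, inter_eq_left.2 hK]
  have hΦc : ContinuousOn Φ (univ ×ˢ Ioo 0 ε) := hΦ.smooth.continuousOn.mono hsub
  have key := setIntegral_image_eq (vol := riemVolume g) (lam' := collarMeasure ν ε) (s := s)
    (f' := fun q => F q / q.2 ^ (n + 1)) (f := f) (g := h)
    hΦc (hΨ.continuousOn.mono (image_mono hsub))
    (hΦ.isOpen_image_Ioo hx le_rfl).measurableSet (hL.mono hsub) hs hsc
    (fun k => hg.riemVolume_lt_top ((hsc k).image_of_continuousOn (hΦc.mono (hsS k)))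
      ((image_mono (hsS k)).trans hint))
    (by
      rw [collarMeasure, Measure.restrict_apply hmS.compl, compl_inter_self, measure_empty])
    (hf.mono hint)
    (hF.div (by fun_prop) fun q hq => pow_ne_zero _ hq.2.1.ne')
    (fun K hK hKS => by rw [hμ K hK hKS, hrestr K hKS]) hDS hmD
    (hΦ.isOpen_image_Ioo hx hδ).measurableSet
  rw [IntegrableOn, hrestr _ hDS] at key
  exact key hh

end CollarDensity


/-! ### Zeta functions on compact sets -/

section CompactPart

variable {M : Type*} [TopologicalSpace M] [T2Space M] [MeasurableSpace M] [BorelSpace M]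
  {vol : Measure M} {K : Set M} {x f : M → ℝ}

theorem continuousOn_zetaIntegrand (hx : ContinuousOn x K) (hx0 : ∀ p ∈ K, 0 < x p)
    (hf : ContinuousOn f K) (z : ℂ) : ContinuousOn (zetaIntegrand x f z) K := by
  refine ContinuousOn.mul (ContinuousOn.cpow (Complex.continuous_ofReal.comp_continuousOn hx)
    continuousOn_const fun p hp => ?_) (Complex.continuous_ofReal.comp_continuousOn hf)
  exact Complex.ofReal_mem_slitPlane.2 (hx0 p hp)

theorem integrableOn_zetaIntegrand (hK : IsCompact K) (hvol : vol K < ⊤) (hx : ContinuousOn x K)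
    (hx0 : ∀ p ∈ K, 0 < x p) (hf : ContinuousOn f K) (z : ℂ) :
    IntegrableOn (zetaIntegrand x f z) K vol :=
  (continuousOn_zetaIntegrand hx hx0 hf z).integrableOn_of_subset_isCompact hK
    hK.measurableSet subset_rfl hvol.ne

theorem differentiable_compactZeta (hK : IsCompact K) (hvol : vol K < ⊤) (hx : ContinuousOn x K)
    (hx0 : ∀ p ∈ K, 0 < x p) (hf : ContinuousOn f K) :
    Differentiable ℂ fun z => ∫ p in K, zetaIntegrand x f z p ∂vol := by
  intro z
  have hlog : ContinuousOn (fun p => Real.log (x p)) K := hx.log fun p hp => (hx0 p hp).ne'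
  obtain ⟨L, hL⟩ := hK.exists_bound_of_continuousOn hlog
  obtain ⟨B, hB⟩ := hK.exists_bound_of_continuousOn hf
  have : IsFiniteMeasure (vol.restrict K) := ⟨by rwa [Measure.restrict_apply_univ]⟩
  refine (hasDerivAt_integral_of_holomorphic one_pos
    (bound := fun _ => Real.exp (L * (‖z‖ + 1)) * B)
    (fun s _ => (continuousOn_zetaIntegrand hx hx0 hf s).aestronglyMeasurable_of_isCompact hK
      hK.measurableSet) ?_ ?_ (integrable_const _)).differentiableAt
  · filter_upwards [ae_restrict_mem hK.measurableSet] with p hp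
    refine Differentiable.differentiableOn fun s => ?_
    refine DifferentiableAt.mul_const (DifferentiableAt.const_cpow differentiableAt_id (.inl ?_)) _
    exact_mod_cast (hx0 p hp).ne'
  · filter_upwards [ae_restrict_mem hK.measurableSet] with p hp s hs
    rw [zetaIntegrand, norm_mul, norm_cpow_of_pos (hx0 p hp), Complex.norm_real]
    refine mul_le_mul ?_ (hB p hp) (norm_nonneg _) (Real.exp_pos _).le
    rw [Real.rpow_def_of_pos (hx0 p hp)]
    refine Real.exp_le_exp.2 ?_
    have h1 : |s.re| ≤ ‖z‖ + 1 := by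
      refine (Complex.abs_re_le_norm s).trans ?_
      rw [Metric.mem_ball, dist_eq_norm] at hs
      have := norm_sub_norm_le s z
      linarith
    calc Real.log (x p) * s.re ≤ |Real.log (x p) * s.re| := le_abs_self _
      _ = |Real.log (x p)| * |s.re| := abs_mul _ _
      _ ≤ L * (‖z‖ + 1) := mul_le_mul (hL p hp) h1 (abs_nonneg _)
          ((norm_nonneg _).trans (hL p hp))

end CompactPart

/-! ### The zeta function of the density -/

section Zeta

variable {M : Type*} [TopologicalSpace M] [T2Space M] [CompactSpace M]
  [ChartedSpace (EuclideanHalfSpace (n + 1)) M] [IsManifold (𝓡∂ (n + 1)) ∞ M]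
  [MeasurableSpace M] [BorelSpace M]
  {N : Type*} [TopologicalSpace N] [T2Space N] [CompactSpace N]
  [ChartedSpace (Euc n) N] [IsManifold (𝓡 n) ∞ N] [MeasurableSpace N] [BorelSpace N]
  {g : BilinField (𝓡∂ (n + 1)) M} {gbar : ContMetric n M} {x : M → ℝ} {ε : ℝ} {Φ : N × ℝ → M}

/-- The complement of a collar. -/
def collarCompl (Φ : N × ℝ → M) (δ : ℝ) : Set M := (Φ '' (univ ×ˢ Ico 0 δ))ᶜ

theorem IsGeodesicCollar.isCompact_collarCompl (hΦ : IsGeodesicCollar gbar x ε Φ)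
    (hx : IsBdf (𝓡∂ (n + 1)) x) {δ : ℝ} (hδ : δ ≤ ε) : IsCompact (collarCompl Φ δ) :=
  (hΦ.isOpen_image_Ico hx hδ).isClosed_compl.isCompact

theorem IsGeodesicCollar.collarCompl_subset (hΦ : IsGeodesicCollar gbar x ε Φ) {δ : ℝ}
    (hδ : 0 < δ) : collarCompl Φ δ ⊆ (𝓡∂ (n + 1)).interior M := by
  rw [← ModelWithCorners.compl_boundary, ← hΦ.image_zero]
  refine compl_subset_compl.2 (image_mono (Set.prod_mono le_rfl ?_))
  rintro _ rfl
  exact ⟨le_rfl, hδ⟩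

theorem IsGeodesicCollar.disjoint_collarCompl (Φ : N × ℝ → M) (δ : ℝ) :
    Disjoint (Φ '' (univ ×ˢ Ioo 0 δ)) (collarCompl Φ δ) :=
  disjoint_compl_right.mono_left (image_mono (Set.prod_mono le_rfl Ioo_subset_Ico_self))

theorem IsGeodesicCollar.interior_eq (hΦ : IsGeodesicCollar gbar x ε Φ)
    (hx : IsBdf (𝓡∂ (n + 1)) x) {δ : ℝ} (hδ0 : 0 < δ) (hδ : δ ≤ ε) :
    (𝓡∂ (n + 1)).interior M = Φ '' (univ ×ˢ Ioo 0 δ) ∪ collarCompl Φ δ := by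
  refine subset_antisymm (fun p hp => ?_) (union_subset ?_ (hΦ.collarCompl_subset hδ0))
  · by_cases h : p ∈ Φ '' (univ ×ˢ Ico 0 δ)
    · obtain ⟨⟨y, t⟩, ⟨-, ht⟩, rfl⟩ := h
      rcases ht.1.eq_or_lt with h0 | h0
      · rw [← ModelWithCorners.compl_boundary, ← hΦ.image_zero] at hp
        exact absurd ⟨(y, t), ⟨mem_univ _, h0.symm⟩, rfl⟩ hp
      · exact .inl ⟨(y, t), ⟨mem_univ _, h0, ht.2⟩, rfl⟩
    · exact .inr h
  · rintro _ ⟨⟨y, t⟩, ⟨-, ht⟩, rfl⟩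
    exact hΦ.collarMap_interior hx y ⟨ht.1, ht.2.trans_le hδ⟩

/-- The zeta function of a density with an expansion in powers of `t`, up to order `t^(n+1)`,
in the collar. -/
theorem IsDensityForm.zeta {f : M → ℝ} {F : N × ℝ → ℝ}
    (hμ : IsDensityForm g gbar ε Φ f F) (hΦ : IsGeodesicCollar gbar x ε Φ)
    (hx : IsBdf (𝓡∂ (n + 1)) x) (hg : IsInteriorMetric g)
    (hf : ContinuousOn f ((𝓡∂ (n + 1)).interior M)) (hF : ContinuousOn F (univ ×ˢ Ioo 0 ε))
    {δ : ℝ} (hδ0 : 0 < δ) (hδ : δ ≤ ε) (hδ1 : δ ≤ 1) {a : N → PowerSeries ℂ}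
    (ha : UnifExp n δ (fun y t => (F (y, t) : ℂ)) a) (hac : ContCoeff a)
    {x' : M → ℝ} (hx' : ContinuousOn x' ((𝓡∂ (n + 1)).interior M))
    (hx'0 : ∀ p ∈ (𝓡∂ (n + 1)).interior M, 0 < x' p)
    {φ : N × ℝ → ℝ} (hφ : ContinuousOn φ (univ ×ˢ Ioo 0 δ))
    (hφx : ∀ y, ∀ t ∈ Ioo 0 δ, x' (Φ (y, t)) = t * Real.exp (φ (y, t)))
    {w : N → PowerSeries ℂ} (hw : UnifExp n δ (fun y t => (φ (y, t) : ℂ)) w) (hwc : ContCoeff w) :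
    HasZetaContinuation (𝓡∂ (n + 1)) (riemVolume g) x' f ∧
    rieszResidue (𝓡∂ (n + 1)) (riemVolume g) x' f =
      ∫ y, (a y).coeff n ∂(riemVolume (sliceMetric gbar Φ 0)) ∧
    rieszIntegral (𝓡∂ (n + 1)) (riemVolume g) x' f =
      (∫ y, (w y * a y).coeff n ∂(riemVolume (sliceMetric gbar Φ 0))) +
        (collarFinitePart (riemVolume (sliceMetric gbar Φ 0)) n δ F a +
          ∫ p in collarCompl Φ δ, (f p : ℂ) ∂(riemVolume g)) := by
  set ν := riemVolume (sliceMetric gbar Φ 0) with hν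
  have : IsFiniteMeasure ν := hΦ.isFiniteMeasure
  have hFδ : ContinuousOn F (univ ×ˢ Ioo 0 δ) :=
    hF.mono (Set.prod_mono le_rfl (Ioo_subset_Ioo_right hδ))
  set K := collarCompl Φ δ with hK
  have hKc : IsCompact K := hΦ.isCompact_collarCompl hx hδ
  have hKi : K ⊆ (𝓡∂ (n + 1)).interior M := hΦ.collarCompl_subset hδ0
  have hvol := hg.riemVolume_lt_top hKc hKi
  have hKd := differentiable_compactZeta hKc hvol (hx'.mono hKi) (fun p hp => hx'0 p (hKi hp))
    (hf.mono hKi)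
  have hZ : IsZetaContinuation (𝓡∂ (n + 1)) (riemVolume g) x' f fun z =>
      collarZeta ν n δ φ F w a z + ∫ p in K, zetaIntegrand x' f z p ∂(riemVolume g) := by
    refine ⟨⟨1 / 2, by norm_num, ?_⟩, n, fun z hz => ?_⟩
    · refine MeromorphicOn.fun_add (meromorphicOn_collarZeta hδ0 hδ1 hφ hFδ hw ha hwc hac) ?_
      exact fun z _ => (hKd.analyticAt z).meromorphicAt
    · obtain ⟨h1, h2⟩ := collarIntegrand_integral (ν := ν) hδ0 hδ1 hφ hFδ hw ha hwc hac hz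
      -- (t e^φ)^z = t^z e^(zφ) as both factors are positive, and the division by t^(n+1) shifts the
      -- exponent.
      have h3 : collarIntegrand n φ F z =ᵐ[collarMeasure ν δ]
          fun q => (x' (Φ q) : ℂ) ^ z * ((F q / q.2 ^ (n + 1) : ℝ) : ℂ) := by
        filter_upwards [ae_collarMeasure ν δ] with q hq
        have hq0 : (q.2 : ℂ) ≠ 0 := by exact_mod_cast hq.1.ne'
        rw [hφx q.1 q.2 hq, collarIntegrand, Complex.ofReal_mul,
          Complex.mul_cpow_ofReal_nonneg hq.1.le (Real.exp_pos _).le,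
          Complex.ofReal_exp, Complex.cpow_def_of_ne_zero (Complex.exp_ne_zero _),
          ← Complex.ofReal_exp, ← Complex.ofReal_log (Real.exp_pos _).le, Real.log_exp,
          sub_sub, Complex.cpow_sub _ _ hq0]
        push_cast
        rw [show (n + 1 : ℂ) = ((n + 1 : ℕ) : ℂ) by push_cast; ring, Complex.cpow_natCast,
          mul_comm z]
        ring
      obtain ⟨h4, h5⟩ := hμ.setIntegral_collar hΦ hx hg hf hF hδ (h := fun p => (x' p : ℂ) ^ z)
        (h1.congr h3)
      have h6 := integrableOn_zetaIntegrand hKc hvol (hx'.mono hKi)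
        (fun p hp => hx'0 p (hKi hp)) (hf.mono hKi) z
      rw [hΦ.interior_eq hx hδ0 hδ]
      refine ⟨IntegrableOn.union h4 h6, ?_⟩
      refine Eq.trans ?_ (setIntegral_union (IsGeodesicCollar.disjoint_collarCompl Φ δ)
        hKc.measurableSet h4 h6).symm
      dsimp only
      rw [← h2, integral_congr_ae h3, ← h5]
      rfl
  obtain ⟨B, hB, hBz, hB0⟩ := collarZeta_simplePole (ν := ν) hδ0 hδ1 hφ hFδ hw ha hwc hac
  -- The complement of the collar contributes an entire function; it leaves the residue alone and
  -- adds its value at 0 to the finite part.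
  have key := riesz_of_simplePole hZ (r₀ := 1 / 2) (by norm_num)
    (hB.add hKd.differentiableOn) (a := ∫ y, (a y).coeff n ∂ν) (by
      filter_upwards [self_mem_nhdsWithin] with z hz
      rw [hBz z hz, add_assoc]
      rfl)
  refine ⟨⟨_, hZ⟩, key.1, ?_⟩
  rw [key.2]
  simp only [Pi.add_apply, hB0, add_assoc]
  congr 2
  refine integral_congr_ae (.of_forall fun p => ?_)
  simp [zetaIntegrand]

end Zeta


/-! ### From polyhomogeneous expansions to uniform expansions -/

section Uniform

variable {N : Type*} [TopologicalSpace N]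

/-- The power series with real coefficients `c k y`. -/
def coeffSeries (c : ℕ → N → ℝ) (y : N) : PowerSeries ℂ := PowerSeries.mk fun k => (c k y : ℂ)

@[simp] theorem coeff_coeffSeries (c : ℕ → N → ℝ) (y : N) (k : ℕ) :
    (coeffSeries c y).coeff k = c k y := PowerSeries.coeff_mk _ _

theorem contCoeff_coeffSeries {c : ℕ → N → ℝ} (hc : ∀ k, Continuous (c k)) :
    ContCoeff (coeffSeries c) := fun k => by
  simp only [coeff_coeffSeries]
  exact Complex.continuous_ofReal.comp (hc k)

/-- Compactness of N turns local remainder bounds into one bound: a union of two sets takes the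
smaller δ and the sum of the constants. -/
theorem exists_unifExp [CompactSpace N] {f : N × ℝ → ℝ} {c : ℕ → N → ℝ}
    (hc : ∀ k, Continuous (c k))
    (hloc : ∀ y₀, (fun q : N × ℝ => f q - ∑ k ∈ Finset.range (n + 1), c k q.1 * q.2 ^ k)
      =O[𝓝 y₀ ×ˢ 𝓝[>] 0] fun q => q.2 ^ (n + 1 / 2 : ℝ)) :
    ∃ δ > 0, UnifExp n δ (fun y t => (f (y, t) : ℂ)) (coeffSeries c) := by
  have key : ∃ δ > 0, ∃ C, 0 ≤ C ∧ ∀ y ∈ (univ : Set N), ∀ t ∈ Ioo 0 δ,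
      |f (y, t) - ∑ k ∈ Finset.range (n + 1), c k y * t ^ k| ≤ C * t ^ (n + 1 / 2 : ℝ) := by
    refine isCompact_univ.induction_on (p := fun s : Set N => ∃ δ > 0, ∃ C, 0 ≤ C ∧ ∀ y ∈ s,
      ∀ t ∈ Ioo 0 δ, |f (y, t) - ∑ k ∈ Finset.range (n + 1), c k y * t ^ k| ≤
        C * t ^ (n + 1 / 2 : ℝ)) ?_ ?_ ?_ ?_
    · exact ⟨1, one_pos, 0, le_rfl, fun y hy => hy.elim⟩
    · rintro s t hst ⟨δ, hδ, C, hC0, hC⟩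
      exact ⟨δ, hδ, C, hC0, fun y hy => hC y (hst hy)⟩
    · rintro s t ⟨δ, hδ, C, hC0, hC⟩ ⟨δ', hδ', C', hC0', hC'⟩
      refine ⟨min δ δ', lt_min hδ hδ', C + C', by positivity, fun y hy t ht => ?_⟩
      have h0 : 0 ≤ t ^ (n + 1 / 2 : ℝ) := Real.rpow_nonneg ht.1.le _
      rcases hy with hy | hy
      · exact (hC y hy t ⟨ht.1, ht.2.trans_le (min_le_left _ _)⟩).trans (by nlinarith)
      · exact (hC' y hy t ⟨ht.1, ht.2.trans_le (min_le_right _ _)⟩).trans (by nlinarith)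
    · intro y₀ _
      obtain ⟨C, hC0, hC⟩ := (hloc y₀).exists_pos
      obtain ⟨V, hV, T, hT, h⟩ := eventually_prod_iff.1 hC.bound
      obtain ⟨δ, hδ, hδT⟩ := mem_nhdsGT_iff_exists_Ioo_subset.1 hT
      refine ⟨{y | V y}, mem_nhdsWithin_of_mem_nhds hV, δ, hδ, C, hC0.le, fun y hy t ht => ?_⟩
      have h1 := h hy (hδT ht)
      rwa [Real.norm_eq_abs, Real.norm_of_nonneg (Real.rpow_nonneg ht.1.le _)] at h1
  obtain ⟨δ, hδ, C, -, hC⟩ := key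
  refine ⟨δ, hδ, fun k _ => ?_, C, fun y t ht => ?_⟩
  · obtain ⟨B, hB⟩ := isCompact_univ.exists_bound_of_continuousOn (hc k).continuousOn
    exact ⟨B, fun y => by simpa using hB y (mem_univ y)⟩
  · have := hC y (mem_univ y) t ht
    rw [← Real.norm_eq_abs, ← Complex.norm_real] at this
    push_cast at this
    simpa using this

end Uniform

/-! ### Global polyhomogeneous expansions on N. -/

section Expansion

variable {N : Type*} [TopologicalSpace N] [ChartedSpace (Euc n) N]
  {f f' : N × ℝ → ℝ} {a b : ℕ → ℕ → N → ℝ}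

theorem HasPhgExpansion.continuous_coeff (h : HasPhgExpansion (n := n) f a) (k p : ℕ) :
    Continuous (a k p) := by
  obtain ⟨P, -, h⟩ := h
  refine continuous_iff_continuousAt.2 fun y₀ => ?_
  have h1 := ((h y₀).smooth_coeff k p).self_of_nhds.continuousAt
  have h2 := ContinuousAt.comp (x := y₀) h1 (continuousAt_extChartAt y₀)
  refine h2.congr ?_
  filter_upwards [extChartAt_source_mem_nhds (I := 𝓡 n) y₀] with y hy
  change a k p ((extChartAt (𝓡 n) y₀).symm (extChartAt (𝓡 n) y₀ y)) = _
  rw [(extChartAt (𝓡 n) y₀).left_inv hy]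

theorem logPoly_eq_of_eq_zero {k P : ℕ} {a : ℕ → Euc n → ℝ} {q : Euc n × ℝ}
    (h : ∀ p, 1 ≤ p → a p q.1 = 0) : logPoly k P a q = a 0 q.1 * q.2 ^ k := by
  rw [logPoly, Finset.sum_eq_single 0]
  · simp
  · intro p _ hp
    rw [h p (Nat.one_le_iff_ne_zero.2 hp)]; simp
  · simp

theorem HasPhgExpansion.exists_unifExp [CompactSpace N] (h : HasPhgExpansion (n := n) f a)
    (hlog : ∀ k < n + 1, ∀ p, 1 ≤ p → ∀ y, a k p y = 0) :
    ∃ δ > 0, UnifExp n δ (fun y t => (f (y, t) : ℂ)) (coeffSeries fun k => a k 0) := by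
  refine PE.exists_unifExp (fun k => h.continuous_coeff k 0) fun y₀ => ?_
  obtain ⟨P, -, h⟩ := h
  have h1 := ((h y₀).conormal n 0).isBigO (ρ := n + 1 / 2) (by linarith)
  have h2 : Tendsto (fun q : N × ℝ => (extChartAt (𝓡 n) y₀ q.1, q.2)) (𝓝 y₀ ×ˢ 𝓝[>] 0)
      (bdryFilter (extChartAt (𝓡 n) y₀ y₀)) :=
    ((continuousAt_extChartAt y₀).tendsto.comp tendsto_fst).prodMk tendsto_snd
  refine (h1.comp_tendsto h2).congr' ?_ .rfl
  filter_upwards [tendsto_fst.eventually (extChartAt_source_mem_nhds (I := 𝓡 n) y₀)] with q hq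
  simp only [Function.comp_apply]
  have h3 : (extChartAt (𝓡 n) y₀).symm (extChartAt (𝓡 n) y₀ q.1) = q.1 :=
    (extChartAt (𝓡 n) y₀).left_inv hq
  congr 1
  · simp only [h3]
  · refine Finset.sum_congr rfl fun k hk => ?_
    rw [logPoly_eq_of_eq_zero fun p hp => hlog k (by simpa using hk) p hp _]
    simp only [h3]

/-- The coefficients of a product of polyhomogeneous expansions. -/
theorem HasPhgExpansion.mul (hf : HasPhgExpansion (n := n) f a)
    (hf' : HasPhgExpansion (n := n) f' b) :
    ∃ c, HasPhgExpansion (n := n) (fun q => f q * f' q) c ∧ ∀ k,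
      (∀ i ≤ k, ∀ p, 1 ≤ p → ∀ y, a i p y = 0) → (∀ i ≤ k, ∀ p, 1 ≤ p → ∀ y, b i p y = 0) →
      ∀ y, c k 0 y = ∑ ij ∈ Finset.HasAntidiagonal.antidiagonal k, a ij.1 0 y * b ij.2 0 y := by
  obtain ⟨P, hP, hf⟩ := hf
  obtain ⟨Q, hQ, hf'⟩ := hf'
  refine ⟨fun k p y => (prodPoly (fun i s => a i s y) (fun i s => b i s y) P Q k).coeff p,
    ⟨prodDeg P Q, fun k p y hp => ?_, fun y₀ => (hf y₀).mul (hf' y₀)⟩, fun k ha hb y => ?_⟩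
  · exact Polynomial.coeff_eq_zero_of_natDegree_lt ((natDegree_prodPoly_le _ _ _ _ _).trans_lt hp)
  · change Polynomial.coeff (∑ ij ∈ _, _) 0 = _
    rw [Polynomial.finsetSum_coeff]
    refine Finset.sum_congr rfl fun ij _ => ?_
    rw [Polynomial.mul_coeff_zero, coeff_logPolyPoly _ (Nat.zero_le _),
      coeff_logPolyPoly _ (Nat.zero_le _)]

end Expansion

/-! ### Evenness of the conformal factor between special bdfs. -/

section Special

variable {M : Type*} [TopologicalSpace M] [T2Space M]
  [ChartedSpace (EuclideanHalfSpace (n + 1)) M] [IsManifold (𝓡∂ (n + 1)) ∞ M]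
  {N : Type*} [TopologicalSpace N] [T2Space N]
  [ChartedSpace (Euc n) N] [IsManifold (𝓡 n) ∞ N]
  {g : BilinField (𝓡∂ (n + 1)) M} {gbar : ContMetric n M} {x x' φ : M → ℝ} {ε : ℝ}
  {Φ : N × ℝ → M}

theorem IsGeodesicCollar.tendsto_collar (hΦ : IsGeodesicCollar gbar x ε Φ) (hφ : Continuous φ)
    (y : N) : Tendsto (fun t => φ (Φ (y, t))) (𝓝[>] 0) (𝓝 (φ (Φ (y, 0)))) := by
  refine (hφ.tendsto _).comp ?_
  have h1 : ContinuousWithinAt Φ (univ ×ˢ Ico 0 ε) (y, 0) :=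
    hΦ.smooth.continuousOn _ ⟨mem_univ _, le_rfl, hΦ.pos⟩
  refine h1.tendsto.comp (tendsto_nhdsWithin_iff.2 ⟨?_, ?_⟩)
  · have : Continuous fun t : ℝ => (y, t) := by fun_prop
    exact (this.tendsto 0).mono_left nhdsWithin_le_nhds
  · filter_upwards [Ioo_mem_nhdsGT hΦ.pos] with t ht
    exact ⟨mem_univ _, ht.1.le, ht.2⟩

/-- The conformal factor relating two special bdfs is even up to order `t^n`. -/
theorem IsPhgBdf.isEvenMod (hΦ : IsGeodesicCollar gbar x ε Φ) (hx : IsBdf (𝓡∂ (n + 1)) x)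
    (hg : IsPoincareEinstein g) (hgbar : IsConfExtension g x gbar) (hphg : IsPhgMetric gbar Φ)
    (hφ : IsPhgBdf (n := n) x Φ x' φ) (hs : IsSpecial g x') {w : ℕ → ℕ → N → ℝ}
    (hw : HasPhgExpansion (n := n) (fun q => φ (Φ q)) w) : IsEvenMod w (n + 1) := by
  obtain ⟨Q, hQ, hw⟩ := hw
  have key : ∀ y₀ : N, EvenCoeff (extChartAt (𝓡 n) y₀ y₀)
      (fun k p u => w k p ((extChartAt (𝓡 n) y₀).symm u)) Q (n + 1) := by
    intro y₀
    choose a P hP hG using hphg y₀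
    have hT := hΦ.tangentialEinstein hx hgbar hg.einstein y₀ fun i j => (hG i j).smooth
    have hdet := hΦ.det_leadingMetric y₀ hG hP
    refine evenCoeff_eikonal hG hP hdet hT (hw y₀) ?_ (hΦ.eikonal hx hgbar hφ hs y₀)
    -- Start of the eikonal induction: φ is continuous up to the boundary along every normal line.
    exact (hw y₀).evenCoeff_one (.of_forall fun u => ⟨_, hΦ.tendsto_collar hφ.cont _⟩)
  intro k hk
  refine ⟨fun p hp y => ?_, fun hodd y => ?_⟩
  · have h1 := (key y k hk).self_of_nhds.1 p hp
    simp only [extChartAt_to_inv] at h1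
    rcases le_or_gt p (Q k) with h | h
    · exact h1 h
    · exact hQ k p y h
  · have h1 := (key y k hk).self_of_nhds.2 hodd
    simpa only [extChartAt_to_inv] using h1

end Special


/-! ### Logarithms of uniform expansions -/

section Log

variable {N : Type*} [TopologicalSpace N]

theorem ContCoeff.add {c d : N → PowerSeries ℂ} (hc : ContCoeff c) (hd : ContCoeff d) :
    ContCoeff fun x => c x + d x := by
  intro k
  simp only [map_add]
  exact (hc k).add (hd k)

theorem ContCoeff.sum {ι : Type*} (s : Finset ι) {c : ι → N → PowerSeries ℂ}
    (hc : ∀ i ∈ s, ContCoeff (c i)) : ContCoeff fun x => ∑ i ∈ s, c i x := by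
  intro k
  simp only [map_sum]
  exact continuous_finsetSum _ fun i hi => hc i hi k

theorem UnifExp.of_continuous [CompactSpace N] {δ : ℝ} {a : N → ℂ} (ha : Continuous a) :
    UnifExp n δ (fun x _ => a x) (fun x => PowerSeries.C (a x)) := by
  obtain ⟨B, hB⟩ := isCompact_univ.exists_bound_of_continuousOn ha.continuousOn
  exact .of_const fun x => hB x (mem_univ x)

/-- log h = log c₀ + log(1 − X), where X = 1 − h/c₀ is O(t^(1/2)). The logarithmic series cut after
2n + 1 terms leaves |X|^(2n+2), of order n + 1. -/
theorem UnifExp.exists_log [CompactSpace N] {δ : ℝ} {h : N × ℝ → ℝ} {c : ℕ → N → ℝ} (hδ0 : 0 < δ)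
    (hδ : δ ≤ 1) (hh : UnifExp n δ (fun y t => (h (y, t) : ℂ)) (coeffSeries c))
    (hc : ∀ k, Continuous (c k)) (h0 : ∀ y, 0 < c 0 y) :
    ∃ δ' > 0, ∃ w : N → PowerSeries ℂ, ContCoeff w ∧ (∀ y, ∀ t ∈ Ioo 0 δ', 0 < h (y, t)) ∧
      UnifExp n δ' (fun y t => (Real.log (h (y, t)) : ℂ)) w := by
  have hinv : Continuous fun y => -((c 0 y)⁻¹ : ℂ) :=
    ((Complex.continuous_ofReal.comp (hc 0)).inv₀ fun y =>
      Complex.ofReal_ne_zero.2 (h0 y).ne').neg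
  have hlog : Continuous fun y => (Real.log (c 0 y) : ℂ) :=
    Complex.continuous_ofReal.comp ((hc 0).log fun y => (h0 y).ne')
  set W : N → PowerSeries ℂ := fun y =>
    PowerSeries.C 1 + PowerSeries.C (-((c 0 y)⁻¹ : ℂ)) * coeffSeries c y with hW
  have hWc : ContCoeff W := (ContCoeff.constantCoeff continuous_const).add
    ((ContCoeff.constantCoeff hinv).mul (contCoeff_coeffSeries hc))
  have hX : UnifExp n δ (fun y t => 1 + -((c 0 y)⁻¹ : ℂ) * h (y, t)) W :=
    (UnifExp.of_continuous continuous_const).add ((UnifExp.of_continuous hinv).mul hδ hh)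
  have hW0 : ∀ y, (W y).coeff 0 = 0 := fun y => by
    have : (c 0 y : ℂ) ≠ 0 := Complex.ofReal_ne_zero.2 (h0 y).ne'
    simp only [hW, map_add, PowerSeries.coeff_C_mul, coeff_coeffSeries, PowerSeries.coeff_zero_C]
    field_simp
    ring
  obtain ⟨A, hA0, hA⟩ := hX.exists_half_bound hδ
  set X : N → ℝ → ℝ := fun y t => 1 - (c 0 y)⁻¹ * h (y, t) with hXdef
  have hXA : ∀ y, ∀ t ∈ Ioo 0 δ, |X y t| ≤ A * t ^ (1 / 2 : ℝ) := fun y t ht => by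
    have := hA y t ht
    rw [hW0, sub_zero] at this
    rw [← Real.norm_eq_abs, ← Complex.norm_real]
    convert this using 2
    simp only [hXdef]; push_cast; ring
  -- Chosen so that A t^(1/2) ≤ 1/2, which keeps X away from 1 and h positive.
  set δ' := min δ ((2 * A + 1)⁻¹ ^ 2) with hδ'
  have hδ'0 : 0 < δ' := lt_min hδ0 (by positivity)
  have hsub : ∀ t ∈ Ioo 0 δ', t ∈ Ioo 0 δ := fun t ht => ⟨ht.1, ht.2.trans_le (min_le_left _ _)⟩
  have hhalf : ∀ y, ∀ t ∈ Ioo 0 δ', |X y t| ≤ 1 / 2 := fun y t ht => by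
    refine (hXA y t (hsub t ht)).trans ?_
    have h1 : t ^ (1 / 2 : ℝ) ≤ (2 * A + 1)⁻¹ := by
      rw [← Real.sqrt_eq_rpow]
      refine Real.sqrt_le_iff.2 ⟨by positivity, ?_⟩
      exact ht.2.le.trans (min_le_right _ _)
    refine (mul_le_mul_of_nonneg_left h1 hA0).trans ?_
    rw [← div_eq_mul_inv, div_le_iff₀ (by positivity)]
    linarith
  have hpos : ∀ y, ∀ t ∈ Ioo 0 δ', 0 < h (y, t) := fun y t ht => by
    have h1 := (abs_le.1 (hhalf y t ht)).2
    have h2 : 0 < (c 0 y)⁻¹ * h (y, t) := by simp only [hXdef] at h1; linarith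
    exact (mul_pos_iff_of_pos_left (inv_pos.2 (h0 y))).1 h2
  have hsum : UnifExp n δ (fun y t => (Real.log (c 0 y) : ℂ) +
      ∑ i ∈ Finset.range (2 * n + 1), (-((i : ℂ) + 1)⁻¹) *
        (1 + -((c 0 y)⁻¹ : ℂ) * h (y, t)) ^ (i + 1))
      (fun y => PowerSeries.C (Real.log (c 0 y) : ℂ) +
        ∑ i ∈ Finset.range (2 * n + 1), PowerSeries.C (-((i : ℂ) + 1)⁻¹) * W y ^ (i + 1)) :=
    (UnifExp.of_continuous hlog).add (UnifExp.sum _ fun i _ =>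
      (UnifExp.of_continuous continuous_const).mul hδ (hX.pow hδ (i + 1)))
  refine ⟨δ', hδ'0, _, ?_, hpos, (hsum.mono (min_le_left _ _)).congr_of_norm_le
    (C := A ^ (2 * n + 2) * 2) fun y t ht => ?_⟩
  · exact (ContCoeff.constantCoeff hlog).add (ContCoeff.sum _ fun i _ =>
      (ContCoeff.constantCoeff continuous_const).mul (hWc.pow _))
  have ht1 : t ≤ 1 := (hsub t ht).2.le.trans hδ
  have h1 := Real.abs_log_sub_add_sum_range_le (x := X y t) ((hhalf y t ht).trans_lt (by norm_num))
    (2 * n + 1)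
  have h2 : Real.log (h (y, t)) = Real.log (c 0 y) + Real.log (1 - X y t) := by
    rw [hXdef, sub_sub_cancel, Real.log_mul (inv_pos.2 (h0 y)).ne' (hpos y t ht).ne', Real.log_inv]
    ring
  have h3 : (Real.log (h (y, t)) : ℂ) - (Real.log (c 0 y) +
      ∑ i ∈ Finset.range (2 * n + 1), (-((i : ℂ) + 1)⁻¹) *
        (1 + -((c 0 y)⁻¹ : ℂ) * h (y, t)) ^ (i + 1)) =
      (((∑ i ∈ Finset.range (2 * n + 1), X y t ^ (i + 1) / (i + 1)) + Real.log (1 - X y t) : ℝ) : ℂ) := by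
    rw [h2]
    simp only [hXdef]
    push_cast
    have : ∀ i ∈ Finset.range (2 * n + 1), (-((i : ℂ) + 1)⁻¹) *
        (1 + -((c 0 y)⁻¹ : ℂ) * h (y, t)) ^ (i + 1) =
        -((1 - ((c 0 y)⁻¹ : ℂ) * h (y, t)) ^ (i + 1) / (i + 1)) := fun i _ => by
      rw [neg_mul (c 0 y : ℂ)⁻¹, ← sub_eq_add_neg]
      ring
    rw [Finset.sum_congr rfl this, Finset.sum_neg_distrib]
    ring
  rw [h3, Complex.norm_real, Real.norm_eq_abs]
  refine h1.trans ?_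
  have h4 : |X y t| ^ (2 * n + 2) ≤ A ^ (2 * n + 2) * t ^ (n + 1 / 2 : ℝ) := by
    refine (pow_le_pow_left₀ (abs_nonneg _) (hXA y t (hsub t ht)) _).trans ?_
    rw [mul_pow]
    refine mul_le_mul_of_nonneg_left ?_ (by positivity)
    rw [← Real.rpow_natCast, ← Real.rpow_mul ht.1.le]
    refine Real.rpow_le_rpow_of_exponent_ge ht.1 ht1 ?_
    push_cast; linarith
  have h5 : 1 / 2 ≤ 1 - |X y t| := by linarith [hhalf y t ht]
  rw [div_le_iff₀ (by linarith)]
  have h6 : 0 ≤ A ^ (2 * n + 2) * t ^ (n + 1 / 2 : ℝ) :=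
    mul_nonneg (by positivity) (Real.rpow_nonneg ht.1.le _)
  change |X y t| ^ (2 * n + 2) ≤ _
  nlinarith [mul_le_mul_of_nonneg_left h5 h6]

end Log


/-! ### Taylor expansion in the normal direction -/

section Slices

variable {T : Set (Euc n)} {b : ℝ} {V : Euc n × ℝ → ℝ}

theorem hasDerivWithinAt_slice {J : Set ℝ} {u : Euc n} (hu : u ∈ T) {t : ℝ}
    (hV : DifferentiableWithinAt ℝ V (T ×ˢ J) (u, t)) :
    HasDerivWithinAt (fun t => V (u, t)) (fderivWithin ℝ V (T ×ˢ J) (u, t) (0, 1)) J t := by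
  have h1 : HasDerivWithinAt (fun t : ℝ => (u, t)) ((0, 1) : Euc n × ℝ) J t :=
    ((hasDerivAt_const t u).prodMk (hasDerivAt_id t)).hasDerivWithinAt
  exact HasFDerivWithinAt.comp_hasDerivWithinAt (f := fun t : ℝ => (u, t)) t
    hV.hasFDerivWithinAt h1 fun s hs => ⟨hu, hs⟩

theorem contDiffOn_iteratedDerivWithin_slice (hT : IsOpen T) (hb : 0 < b)
    (hV : ContDiffOn ℝ ∞ V (T ×ˢ Icc 0 b)) (k : ℕ) :
    ContDiffOn ℝ ∞ (fun q : Euc n × ℝ => iteratedDerivWithin k (fun t => V (q.1, t)) (Icc 0 b) q.2)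
      (T ×ˢ Icc 0 b) := by
  have hU : UniqueDiffOn ℝ (T ×ˢ Icc 0 b) := hT.uniqueDiffOn.prod (uniqueDiffOn_Icc hb)
  induction k with
  | zero => simpa only [iteratedDerivWithin_zero] using hV
  | succ k ih =>
    have h1 : ContDiffOn ℝ ∞ (fun q => fderivWithin ℝ (fun q : Euc n × ℝ =>
        iteratedDerivWithin k (fun t => V (q.1, t)) (Icc 0 b) q.2) (T ×ˢ Icc 0 b) q (0, 1))
        (T ×ˢ Icc 0 b) :=
      (ih.fderivWithin hU (by simp)).clm_apply contDiffOn_const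
    refine h1.congr fun q hq => ?_
    rw [iteratedDerivWithin_succ]
    exact (hasDerivWithinAt_slice hq.1 ((ih.differentiableOn (by simp)) q hq)).derivWithin
      (uniqueDiffOn_Icc hb _ hq.2)

theorem abs_sub_taylor_le {b C : ℝ} {v : ℝ → ℝ} {k : ℕ}
    (hv : ContDiffOn ℝ ∞ v (Icc 0 b))
    (hC : ∀ t ∈ Icc 0 b, ‖iteratedDerivWithin (k + 1) v (Icc 0 b) t‖ ≤ C) {t : ℝ}
    (ht : t ∈ Icc 0 b) :
    |v t - ∑ i ∈ Finset.range (k + 1), (i.factorial : ℝ)⁻¹ *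
      iteratedDerivWithin i v (Icc 0 b) 0 * t ^ i| ≤ C * t ^ (k + 1) := by
  have h1 := taylor_mean_remainder_bound (ht.1.trans ht.2)
    (n := k) (by exact_mod_cast contDiffOn_infty.1 hv (k + 1)) ht hC
  rw [taylor_within_apply, sub_zero, Real.norm_eq_abs] at h1
  have hC0 : 0 ≤ C * t ^ (k + 1) :=
    mul_nonneg ((norm_nonneg _).trans (hC t ht)) (pow_nonneg ht.1 _)
  refine le_trans (le_of_eq ?_) (h1.trans (div_le_self hC0 ?_))
  · congr 2
    refine Finset.sum_congr rfl fun i _ => ?_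
    rw [smul_eq_mul]; ring
  · exact_mod_cast k.factorial_pos

end Slices

/-! ### Smooth boundary defining functions in the collar -/

section SmoothBdf

variable {M : Type*} [TopologicalSpace M]
  [ChartedSpace (EuclideanHalfSpace (n + 1)) M] [IsManifold (𝓡∂ (n + 1)) ∞ M]
  {N : Type*} [TopologicalSpace N]
  [ChartedSpace (Euc n) N] [IsManifold (𝓡 n) ∞ N]
  {gbar : ContMetric n M} {x x' : M → ℝ} {ε : ℝ} {Φ : N × ℝ → M}

theorem IsGeodesicCollar.contDiffOn_comp (hΦ : IsGeodesicCollar gbar x ε Φ)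
    (hx' : ContMDiff (𝓡∂ (n + 1)) 𝓘(ℝ, ℝ) ∞ x') (y₀ : N) :
    ContDiffOn ℝ ∞ (fun q => x' (collarMap Φ y₀ q)) (collarDom n y₀ ε) :=
  contMDiffOn_iff_contDiffOn.1 (hx'.comp_contMDiffOn (hΦ.contMDiffOn_collarMap y₀))

theorem IsGeodesicCollar.bdf_zero (hΦ : IsGeodesicCollar gbar x ε Φ)
    (hx' : IsBdf (𝓡∂ (n + 1)) x') (y : N) : x' (Φ (y, 0)) = 0 := by
  rw [hx'.zero_iff, ← hΦ.image_zero]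
  exact ⟨(y, 0), ⟨mem_univ _, rfl⟩, rfl⟩

/-- The normal derivative of a boundary defining function does not vanish on the boundary. -/
theorem IsGeodesicCollar.fderivWithin_bdf_ne_zero (hΦ : IsGeodesicCollar gbar x ε Φ)
    (hx' : IsBdf (𝓡∂ (n + 1)) x') (y₀ : N) {u : Euc n} (hu : u ∈ (extChartAt (𝓡 n) y₀).target) :
    fderivWithin ℝ (fun q => x' (collarMap Φ y₀ q)) (collarDom n y₀ ε) (u, 0) (0, 1) ≠ 0 := by
  have hq : ((u, 0) : Euc n × ℝ) ∈ collarDom n y₀ ε := ⟨hu, le_rfl, hΦ.pos⟩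
  set D : (Euc n × ℝ) →L[ℝ] Euc (n + 1) :=
    mfderivWithin 𝓘(ℝ, Euc n × ℝ) (𝓡∂ (n + 1)) (collarMap Φ y₀) (collarDom n y₀ ε) (u, 0) with hD
  set L : Euc (n + 1) →L[ℝ] ℝ := mfderiv (𝓡∂ (n + 1)) 𝓘(ℝ, ℝ) x' (collarMap Φ y₀ (u, 0)) with hL
  have hDi : Function.Injective D := hΦ.injective_mfderivWithin_collarMap y₀ hq
  have hDs : Function.Surjective D := by
    refine (LinearMap.injective_iff_surjective_of_finrank_eq_finrank
      (f := (D : (Euc n × ℝ) →ₗ[ℝ] Euc (n + 1))) ?_).1 hDi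
    simp
  have hUd := uniqueDiffOn_collarDom y₀ ε (u, 0) hq
  have hchain : ∀ v, fderivWithin ℝ (fun q => x' (collarMap Φ y₀ q)) (collarDom n y₀ ε) (u, 0) v =
      L (D v) := by
    intro v
    have h1 := ((mdifferentiableAt_bdf hx' (collarMap Φ y₀ (u, 0))).hasMFDerivAt).comp_hasMFDerivWithinAt
      (u, (0 : ℝ)) ((hΦ.contMDiffOn_collarMap y₀ _ hq).mdifferentiableWithinAt
        (by simp)).hasMFDerivWithinAt
    have h2 := h1.mfderivWithin hUd.uniqueMDiffWithinAt
    have h3 : mfderivWithin 𝓘(ℝ, Euc n × ℝ) 𝓘(ℝ, ℝ) (fun q => x' (collarMap Φ y₀ q))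
      (collarDom n y₀ ε) (u, 0) = fderivWithin ℝ (fun q => x' (collarMap Φ y₀ q))
        (collarDom n y₀ ε) (u, 0) := mfderivWithin_eq_fderivWithin
    exact (DFunLike.congr_fun h3 v).symm.trans (DFunLike.congr_fun h2 v)
  -- x′ is zero along t = 0, so its tangential derivatives vanish there; a vanishing normal
  -- derivative would then make dx′ zero.
  have htan : ∀ v : Euc n, fderivWithin ℝ (fun q => x' (collarMap Φ y₀ q)) (collarDom n y₀ ε)
      (u, 0) (v, 0) = 0 := by
    intro v
    have h1 : HasFDerivWithinAt (fun u : Euc n => ((u, 0) : Euc n × ℝ))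
        (ContinuousLinearMap.inl ℝ (Euc n) ℝ) (extChartAt (𝓡 n) y₀).target u :=
      ((hasFDerivAt_id u).prodMk (hasFDerivAt_const (0 : ℝ) u)).hasFDerivWithinAt
    have h2 := (((hΦ.contDiffOn_comp hx'.smooth y₀).differentiableOn (by simp)) _ hq).hasFDerivWithinAt
    have h3 := HasFDerivWithinAt.comp (f := fun u : Euc n => ((u, 0) : Euc n × ℝ)) u h2 h1
      fun w hw => ⟨hw, le_rfl, hΦ.pos⟩
    have h4 : HasFDerivWithinAt ((fun q => x' (collarMap Φ y₀ q)) ∘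
        fun u : Euc n => ((u, 0) : Euc n × ℝ)) (0 : Euc n →L[ℝ] ℝ) (extChartAt (𝓡 n) y₀).target u :=
      (hasFDerivWithinAt_const (0 : ℝ) u _).congr (fun w _ => hΦ.bdf_zero hx' _) (hΦ.bdf_zero hx' _)
    exact DFunLike.congr_fun ((isOpen_extChartAt_target y₀).uniqueDiffOn u hu |>.eq h3 h4) v
  intro h0
  have hp : collarMap Φ y₀ (u, 0) ∈ (𝓡∂ (n + 1)).boundary M := by
    rw [← hx'.zero_iff]; exact hΦ.bdf_zero hx' _
  refine hx'.nondeg _ hp (ContinuousLinearMap.ext fun w => ?_)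
  obtain ⟨v, rfl⟩ := hDs w
  refine (hchain v).symm.trans ?_
  have hv : v = (v.1, 0) + v.2 • ((0, 1) : Euc n × ℝ) := by ext <;> simp
  rw [hv, map_add, map_smul, h0, htan, smul_zero, add_zero]
  rfl

/-- Joint continuity on the compact set N × [0, b] is what makes the Taylor remainder uniform in y.
-/
theorem IsGeodesicCollar.continuousOn_normalDeriv (hΦ : IsGeodesicCollar gbar x ε Φ)
    (hx' : ContMDiff (𝓡∂ (n + 1)) 𝓘(ℝ, ℝ) ∞ x') {b : ℝ} (hb : 0 < b) (hbε : b < ε) (k : ℕ) :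
    ContinuousOn (fun q : N × ℝ => iteratedDerivWithin k (fun t => x' (Φ (q.1, t))) (Icc 0 b) q.2)
      (univ ×ˢ Icc 0 b) := by
  rintro ⟨y₀, t₀⟩ ⟨-, ht₀⟩
  have h1 := contDiffOn_iteratedDerivWithin_slice (isOpen_extChartAt_target y₀) hb
    ((hΦ.contDiffOn_comp hx' y₀).mono (Set.prod_mono le_rfl fun t ht =>
      ⟨ht.1, ht.2.trans_lt hbε⟩)) k
  have h2 := h1.continuousOn (extChartAt (𝓡 n) y₀ y₀, t₀) ⟨mem_extChartAt_target y₀, ht₀⟩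
  have h3 : ContinuousWithinAt (fun q : N × ℝ => (extChartAt (𝓡 n) y₀ q.1, q.2))
      ((extChartAt (𝓡 n) y₀).source ×ˢ Icc 0 b) (y₀, t₀) :=
    ((ContinuousAt.comp (x := (y₀, t₀)) (f := Prod.fst) (continuousAt_extChartAt y₀)
      continuousAt_fst).prodMk continuousAt_snd).continuousWithinAt
  have hmaps : MapsTo (fun q : N × ℝ => (extChartAt (𝓡 n) y₀ q.1, q.2))
      ((extChartAt (𝓡 n) y₀).source ×ˢ Icc 0 b) ((extChartAt (𝓡 n) y₀).target ×ˢ Icc 0 b) :=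
    fun q hq => ⟨(extChartAt (𝓡 n) y₀).map_source hq.1, hq.2⟩
  have h4 := ContinuousWithinAt.comp (x := (y₀, t₀)) h2 h3 hmaps
  have h5 : ContinuousWithinAt
      (fun q : N × ℝ => iteratedDerivWithin k (fun t => x' (Φ (q.1, t))) (Icc 0 b) q.2)
      ((extChartAt (𝓡 n) y₀).source ×ˢ Icc 0 b) (y₀, t₀) := by
    refine h4.congr (fun q hq => ?_) ?_
    · simp only [Function.comp_apply, collarMap, (extChartAt (𝓡 n) y₀).left_inv hq.1]
    · simp only [Function.comp_apply, collarMap, extChartAt_to_inv]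
  refine h5.mono_of_mem_nhdsWithin ?_
  rw [nhdsWithin_prod_eq, nhdsWithin_univ]
  exact Filter.prod_mem_prod (extChartAt_source_mem_nhds y₀) self_mem_nhdsWithin

/-- The difference quotients at t = 0 are nonnegative because x′ ≥ 0 vanishes on the boundary;
nondegeneracy excludes the limit 0. -/
theorem IsGeodesicCollar.normalDeriv_pos (hΦ : IsGeodesicCollar gbar x ε Φ)
    (hx' : IsBdf (𝓡∂ (n + 1)) x') {b : ℝ} (hb : 0 < b) (hbε : b < ε) (y : N) :
    0 < iteratedDerivWithin 1 (fun t => x' (Φ (y, t))) (Icc 0 b) 0 := by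
  have hU : UniqueDiffWithinAt ℝ (Icc 0 b) 0 := uniqueDiffOn_Icc hb 0 ⟨le_rfl, hb.le⟩
  have hq : ((extChartAt (𝓡 n) y y, 0) : Euc n × ℝ) ∈ collarDom n y ε :=
    ⟨mem_extChartAt_target y, le_rfl, hΦ.pos⟩
  have h1 := hasDerivWithinAt_slice (mem_extChartAt_target y)
    ((hΦ.contDiffOn_comp hx'.smooth y).differentiableOn (by simp) _ hq)
  have h2 := h1.mono fun t (ht : t ∈ Icc 0 b) => ⟨ht.1, ht.2.trans_lt hbε⟩
  simp only [collarMap, extChartAt_to_inv] at h2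
  rw [iteratedDerivWithin_one]
  refine lt_of_le_of_ne ?_ (Ne.symm ?_)
  · rw [hasDerivWithinAt_iff_tendsto_slope] at h2
    rw [(hasDerivWithinAt_iff_tendsto_slope.2 h2).derivWithin hU]
    have : (𝓝[Icc 0 b \ {0}] (0 : ℝ)).NeBot := by
      rw [Icc_sdiff_left]
      exact (nhdsWithin_Ioc_eq_nhdsGT hb) ▸ inferInstance
    refine ge_of_tendsto h2 ?_
    filter_upwards [self_mem_nhdsWithin] with t ht
    rw [slope_def_field, hΦ.bdf_zero hx', sub_zero, sub_zero]
    exact div_nonneg (hx'.nonneg _) ht.1.1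
  · rw [h2.derivWithin hU]
    exact hΦ.fderivWithin_bdf_ne_zero hx' y (mem_extChartAt_target y)

/-- A smooth boundary defining function is `t e^φ` in the collar, where `φ` has a uniform expansion
in powers of `t`. -/
theorem IsGeodesicCollar.exists_bdf_expansion [CompactSpace N]
    (hΦ : IsGeodesicCollar gbar x ε Φ) (hx' : IsBdf (𝓡∂ (n + 1)) x') :
    ∃ δ > 0, ∃ (φ : N × ℝ → ℝ) (w : N → PowerSeries ℂ), δ ≤ ε ∧ ContCoeff w ∧
      ContinuousOn φ (univ ×ˢ Ioo 0 δ) ∧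
      (∀ y, ∀ t ∈ Ioo 0 δ, x' (Φ (y, t)) = t * Real.exp (φ (y, t))) ∧
      UnifExp n δ (fun y t => (φ (y, t) : ℂ)) w := by
  set b := ε / 2 with hbdef
  have hb : 0 < b := half_pos hΦ.pos
  have hbε : b < ε := half_lt_self hΦ.pos
  set D : ℕ → N × ℝ → ℝ := fun k q =>
    iteratedDerivWithin k (fun t => x' (Φ (q.1, t))) (Icc 0 b) q.2 with hD
  have hDc : ∀ k, ContinuousOn (D k) (univ ×ˢ Icc 0 b) :=
    hΦ.continuousOn_normalDeriv hx'.smooth hb hbε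
  set c : ℕ → N → ℝ := fun k y => ((k + 1).factorial : ℝ)⁻¹ * D (k + 1) (y, 0) with hcdef
  have hc : ∀ k, Continuous (c k) := fun k => by
    refine continuous_const.mul ?_
    have h1 : Continuous fun y : N => (y, (0 : ℝ)) := by fun_prop
    exact (hDc (k + 1)).comp_continuous h1 fun y => ⟨mem_univ _, le_rfl, hb.le⟩
  -- Taylor's formula for x′ through order n + 1 needs n + 2 derivatives; after division by t it
  -- gives x′/t through order n.
  obtain ⟨C, hC⟩ := (isCompact_univ.prod isCompact_Icc).exists_bound_of_continuousOn (hDc (n + 2))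
  have hsm : ∀ y : N, ContDiffOn ℝ ∞ (fun t => x' (Φ (y, t))) (Icc 0 b) := fun y => by
    have h1 : ContDiffOn ℝ ∞ (fun t : ℝ => (extChartAt (𝓡 n) y y, t)) (Icc 0 b) := by fun_prop
    have h2 := (hΦ.contDiffOn_comp hx'.smooth y).comp h1
      fun t ht => ⟨mem_extChartAt_target y, ht.1, ht.2.trans_lt hbε⟩
    refine h2.congr fun t _ => ?_
    simp only [Function.comp_apply, collarMap, extChartAt_to_inv]
  obtain ⟨δ, hδ0, hδ⟩ := exists_unifExp (n := n) (f := fun q => x' (Φ q) / q.2) hc fun y₀ => by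
    refine Asymptotics.IsBigO.of_bound |C| ?_
    filter_upwards [tendsto_snd.eventually (Ioo_mem_nhdsGT (lt_min hb one_pos))] with q hq
    have hq1 : q.2 ∈ Ioo (0 : ℝ) 1 := ⟨hq.1, hq.2.trans_le (min_le_right _ _)⟩
    have h1 := abs_sub_taylor_le (hsm q.1) (k := n + 1)
      (fun t ht => hC (q.1, t) ⟨mem_univ _, ht⟩) (t := q.2)
      ⟨hq.1.le, hq.2.le.trans (min_le_left _ _)⟩
    rw [Finset.sum_range_succ'] at h1
    simp only [iteratedDerivWithin_zero, hΦ.bdf_zero hx', mul_zero, zero_mul, add_zero] at h1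
    have h2 : x' (Φ q) / q.2 - ∑ k ∈ Finset.range (n + 1), c k q.1 * q.2 ^ k =
        (x' (Φ (q.1, q.2)) - ∑ k ∈ Finset.range (n + 1), ((k + 1).factorial : ℝ)⁻¹ *
          iteratedDerivWithin (k + 1) (fun t => x' (Φ (q.1, t))) (Icc 0 b) 0 * q.2 ^ (k + 1)) /
            q.2 := by
      rw [sub_div, Finset.sum_div]
      congr 1
      refine Finset.sum_congr rfl fun k _ => ?_
      rw [pow_succ, ← mul_assoc, mul_div_assoc, div_self hq.1.ne', mul_one]
    rw [h2, norm_div, Real.norm_eq_abs, Real.norm_of_nonneg hq.1.le, div_le_iff₀ hq.1,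
      Real.norm_of_nonneg (Real.rpow_nonneg hq.1.le _)]
    refine h1.trans ?_
    have h3 : q.2 ^ (n + 1) ≤ q.2 ^ (n + 1 / 2 : ℝ) :=
      UnifExp.pow_le_rpow_half le_rfl hq1 (Nat.lt_succ_self n)
    calc C * q.2 ^ (n + 1 + 1) ≤ |C| * q.2 ^ (n + 1 + 1) :=
          mul_le_mul_of_nonneg_right (le_abs_self _) (pow_nonneg hq.1.le _)
      _ = |C| * q.2 ^ (n + 1) * q.2 := by ring
      _ ≤ _ := mul_le_mul_of_nonneg_right (mul_le_mul_of_nonneg_left h3 (abs_nonneg _)) hq.1.le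
  have hδ1 : 0 < min δ 1 := lt_min hδ0 one_pos
  have hc0 : ∀ y, 0 < c 0 y := fun y =>
    mul_pos (by positivity) (hΦ.normalDeriv_pos hx' hb hbε y)
  obtain ⟨δ', hδ'0, w, hw, hpos, hexp⟩ := UnifExp.exists_log (h := fun q => x' (Φ q) / q.2) hδ1
    (min_le_right _ _) (hδ.mono (min_le_left δ 1)) hc hc0
  refine ⟨min δ' ε, lt_min hδ'0 hΦ.pos, fun q => Real.log (x' (Φ q) / q.2), w, min_le_right _ _,
    hw, ?_, fun y t ht => ?_, hexp.mono (min_le_left _ _)⟩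
  · have h1 : ContinuousOn Φ (univ ×ˢ Ioo 0 (min δ' ε)) :=
      hΦ.smooth.continuousOn.mono (Set.prod_mono le_rfl fun t ht =>
        ⟨ht.1.le, ht.2.trans_le (min_le_right _ _)⟩)
    refine ContinuousOn.log ((hx'.smooth.continuous.comp_continuousOn h1).div continuousOn_snd
      fun q hq => hq.2.1.ne') fun q hq => ?_
    exact (hpos q.1 q.2 ⟨hq.2.1, hq.2.2.trans_le (min_le_left _ _)⟩).ne'
  · rw [Real.exp_log (hpos y t ⟨ht.1, ht.2.trans_le (min_le_left _ _)⟩), mul_div_cancel₀ _ ht.1.ne']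

end SmoothBdf


/-! ### Comparison of boundary defining functions -/

section Comparison

variable {M : Type*} [TopologicalSpace M] [T2Space M] [CompactSpace M]
  [ChartedSpace (EuclideanHalfSpace (n + 1)) M] [IsManifold (𝓡∂ (n + 1)) ∞ M]
  [MeasurableSpace M] [BorelSpace M]
  {N : Type*} [TopologicalSpace N] [T2Space N] [CompactSpace N]
  [ChartedSpace (Euc n) N] [IsManifold (𝓡 n) ∞ N] [MeasurableSpace N] [BorelSpace N]
  {g : BilinField (𝓡∂ (n + 1)) M} {gbar : ContMetric n M} {x x' : M → ℝ} {ε : ℝ} {Φ : N × ℝ → M}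
  {f : M → ℝ} {F : N × ℝ → ℝ} {a : ℕ → ℕ → N → ℝ}

theorem IsBdf.pos (hx : IsBdf (𝓡∂ (n + 1)) x) {p : M} (hp : p ∈ (𝓡∂ (n + 1)).interior M) :
    0 < x p := by
  refine (hx.nonneg p).lt_of_ne fun h => ?_
  rw [← ModelWithCorners.compl_boundary] at hp
  exact hp ((hx.zero_iff p).1 h.symm)

/-- The zeta functions of two boundary defining functions `x` and `x' = x e^φ`. -/
theorem IsDensityForm.compare (hμ : IsDensityForm g gbar ε Φ f F)
    (hΦ : IsGeodesicCollar gbar x ε Φ) (hx : IsBdf (𝓡∂ (n + 1)) x) (hg : IsInteriorMetric g)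
    (hf : ContinuousOn f ((𝓡∂ (n + 1)).interior M)) (hF : ContinuousOn F (univ ×ˢ Ioo 0 ε))
    (ha : HasPhgExpansion (n := n) F a) (heven : IsEvenMod a (n + 2))
    (hx' : ContinuousOn x' ((𝓡∂ (n + 1)).interior M))
    (hx'0 : ∀ p ∈ (𝓡∂ (n + 1)).interior M, 0 < x' p)
    {δ : ℝ} (hδ0 : 0 < δ) {φ : N × ℝ → ℝ} (hφ : ContinuousOn φ (univ ×ˢ Ioo 0 δ))
    (hφx : ∀ y, ∀ t ∈ Ioo 0 δ, x' (Φ (y, t)) = t * Real.exp (φ (y, t)))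
    {w : N → PowerSeries ℂ} (hw : UnifExp n δ (fun y t => (φ (y, t) : ℂ)) w) (hwc : ContCoeff w) :
    HasZetaContinuation (𝓡∂ (n + 1)) (riemVolume g) x f ∧
    HasZetaContinuation (𝓡∂ (n + 1)) (riemVolume g) x' f ∧
    rieszResidue (𝓡∂ (n + 1)) (riemVolume g) x' f =
      rieszResidue (𝓡∂ (n + 1)) (riemVolume g) x f ∧
    rieszIntegral (𝓡∂ (n + 1)) (riemVolume g) x' f - rieszIntegral (𝓡∂ (n + 1)) (riemVolume g) x f =
      ∫ y, (w y * coeffSeries (fun k => a k 0) y).coeff n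
        ∂(riemVolume (sliceMetric gbar Φ 0)) := by
  obtain ⟨δ₁, hδ₁, hFe⟩ := ha.exists_unifExp fun k hk => (heven k (by omega)).1
  have hac : ContCoeff (coeffSeries fun k => a k 0) :=
    contCoeff_coeffSeries fun k => ha.continuous_coeff k 0
  set δ₂ := min (min δ δ₁) (min ε 1) with hδ₂
  have h0 : 0 < δ₂ := lt_min (lt_min hδ0 hδ₁) (lt_min hΦ.pos one_pos)
  have h1 : δ₂ ≤ δ := (min_le_left _ _).trans (min_le_left _ _)
  have h2 : δ₂ ≤ δ₁ := (min_le_left _ _).trans (min_le_right _ _)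
  have h3 : δ₂ ≤ ε := (min_le_right _ _).trans (min_le_left _ _)
  have h4 : δ₂ ≤ 1 := (min_le_right _ _).trans (min_le_right _ _)
  have e1 := hμ.zeta hΦ hx hg hf hF h0 h3 h4 (hFe.mono h2) hac hx' hx'0
    (hφ.mono (Set.prod_mono le_rfl (Ioo_subset_Ioo_right h1)))
    (fun y t ht => hφx y t ⟨ht.1, ht.2.trans_le h1⟩) (hw.mono h1) hwc
  -- The reference x is the case φ = 0. The same δ₂ is used for both, so the parts independent of φ
  -- cancel.
  have e2 := hμ.zeta hΦ hx hg hf hF h0 h3 h4 (hFe.mono h2) hac hx.smooth.continuous.continuousOn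
    (fun p hp => hx.pos hp) (φ := fun _ => 0) continuousOn_const
    (fun y t ht => by rw [Real.exp_zero, mul_one, hΦ.x_eq y t ⟨ht.1.le, ht.2.trans_le h3⟩])
    (by simpa using UnifExp.of_continuous (N := N) (a := fun _ => (0 : ℂ)) continuous_const)
    (ContCoeff.constantCoeff (a := fun _ => (0 : ℂ)) continuous_const)
  refine ⟨e2.1, e1.1, e1.2.1.trans e2.2.1.symm, ?_⟩
  rw [e1.2.2, e2.2.2]
  simp

/-- Log-freeness of φ up to order n, a consequence of the eikonal equation, identifies the anomaly
integrand with an actual coefficient of the expansion of φF. -/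
theorem IsPhgBdf.compare {φ : M → ℝ} (hμ : IsDensityForm g gbar ε Φ f F)
    (hΦ : IsGeodesicCollar gbar x ε Φ) (hx : IsBdf (𝓡∂ (n + 1)) x) (hg : IsPoincareEinstein g)
    (hgbar : IsConfExtension g x gbar) (hphg : IsPhgMetric gbar Φ)
    (hf : ContinuousOn f ((𝓡∂ (n + 1)).interior M)) (hF : ContinuousOn F (univ ×ˢ Ioo 0 ε))
    (ha : HasPhgExpansion (n := n) F a) (heven : IsEvenMod a (n + 2))
    (hφ : IsPhgBdf (n := n) x Φ x' φ) (hs : IsSpecial g x') :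
    HasZetaContinuation (𝓡∂ (n + 1)) (riemVolume g) x' f ∧
    rieszResidue (𝓡∂ (n + 1)) (riemVolume g) x' f =
      rieszResidue (𝓡∂ (n + 1)) (riemVolume g) x f ∧
    ∃ w b : ℕ → ℕ → N → ℝ, IsEvenMod w (n + 1) ∧
      HasPhgExpansion (n := n) (fun q => φ (Φ q) * F q) b ∧
      (∀ y, b n 0 y =
        ∑ ij ∈ Finset.HasAntidiagonal.antidiagonal n, w ij.1 0 y * a ij.2 0 y) ∧
      rieszIntegral (𝓡∂ (n + 1)) (riemVolume g) x' f -
        rieszIntegral (𝓡∂ (n + 1)) (riemVolume g) x f =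
        ((∫ y, b n 0 y ∂(riemVolume (sliceMetric gbar Φ 0)) : ℝ) : ℂ) := by
  obtain ⟨w, hw⟩ := hφ.phg
  have hwe := IsPhgBdf.isEvenMod hΦ hx hg hgbar hphg hφ hs hw
  obtain ⟨b, hb, hbw⟩ := hw.mul ha
  have hbn := hbw n (fun i hi => (hwe i (by omega)).1) (fun i hi => (heven i (by omega)).1)
  obtain ⟨δ, hδ, hwu⟩ := hw.exists_unifExp fun k hk => (hwe k hk).1
  have h1 : min δ ε ≤ δ := min_le_left _ _
  have hcΦ : ContinuousOn Φ (univ ×ˢ Ioo 0 (min δ ε)) :=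
    hΦ.smooth.continuousOn.mono (Set.prod_mono le_rfl fun t ht =>
      ⟨ht.1.le, ht.2.trans_le (min_le_right _ _)⟩)
  have hx'eq : x' = fun p => x p * Real.exp (φ p) := funext hφ.eq
  have hcont : Continuous x' := by
    rw [hx'eq]
    exact hx.smooth.continuous.mul (Real.continuous_exp.comp hφ.cont)
  have key := hμ.compare hΦ hx hg.metric hf hF ha heven hcont.continuousOn
    (fun p hp => by rw [hφ.eq]; exact mul_pos (hx.pos hp) (Real.exp_pos _))
    (lt_min hδ hΦ.pos) (φ := fun q => φ (Φ q)) (hφ.cont.comp_continuousOn hcΦ)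
    (fun y t ht => by
      rw [hφ.eq, hΦ.x_eq y t ⟨ht.1.le, ht.2.trans_le (min_le_right _ _)⟩])
    (hwu.mono h1) (contCoeff_coeffSeries fun k => hw.continuous_coeff k 0)
  refine ⟨key.2.1, key.2.2.1, w, b, hwe, hb, hbn, key.2.2.2.trans ?_⟩
  rw [← integral_complex_ofReal]
  refine integral_congr_ae (.of_forall fun y => ?_)
  simp only [PowerSeries.coeff_mul, coeff_coeffSeries, hbn]
  push_cast
  rfl

/-- If i + j is odd then one of i, j is odd, and the corresponding coefficient vanishes. -/
theorem sum_antidiagonal_eq_zero {w a : ℕ → ℕ → N → ℝ} (hw : IsEvenMod w (n + 1))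
    (ha : IsEvenMod a (n + 2)) (hn : Odd n) (y : N) :
    ∑ ij ∈ Finset.HasAntidiagonal.antidiagonal n, w ij.1 0 y * a ij.2 0 y = 0 := by
  refine Finset.sum_eq_zero fun ij hij => ?_
  have h := Finset.HasAntidiagonal.mem_antidiagonal.1 hij
  rcases Nat.even_or_odd ij.1 with h1 | h1
  · have h2 : Odd ij.2 := by
      rw [← h] at hn
      exact (Nat.odd_add.1 (add_comm ij.1 ij.2 ▸ hn)).2 h1
    rw [(ha ij.2 (by omega)).2 h2 y, mul_zero]
  · rw [(hw ij.1 (by omega)).2 h1 y, zero_mul]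

end Comparison

end PE

end

theorem mainTheorem6 (n : ℕ)
    {M : Type*} [TopologicalSpace M] [T2Space M] [CompactSpace M]
    [ChartedSpace (EuclideanHalfSpace (n + 1)) M] [IsManifold (𝓡∂ (n + 1)) ∞ M]
    [MeasurableSpace M] [BorelSpace M]
    {N : Type*} [TopologicalSpace N] [T2Space N] [CompactSpace N]
    [ChartedSpace (PE.Euc n) N] [IsManifold (𝓡 n) ∞ N]
    [MeasurableSpace N] [BorelSpace N]
    -- the metric, the special bdf, and the collar that it induces
    (g : PE.BilinField (𝓡∂ (n + 1)) M) (hg : PE.IsPoincareEinstein g)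
    (x : M → ℝ) (hx : PE.IsBdf (𝓡∂ (n + 1)) x) (hxs : PE.IsSpecial g x)
    (gbar : PE.ContMetric n M) (hgbar : PE.IsConfExtension g x gbar)
    (ε : ℝ) (Φ : N × ℝ → M) (hΦ : PE.IsGeodesicCollar gbar x ε Φ)
    (hphg : PE.IsPhgMetric gbar Φ)
    -- the density `μ = f dvol_g = F dvol_{g^{(0)}} dx / x^m`, where `m = n + 1`
    (f : M → ℝ) (hf : ContMDiffOn (𝓡∂ (n + 1)) 𝓘(ℝ, ℝ) ∞ f ((𝓡∂ (n + 1)).interior M))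
    (F : N × ℝ → ℝ) (hF : ContMDiffOn ((𝓡 n).prod 𝓘(ℝ, ℝ)) 𝓘(ℝ, ℝ) ∞ F (univ ×ˢ Ioo 0 ε))
    (a : ℕ → ℕ → N → ℝ) (ha : PE.HasPhgExpansion (n := n) F a) (heven : PE.IsEvenMod a (n + 2))
    (hμ : PE.IsDensityForm g gbar ε Φ f F) :
    PE.HasZetaContinuation (𝓡∂ (n + 1)) (PE.riemVolume g) x f ∧
    -- `m` even: independence of the special bdf
    (Even (n + 1) → ∀ x' φ : M → ℝ, PE.IsPhgBdf (n := n) x Φ x' φ → PE.IsSpecial g x' →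
      PE.HasZetaContinuation (𝓡∂ (n + 1)) (PE.riemVolume g) x' f ∧
      PE.rieszIntegral (𝓡∂ (n + 1)) (PE.riemVolume g) x' f
        = PE.rieszIntegral (𝓡∂ (n + 1)) (PE.riemVolume g) x f) ∧
    -- `m` odd: the anomaly formula
    (Odd (n + 1) → ∀ x' φ : M → ℝ, PE.IsPhgBdf (n := n) x Φ x' φ → PE.IsSpecial g x' →
      PE.HasZetaContinuation (𝓡∂ (n + 1)) (PE.riemVolume g) x' f ∧
      ∃ b : ℕ → ℕ → N → ℝ, PE.HasPhgExpansion (n := n) (fun q => φ (Φ q) * F q) b ∧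
        PE.rieszIntegral (𝓡∂ (n + 1)) (PE.riemVolume g) x' f
          - PE.rieszIntegral (𝓡∂ (n + 1)) (PE.riemVolume g) x f
          = ((∫ y, b n 0 y ∂(PE.riemVolume (PE.sliceMetric gbar Φ 0)) : ℝ) : ℂ)) ∧
    -- the residue is the same for all smooth bdfs and for all special bdfs
    (∀ x' : M → ℝ, (PE.IsBdf (𝓡∂ (n + 1)) x' ∨
        ((∃ φ : M → ℝ, PE.IsPhgBdf (n := n) x Φ x' φ) ∧ PE.IsSpecial g x')) →
      PE.HasZetaContinuation (𝓡∂ (n + 1)) (PE.riemVolume g) x' f ∧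
      PE.rieszResidue (𝓡∂ (n + 1)) (PE.riemVolume g) x' f
        = PE.rieszResidue (𝓡∂ (n + 1)) (PE.riemVolume g) x f) := by
  have hf' := hf.continuousOn
  have hF' := hF.continuousOn
  -- Comparing x with itself yields the continuation of its own zeta function.
  have hself := hμ.compare hΦ hx hg.metric hf' hF' ha heven hx.smooth.continuous.continuousOn
    (fun p hp => hx.pos hp) hΦ.pos (φ := fun _ => 0) continuousOn_const
    (fun y t ht => by rw [Real.exp_zero, mul_one, hΦ.x_eq y t ⟨ht.1.le, ht.2⟩])
    (by simpa using PE.UnifExp.of_continuous (N := N) (a := fun _ => (0 : ℂ)) continuous_const)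
    (PE.ContCoeff.constantCoeff (a := fun _ => (0 : ℂ)) continuous_const)
  refine ⟨hself.1, fun hm x' φ hφ hs => ?_, fun _ x' φ hφ hs => ?_, fun x' hx' => ?_⟩
  · obtain ⟨h1, -, w, b, hw, -, hb, h2⟩ :=
      PE.IsPhgBdf.compare hμ hΦ hx hg hgbar hphg hf' hF' ha heven hφ hs
    refine ⟨h1, sub_eq_zero.1 (h2.trans ?_)⟩
    have hn : Odd n := by simpa [Nat.even_add_one] using hm
    simp [hb, PE.sum_antidiagonal_eq_zero hw heven hn]
  · obtain ⟨h1, -, w, b, -, hb, -, h2⟩ :=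
      PE.IsPhgBdf.compare hμ hΦ hx hg hgbar hphg hf' hF' ha heven hφ hs
    exact ⟨h1, b, hb, h2⟩
  · rcases hx' with hx' | ⟨⟨φ, hφ⟩, hs⟩
    -- A smooth bdf need not be special; its log-free expansion comes from Taylor's formula and not
    -- from the eikonal equation.
    · obtain ⟨δ, hδ, φ, w, -, hwc, hφc, hφx, hw⟩ := hΦ.exists_bdf_expansion hx'
      have key := hμ.compare hΦ hx hg.metric hf' hF' ha heven hx'.smooth.continuous.continuousOn
        (fun p hp => hx'.pos hp) hδ hφc hφx hw hwc
      exact ⟨key.2.1, key.2.2.1⟩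
    · have key := PE.IsPhgBdf.compare hμ hΦ hx hg hgbar hphg hf' hF' ha heven hφ hs
      exact ⟨key.1, key.2.1⟩
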